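/- **Setup.** Let $k$ be a field and let $X$ be a projective toric variety over $k$ with fan $\Sigma$ in $N\otimes\mathbb Q$, with rays $u_1,\dots,u_n$. Let $S=k[x_1,\dots,x_n]$ be its Cox ring, graded by $\mathrm{Cl}(X)=\mathbb Z^n/M$, and let $\mathcal X=[(\mathrm{Spec}\,S\setminus V(B))/G]$ be the associated toric stack, where $B$ is the irrelevant ideal and $G=\mathrm{Spec}\,k[\mathrm{Cl}(X)]$. For a cone $\sigma\in\Sigma$ let $V_\sigma=\{x_i\neq 0 \text{ for } u_i\notin\sigma\}$; the $V_\sigma$ with $\sigma$ maximal cover $\mathrm{Spec}\,S\setminus V(B)$, and all Čech complexes below are taken for this cover. Let $\mathrm{Eff}\subseteq\mathrm{Cl}(X)$ be the semigroup generated by $\deg x_1,\dots,\deg x_n$. Let $E=\bigwedge_k(e_1,\dots,e_n)$, with the $\mathrm{Cl}(X)\oplus\mathbb Z$-grading in which $\deg e_i=(-\deg x_i;-1)$, and let $\omega_E=\mathrm{Hom}_k(E,k)$. A differential $E$-module is a graded right $E$-module $D$ with an $E$-linear endomorphism $\partial$ of degree $(0;-1)$ and $\partial^2=0$; homotopies are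 $E$-linear of degree $(0;1)$. We put $e_i d=(-1)^{j}d e_i$ for $d\in D_{(a;j)}$. Such a $D$ is free if its underlying $E$-module is free, and minimal if $\partial(D)\subseteq D\cdot(e_1,\dots,e_n)$. * $\mathbb{LL}(D)$ is the complex of graded $S$-modules with terms $\mathbb{LL}(D)_j=\bigoplus_{a}S(-a)\otimes_k D_{(a;j)}$ and differential $s\otimes d\mapsto\sum_i x_is\otimes e_id-s\otimes\partial d$. * $\mathbf U(D)$ is the complex of $\mathcal O_{\mathcal X}$-modules associated with $\mathbb{LL}(D')$, where $D'=\bigoplus_{-a\in \mathrm{Eff},\,j\in\mathbb Z}D_{(a;j)}\subseteq D$. * For a coherent sheaf $\mathcal F$ on $\mathcal X$, $\Phi_{\mathcal K}(\mathcal F)$ is the differential $E$-module obtained by totalizing the Čech complex (i.e. the $G$-invariant Čech cochains) of $\bigoplus_a\mathcal F(a)\otimes_k\omega_E(-a;0)$ with the differential $\sum_i x_i\otimes e_i$. A Tate resolution $\mathbf T(\mathcal F)$ is a minimal free differential $E$-module together with a homotopy equivalence $h_{\mathcal F}\colon\mathbf T(\mathcal F)\to\Phi_{\mathcal K}(\mathcal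 F)$. * $\mathcal R$ is the toric resolution of the diagonal on $\mathcal X\times\mathcal X$. With coordinates $y_i$ on the first factor and $x_i$ on the second one, it is the complex of sheaves associated with the Koszul complex on the elements $y_i-x_iu^{\deg x_i}$ over $k[x,y][\mathrm{Eff}]$, where $u^{d}$ has bidegree $(d,-d)$ (first factor, second factor); so $\mathcal R_p=\bigoplus_{|I|=p}\bigoplus_{d\in\mathrm{Eff}}\mathcal O(-d-\sum_{i\in I}\deg x_i)\boxtimes\mathcal O(d)$. With $\pi_1,\pi_2$ the projections, $\Phi_{\mathcal R}(\mathcal F)=R\pi_{2*}(\pi_1^*\mathcal F\otimes\mathcal R)$, computed, over the chart $V_\tau$ of the second factor, by the Čech complex for the cover by the products $V_\alpha\times(V_\beta\cap V_\tau)$, with $\alpha,\beta$ maximal cones. **Theorem (the toric Beilinson monad).** Every coherent sheaf $\mathcal F$ on $\mathcal X$ has a Tate resolution $\mathbf T(\mathcal F)$, and there is a natural transformation $\eta\colon\mathbf U\circ\Phi_{\mathcal K}\to\Phi_{\mathcal R}$ of functors from coherent sheaves to complexes of $\mathcal O_{\mathcal X}$-modules, with all $\eta_{\mathcal F}$ quasi-isomorphisms,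 such that the following hold. 1. For every coherent sheaf $\mathcal F$ and every Tate resolution $\mathbf T(\mathcal F)$ of $\mathcal F$, the composition $$\mathbf U(\mathbf T(\mathcal F))\xrightarrow{\ \mathbf U(h_{\mathcal F})\ }\mathbf U(\Phi_{\mathcal K}(\mathcal F))\xrightarrow{\ \eta_{\mathcal F}\ }\Phi_{\mathcal R}(\mathcal F)$$ is a quasi-isomorphism. 2. This quasi-isomorphism is natural in $\mathcal F$ up to homotopy: if $f\colon\mathcal F\to\mathcal F'$ is a morphism and $\varphi\colon\mathbf T(\mathcal F)\to\mathbf T(\mathcal F')$ is a morphism of differential $E$-modules with $h_{\mathcal F'}\circ\varphi$ homotopic to $\Phi_{\mathcal K}(f)\circ h_{\mathcal F}$, then $\eta_{\mathcal F'}\circ\mathbf U(h_{\mathcal F'})\circ\mathbf U(\varphi)$ is homotopic to $\Phi_{\mathcal R}(f)\circ\eta_{\mathcal F}\circ\mathbf U(h_{\mathcal F})$. 3. In particular, the complex $\mathbf U(\mathbf T(\mathcal F))$ has homology only in homological degree $0$, and $H_0(\mathbf U(\mathbf T(\mathcal F)))\cong\mathcal F$. -/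

import Mathlib

open CategoryTheory CategoryTheory.Limits Opposite

universe u

set_option linter.unusedSectionVars false

noncomputable section

namespace ToricBGG

/-! ## Fans -/

/-- The lattice points of the rational cone generated by the vectors `u i`, `i ∈ σ`. -/
def latticeCone {N ι : Type} [AddCommGroup N] (u : ι → N) (σ : Finset ι) : Set N :=
  {v | ∃ n : ℕ, 0 < n ∧ ∃ c : ι → ℕ, n • v = ∑ i ∈ σ, c i • u i}

/-- `τ` is the set of rays of a face of the cone generated by the `u i`, `i ∈ σ`: the face is cut
out by a supporting hyperplane `m = 0`. -/
def IsFaceOf {N ι : Type} [AddCommGroup N] (u : ι → N) (τ σ : Finset ι) : Prop :=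
  ∃ m : N →+ ℤ, (∀ i ∈ σ, 0 ≤ m (u i)) ∧ ∀ i, i ∈ τ ↔ i ∈ σ ∧ m (u i) = 0

/-- A rational fan in `N ⊗ ℚ`, presented by the primitive generators `u i` of its rays and by the
set of its cones, each cone being recorded by the set of rays that it contains. -/
structure Fan (N ι : Type) [AddCommGroup N] [DecidableEq ι] where
  /-- the generators of the rays -/
  u : ι → N
  /-- the cones -/
  cones : Set (Finset ι)
  primitive : ∀ (i : ι) (n : ℤ) (v : N), n • v = u i → IsUnit n
  ray_mem : ∀ i, {i} ∈ cones
  /-- the cones are strongly convex -/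
  stronglyConvex : ∀ σ ∈ cones, ∀ c : ι → ℕ, ∑ i ∈ σ, c i • u i = 0 → ∀ i ∈ σ, c i = 0
  /-- faces of cones are cones -/
  face_mem : ∀ σ ∈ cones, ∀ τ, IsFaceOf u τ σ → τ ∈ cones
  /-- the intersection of two cones is a face of each of them -/
  inter_isFace : ∀ σ ∈ cones, ∀ τ ∈ cones, IsFaceOf u (σ ∩ τ) σ
  inter_cone : ∀ σ ∈ cones, ∀ τ ∈ cones,
    latticeCone u σ ∩ latticeCone u τ ⊆ latticeCone u (σ ∩ τ)

namespace Fan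

variable {N ι : Type} [AddCommGroup N] [DecidableEq ι] (Φ : Fan N ι)

/-- The cones of the fan, ordered by inclusion. -/
abbrev Cone : Type := {σ : Finset ι // σ ∈ Φ.cones}

theorem inter_mem {σ τ : Finset ι} (hσ : σ ∈ Φ.cones) (hτ : τ ∈ Φ.cones) : σ ∩ τ ∈ Φ.cones :=
  Φ.face_mem σ hσ _ (Φ.inter_isFace σ hσ τ hτ)

instance : SemilatticeInf Φ.Cone :=
  Subtype.semilatticeInf fun _ _ hσ hτ => Φ.inter_mem hσ hτ

/-- The maximal cones. -/
abbrev MaxCone : Type := {σ : Φ.Cone // IsMax σ}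

/-- The fan is complete: its cones cover `N ⊗ ℚ`. -/
def IsComplete : Prop := ∀ v : N, ∃ σ ∈ Φ.cones, v ∈ latticeCone Φ.u σ

/-- The fan is the normal fan of a lattice polytope, i.e. the toric variety is projective: the fan
is complete and some torus invariant divisor `∑ a i D_i` has a strictly convex support function,
i.e. is ample. -/
def IsProjective : Prop :=
  Φ.IsComplete ∧ ∃ a : ι → ℤ, ∀ σ : Φ.MaxCone, ∃ m : N →+ ℤ,
    (∀ i ∈ σ.1.1, m (Φ.u i) = - a i) ∧ ∀ i ∉ σ.1.1, - a i < m (Φ.u i)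

/-- The homomorphism `M → ℤ^{Σ(1)}` sending a character to its divisor. -/
def divHom : (N →+ ℤ) →+ (ι → ℤ) where
  toFun m i := m (Φ.u i)
  map_zero' := rfl
  map_add' _ _ := rfl

/-- The divisor class group of the toric variety. -/
abbrev Cl : Type := (ι → ℤ) ⧸ Φ.divHom.range

/-- The degree of the variable `x_i` of the Cox ring: the class of the divisor of the ray `i`. -/
def coxDeg (i : ι) : Φ.Cl := QuotientAddGroup.mk (Pi.single i 1)

end Fan

/-! ## Sheaves on the quotient stack -/

/-- The data needed to describe sheaves on a quotient stack `[Z / G]`, with `Z` an open subset of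
affine space with coordinates `x_i`, `i : ι`, that is covered by coordinate open sets
`Z_p = {x_i ≠ 0 for i ∉ supp p}`, and `G` the diagonalizable group with character group `A` acting
through the degrees `deg i : A`. The coordinate ring of the chart `Z_p` is the `A`-graded ring
`S_p = k[x_i, x_j⁻¹ : i ∈ ι, j ∉ supp p]`. The charts `p : P` are closed under intersection. -/
structure CoxData (ι A P : Type) [DecidableEq ι] [AddCommGroup A] [SemilatticeInf P] where
  deg : ι → A
  supp : P → Finset ι
  supp_inf : ∀ p q, supp (p ⊓ q) = supp p ∩ supp q

/-- The toric stack of a fan, with the charts given by the cones. -/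
def Fan.stack {N ι : Type} [AddCommGroup N] [DecidableEq ι] (Φ : Fan N ι) :
    CoxData ι Φ.Cl Φ.Cone where
  deg := Φ.coxDeg
  supp σ := σ.1
  supp_inf _ _ := rfl

namespace CoxData

variable {ι A P : Type} [Fintype ι] [DecidableEq ι] [AddCommGroup A] [SemilatticeInf P]
  (X : CoxData ι A P)

theorem supp_mono {p q : P} (h : p ≤ q) : X.supp p ⊆ X.supp q := by
  have h1 := X.supp_inf p q
  rw [inf_eq_left.2 h] at h1
  rw [h1]
  exact Finset.inter_subset_right

/-- The objects of the category that indexes the graded pieces of sheaves: a chart `p` together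
with a degree `a`. -/
structure Loc (X : CoxData ι A P) where
  chart : P
  wt : A

/-- A morphism `(p, a) ⟶ (q, b)` is the restriction from the chart `p` to a smaller chart `q`
followed by the multiplication by a Laurent monomial in the coordinate ring `S_q` that has
degree `b - a`. -/
@[ext] structure LocHom (x y : X.Loc) where
  chart_le : y.chart ≤ x.chart
  exp : ι → ℤ
  nonneg : ∀ i ∈ X.supp y.chart, 0 ≤ exp i
  wt_add : x.wt + ∑ i, exp i • X.deg i = y.wt

instance : SmallCategory X.Loc where
  Hom x y := X.LocHom x y
  id x := ⟨le_rfl, 0, fun _ _ => le_rfl, by simp⟩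
  comp {x y z} f g := ⟨g.chart_le.trans f.chart_le, f.exp + g.exp, fun i hi =>
    add_nonneg (f.nonneg i (X.supp_mono g.chart_le hi)) (g.nonneg i hi), by
      rw [← g.wt_add, ← f.wt_add]
      simp [add_smul, Finset.sum_add_distrib, add_assoc]⟩
  id_comp f := by ext; simp
  comp_id f := by ext; simp
  assoc f g h := by ext; simp [add_assoc]

@[ext] theorem loc_hom_ext {x y : X.Loc} {f g : x ⟶ y} (h : f.exp = g.exp) : f = g :=
  LocHom.ext h

@[simp] theorem id_exp (x : X.Loc) : LocHom.exp (𝟙 x) = 0 := rfl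

@[simp] theorem comp_exp {x y z : X.Loc} (f : x ⟶ y) (g : y ⟶ z) :
    LocHom.exp (f ≫ g) = f.exp + g.exp := rfl

/-- The category of modules over the structure sheaf, described on the charts: a sheaf `F` is given
by the graded `S_p`-modules of its sections over the charts `p`, together with the restriction
maps. Here `F.obj (p, a)` is the degree `a` part of the sections of `F` over the chart `p`, i.e. the
vector space of `G`-invariant sections of the twisted sheaf `F(a)`; Laurent monomials act through
`F.map`. Kernels, cokernels, sums and the homology of complexes are computed chart by chart and
degree by degree; as the charts are affine, this agrees with the usual operations on
quasi-coherent sheaves, which form the full subcategory defined below. -/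
abbrev Mod (k : Type u) [Field k] : Type (u + 1) := X.Loc ⥤ ModuleCat.{u} k

variable {X} in
/-- The restriction from the chart `p` to the chart `q`. -/
def res {p q : P} (h : q ≤ p) (a : A) : (⟨p, a⟩ : X.Loc) ⟶ ⟨q, a⟩ :=
  ⟨h, 0, fun _ _ => le_rfl, by simp⟩

/-- A sheaf of modules is quasi-coherent if, for charts `q ≤ p`, the restriction map exhibits the
sections over `q` as the localization of the sections over `p` at the monomials that are invertible
on `q`. -/
def IsQuasicoherent {k : Type u} [Field k] (F : X.Mod k) : Prop :=
  ∀ (p q : P) (h : q ≤ p) (a : A),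
    (∀ s : F.obj ⟨p, a⟩, F.map (res h a) s = 0 →
      ∃ (b : A) (m : (⟨p, a⟩ : X.Loc) ⟶ ⟨p, b⟩), (∀ i ∈ X.supp q, m.exp i = 0) ∧
        F.map m s = 0) ∧
    (∀ t : F.obj ⟨q, a⟩, ∃ (b : A) (m : (⟨p, a⟩ : X.Loc) ⟶ ⟨p, b⟩)
      (m' : (⟨q, a⟩ : X.Loc) ⟶ ⟨q, b⟩) (s : F.obj ⟨p, b⟩),
      (∀ i ∈ X.supp q, m.exp i = 0) ∧ m'.exp = m.exp ∧ F.map (res h b) s = F.map m' t)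

/-- The graded module of sections over every chart is generated by finitely many homogeneous
elements. -/
def IsFiniteType {k : Type u} [Field k] (F : X.Mod k) : Prop :=
  ∀ p : P, ∃ (n : ℕ) (a : Fin n → A) (g : ∀ l, F.obj ⟨p, a l⟩), ∀ b : A,
    Submodule.span k {s : F.obj ⟨p, b⟩ |
      ∃ (l : Fin n) (m : (⟨p, a l⟩ : X.Loc) ⟶ ⟨p, b⟩), s = F.map m (g l)} = ⊤

/-- The coherent sheaves. (The rings `S_p` are noetherian.) -/
def coherent (k : Type u) [Field k] : ObjectProperty (X.Mod k) :=
  fun F => X.IsQuasicoherent F ∧ X.IsFiniteType F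

/-- The category of coherent sheaves. -/
abbrev Coh (k : Type u) [Field k] : Type (u + 1) := (X.coherent k).FullSubcategory

/-! ### Twists -/

/-- The functor behind the twist `F ↦ F(a)`. -/
def shift (a : A) : X.Loc ⥤ X.Loc where
  obj x := ⟨x.chart, a + x.wt⟩
  map {x y} f := ⟨f.chart_le, f.exp, f.nonneg, by
    have h := f.wt_add
    dsimp only
    rw [add_assoc, h]⟩

@[simp] theorem shift_map_exp (a : A) {x y : X.Loc} (f : x ⟶ y) :
    ((X.shift a).map f).exp = f.exp := rfl

/-- Multiplication by the variable `x_i`, as a natural transformation. -/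
def mulVar (i : ι) {a b : A} (h : a + X.deg i = b) : X.shift a ⟶ X.shift b where
  app x := ⟨le_rfl, Pi.single i 1, fun j _ => by
      by_cases hj : j = i
      · subst hj; simp
      · simp [hj], by
    subst h
    have : ∑ j, (Pi.single i (1 : ℤ) : ι → ℤ) j • X.deg j = X.deg i := by
      rw [Finset.sum_eq_single i] <;> simp +contextual
    simp only [shift, this]
    abel⟩
  naturality x y f := by
    ext
    simp [add_comm]

@[simp] theorem mulVar_app_exp (i : ι) {a b : A} (h : a + X.deg i = b) (x : X.Loc) :
    ((X.mulVar i h).app x).exp = Pi.single i 1 := rfl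

/-- The twist `F(a) = F ⊗ 𝒪(a)` of a sheaf. -/
def twist {k : Type u} [Field k] (a : A) : X.Mod k ⥤ X.Mod k :=
  (Functor.whiskeringLeft _ _ _).obj (X.shift a)

/-- Multiplication by the variable `x_i`, as a map of sheaves `F(a) ⟶ F(a + deg x_i)`. -/
def twistMul {k : Type u} [Field k] (i : ι) {a b : A} (h : a + X.deg i = b) :
    X.twist (k := k) a ⟶ X.twist b :=
  (Functor.whiskeringLeft _ _ _).map (X.mulVar i h)

/-- The Laurent monomials of degree `a` in the ring `S_p`. They form a basis of the degree `a` part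
of `S_p`. -/
@[ext] structure Monomial (p : P) (a : A) where
  exp : ι → ℤ
  nonneg : ∀ i ∈ X.supp p, 0 ≤ exp i
  wt : ∑ i, exp i • X.deg i = a

/-- The action of the morphisms of `X.Loc` on monomials. -/
def Monomial.map {X : CoxData ι A P} {x y : X.Loc} (f : x ⟶ y) (m : X.Monomial x.chart x.wt) :
    X.Monomial y.chart y.wt where
  exp := m.exp + f.exp
  nonneg i hi := add_nonneg (m.nonneg i (X.supp_mono f.chart_le hi)) (f.nonneg i hi)
  wt := by
    refine Eq.trans ?_ ((congrArg (· + ∑ i, f.exp i • X.deg i) m.wt).trans f.wt_add)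
    simp [add_smul, Finset.sum_add_distrib]

/-- The structure sheaf. -/
def structureSheaf (k : Type u) [Field k] : X.Mod k where
  obj x := ModuleCat.of k (X.Monomial x.chart x.wt →₀ k)
  map f := ModuleCat.ofHom (Finsupp.lmapDomain k k (Monomial.map f))
  map_id x := by
    have h : Monomial.map (𝟙 x) = id := by
      funext m
      ext : 1
      simp [Monomial.map]
    rw [h]
    ext : 1
    exact Finsupp.lmapDomain_id k k
  map_comp {x y z} f g := by
    have h : Monomial.map (f ≫ g) = Monomial.map g ∘ Monomial.map f := by
      funext m
      ext : 1
      simp [Monomial.map, add_assoc]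
    rw [h]
    ext : 1
    exact Finsupp.lmapDomain_comp k k _ _

/-! ### Products -/

section

variable {ι' A' P' : Type} [Fintype ι'] [DecidableEq ι'] [AddCommGroup A'] [SemilatticeInf P']

/-- The product of two quotient stacks. -/
def prod (Y : CoxData ι' A' P') : CoxData (ι ⊕ ι') (A × A') (P × P') where
  deg := Sum.elim (fun i => (X.deg i, 0)) (fun i => (0, Y.deg i))
  supp p := (X.supp p.1).disjSum (Y.supp p.2)
  supp_inf p q := by
    ext (i | i) <;> simp [X.supp_inf, Y.supp_inf]

variable (Y : CoxData ι' A' P')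

/-- The first projection, on charts, degrees and monomials. -/
def prodFst : (X.prod Y).Loc ⥤ X.Loc where
  obj z := ⟨z.chart.1, z.wt.1⟩
  map {z w} f := ⟨f.chart_le.1, fun i => f.exp (Sum.inl i), fun i hi =>
    f.nonneg (Sum.inl i) (Finset.inl_mem_disjSum.2 hi), by
      have h := congrArg Prod.fst f.wt_add
      simpa [prod, Prod.fst_sum] using h⟩

/-- The second projection, on charts, degrees and monomials. -/
def prodSnd : (X.prod Y).Loc ⥤ Y.Loc where
  obj z := ⟨z.chart.2, z.wt.2⟩
  map {z w} f := ⟨f.chart_le.2, fun i => f.exp (Sum.inr i), fun i hi =>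
    f.nonneg (Sum.inr i) (Finset.inr_mem_disjSum.2 hi), by
      have h := congrArg Prod.snd f.wt_add
      simpa [prod, Prod.snd_sum] using h⟩

/-- The pullback `π₁^* F = F ⊠ 𝒪` of a sheaf along the first projection of a product. Its sections
over the chart `p × q` are `F(p) ⊗ S_q`, bigraded by the degrees of the two factors. -/
def pullbackFst (k : Type u) [Field k] : X.Mod k ⥤ (X.prod Y).Mod k :=
  (Functor.whiskeringLeft _ _ _).obj (X.prodFst Y) ⋙
    MonoidalCategory.tensorRight (X.prodSnd Y ⋙ Y.structureSheaf k)

end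

end CoxData
/-! ## Differential modules over the exterior algebra -/

section DifferentialModules

variable {ι A : Type} [AddCommGroup A] (deg : ι → A)

/-- Differential modules over the exterior algebra `E` on generators `e_i`, `i : ι`, of degree
`(- deg i; -1)`, in a preadditive category `V` (for vector spaces, these are the differential
`E`-modules; for sheaves on a stack, these are the differential `𝒪`-`E` bimodules). The piece of
degree `(a; j)` is `(cx a).X j`, the differential has degree `(0; -1)`, and the right action of
`e_i` sends the piece of degree `(a; j)` to the piece of degree `(a - deg i; j - 1)`. The action
satisfies the defining relations of the exterior algebra, and the differential is `E`-linear. -/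
structure DM (V : Type*) [Category V] [Preadditive V] where
  cx : A → ChainComplex V ℤ
  act : ∀ (i : ι) {a b : A} (_ : b + deg i = a) (j j' : ℤ) (_ : j' + 1 = j),
    (cx a).X j ⟶ (cx b).X j'
  act_sq : ∀ (i : ι) {a b c : A} (h : b + deg i = a) (h' : c + deg i = b) (j j' j'' : ℤ)
    (hj : j' + 1 = j) (hj' : j'' + 1 = j'), act i h j j' hj ≫ act i h' j' j'' hj' = 0
  act_anticomm : ∀ (i l : ι) {a b b' c : A} (h : b + deg i = a) (h' : c + deg l = b)
    (g : b' + deg l = a) (g' : c + deg i = b') (j j' j'' : ℤ) (hj : j' + 1 = j)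
    (hj' : j'' + 1 = j'),
    act i h j j' hj ≫ act l h' j' j'' hj' = - (act l g j j' hj ≫ act i g' j' j'' hj')
  act_d : ∀ (i : ι) {a b : A} (h : b + deg i = a) (j j' j'' : ℤ) (hj : j' + 1 = j)
    (hj' : j'' + 1 = j'),
    act i h j j' hj ≫ (cx b).d j' j'' = (cx a).d j j' ≫ act i h j' j'' hj'

namespace DM

variable {deg} {V : Type*} [Category V] [Preadditive V]

/-- Morphisms of differential modules. -/
@[ext] structure Hom (D D' : DM deg V) where
  f : ∀ a, D.cx a ⟶ D'.cx a
  comm : ∀ (i : ι) {a b : A} (h : b + deg i = a) (j j' : ℤ) (hj : j' + 1 = j),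
    D.act i h j j' hj ≫ (f b).f j' = (f a).f j ≫ D'.act i h j j' hj

instance : Category (DM deg V) where
  Hom D D' := Hom D D'
  id D := ⟨fun _ => 𝟙 _, by simp⟩
  comp φ ψ := ⟨fun a => φ.f a ≫ ψ.f a, fun i _ _ h j j' hj => by
    simp [← ψ.comm, reassoc_of% φ.comm i h j j' hj]⟩
  id_comp φ := Hom.ext (funext fun a => Category.id_comp (φ.f a))
  comp_id φ := Hom.ext (funext fun a => Category.comp_id (φ.f a))
  assoc φ ψ χ := Hom.ext (funext fun a => Category.assoc (φ.f a) (ψ.f a) (χ.f a))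

@[ext] theorem hom_ext {D D' : DM deg V} {φ ψ : D ⟶ D'} (h : ∀ a, φ.f a = ψ.f a) : φ = ψ :=
  Hom.ext (funext h)

@[simp] theorem id_f (D : DM deg V) (a : A) : Hom.f (𝟙 D) a = 𝟙 _ := rfl

@[simp] theorem comp_f {D D' D'' : DM deg V} (φ : D ⟶ D') (ψ : D' ⟶ D'') (a : A) :
    Hom.f (φ ≫ ψ) a = φ.f a ≫ ψ.f a := rfl

/-- A homotopy between morphisms of differential modules: a family of maps of degree `(0; 1)` that
is `E`-linear and satisfies the usual identity `φ - ψ = h ∂ + ∂ h`. -/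
structure Htpy {D D' : DM deg V} (φ ψ : D ⟶ D') where
  htpy : ∀ a, Homotopy (φ.f a) (ψ.f a)
  comm : ∀ (i : ι) {a b : A} (h : b + deg i = a) (j j' : ℤ) (hj : j' + 1 = j),
    D.act i h j j' hj ≫ (htpy b).hom j' (j' + 1) =
      (htpy a).hom j (j + 1) ≫ D'.act i h (j + 1) (j' + 1) (by rw [hj])

/-- Homotopy equivalences of differential modules. -/
structure HtpyEquiv (D D' : DM deg V) where
  hom : D ⟶ D'
  inv : D' ⟶ D
  homInv : Htpy (hom ≫ inv) (𝟙 D)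
  invHom : Htpy (inv ≫ hom) (𝟙 D')

/-- The strand of weight `a` of a differential module, as a chain complex. -/
def strand (V : Type*) [Category V] [Preadditive V] (a : A) : DM deg V ⥤ ChainComplex V ℤ where
  obj D := D.cx a
  map φ := φ.f a

/-- The right action of the product `e_{i_1} ⋯ e_{i_r}` attached to a list `[i_1, …, i_r]`. -/
def actList (D : DM deg V) : ∀ (l : List ι) {a b : A} (_ : b + (l.map deg).sum = a) {j j' : ℤ}
    (_ : j' + l.length = j), (D.cx a).X j ⟶ (D.cx b).X j'
  | [], a, b, h, j, j', hj =>
    eqToHom (by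
      obtain rfl : b = a := by simpa using h
      obtain rfl : j' = j := by simpa using hj
      rfl)
  | i :: l, a, b, h, j, j', hj =>
    D.act i (b := b + (l.map deg).sum) (by rw [← h, List.map_cons, List.sum_cons]; abel) j
      (j' + l.length) (by rw [← hj, List.length_cons]; push_cast; ring) ≫ D.actList l rfl rfl

end DM

namespace DM

variable {deg} {k : Type u} [Field k]

/-- The left action `e_i x = (-1) ^ j x e_i` on the elements `x` of degree `(a; j)` of a
differential `E`-module. -/
def leftAct (D : DM deg (ModuleCat.{u} k)) (i : ι) {a b : A} (h : b + deg i = a) (j j' : ℤ)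
    (hj : j' + 1 = j) : (D.cx a).X j ⟶ (D.cx b).X j' :=
  j.negOnePow • D.act i h j j' hj

/-- The underlying `E`-module is free: there are homogeneous elements `g β` of degrees
`(α β; ν β)` such that the elements `g β • e_I`, `I ⊆ ι`, form a basis. -/
def IsFree [LinearOrder ι] (D : DM deg (ModuleCat.{u} k)) : Prop :=
  ∃ (B : Type u) (α : B → A) (ν : B → ℤ) (g : ∀ β, (D.cx (α β)).X (ν β)),
    ∀ (a : A) (j : ℤ),
      let v : {x : B × Finset ι // a + ((x.2.sort (· ≤ ·)).map deg).sum = α x.1 ∧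
          j + (x.2.sort (· ≤ ·)).length = ν x.1} → (D.cx a).X j :=
        fun x => D.actList (x.1.2.sort (· ≤ ·)) x.2.1 x.2.2 (g x.1.1)
      LinearIndependent k v ∧ Submodule.span k (Set.range v) = ⊤

/-- A differential module is minimal if the image of the differential lies in the submodule
generated by the multiples of the `e_i`. -/
def IsMinimal (D : DM deg (ModuleCat.{u} k)) : Prop :=
  ∀ (a : A) (j j' : ℤ), (ComplexShape.down ℤ).Rel j j' → ∀ x : (D.cx a).X j,
    (D.cx a).d j j' x ∈ Submodule.span k {y : (D.cx a).X j' |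
      ∃ (i : ι) (z : (D.cx (a + deg i)).X (j' + 1)), y = D.act i rfl (j' + 1) j' rfl z}

end DM

end DifferentialModules
/-! ## Koszul complexes -/

section Koszul

variable {ι A : Type} [Fintype ι] [LinearOrder ι] [AddCommGroup A] (deg : ι → A)

/-- An `A`-graded module over the polynomial ring on variables of degrees `deg i`, in a category
`V`: a family of objects indexed by `A` with commuting multiplication maps by the variables. -/
structure GrObj (V : Type*) [Category V] where
  obj : A → V
  mul : ∀ (i : ι) {a b : A} (_ : a + deg i = b), obj a ⟶ obj b
  mul_comm : ∀ (i l : ι) {a b b' c : A} (h : a + deg i = b) (h' : b + deg l = c)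
    (g : a + deg l = b') (g' : b' + deg i = c), mul i h ≫ mul l h' = mul l g ≫ mul i g'

namespace GrObj

variable {deg} {V : Type*} [Category V]

/-- Morphisms of graded modules. -/
@[ext] structure Hom (M M' : GrObj deg V) where
  app : ∀ a, M.obj a ⟶ M'.obj a
  comm : ∀ (i : ι) {a b : A} (h : a + deg i = b), M.mul i h ≫ app b = app a ≫ M'.mul i h

instance : Category (GrObj deg V) where
  Hom M M' := Hom M M'
  id M := ⟨fun _ => 𝟙 _, by simp⟩
  comp φ ψ := ⟨fun a => φ.app a ≫ ψ.app a, fun i _ _ h => by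
    simp [← ψ.comm, reassoc_of% φ.comm i h]⟩
  id_comp φ := Hom.ext (funext fun a => Category.id_comp (φ.app a))
  comp_id φ := Hom.ext (funext fun a => Category.comp_id (φ.app a))
  assoc φ ψ χ := Hom.ext (funext fun a => Category.assoc (φ.app a) (ψ.app a) (χ.app a))

@[simp] theorem id_app (M : GrObj deg V) (a : A) : Hom.app (𝟙 M) a = 𝟙 _ := rfl

@[simp] theorem comp_app {M M' M'' : GrObj deg V} (φ : M ⟶ M') (ψ : M' ⟶ M'') (a : A) :
    Hom.app (φ ≫ ψ) a = φ.app a ≫ ψ.app a := rfl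

theorem eqToHom_mul (M : GrObj deg V) (i : ι) {a a' b b' : A} (h : a + deg i = b)
    (h' : a' + deg i = b') (e : a' = a) (e' : b' = b) :
    eqToHom (congrArg M.obj e) ≫ M.mul i h = M.mul i h' ≫ eqToHom (congrArg M.obj e') := by
  subst e e'
  simp

end GrObj

/-- The subsets of `ι` with `p` elements. -/
abbrev SubsetsOfCard (ι : Type) (p : ℤ) : Type := {I : Finset ι // (I.card : ℤ) = p}

/-- The sign with which `e_i` contracts the dual of the monomial `e_I`. -/
def contractSign (i : ι) (I : Finset ι) : ℤ := (-1) ^ (I.filter (· < i)).card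

variable {V : Type*} [Category V] [Preadditive V] [HasFiniteBiproducts V]

theorem card_erase_eq {i : ι} {p p' : ℤ} (hp : p' + 1 = p) (I : SubsetsOfCard ι p)
    (h : i ∈ I.1) : ((I.1.erase i).card : ℤ) = p' := by
  have h1 := Finset.card_erase_add_one h
  have h2 := I.2
  rw [← h1] at h2
  push_cast at h2
  linarith

/-- The contraction with `e_i`, with coefficients: on `⨁_I F I`, where the summand `F I` stands for
`F I ⊗ y_I` with `y_I` dual to the monomial `e_I`, this is the map that sends `f ⊗ y_I` to
`g f ⊗ e_i y_I`, where `e_i y_I` is `± y_{I \ i}` if `i ∈ I`, and zero otherwise. -/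
def contraction (i : ι) {F F' : Finset ι → V} (g : ∀ I, i ∈ I → (F I ⟶ F' (I.erase i)))
    (p p' : ℤ) (hp : p' + 1 = p) :
    (⨁ fun I : SubsetsOfCard ι p => F I.1) ⟶ ⨁ fun I : SubsetsOfCard ι p' => F' I.1 :=
  biproduct.desc fun I =>
    if h : i ∈ I.1 then
      contractSign i I.1 • (g I.1 h ≫
        biproduct.ι (fun J : SubsetsOfCard ι p' => F' J.1) ⟨I.1.erase i, card_erase_eq hp I h⟩)
    else 0

theorem contractSign_anticomm {i l : ι} {I : Finset ι} (hi : i ∈ I) (hl : l ∈ I) (hil : i ≠ l) :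
    contractSign i I * contractSign l (I.erase i) =
      - (contractSign l I * contractSign i (I.erase l)) := by
  have key : ∀ {a b : ι}, a ∈ I → b ∈ I → a < b →
      contractSign b (I.erase a) = - contractSign b I ∧
      contractSign a (I.erase b) = contractSign a I := by
    intro a b ha hb hab
    constructor
    · have h1 : (I.erase a).filter (· < b) = (I.filter (· < b)).erase a := by
        ext x; simp only [Finset.mem_filter, Finset.mem_erase]; tauto
      have h2 : a ∈ I.filter (· < b) := by simp [ha, hab]
      unfold contractSign
      rw [h1, ← Finset.card_erase_add_one h2, pow_succ]
      ring
    · unfold contractSign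
      congr 2
      ext x
      simp only [Finset.mem_filter, Finset.mem_erase]
      constructor
      · tauto
      · rintro ⟨h1, h2⟩
        exact ⟨⟨(h2.trans hab).ne, h1⟩, h2⟩
  rcases lt_or_gt_of_ne hil with h | h
  · rw [(key hi hl h).1, (key hi hl h).2]; ring
  · rw [(key hl hi h).1, (key hl hi h).2]; ring

theorem contraction_self (i : ι) {F F' F'' : Finset ι → V}
    (g : ∀ I, i ∈ I → (F I ⟶ F' (I.erase i))) (g' : ∀ I, i ∈ I → (F' I ⟶ F'' (I.erase i)))
    (p p' p'' : ℤ) (hp : p' + 1 = p) (hp' : p'' + 1 = p') :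
    contraction i g p p' hp ≫ contraction i g' p' p'' hp' = 0 := by
  refine biproduct.hom_ext' _ _ fun I => ?_
  unfold contraction
  by_cases h : i ∈ I.1
  · simp [h]
  · simp [h]

theorem contraction_anticomm (i l : ι) (hil : i ≠ l) {F F₁ F₂ F' : Finset ι → V}
    (g : ∀ I, i ∈ I → (F I ⟶ F₁ (I.erase i))) (g' : ∀ I, l ∈ I → (F₁ I ⟶ F' (I.erase l)))
    (f : ∀ I, l ∈ I → (F I ⟶ F₂ (I.erase l))) (f' : ∀ I, i ∈ I → (F₂ I ⟶ F' (I.erase i)))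
    (p p' p'' : ℤ) (hp : p' + 1 = p) (hp' : p'' + 1 = p')
    (H : ∀ I (h1 : i ∈ I) (h2 : l ∈ I),
      g I h1 ≫ g' (I.erase i) (Finset.mem_erase.2 ⟨hil.symm, h2⟩) =
        f I h2 ≫ f' (I.erase l) (Finset.mem_erase.2 ⟨hil, h1⟩) ≫
          eqToHom (congrArg F' Finset.erase_right_comm)) :
    contraction i g p p' hp ≫ contraction l g' p' p'' hp' =
      - (contraction l f p p' hp ≫ contraction i f' p' p'' hp') := by
  refine biproduct.hom_ext' _ _ fun I => ?_
  unfold contraction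
  by_cases h1 : i ∈ I.1
  · by_cases h2 : l ∈ I.1
    · have h3 : l ∈ I.1.erase i := Finset.mem_erase.2 ⟨hil.symm, h2⟩
      have h4 : i ∈ I.1.erase l := Finset.mem_erase.2 ⟨hil, h1⟩
      simp only [biproduct.ι_desc_assoc, h1, h2, dite_true, Preadditive.zsmul_comp,
        Category.assoc, biproduct.ι_desc, h3, h4, Preadditive.comp_zsmul, Preadditive.comp_neg,
        smul_smul]
      rw [contractSign_anticomm h1 h2 hil, neg_smul, reassoc_of% H I.1 h1 h2]
      congr 4
      exact biproduct.eqToHom_comp_ι (fun J : SubsetsOfCard ι p'' => F' J.1)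
        (j := ⟨(I.1.erase l).erase i, _⟩) (j' := ⟨(I.1.erase i).erase l, _⟩)
        (Subtype.ext Finset.erase_right_comm)
    · have h3 : l ∉ I.1.erase i := fun h => h2 (Finset.mem_of_mem_erase h)
      simp [h1, h2, h3]
  · by_cases h2 : l ∈ I.1
    · have h4 : i ∉ I.1.erase l := fun h => h1 (Finset.mem_of_mem_erase h)
      simp [h1, h2, h4]
    · simp [h1, h2]

theorem sum_antisymm_eq_zero {ι : Type} [Fintype ι] [DecidableEq ι] {G : Type*} [AddCommGroup G] (f : ι → ι → G)
    (h : ∀ i, f i i = 0) (h' : ∀ i l, i ≠ l → f i l = - f l i) : ∑ i, ∑ l, f i l = 0 := by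
  rw [← Finset.sum_product']
  refine Finset.sum_involution (fun x _ => (x.2, x.1)) ?_ ?_ ?_ ?_
  · rintro ⟨i, l⟩ _
    by_cases hil : i = l
    · subst hil; simp [h]
    · simp [h' i l hil]
  · rintro ⟨i, l⟩ _ hne heq
    obtain rfl : l = i := congrArg Prod.fst heq
    exact hne (h l)
  · simp
  · simp

namespace GrObj

variable {deg}

/-- The total degree of the subset `I`. -/
theorem wt_erase_mul {i : ι} {I : Finset ι} (hi : i ∈ I) (c : A) :
    c - ∑ l ∈ I, deg l + deg i = c - ∑ l ∈ I.erase i, deg l := by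
  rw [← Finset.sum_erase_add I deg hi]
  abel

theorem wt_erase_act {i : ι} {I : Finset ι} (hi : i ∈ I) {a b : A} (h : b + deg i = a) :
    a - ∑ l ∈ I, deg l = b - ∑ l ∈ I.erase i, deg l := by
  rw [← Finset.sum_erase_add I deg hi, ← h]
  abel

variable (M : GrObj deg V)

/-- The operator `x_i ⊗ e_i`. -/
def mulContract (c : A) (i : ι) (p p' : ℤ) (hp : p' + 1 = p) :
    (⨁ fun I : SubsetsOfCard ι p => M.obj (c - ∑ l ∈ I.1, deg l)) ⟶
      ⨁ fun I : SubsetsOfCard ι p' => M.obj (c - ∑ l ∈ I.1, deg l) :=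
  contraction i (F := fun I => M.obj (c - ∑ l ∈ I, deg l))
    (F' := fun I => M.obj (c - ∑ l ∈ I, deg l))
    (fun _ hi => M.mul i (wt_erase_mul hi c)) p p' hp

/-- The operator `1 ⊗ e_i`. -/
def contract (i : ι) {a b : A} (h : b + deg i = a) (p p' : ℤ) (hp : p' + 1 = p) :
    (⨁ fun I : SubsetsOfCard ι p => M.obj (a - ∑ l ∈ I.1, deg l)) ⟶
      ⨁ fun I : SubsetsOfCard ι p' => M.obj (b - ∑ l ∈ I.1, deg l) :=
  contraction i (F := fun I => M.obj (a - ∑ l ∈ I, deg l))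
    (F' := fun I => M.obj (b - ∑ l ∈ I, deg l))
    (fun _ hi => eqToHom (congrArg M.obj (wt_erase_act hi h))) p p' hp

theorem mulContract_anticomm (c : A) (i l : ι) (hil : i ≠ l) (p p' p'' : ℤ) (hp : p' + 1 = p)
    (hp' : p'' + 1 = p') :
    M.mulContract c i p p' hp ≫ M.mulContract c l p' p'' hp' =
      - (M.mulContract c l p p' hp ≫ M.mulContract c i p' p'' hp') := by
  refine contraction_anticomm i l hil _ _ _ _ p p' p'' hp hp' fun I h1 h2 => ?_
  have e : c - ∑ j ∈ (I.erase l).erase i, deg j = c - ∑ j ∈ (I.erase i).erase l, deg j := by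
    rw [Finset.erase_right_comm]
  have := M.eqToHom_mul i (wt_erase_mul (Finset.mem_erase.2 ⟨hil, h1⟩) c)
    (b' := c - ∑ j ∈ (I.erase i).erase l, deg j)
    ((wt_erase_mul (Finset.mem_erase.2 ⟨hil, h1⟩) c).trans e) rfl e.symm
  have h3 := M.mul_comm i l (wt_erase_mul h1 c)
    (wt_erase_mul (Finset.mem_erase.2 ⟨hil.symm, h2⟩) c) (wt_erase_mul h2 c)
    ((wt_erase_mul (Finset.mem_erase.2 ⟨hil, h1⟩) c).trans e)
  rw [h3]
  congr 1
  simp only [eqToHom_refl, Category.id_comp] at this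
  rw [this]
  simp

theorem contract_anticomm (i l : ι) (hil : i ≠ l) {a b b' c : A} (h : b + deg i = a)
    (h' : c + deg l = b) (g : b' + deg l = a) (g' : c + deg i = b') (p p' p'' : ℤ)
    (hp : p' + 1 = p) (hp' : p'' + 1 = p') :
    M.contract i h p p' hp ≫ M.contract l h' p' p'' hp' =
      - (M.contract l g p p' hp ≫ M.contract i g' p' p'' hp') := by
  refine contraction_anticomm i l hil _ _ _ _ p p' p'' hp hp' fun I h1 h2 => ?_
  simp

theorem contract_mulContract (i l : ι) (hil : i ≠ l) {a b : A} (h : b + deg i = a)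
    (p p' p'' : ℤ) (hp : p' + 1 = p) (hp' : p'' + 1 = p') :
    M.contract i h p p' hp ≫ M.mulContract b l p' p'' hp' =
      - (M.mulContract a l p p' hp ≫ M.contract i h p' p'' hp') := by
  refine contraction_anticomm i l hil _ _ _ _ p p' p'' hp hp' fun I h1 h2 => ?_
  have h3 : i ∈ I.erase l := Finset.mem_erase.2 ⟨hil, h1⟩
  have h4 : l ∈ I.erase i := Finset.mem_erase.2 ⟨hil.symm, h2⟩
  rw [M.eqToHom_mul l (wt_erase_mul h4 b) (a' := a - ∑ j ∈ I, deg j)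
    (b' := a - ∑ j ∈ I.erase l, deg j) (wt_erase_mul h2 a) (wt_erase_act h1 h)
    ((wt_erase_act h3 h).trans (by rw [Finset.erase_right_comm]))]
  simp

/-- The weight `c` and degree `p` part of `⨁_a M_a ⊗ ω_E(-a; 0)`. -/
abbrev koszulX (c : A) (p : ℤ) : V :=
  ⨁ fun I : SubsetsOfCard ι p => M.obj (c - ∑ l ∈ I.1, deg l)

/-- The differential `∑_i x_i ⊗ e_i`. -/
def koszulD (c : A) (p p' : ℤ) : M.koszulX c p ⟶ M.koszulX c p' :=
  if hp : p' + 1 = p then ∑ i, M.mulContract c i p p' hp else 0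

theorem koszulD_eq (c : A) (p p' : ℤ) (hp : p' + 1 = p) :
    M.koszulD c p p' = ∑ i, M.mulContract c i p p' hp := dif_pos hp

theorem koszulD_comp (c : A) (p p' p'' : ℤ) (hp : p' + 1 = p) (hp' : p'' + 1 = p') :
    M.koszulD c p p' ≫ M.koszulD c p' p'' = 0 := by
  rw [M.koszulD_eq c p p' hp, M.koszulD_eq c p' p'' hp', Preadditive.sum_comp]
  simp_rw [Preadditive.comp_sum]
  refine sum_antisymm_eq_zero _ (fun i => ?_) fun i l hil => ?_
  · exact contraction_self i _ _ p p' p'' hp hp'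
  · exact M.mulContract_anticomm c i l hil p p' p'' hp hp'

/-- The weight `c` strand of the Koszul complex of `M`. -/
def koszul (c : A) : ChainComplex V ℤ where
  X p := M.koszulX c p
  d p p' := M.koszulD c p p'
  shape _ _ h := dif_neg h
  d_comp_d' p p' p'' hp hp' := M.koszulD_comp c p p' p'' hp hp'

/-- The right action of `e_i`, which is given by `f e_i = (-1)^{|f|} e_i f`. -/
def rightContract (i : ι) {a b : A} (h : b + deg i = a) (p p' : ℤ) (hp : p' + 1 = p) :
    M.koszulX a p ⟶ M.koszulX b p' :=
  p.negOnePow • M.contract i h p p' hp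

theorem contract_self (i : ι) {a b c : A} (h : b + deg i = a) (h' : c + deg i = b) (p p' p'' : ℤ)
    (hp : p' + 1 = p) (hp' : p'' + 1 = p') :
    M.contract i h p p' hp ≫ M.contract i h' p' p'' hp' = 0 :=
  contraction_self i _ _ p p' p'' hp hp'

theorem rightContract_self (i : ι) {a b c : A} (h : b + deg i = a) (h' : c + deg i = b)
    (p p' p'' : ℤ) (hp : p' + 1 = p) (hp' : p'' + 1 = p') :
    M.rightContract i h p p' hp ≫ M.rightContract i h' p' p'' hp' = 0 := by
  simp [rightContract, contract_self]

theorem rightContract_anticomm (i l : ι) {a b b' c : A} (h : b + deg i = a) (h' : c + deg l = b)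
    (g : b' + deg l = a) (g' : c + deg i = b') (p p' p'' : ℤ) (hp : p' + 1 = p)
    (hp' : p'' + 1 = p') :
    M.rightContract i h p p' hp ≫ M.rightContract l h' p' p'' hp' =
      - (M.rightContract l g p p' hp ≫ M.rightContract i g' p' p'' hp') := by
  by_cases hil : i = l
  · subst hil
    rw [rightContract_self, rightContract_self, neg_zero]
  · simp [rightContract, M.contract_anticomm i l hil h h' g g' p p' p'' hp hp']

theorem rightContract_koszulD (i : ι) {a b : A} (h : b + deg i = a) (p p' p'' : ℤ)
    (hp : p' + 1 = p) (hp' : p'' + 1 = p') :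
    M.rightContract i h p p' hp ≫ M.koszulD b p' p'' =
      M.koszulD a p p' ≫ M.rightContract i h p' p'' hp' := by
  rw [M.koszulD_eq b p' p'' hp', M.koszulD_eq a p p' hp, Preadditive.comp_sum,
    Preadditive.sum_comp]
  refine Finset.sum_congr rfl fun l _ => ?_
  unfold rightContract
  by_cases hil : i = l
  · subst hil
    have h1 : M.contract i h p p' hp ≫ M.mulContract b i p' p'' hp' = 0 :=
      contraction_self i _ _ p p' p'' hp hp'
    have h2 : M.mulContract a i p p' hp ≫ M.contract i h p' p'' hp' = 0 :=
      contraction_self i _ _ p p' p'' hp hp'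
    simp [h1, h2]
  · have hs : p.negOnePow = - p'.negOnePow := by rw [← hp, Int.negOnePow_succ]
    rw [Linear.units_smul_comp, M.contract_mulContract i l hil h p p' p'' hp hp', hs]
    simp

/-- The Koszul complex `⨁_a M_a ⊗ ω_E(-a; 0)` of a graded module `M`, as a differential
`E`-module. Here `ω_E = Hom(E, k)` has the basis `y_I`, `I ⊆ ι`, dual to the monomials `e_I`, with
`y_I` of degree `(∑_{i ∈ I} deg i; |I|)`. The differential is `∑_i x_i ⊗ e_i`, for the left action
of the `e_i` on `ω_E`. -/
def koszulDM : DM deg V where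
  cx := M.koszul
  act i _ _ h p p' hp := M.rightContract i h p p' hp
  act_sq i _ _ _ h h' p p' p'' hp hp' := M.rightContract_self i h h' p p' p'' hp hp'
  act_anticomm i l _ _ _ _ h h' g g' p p' p'' hp hp' :=
    M.rightContract_anticomm i l h h' g g' p p' p'' hp hp'
  act_d i _ _ h p p' p'' hp hp' := M.rightContract_koszulD i h p p' p'' hp hp'

end GrObj

variable {deg}

/-- Maps of coefficients commute with contractions. -/
theorem contraction_map (i : ι) {F F' G G' : Finset ι → V}
    (f : ∀ I, i ∈ I → (F I ⟶ F' (I.erase i))) (g : ∀ I, i ∈ I → (G I ⟶ G' (I.erase i)))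
    (φ : ∀ I, F I ⟶ G I) (φ' : ∀ I, F' I ⟶ G' I)
    (H : ∀ I hi, f I hi ≫ φ' (I.erase i) = φ I ≫ g I hi) (p p' : ℤ) (hp : p' + 1 = p) :
    contraction i f p p' hp ≫ biproduct.map (fun I : SubsetsOfCard ι p' => φ' I.1) =
      biproduct.map (fun I : SubsetsOfCard ι p => φ I.1) ≫ contraction i g p p' hp := by
  refine biproduct.hom_ext' _ _ fun I => ?_
  unfold contraction
  by_cases h : i ∈ I.1
  · simp [h, reassoc_of% H I.1 h]
  · simp [h]

/-- The map between the terms of Koszul complexes induced by a map of graded modules. -/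
def GrObj.koszulMap {M M' : GrObj deg V} (φ : M ⟶ M') (c : A) (p : ℤ) :
    M.koszulX c p ⟶ M'.koszulX c p :=
  biproduct.map fun I : SubsetsOfCard ι p => φ.app (c - ∑ l ∈ I.1, deg l)

theorem GrObj.koszulMap_koszulD {M M' : GrObj deg V} (φ : M ⟶ M') (c : A) (p p' : ℤ)
    (hp : p' + 1 = p) :
    koszulMap φ c p ≫ M'.koszulD c p p' = M.koszulD c p p' ≫ koszulMap φ c p' := by
  rw [M.koszulD_eq c p p' hp, M'.koszulD_eq c p p' hp, Preadditive.comp_sum, Preadditive.sum_comp]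
  exact Finset.sum_congr rfl fun i _ => (contraction_map i _ _
    (fun I => φ.app (c - ∑ l ∈ I, deg l)) (fun I => φ.app (c - ∑ l ∈ I, deg l))
    (fun I hi => φ.comm i _) p p' hp).symm

theorem GrObj.rightContract_koszulMap {M M' : GrObj deg V} (φ : M ⟶ M') (i : ι) {a b : A}
    (h : b + deg i = a) (p p' : ℤ) (hp : p' + 1 = p) :
    M.rightContract i h p p' hp ≫ koszulMap φ b p' =
      koszulMap φ a p ≫ M'.rightContract i h p p' hp := by
  have key : M.contract i h p p' hp ≫ koszulMap φ b p' =
      koszulMap φ a p ≫ M'.contract i h p p' hp := by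
    refine contraction_map i _ _
      (fun I => φ.app (a - ∑ l ∈ I, deg l)) (fun I => φ.app (b - ∑ l ∈ I, deg l))
      (fun I hi => ?_) p p' hp
    have : ∀ {x y : A} (e : x = y), eqToHom (congrArg M.obj e) ≫ φ.app y =
        φ.app x ≫ eqToHom (congrArg M'.obj e) := by
      rintro x y rfl
      simp
    exact this (wt_erase_act hi h)
  simp [rightContract, key]

/-- The functor that sends a graded module to its Koszul complex. -/
def koszulFunctor : GrObj deg V ⥤ DM deg V where
  obj M := M.koszulDM
  map {M M'} φ :=
    { f := fun c =>
        { f := fun p => GrObj.koszulMap φ c p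
          comm' := fun p p' hp => GrObj.koszulMap_koszulD φ c p p' hp }
      comm := fun i _ _ h p p' hp => GrObj.rightContract_koszulMap φ i h p p' hp }
  map_id M := by
    have : ∀ c p, GrObj.koszulMap (𝟙 M) c p = 𝟙 (M.koszulX c p) := fun c p =>
      biproduct.hom_ext' _ _ fun I => by simp [GrObj.koszulMap]
    refine DM.hom_ext fun c => ?_
    ext p : 1
    exact this c p
  map_comp {M M' M''} φ ψ := by
    have : ∀ c p, GrObj.koszulMap (φ ≫ ψ) c p = GrObj.koszulMap φ c p ≫ GrObj.koszulMap ψ c p :=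
      fun c p => biproduct.hom_ext' _ _ fun I => by simp [GrObj.koszulMap]
    refine DM.hom_ext fun c => ?_
    ext p : 1
    exact this c p

end Koszul
/-! ## Čech complexes and totalizations -/

section Cech

variable {P K V : Type*} [SemilatticeInf P] [Finite K] [Category V] [Preadditive V]
  [HasFiniteProducts V]

/-- The intersection of the charts of a tuple. -/
def chartInf (c : K → P) {n : SimplexCategory} (s : Fin (n.len + 1) → K) : P :=
  Finset.univ.inf' Finset.univ_nonempty (c ∘ s)

theorem chartInf_le (c : K → P) {m n : SimplexCategory} (θ : m ⟶ n) (s : Fin (n.len + 1) → K) :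
    chartInf c s ≤ chartInf c (s ∘ θ.toOrderHom) :=
  Finset.le_inf' _ _ fun j _ => Finset.inf'_le (c ∘ s) (Finset.mem_univ (θ.toOrderHom j))

/-- The cosimplicial object `n ↦ ∏_{s_0, …, s_n} F(c(s_0) ∩ ⋯ ∩ c(s_n))` of Čech cochains of the
presheaf `F`, with respect to the family `c` of charts. -/
def cechCosimplicial (c : K → P) : (Pᵒᵖ ⥤ V) ⥤ CosimplicialObject V where
  obj F :=
    { obj := fun n => ∏ᶜ fun s : Fin (n.len + 1) → K => F.obj (op (chartInf c s))
      map := fun θ => Pi.lift fun s =>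
        Pi.π (fun t => F.obj (op (chartInf c t))) (s ∘ θ.toOrderHom) ≫
          F.map (homOfLE (chartInf_le c θ s)).op
      map_id := fun n => by
        refine Pi.hom_ext _ _ fun s => ?_
        rw [Pi.lift_π, Category.id_comp]
        exact (congrArg _ (F.map_id _)).trans (Category.comp_id _)
      map_comp := fun θ θ' => by
        refine Pi.hom_ext _ _ fun s => ?_
        rw [Pi.lift_π, Category.assoc, Pi.lift_π, Pi.lift_π_assoc, Category.assoc, ← F.map_comp]
        rfl }
  map {F F'} φ :=
    { app := fun n => Limits.Pi.map fun s : Fin (n.len + 1) → K => φ.app (op (chartInf c s))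
      naturality := fun m n θ => by
        refine Pi.hom_ext _ _ fun s => ?_
        simp [Limits.Pi.map] }
  map_id F := by
    refine NatTrans.ext (funext fun n => Pi.hom_ext _ _ fun s => ?_)
    simp
  map_comp φ ψ := by
    refine NatTrans.ext (funext fun n => Pi.hom_ext _ _ fun s => ?_)
    simp

/-- The Čech complex of a presheaf with respect to the family `c` of charts. -/
def cech (c : K → P) : (Pᵒᵖ ⥤ V) ⥤ CochainComplex V ℕ :=
  cechCosimplicial c ⋙ AlgebraicTopology.alternatingCofaceMapComplex V

instance (c : K → P) : (cech (V := V) c).Additive where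
  map_add {F F' φ ψ} := by
    have key : ∀ χ : F ⟶ F', ∀ q : ℕ, ((cech c).map χ).f q =
        Limits.Pi.map fun s : Fin ((SimplexCategory.mk q).len + 1) → K =>
          χ.app (op (chartInf c s)) := fun _ _ => rfl
    ext q : 1
    rw [HomologicalComplex.add_f_apply, key, key, key]
    refine Pi.hom_ext _ _ fun s => Eq.trans ?_ (Preadditive.add_comp _ _ _ _ _ _).symm
    simp

end Cech

section Total

/-- The convention for the total complexes of Čech bicomplexes: row `q` of a bicomplex is in Čech
degree `q`, the entry of column `p` and row `q` has homological degree `p - q`, and the horizontal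
differential of row `q` is multiplied by `(-1) ^ q`. -/
instance : TotalComplexShape (ComplexShape.down ℤ) (ComplexShape.up ℕ) (ComplexShape.down ℤ) where
  π x := x.1 - x.2
  ε₁ x := (-1) ^ x.2
  ε₂ _ := 1
  rel₁ {p p'} h q := by
    have h' : p' + 1 = p := h
    change p' - q + 1 = p - q
    rw [← h']; ring
  rel₂ p {q q'} h := by
    have h' : q + 1 = q' := h
    change p - q' + 1 = p - q
    rw [← h']; push_cast; ring
  ε₂_ε₁ {p p' q q'} _ h := by
    have h' : q + 1 = q' := h
    rw [← h', pow_succ]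
    simp

variable {V : Type*} [Category V] [Preadditive V] [HasCountableCoproducts V]

/-- Bicomplexes with a horizontal differential of degree `-1` and a vertical differential of
degree `1`, the rows being indexed by natural numbers. -/
abbrev Bicomplex (V : Type*) [Category V] [Preadditive V] :=
  HomologicalComplex₂ V (ComplexShape.down ℤ) (ComplexShape.up ℕ)

instance (L : Bicomplex V) : L.HasTotal (ComplexShape.down ℤ) := fun _ => inferInstance

/-- The total complex. -/
abbrev tot (L : Bicomplex V) : ChainComplex V ℤ := L.total (ComplexShape.down ℤ)

theorem pi_eq (p : ℤ) (q : ℕ) : ComplexShape.π (ComplexShape.down ℤ) (ComplexShape.up ℕ)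
    (ComplexShape.down ℤ) (p, q) = p - q := rfl

theorem pi_pred {p p' n n' : ℤ} {q : ℕ} (hp : p' + 1 = p) (hn : n' + 1 = n)
    (h : ComplexShape.π (ComplexShape.down ℤ) (ComplexShape.up ℕ) (ComplexShape.down ℤ)
      (p, q) = n) :
    ComplexShape.π (ComplexShape.down ℤ) (ComplexShape.up ℕ) (ComplexShape.down ℤ)
      (p', q) = n' := by
  rw [pi_eq] at h ⊢
  linarith

theorem pi_succ {p n n' : ℤ} {q : ℕ} (hn : n' + 1 = n)
    (h : ComplexShape.π (ComplexShape.down ℤ) (ComplexShape.up ℕ) (ComplexShape.down ℤ)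
      (p, q) = n) :
    ComplexShape.π (ComplexShape.down ℤ) (ComplexShape.up ℕ) (ComplexShape.down ℤ)
      (p, q + 1) = n' := by
  rw [pi_eq] at h ⊢
  push_cast
  linarith

variable {L L' L'' M M' : Bicomplex V}

/-- The map of degree `-1` between total complexes induced by maps of degree `-1` between the
columns of two bicomplexes. -/
def totAct (f : ∀ p p' : ℤ, p' + 1 = p → (L.X p ⟶ L'.X p')) (n n' : ℤ) (h : n' + 1 = n) :
    (tot L).X n ⟶ (tot L').X n' :=
  L.totalDesc fun p q hpq => (f p (p - 1) (by ring)).f q ≫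
    L'.ιTotal (ComplexShape.down ℤ) (p - 1) q n' (pi_pred (by ring) h hpq)

theorem ι_totAct (f : ∀ p p' : ℤ, p' + 1 = p → (L.X p ⟶ L'.X p')) (n n' : ℤ) (h : n' + 1 = n)
    (p p' : ℤ) (q : ℕ) (hp : p' + 1 = p) (hpq) :
    L.ιTotal (ComplexShape.down ℤ) p q n hpq ≫ totAct f n n' h =
      (f p p' hp).f q ≫ L'.ιTotal (ComplexShape.down ℤ) p' q n' (pi_pred hp h hpq) := by
  obtain rfl : p' = p - 1 := by linarith
  exact HomologicalComplex₂.ι_totalDesc _ _ _ _ _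

theorem totAct_comp_eq_zero (f : ∀ p p' : ℤ, p' + 1 = p → (L.X p ⟶ L'.X p'))
    (g : ∀ p p' : ℤ, p' + 1 = p → (L'.X p ⟶ L''.X p'))
    (H : ∀ (p p' p'' : ℤ) (h : p' + 1 = p) (h' : p'' + 1 = p'), f p p' h ≫ g p' p'' h' = 0)
    (n n' n'' : ℤ) (h : n' + 1 = n) (h' : n'' + 1 = n') :
    totAct f n n' h ≫ totAct g n' n'' h' = 0 := by
  refine HomologicalComplex₂.total.hom_ext _ fun p q hpq => ?_
  have e := congrArg (fun φ => HomologicalComplex.Hom.f φ q)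
    (H p (p - 1) (p - 1 - 1) (by ring) (by ring))
  rw [HomologicalComplex.comp_f, HomologicalComplex.zero_f] at e
  rw [reassoc_of% (ι_totAct f n n' h p (p - 1) q (by ring) hpq),
    ι_totAct g n' n'' h' (p - 1) (p - 1 - 1) q (by ring), reassoc_of% e, comp_zero, zero_comp]

theorem totAct_anticomm (f : ∀ p p' : ℤ, p' + 1 = p → (L.X p ⟶ L'.X p'))
    (g : ∀ p p' : ℤ, p' + 1 = p → (L'.X p ⟶ L''.X p'))
    (f' : ∀ p p' : ℤ, p' + 1 = p → (L.X p ⟶ M.X p'))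
    (g' : ∀ p p' : ℤ, p' + 1 = p → (M.X p ⟶ L''.X p'))
    (H : ∀ (p p' p'' : ℤ) (h : p' + 1 = p) (h' : p'' + 1 = p'),
      f p p' h ≫ g p' p'' h' = - (f' p p' h ≫ g' p' p'' h'))
    (n n' n'' : ℤ) (h : n' + 1 = n) (h' : n'' + 1 = n') :
    totAct f n n' h ≫ totAct g n' n'' h' = - (totAct f' n n' h ≫ totAct g' n' n'' h') := by
  refine HomologicalComplex₂.total.hom_ext _ fun p q hpq => ?_
  have e := congrArg (fun φ => HomologicalComplex.Hom.f φ q)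
    (H p (p - 1) (p - 1 - 1) (by ring) (by ring))
  rw [HomologicalComplex.comp_f, HomologicalComplex.neg_f_apply, HomologicalComplex.comp_f] at e
  rw [Preadditive.comp_neg, reassoc_of% (ι_totAct f n n' h p (p - 1) q (by ring) hpq),
    reassoc_of% (ι_totAct f' n n' h p (p - 1) q (by ring) hpq),
    ι_totAct g n' n'' h' (p - 1) (p - 1 - 1) q (by ring),
    ι_totAct g' n' n'' h' (p - 1) (p - 1 - 1) q (by ring), reassoc_of% e, Preadditive.neg_comp,
    Category.assoc]

theorem totAct_d (f : ∀ p p' : ℤ, p' + 1 = p → (L.X p ⟶ L'.X p'))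
    (hf : ∀ (p p' p'' : ℤ) (h : p' + 1 = p) (h' : p'' + 1 = p'),
      f p p' h ≫ L'.d p' p'' = L.d p p' ≫ f p' p'' h')
    (n n' n'' : ℤ) (h : n' + 1 = n) (h' : n'' + 1 = n') :
    totAct f n n' h ≫ (tot L').d n' n'' = (tot L).d n n' ≫ totAct f n' n'' h' := by
  refine HomologicalComplex₂.total.hom_ext _ fun p q hpq => ?_
  have h1 := pi_pred (p' := p - 1) (by ring) h hpq
  have h2 := pi_succ h hpq
  have h3 := pi_pred (p' := p - 1 - 1) (by ring) h' h1
  have h4 := pi_succ h' h1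
  have r1 : (ComplexShape.down ℤ).Rel p (p - 1) := by simp
  have r2 : (ComplexShape.down ℤ).Rel (p - 1) (p - 1 - 1) := by simp
  have r3 : (ComplexShape.up ℕ).Rel q (q + 1) := rfl
  have e1 := congrArg (fun φ => HomologicalComplex.Hom.f φ q)
    (hf p (p - 1) (p - 1 - 1) (by ring) (by ring))
  rw [HomologicalComplex.comp_f, HomologicalComplex.comp_f] at e1
  have e2 := (f p (p - 1) (by ring)).comm q (q + 1)
  rw [reassoc_of% (ι_totAct f n n' h p (p - 1) q (by ring) hpq), HomologicalComplex₂.total_d,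
    HomologicalComplex₂.total_d,
    Preadditive.comp_add, Preadditive.comp_add, Preadditive.add_comp, Preadditive.comp_add,
    HomologicalComplex₂.ι_D₁, HomologicalComplex₂.ι_D₂, HomologicalComplex₂.ι_D₁_assoc,
    HomologicalComplex₂.ι_D₂_assoc, HomologicalComplex₂.d₁_eq _ _ r1 _ _ h1,
    HomologicalComplex₂.d₁_eq _ _ r2 _ _ h3, HomologicalComplex₂.d₂_eq _ _ _ r3 _ h2,
    HomologicalComplex₂.d₂_eq _ _ _ r3 _ h4]
  simp only [Linear.units_smul_comp, Linear.comp_units_smul, Category.assoc]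
  rw [ι_totAct f n' n'' h' (p - 1) (p - 1 - 1) q (by ring),
    ι_totAct f n' n'' h' p (p - 1) (q + 1) (by ring), reassoc_of% e1, reassoc_of% e2]
  rfl

theorem totAct_map (f : ∀ p p' : ℤ, p' + 1 = p → (L.X p ⟶ L'.X p'))
    (g : ∀ p p' : ℤ, p' + 1 = p → (M.X p ⟶ M'.X p')) (φ : L ⟶ M) (φ' : L' ⟶ M')
    (H : ∀ (p p' : ℤ) (h : p' + 1 = p), f p p' h ≫ φ'.f p' = φ.f p ≫ g p p' h)
    (n n' : ℤ) (h : n' + 1 = n) :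
    totAct f n n' h ≫ (HomologicalComplex₂.total.map φ' (ComplexShape.down ℤ)).f n' =
      (HomologicalComplex₂.total.map φ (ComplexShape.down ℤ)).f n ≫ totAct g n n' h := by
  refine HomologicalComplex₂.total.hom_ext _ fun p q hpq => ?_
  have e := congrArg (fun φ => HomologicalComplex.Hom.f φ q) (H p (p - 1) (by ring))
  rw [HomologicalComplex.comp_f, HomologicalComplex.comp_f] at e
  rw [reassoc_of% (ι_totAct f n n' h p (p - 1) q (by ring) hpq),
    HomologicalComplex₂.ιTotal_map_assoc, HomologicalComplex₂.ιTotal_map,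
    ι_totAct g n n' h p (p - 1) q (by ring), reassoc_of% e]

variable {W : Type*} [Category W] [Preadditive W] (G : W ⥤ CochainComplex V ℕ) [G.Additive]

/-- Given an additive functor `G` with values in cochain complexes, apply `G` to the terms of a
chain complex and totalize the resulting bicomplex. -/
def totalize : ChainComplex W ℤ ⥤ ChainComplex V ℤ where
  obj C := tot ((G.mapHomologicalComplex _).obj C)
  map φ := HomologicalComplex₂.total.map ((G.mapHomologicalComplex _).map φ) _
  map_id C := by
    rw [CategoryTheory.Functor.map_id]
    exact HomologicalComplex₂.total.map_id _ _
  map_comp φ ψ := by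
    rw [CategoryTheory.Functor.map_comp]
    exact HomologicalComplex₂.total.map_comp _ _ _

/-- The same construction for differential modules: each strand is totalized, and the exterior
algebra acts termwise. -/
def totalizeDM {ι A : Type} [AddCommGroup A] {deg : ι → A} : DM deg W ⥤ DM deg V where
  obj D :=
    { cx := fun a => (totalize G).obj (D.cx a)
      act := fun i a b h n n' hn =>
        totAct (L := (G.mapHomologicalComplex _).obj (D.cx a))
          (L' := (G.mapHomologicalComplex _).obj (D.cx b))
          (fun p p' hp => G.map (D.act i h p p' hp)) n n' hn
      act_sq := fun i a b c h h' n n' n'' hn hn' => totAct_comp_eq_zero _ _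
        (fun p p' p'' hp hp' => by
          have := congrArg G.map (D.act_sq i h h' p p' p'' hp hp')
          rwa [G.map_comp, G.map_zero] at this) n n' n'' hn hn'
      act_anticomm := fun i l a b b' c h h' g g' n n' n'' hn hn' => totAct_anticomm _ _ _ _
        (fun p p' p'' hp hp' => by
          have := congrArg G.map (D.act_anticomm i l h h' g g' p p' p'' hp hp')
          rwa [G.map_comp, G.map_neg, G.map_comp] at this) n n' n'' hn hn'
      act_d := fun i a b h n n' n'' hn hn' => totAct_d _
        (fun p p' p'' hp hp' => by
          have := congrArg G.map (D.act_d i h p p' p'' hp hp')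
          rwa [G.map_comp, G.map_comp] at this) n n' n'' hn hn' }
  map {D D'} φ :=
    { f := fun a => (totalize G).map (φ.f a)
      comm := fun i a b h n n' hn => totAct_map (L := (G.mapHomologicalComplex _).obj (D.cx a))
        (L' := (G.mapHomologicalComplex _).obj (D.cx b))
        (M := (G.mapHomologicalComplex _).obj (D'.cx a))
        (M' := (G.mapHomologicalComplex _).obj (D'.cx b))
        (fun p p' hp => G.map (D.act i h p p' hp)) (fun p p' hp => G.map (D'.act i h p p' hp))
        ((G.mapHomologicalComplex _).map (φ.f a)) ((G.mapHomologicalComplex _).map (φ.f b))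
        (fun p p' hp => by
          have := congrArg G.map (φ.comm i h p p' hp)
          rwa [G.map_comp, G.map_comp] at this) n n' hn }
  map_id D := DM.hom_ext fun a => (totalize G).map_id _
  map_comp φ ψ := DM.hom_ext fun a => (totalize G).map_comp _ _

end Total
/-! ## The Fourier–Mukai transforms -/

namespace CoxData

section

variable {ι A P : Type} [Fintype ι] [DecidableEq ι] [AddCommGroup A] [SemilatticeInf P]
  (X : CoxData ι A P)

theorem twistMul_comm {k : Type u} [Field k] (i l : ι) {a b b' c : A} (h : a + X.deg i = b)
    (h' : b + X.deg l = c) (g : a + X.deg l = b') (g' : b' + X.deg i = c) :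
    X.twistMul (k := k) i h ≫ X.twistMul l h' = X.twistMul l g ≫ X.twistMul i g' := by
  have e : X.mulVar i h ≫ X.mulVar l h' = X.mulVar l g ≫ X.mulVar i g' := by
    ext x : 2
    refine X.loc_hom_ext ?_
    rw [NatTrans.comp_app, NatTrans.comp_app, comp_exp, comp_exp]
    simp [add_comm]
  have e' := congrArg ((Functor.whiskeringLeft _ _ (ModuleCat.{u} k)).map) e
  rw [Functor.map_comp, Functor.map_comp] at e'
  exact e'

/-- The presheaf on the charts formed by the pieces of degree `b` of a sheaf. -/
def atDegree (k : Type u) [Field k] (b : A) : X.Mod k ⥤ (Pᵒᵖ ⥤ ModuleCat.{u} k) :=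
  (Functor.whiskeringLeft _ _ _).obj
    { obj := fun p => (⟨p.unop, b⟩ : X.Loc)
      map := fun f => res (leOfHom f.unop) b }

instance (k : Type u) [Field k] (b : A) : (X.atDegree k b).Additive := ⟨rfl⟩

instance (k : Type u) [Field k] : HasFiniteBiproducts (X.Mod k) :=
  HasFiniteBiproducts.of_hasFiniteProducts

/-- The semigroup of effective divisor classes, which is generated by the degrees of the
variables. -/
def Eff : AddSubmonoid A := AddSubmonoid.closure (Set.range X.deg)

theorem deg_mem_Eff (i : ι) : X.deg i ∈ X.Eff := AddSubmonoid.subset_closure ⟨i, rfl⟩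

variable {ι' A' P' : Type} [Fintype ι'] [DecidableEq ι'] [AddCommGroup A'] [SemilatticeInf P']
  (Y : CoxData ι' A' P')

/-- The charts `p × q` of a product. -/
def ChartPair (P P' : Type) : Type := P × P'

instance : SemilatticeInf (ChartPair P P') := inferInstanceAs (SemilatticeInf (P × P'))

/-- The covering of a product by the products of the charts of two coverings. -/
def chartPair {K K' : Type} (c : K → P) (c' : K' → P') (s : K × K') : ChartPair P P' :=
  (c s.1, c' s.2)

/-- The chart `p × (q ∩ τ)` and the degree `(0, b)` attached to charts `p × q` and `τ` and to a
degree `b`. -/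
def pushforwardIndex : (ChartPair P P')ᵒᵖ × Y.Loc ⥤ (X.prod Y).Loc where
  obj z := ⟨(z.1.unop.1, z.1.unop.2 ⊓ z.2.chart), (0, z.2.wt)⟩
  map {z w} f :=
    { chart_le := ⟨(leOfHom f.1.unop).1, inf_le_inf (leOfHom f.1.unop).2 f.2.chart_le⟩
      exp := Sum.elim 0 f.2.exp
      nonneg := by
        rintro (i | i) hi
        · exact le_rfl
        · refine f.2.nonneg i ?_
          exact Y.supp_mono inf_le_right (Finset.inr_mem_disjSum.1 hi)
      wt_add := by
        have h := f.2.wt_add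
        simp [prod, Prod.ext_iff, Prod.fst_sum, Prod.snd_sum, h] }
  map_id z := by
    refine (X.prod Y).loc_hom_ext ?_
    funext i
    rcases i with i | i <;> rfl
  map_comp f g := by
    refine (X.prod Y).loc_hom_ext ?_
    funext i
    rcases i with i | i
    · exact (add_zero _).symm
    · rfl

/-- The Čech model of the derived pushforward `R π₂_*` of a sheaf `H` on `X × Y` along the second
projection. The families `c` and `c'` of charts cover `X` and `Y`. Over the chart `τ` of `Y`, and
in degree `b`, this is the degree `(0, b)` part of the Čech complex of `H` on `X × τ` for the
covering by the products `c s × (c' s' ∩ τ)`. -/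
def pushforwardCech (k : Type u) [Field k] {K K' : Type} [Finite K] [Finite K'] (c : K → P)
    (c' : K' → P') : (X.prod Y).Mod k ⥤ CochainComplex (Y.Mod k) ℕ :=
  (Functor.whiskeringLeft _ _ _).obj (X.pushforwardIndex Y) ⋙ Functor.curry ⋙ cech (chartPair c c')

instance (k : Type u) [Field k] {K K' : Type} [Finite K] [Finite K'] (c : K → P)
    (c' : K' → P') : (X.pushforwardCech Y k c c').Additive := by
  have : ((Functor.whiskeringLeft _ _ (ModuleCat.{u} k)).obj (X.pushforwardIndex Y) ⋙
    Functor.curry).Additive := ⟨rfl⟩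
  exact inferInstanceAs (((Functor.whiskeringLeft _ _ (ModuleCat.{u} k)).obj
    (X.pushforwardIndex Y) ⋙ Functor.curry) ⋙ cech (chartPair c c')).Additive

end

section

variable {ι A P : Type} [Fintype ι] [LinearOrder ι] [AddCommGroup A] [SemilatticeInf P]
  (X : CoxData ι A P) (k : Type u) [Field k]

/-- The graded module `a ↦ F(a)` attached to a sheaf `F`. -/
def twists : X.Mod k ⥤ GrObj X.deg (X.Mod k) where
  obj F :=
    { obj := fun a => (X.twist a).obj F
      mul := fun i _ _ h => (X.twistMul i h).app F
      mul_comm := fun i l _ _ _ _ h h' g g' => congrArg (fun α => NatTrans.app α F)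
        (X.twistMul_comm (k := k) i l h h' g g') }
  map φ :=
    { app := fun a => (X.twist a).map φ
      comm := fun i _ _ h => ((X.twistMul i h).naturality φ).symm }

/-- The Fourier–Mukai transform `F ↦ R π₂_*(π₁^* F ⊗ 𝒦)` from sheaves to differential `E`-modules
with respect to the noncommutative kernel `𝒦 = ⨁_a 𝒪(a) ⊗ ω_E(-a; 0)`, whose differential is
`∑_i x_i ⊗ e_i`: the totalization of the Čech complex of `F ⊗ 𝒦 = ⨁_a F(a) ⊗ ω_E(-a; 0)`, for the
covering by the charts `c s`. -/
def transformK {K : Type} [Finite K] (c : K → P) : X.Mod k ⥤ DM X.deg (ModuleCat.{u} k) :=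
  X.twists k ⋙ koszulFunctor ⋙ totalizeDM (X.atDegree k 0 ⋙ cech c)

theorem wt_inl (i : ι) {b b' : A} (h : b + X.deg i = b') (d : A) :
    (b - d, d) + (X.prod X).deg (Sum.inl i) = (b' - d, d) := by
  rw [← h]
  simp only [prod, Sum.elim_inl, Prod.mk_add_mk, add_zero]
  congr 1
  abel

theorem wt_inr (i : ι) {b b' : A} (h : b + X.deg i = b') (d : A) :
    (b - d, d) + (X.prod X).deg (Sum.inr i) = (b' - (d + X.deg i), d + X.deg i) := by
  rw [← h]
  simp only [prod, Sum.elim_inr, Prod.mk_add_mk, add_zero]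
  congr 1
  abel

section

variable {k}

/-- The piece of degree `b` of the graded module `H ⊗ k[x, y][Eff]`, see below. -/
def diagObj (H : (X.prod X).Mod k) (b : A) : (X.prod X).Mod k :=
  ∐ fun d : X.Eff => ((X.prod X).twist (b - d.1, d.1)).obj H

/-- The inclusion of the summand with index `d`. -/
def diagIncl (H : (X.prod X).Mod k) (b : A) (d : X.Eff) :
    ((X.prod X).twist (b - d.1, d.1)).obj H ⟶ X.diagObj H b :=
  Sigma.ι (fun d : X.Eff => ((X.prod X).twist (b - d.1, d.1)).obj H) d

/-- The class `d + deg x_i`. -/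
def addDeg (d : X.Eff) (i : ι) : X.Eff := ⟨d.1 + X.deg i, add_mem d.2 (X.deg_mem_Eff i)⟩

/-- Multiplication by `y_i` on a summand. -/
def diagY (H : (X.prod X).Mod k) (i : ι) {b b' : A} (h : b + X.deg i = b') (d : X.Eff) :
    ((X.prod X).twist (b - d.1, d.1)).obj H ⟶ ((X.prod X).twist (b' - d.1, d.1)).obj H :=
  ((X.prod X).twistMul (Sum.inl i) (X.wt_inl i h d.1)).app H

/-- Multiplication by `x_i` on a summand. -/
def diagX (H : (X.prod X).Mod k) (i : ι) {b b' : A} (h : b + X.deg i = b') (d : X.Eff) :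
    ((X.prod X).twist (b - d.1, d.1)).obj H ⟶
      ((X.prod X).twist (b' - (X.addDeg d i).1, (X.addDeg d i).1)).obj H :=
  ((X.prod X).twistMul (Sum.inr i) (X.wt_inr i h d.1)).app H

/-- Multiplication by `y_i - x_i u_i`. -/
def diagMul (H : (X.prod X).Mod k) (i : ι) {b b' : A} (h : b + X.deg i = b') :
    X.diagObj H b ⟶ X.diagObj H b' :=
  Sigma.desc fun d => X.diagY H i h d ≫ X.diagIncl H b' d -
    X.diagX H i h d ≫ X.diagIncl H b' (X.addDeg d i)

theorem diagIncl_mul (H : (X.prod X).Mod k) (i : ι) {b b' : A} (h : b + X.deg i = b')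
    (d : X.Eff) : X.diagIncl H b d ≫ X.diagMul H i h =
      X.diagY H i h d ≫ X.diagIncl H b' d -
        X.diagX H i h d ≫ X.diagIncl H b' (X.addDeg d i) :=
  Sigma.ι_desc _ _

theorem diag_hom_ext {H H' : (X.prod X).Mod k} {b : A} {f g : X.diagObj H b ⟶ H'}
    (h : ∀ d, X.diagIncl H b d ≫ f = X.diagIncl H b d ≫ g) : f = g :=
  Sigma.hom_ext _ _ h

theorem twistMul_comm_app {Y : CoxData (ι ⊕ ι) (A × A) (P × P)} (H : Y.Mod k) (i l : ι ⊕ ι)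
    {a b b' c : A × A} (h : a + Y.deg i = b) (h' : b + Y.deg l = c) (g : a + Y.deg l = b')
    (g' : b' + Y.deg i = c) :
    (Y.twistMul i h).app H ≫ (Y.twistMul l h').app H =
      (Y.twistMul l g).app H ≫ (Y.twistMul i g').app H :=
  congrArg (fun α => NatTrans.app α H) (Y.twistMul_comm (k := k) i l h h' g g')

theorem diagY_diagY (H : (X.prod X).Mod k) (i l : ι) {a b b' c : A} (h : a + X.deg i = b)
    (h' : b + X.deg l = c) (g : a + X.deg l = b') (g' : b' + X.deg i = c) (d : X.Eff) :
    X.diagY H i h d ≫ X.diagY H l h' d = X.diagY H l g d ≫ X.diagY H i g' d :=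
  twistMul_comm_app H _ _ _ _ _ _

theorem diagY_diagX (H : (X.prod X).Mod k) (i l : ι) {a b b' c : A} (h : a + X.deg i = b)
    (h' : b + X.deg l = c) (g : a + X.deg l = b') (g' : b' + X.deg i = c) (d : X.Eff) :
    X.diagY H i h d ≫ X.diagX H l h' d = X.diagX H l g d ≫ X.diagY H i g' (X.addDeg d l) :=
  twistMul_comm_app H _ _ _ _ _ _

theorem diagX_diagX (H : (X.prod X).Mod k) (i l : ι) {a b b' c : A} (h : a + X.deg i = b)
    (h' : b + X.deg l = c) (g : a + X.deg l = b') (g' : b' + X.deg i = c) (d : X.Eff) :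
    X.diagX H i h d ≫ X.diagX H l h' (X.addDeg d i) ≫
        X.diagIncl H c (X.addDeg (X.addDeg d i) l) =
      X.diagX H l g d ≫ X.diagX H i g' (X.addDeg d l) ≫
        X.diagIncl H c (X.addDeg (X.addDeg d l) i) := by
  have key : ∀ (z z₁ z₂ : A × A) (e e' : X.Eff) (_ : e = e')
      (h₁ : z + (X.prod X).deg (Sum.inr i) = z₁)
      (h₂ : z₁ + (X.prod X).deg (Sum.inr l) = (c - e.1, e.1))
      (g₁ : z + (X.prod X).deg (Sum.inr l) = z₂)
      (g₂ : z₂ + (X.prod X).deg (Sum.inr i) = (c - e'.1, e'.1)),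
      ((X.prod X).twistMul (Sum.inr i) h₁).app H ≫ ((X.prod X).twistMul (Sum.inr l) h₂).app H ≫
        X.diagIncl H c e =
      ((X.prod X).twistMul (Sum.inr l) g₁).app H ≫ ((X.prod X).twistMul (Sum.inr i) g₂).app H ≫
        X.diagIncl H c e' := by
    rintro z z₁ z₂ e _ rfl h₁ h₂ g₁ g₂
    rw [← Category.assoc, ← Category.assoc]
    exact congrArg (· ≫ _) (twistMul_comm_app H _ _ h₁ h₂ g₁ g₂)
  exact key _ _ _ (X.addDeg (X.addDeg d i) l) (X.addDeg (X.addDeg d l) i)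
    (Subtype.ext (add_right_comm _ _ _)) _ _ _ _

theorem diagMul_comm (H : (X.prod X).Mod k) (i l : ι) {a b b' c : A} (h : a + X.deg i = b)
    (h' : b + X.deg l = c) (g : a + X.deg l = b') (g' : b' + X.deg i = c) :
    X.diagMul H i h ≫ X.diagMul H l h' = X.diagMul H l g ≫ X.diagMul H i g' := by
  refine X.diag_hom_ext fun d => ?_
  have e : ∀ {a b c : A} (i l : ι) (h : a + X.deg i = b) (h' : b + X.deg l = c),
      X.diagIncl H a d ≫ X.diagMul H i h ≫ X.diagMul H l h' =
        (X.diagY H i h d ≫ X.diagY H l h' d) ≫ X.diagIncl H c d -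
          (X.diagY H i h d ≫ X.diagX H l h' d) ≫ X.diagIncl H c (X.addDeg d l) -
        (X.diagX H i h d ≫ X.diagY H l h' (X.addDeg d i)) ≫ X.diagIncl H c (X.addDeg d i) +
          X.diagX H i h d ≫ X.diagX H l h' (X.addDeg d i) ≫
            X.diagIncl H c (X.addDeg (X.addDeg d i) l) := by
    intro a b c i l h h'
    rw [← Category.assoc, X.diagIncl_mul, Preadditive.sub_comp, Category.assoc, Category.assoc,
      X.diagIncl_mul, X.diagIncl_mul, Preadditive.comp_sub, Preadditive.comp_sub,
      Category.assoc, Category.assoc, Category.assoc]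
    exact sub_sub_eq_add_sub _ _ _ |>.trans (by abel)
  rw [e, e, X.diagY_diagY H i l h h' g g', X.diagY_diagX H i l h h' g g',
    X.diagY_diagX H l i g g' h h', X.diagX_diagX H i l h h' g g']
  abel

/-- The maps induced by maps of sheaves. -/
def diagMap {H H' : (X.prod X).Mod k} (φ : H ⟶ H') (b : A) : X.diagObj H b ⟶ X.diagObj H' b :=
  Sigma.desc fun d => ((X.prod X).twist (b - d.1, d.1)).map φ ≫ X.diagIncl H' b d

theorem diagIncl_map {H H' : (X.prod X).Mod k} (φ : H ⟶ H') (b : A) (d : X.Eff) :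
    X.diagIncl H b d ≫ X.diagMap φ b =
      ((X.prod X).twist (b - d.1, d.1)).map φ ≫ X.diagIncl H' b d :=
  Sigma.ι_desc _ _

theorem diagMap_comm {H H' : (X.prod X).Mod k} (φ : H ⟶ H') (i : ι) {b b' : A}
    (h : b + X.deg i = b') :
    X.diagMul H i h ≫ X.diagMap φ b' = X.diagMap φ b ≫ X.diagMul H' i h := by
  have e1 : ∀ d : X.Eff, X.diagY H i h d ≫ ((X.prod X).twist (b' - d.1, d.1)).map φ =
      ((X.prod X).twist (b - d.1, d.1)).map φ ≫ X.diagY H' i h d :=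
    fun d => (((X.prod X).twistMul (Sum.inl i) (X.wt_inl i h d.1)).naturality φ).symm
  have e2 : ∀ d : X.Eff, X.diagX H i h d ≫
      ((X.prod X).twist (b' - (X.addDeg d i).1, (X.addDeg d i).1)).map φ =
      ((X.prod X).twist (b - d.1, d.1)).map φ ≫ X.diagX H' i h d :=
    fun d => (((X.prod X).twistMul (Sum.inr i) (X.wt_inr i h d.1)).naturality φ).symm
  refine X.diag_hom_ext fun d => ?_
  rw [← Category.assoc, X.diagIncl_mul, ← Category.assoc, X.diagIncl_map, Preadditive.sub_comp,
    Category.assoc, Category.assoc, Category.assoc, X.diagIncl_map, X.diagIncl_map,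
    X.diagIncl_mul, Preadditive.comp_sub, reassoc_of% (e1 d), reassoc_of% (e2 d)]

theorem diagMap_id (H : (X.prod X).Mod k) (b : A) : X.diagMap (𝟙 H) b = 𝟙 _ := by
  refine X.diag_hom_ext fun d => ?_
  rw [X.diagIncl_map, CategoryTheory.Functor.map_id, Category.id_comp, Category.comp_id]

theorem diagMap_comp {H H' H'' : (X.prod X).Mod k} (φ : H ⟶ H') (ψ : H' ⟶ H'') (b : A) :
    X.diagMap (φ ≫ ψ) b = X.diagMap φ b ≫ X.diagMap ψ b := by
  refine X.diag_hom_ext fun d => ?_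
  rw [X.diagIncl_map, ← Category.assoc, X.diagIncl_map, Category.assoc, X.diagIncl_map,
    CategoryTheory.Functor.map_comp, Category.assoc]

end

/-- For a sheaf `H` on `X × X`, where the coordinates are denoted by `y_i` on the first factor and
by `x_i` on the second factor, this is the sheaf version of the graded module
`H ⊗ k[x, y][Eff]`: its piece of degree `b` is `⨁_{d ∈ Eff} H(b - d, d) u^d`, and the `i`-th
multiplication map is the multiplication by `y_i - x_i u_i`, where the monomial `u_i = u^{deg x_i}`
has degree `(deg x_i, - deg x_i)`. -/
def diagonalModule : (X.prod X).Mod k ⥤ GrObj X.deg ((X.prod X).Mod k) where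
  obj H :=
    { obj := X.diagObj H
      mul := fun i _ _ h => X.diagMul H i h
      mul_comm := fun i l _ _ _ _ h h' g g' => X.diagMul_comm H i l h h' g g' }
  map φ :=
    { app := fun b => X.diagMap φ b
      comm := fun i _ _ h => X.diagMap_comm φ i h }
  map_id H := GrObj.Hom.ext (funext fun b => X.diagMap_id H b)
  map_comp φ ψ := GrObj.Hom.ext (funext fun b => X.diagMap_comp φ ψ b)

/-- The complex `H ⊗ ℛ` of sheaves on `X × X`, where `ℛ` is the toric resolution of the diagonal,
i.e. the complex of sheaves associated with the Koszul complex on the elements `y_i - x_i u_i` over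
the ring `k[x, y][Eff]`. Its terms are
`(H ⊗ ℛ)_p = ⨁_{|I| = p} ⨁_{d ∈ Eff} H(- d - ∑_{i ∈ I} deg x_i, d)`. -/
def tensorR : (X.prod X).Mod k ⥤ ChainComplex ((X.prod X).Mod k) ℤ :=
  X.diagonalModule k ⋙ koszulFunctor ⋙ DM.strand _ 0

/-- The toric resolution of the diagonal, with the terms
`ℛ_p = ⨁_{|I| = p} ⨁_{d ∈ Eff} 𝒪(- d - ∑_{i ∈ I} deg x_i) ⊠ 𝒪(d)`. -/
def resolutionOfDiagonal : ChainComplex ((X.prod X).Mod k) ℤ :=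
  (X.tensorR k).obj ((X.prod X).structureSheaf k)

/-- The Fourier–Mukai transform `Φ_ℛ : F ↦ R π₂_*(π₁^* F ⊗ ℛ)` with the kernel `ℛ`, where `R π₂_*`
is computed by the Čech complex for the covering by the products of the charts `c s`. -/
def transformR {K : Type} [Finite K] (c : K → P) : X.Mod k ⥤ ChainComplex (X.Mod k) ℤ :=
  X.pullbackFst X k ⋙ X.tensorR k ⋙ totalize (X.pushforwardCech X k c c)

end

end CoxData
/-! ## The functor `U` -/

namespace CoxData

section

variable {ι A P : Type} [Fintype ι] [DecidableEq ι] [AddCommGroup A] [SemilatticeInf P]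
  (X : CoxData ι A P)

theorem mapRange_lmapDomain {k : Type*} [Field k] {α β V V' : Type*} [AddCommGroup V] [Module k V]
    [AddCommGroup V'] [Module k V'] (φ : V →ₗ[k] V') (f : α → β) :
    Finsupp.mapRange.linearMap φ ∘ₗ Finsupp.lmapDomain V k f =
      Finsupp.lmapDomain V' k f ∘ₗ Finsupp.mapRange.linearMap φ := by
  refine Finsupp.lhom_ext fun m v => ?_
  simp [Finsupp.mapDomain_single]

/-- The sheaf `𝒪(-a) ⊗ V` on the chart `p`, for `x = (p, a)` and a vector space `V`: the space of
homomorphisms `x ⟶ y` has the Laurent monomials of the right degree as a basis. -/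
def free (k : Type u) [Field k] (x : X.Loc) : ModuleCat.{u} k ⥤ X.Mod k where
  obj V :=
    { obj := fun y => ModuleCat.of k ((x ⟶ y) →₀ V)
      map := fun f => ModuleCat.ofHom (Finsupp.lmapDomain V k (· ≫ f))
      map_id := fun y => by
        ext : 1
        simp only [Category.comp_id]
        exact Finsupp.lmapDomain_id V k
      map_comp := fun f g => by
        ext : 1
        simp only [← Category.assoc]
        exact Finsupp.lmapDomain_comp V k (· ≫ f) (· ≫ g) }
  map φ :=
    { app := fun y => ModuleCat.ofHom (Finsupp.mapRange.linearMap φ.hom)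
      naturality := fun y z f => by
        ext : 1
        exact mapRange_lmapDomain φ.hom (· ≫ f) }
  map_id V := by
    ext y : 3
    exact Finsupp.mapRange.linearMap_id
  map_comp φ ψ := by
    ext y : 3
    exact Finsupp.mapRange.linearMap_comp ψ.hom φ.hom

instance (k : Type u) [Field k] (x : X.Loc) : (X.free k x).Additive where
  map_add {V V' φ ψ} := by
    ext y : 3
    refine Finsupp.lhom_ext fun m v => ?_
    change Finsupp.mapRange.linearMap (φ.hom + ψ.hom) (Finsupp.single m v) =
      Finsupp.mapRange.linearMap φ.hom (Finsupp.single m v) +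
        Finsupp.mapRange.linearMap ψ.hom (Finsupp.single m v)
    simp

/-- Multiplication by a monomial. -/
def freeMap (k : Type u) [Field k] {x x' : X.Loc} (f : x' ⟶ x) : X.free k x ⟶ X.free k x' where
  app V :=
    { app := fun y => ModuleCat.ofHom (Finsupp.lmapDomain V k (f ≫ ·))
      naturality := fun y z g => by
        ext : 1
        refine (Finsupp.lmapDomain_comp V k (· ≫ g) (f ≫ ·)).symm.trans
          (Eq.trans ?_ (Finsupp.lmapDomain_comp V k (f ≫ ·) (· ≫ g)))
        exact congrArg _ (funext fun m => (Category.assoc f m g).symm) }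
  naturality V V' φ := by
    ext y : 3
    exact (mapRange_lmapDomain φ.hom (f ≫ ·)).symm

theorem freeMap_comp (k : Type u) [Field k] {x x' x'' : X.Loc} (f : x' ⟶ x) (g : x'' ⟶ x') :
    X.freeMap k f ≫ X.freeMap k g = X.freeMap k (g ≫ f) := by
  ext V y : 5
  refine (Finsupp.lmapDomain_comp V k (f ≫ ·) (g ≫ ·)).symm.trans ?_
  exact congrArg _ (funext fun m => (Category.assoc g f m).symm)

/-- The quotient stack `[Spec S / G]`, with its only chart: sheaves on it are the graded
`S`-modules. -/
def affine : CoxData ι A PUnit where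
  deg := X.deg
  supp _ := Finset.univ
  supp_inf _ _ := by simp

/-- The charts of `X`, together with the additional chart `Spec S`. -/
def withSpec : CoxData ι A (WithTop P) where
  deg := X.deg
  supp := WithTop.recTopCoe Finset.univ X.supp
  supp_inf p q := by
    induction p using WithTop.recTopCoe with
    | top => simp
    | coe p =>
      induction q using WithTop.recTopCoe with
      | top => simp
      | coe q => exact X.supp_inf p q

/-- The inclusion of the chart `Spec S`. -/
def affineIncl : X.affine.Loc ⥤ X.withSpec.Loc where
  obj x := ⟨⊤, x.wt⟩
  map f := ⟨le_rfl, f.exp, f.nonneg, f.wt_add⟩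

/-- The inclusion of the charts of `X`. -/
def chartIncl : X.Loc ⥤ X.withSpec.Loc where
  obj x := ⟨x.chart, x.wt⟩
  map f := ⟨WithTop.coe_le_coe.2 f.chart_le, f.exp, f.nonneg, f.wt_add⟩

/-- The sheaf associated with a graded `S`-module `M`: its sections over the chart `p` are the
extension of scalars `S_p ⊗_S M`, i.e. the localization of `M`. -/
def sheafify (k : Type u) [Field k] : X.affine.Mod k ⥤ X.Mod k :=
  X.affineIncl.lan ⋙ (Functor.whiskeringLeft _ _ _).obj X.chartIncl

instance (k : Type u) [Field k] : (X.sheafify k).Additive := by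
  have : (X.affineIncl.lan : X.affine.Mod k ⥤ X.withSpec.Mod k).Additive :=
    Adjunction.left_adjoint_additive (X.affineIncl.lanAdjunction _)
  have : ((Functor.whiskeringLeft _ _ (ModuleCat.{u} k)).obj X.chartIncl).Additive := ⟨rfl⟩
  exact inferInstanceAs (X.affineIncl.lan ⋙
    (Functor.whiskeringLeft _ _ (ModuleCat.{u} k)).obj X.chartIncl).Additive

/-! ### The functor `LL` -/

variable (k : Type u) [Field k]

/-- The graded `S`-module `S(-a) ⊗ V`. -/
abbrev freeS (a : A) : ModuleCat.{u} k ⥤ X.affine.Mod k := X.affine.free k ⟨PUnit.unit, a⟩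

/-- Multiplication by `x_i`, as a map `S(-a) ⊗ V ⟶ S(-b) ⊗ V` with `a = b + deg x_i`. -/
def freeSMul (i : ι) {a b : A} (h : b + X.deg i = a) : X.freeS k a ⟶ X.freeS k b :=
  X.affine.freeMap k ⟨le_rfl, Pi.single i 1, fun j _ => by
      by_cases hj : j = i
      · subst hj; simp
      · simp [hj], by
    rw [← h]
    refine congrArg (b + ·) ?_
    rw [Finset.sum_eq_single i]
    · simp [affine]
    · simp +contextual
    · simp⟩

theorem freeSMul_comm (i l : ι) {a b b' c : A} (h : b + X.deg i = a) (h' : c + X.deg l = b)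
    (g : b' + X.deg l = a) (g' : c + X.deg i = b') :
    X.freeSMul k i h ≫ X.freeSMul k l h' = X.freeSMul k l g ≫ X.freeSMul k i g' := by
  unfold freeSMul
  rw [freeMap_comp, freeMap_comp]
  congr 1
  refine X.affine.loc_hom_ext ?_
  rw [comp_exp, comp_exp]
  exact add_comm _ _

variable {X k}

/-- The term `⨁_a S(-a) ⊗ D_{(a; j)}` of `LL(D)`. -/
def llObj (D : DM X.deg (ModuleCat.{u} k)) (j : ℤ) : X.affine.Mod k :=
  ∐ fun a : A => (X.freeS k a).obj ((D.cx a).X j)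

/-- The inclusion of a summand. -/
def llIncl (D : DM X.deg (ModuleCat.{u} k)) (j : ℤ) (a : A) :
    (X.freeS k a).obj ((D.cx a).X j) ⟶ llObj D j :=
  Sigma.ι (fun a : A => (X.freeS k a).obj ((D.cx a).X j)) a

theorem ll_hom_ext {D : DM X.deg (ModuleCat.{u} k)} {j : ℤ} {H : X.affine.Mod k}
    {f g : llObj D j ⟶ H} (h : ∀ a, llIncl D j a ≫ f = llIncl D j a ≫ g) : f = g :=
  Sigma.hom_ext _ _ h

/-- The map `s ⊗ d ↦ x_i s ⊗ e_i d`. -/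
def llMul (D : DM X.deg (ModuleCat.{u} k)) (i : ι) {a b : A} (h : b + X.deg i = a) (j j' : ℤ)
    (hj : j' + 1 = j) : (X.freeS k a).obj ((D.cx a).X j) ⟶ (X.freeS k b).obj ((D.cx b).X j') :=
  (X.freeSMul k i h).app _ ≫ (X.freeS k b).map (D.leftAct i h j j' hj)

/-- The differential `s ⊗ d ↦ ∑_i x_i s ⊗ e_i d - s ⊗ ∂ d` of `LL(D)`. -/
def llD (D : DM X.deg (ModuleCat.{u} k)) (j j' : ℤ) (hj : j' + 1 = j) : llObj D j ⟶ llObj D j' :=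
  Sigma.desc fun a =>
    ∑ i, llMul D i (sub_add_cancel a (X.deg i)) j j' hj ≫ llIncl D j' (a - X.deg i) -
      (X.freeS k a).map ((D.cx a).d j j') ≫ llIncl D j' a

theorem llIncl_d (D : DM X.deg (ModuleCat.{u} k)) (j j' : ℤ) (hj : j' + 1 = j) (a : A) :
    llIncl D j a ≫ llD D j j' hj =
      ∑ i, llMul D i (sub_add_cancel a (X.deg i)) j j' hj ≫ llIncl D j' (a - X.deg i) -
        (X.freeS k a).map ((D.cx a).d j j') ≫ llIncl D j' a :=
  Sigma.ι_desc _ _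

theorem llMul_comp (D : DM X.deg (ModuleCat.{u} k)) (i l : ι) {a b c : A} (h : b + X.deg i = a)
    (h' : c + X.deg l = b) (j j' j'' : ℤ) (hj : j' + 1 = j) (hj' : j'' + 1 = j') :
    llMul D i h j j' hj ≫ llMul D l h' j' j'' hj' =
      (X.freeSMul k i h ≫ X.freeSMul k l h').app _ ≫
        (X.freeS k c).map (D.leftAct i h j j' hj ≫ D.leftAct l h' j' j'' hj') := by
  unfold llMul
  rw [Functor.map_comp, NatTrans.comp_app, Category.assoc, Category.assoc,
    NatTrans.naturality_assoc]

theorem llMul_self (D : DM X.deg (ModuleCat.{u} k)) (i : ι) {a b c : A} (h : b + X.deg i = a)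
    (h' : c + X.deg i = b) (j j' j'' : ℤ) (hj : j' + 1 = j) (hj' : j'' + 1 = j') :
    llMul D i h j j' hj ≫ llMul D i h' j' j'' hj' = 0 := by
  rw [llMul_comp]
  have : D.leftAct i h j j' hj ≫ D.leftAct i h' j' j'' hj' = 0 := by
    simp [DM.leftAct, D.act_sq]
  rw [this, Functor.map_zero, comp_zero]

theorem llMul_anticomm (D : DM X.deg (ModuleCat.{u} k)) (i l : ι) {a b b' c : A}
    (h : b + X.deg i = a) (h' : c + X.deg l = b) (g : b' + X.deg l = a) (g' : c + X.deg i = b')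
    (j j' j'' : ℤ) (hj : j' + 1 = j) (hj' : j'' + 1 = j') :
    llMul D i h j j' hj ≫ llMul D l h' j' j'' hj' =
      - (llMul D l g j j' hj ≫ llMul D i g' j' j'' hj') := by
  rw [llMul_comp, llMul_comp, X.freeSMul_comm k i l h h' g g']
  have : D.leftAct i h j j' hj ≫ D.leftAct l h' j' j'' hj' =
      - (D.leftAct l g j j' hj ≫ D.leftAct i g' j' j'' hj') := by
    simp [DM.leftAct, D.act_anticomm i l h h' g g']
  rw [this, Functor.map_neg, Preadditive.comp_neg]

theorem llMul_d (D : DM X.deg (ModuleCat.{u} k)) (i : ι) {a b : A} (h : b + X.deg i = a)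
    (j j' j'' : ℤ) (hj : j' + 1 = j) (hj' : j'' + 1 = j') :
    llMul D i h j j' hj ≫ (X.freeS k b).map ((D.cx b).d j' j'') =
      - ((X.freeS k a).map ((D.cx a).d j j') ≫ llMul D i h j' j'' hj') := by
  unfold llMul
  rw [Category.assoc, ← Functor.map_comp, NatTrans.naturality_assoc, ← Functor.map_comp,
    ← Preadditive.comp_neg, ← Functor.map_neg]
  have hs : j.negOnePow = - j'.negOnePow := by rw [← hj, Int.negOnePow_succ]
  congr 2
  simp [DM.leftAct, D.act_d i h j j' j'' hj hj', hs]

theorem llD_comp (D : DM X.deg (ModuleCat.{u} k)) (j j' j'' : ℤ) (hj : j' + 1 = j)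
    (hj' : j'' + 1 = j') : llD D j j' hj ≫ llD D j' j'' hj' = 0 := by
  refine ll_hom_ext fun a => ?_
  rw [← Category.assoc, llIncl_d, Preadditive.sub_comp, Preadditive.sum_comp, Category.assoc,
    llIncl_d, comp_zero]
  simp_rw [Category.assoc, llIncl_d, Preadditive.comp_sub, Preadditive.comp_sum]
  rw [Finset.sum_sub_distrib]
  have e1 : ∑ i, ∑ l, llMul D i (sub_add_cancel a (X.deg i)) j j' hj ≫
      llMul D l (sub_add_cancel (a - X.deg i) (X.deg l)) j' j'' hj' ≫
        llIncl D j'' (a - X.deg i - X.deg l) = 0 := by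
    have key : ∀ (i l : ι) (c c' : A) (_ : c = c') (h : c + X.deg l = a - X.deg i)
        (h' : c' + X.deg i = a - X.deg l),
        llMul D i (sub_add_cancel a (X.deg i)) j j' hj ≫ llMul D l h j' j'' hj' ≫
          llIncl D j'' c =
        - (llMul D l (sub_add_cancel a (X.deg l)) j j' hj ≫ llMul D i h' j' j'' hj' ≫
          llIncl D j'' c') := by
      rintro i l c _ rfl h h'
      rw [← Category.assoc, llMul_anticomm D i l _ h (sub_add_cancel a (X.deg l)) h',
        Preadditive.neg_comp, Category.assoc]
    refine sum_antisymm_eq_zero _ (fun i => ?_) fun i l _ => key i l _ _ (sub_right_comm _ _ _) _ _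
    rw [← Category.assoc, llMul_self, zero_comp]
  have e2 : ∀ i, llMul D i (sub_add_cancel a (X.deg i)) j j' hj ≫
      (X.freeS k (a - X.deg i)).map ((D.cx (a - X.deg i)).d j' j'') ≫
        llIncl D j'' (a - X.deg i) =
      - ((X.freeS k a).map ((D.cx a).d j j') ≫
        llMul D i (sub_add_cancel a (X.deg i)) j' j'' hj' ≫ llIncl D j'' (a - X.deg i)) := by
    intro i
    rw [← Category.assoc, llMul_d D i _ j j' j'' hj hj', Preadditive.neg_comp, Category.assoc]
  have e3 : (X.freeS k a).map ((D.cx a).d j j') ≫ (X.freeS k a).map ((D.cx a).d j' j'') ≫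
      llIncl D j'' a = 0 := by
    rw [← Category.assoc, ← Functor.map_comp, HomologicalComplex.d_comp_d, Functor.map_zero,
      zero_comp]
  rw [e1, e3, Finset.sum_congr rfl fun i _ => e2 i, Finset.sum_neg_distrib]
  simp

/-- The map on the terms of `LL(D)`. -/
def llMap {D D' : DM X.deg (ModuleCat.{u} k)} (φ : D ⟶ D') (j : ℤ) : llObj D j ⟶ llObj D' j :=
  Sigma.desc fun a => (X.freeS k a).map ((φ.f a).f j) ≫ llIncl D' j a

theorem llIncl_map {D D' : DM X.deg (ModuleCat.{u} k)} (φ : D ⟶ D') (j : ℤ) (a : A) :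
    llIncl D j a ≫ llMap φ j = (X.freeS k a).map ((φ.f a).f j) ≫ llIncl D' j a :=
  Sigma.ι_desc _ _

theorem llMul_map {D D' : DM X.deg (ModuleCat.{u} k)} (φ : D ⟶ D') (i : ι) {a b : A}
    (h : b + X.deg i = a) (j j' : ℤ) (hj : j' + 1 = j) :
    llMul D i h j j' hj ≫ (X.freeS k b).map ((φ.f b).f j') =
      (X.freeS k a).map ((φ.f a).f j) ≫ llMul D' i h j j' hj := by
  unfold llMul
  rw [Category.assoc, ← Functor.map_comp, NatTrans.naturality_assoc, ← Functor.map_comp]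
  congr 2
  simp [DM.leftAct, φ.comm i h j j' hj]

theorem llMap_d {D D' : DM X.deg (ModuleCat.{u} k)} (φ : D ⟶ D') (j j' : ℤ) (hj : j' + 1 = j) :
    llMap φ j ≫ llD D' j j' hj = llD D j j' hj ≫ llMap φ j' := by
  refine ll_hom_ext fun a => ?_
  rw [← Category.assoc, llIncl_map, Category.assoc, llIncl_d, ← Category.assoc, llIncl_d,
    Preadditive.sub_comp, Preadditive.comp_sub, Preadditive.sum_comp, Preadditive.comp_sum]
  congr 1
  · refine Finset.sum_congr rfl fun i _ => ?_
    rw [Category.assoc, llIncl_map, ← Category.assoc, ← Category.assoc, llMul_map]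
  · rw [Category.assoc, llIncl_map, ← Category.assoc, ← Category.assoc, ← Functor.map_comp,
      ← Functor.map_comp, (φ.f a).comm]

/-- The differential of `LL(D)`. -/
def llDiff (D : DM X.deg (ModuleCat.{u} k)) (j j' : ℤ) : llObj D j ⟶ llObj D j' :=
  if hj : j' + 1 = j then llD D j j' hj else 0

theorem llDiff_eq (D : DM X.deg (ModuleCat.{u} k)) (j j' : ℤ) (hj : j' + 1 = j) :
    llDiff D j j' = llD D j j' hj := dif_pos hj

variable (X k)

/-- The functor `LL` from differential `E`-modules to complexes of graded `S`-modules: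
`LL(D)_j = ⨁_a S(-a) ⊗ D_{(a; j)}`, with the differential
`s ⊗ d ↦ ∑_i x_i s ⊗ e_i d - s ⊗ ∂ d`. -/
def LL : DM X.deg (ModuleCat.{u} k) ⥤ ChainComplex (X.affine.Mod k) ℤ where
  obj D :=
    { X := llObj D
      d := llDiff D
      shape := fun _ _ h => dif_neg h
      d_comp_d' := fun j j' j'' hj hj' => by
        rw [llDiff_eq D j j' hj, llDiff_eq D j' j'' hj']
        exact llD_comp D j j' j'' hj hj' }
  map {D D'} φ :=
    { f := llMap φ
      comm' := fun j j' hj => by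
        refine Eq.trans (congrArg (llMap φ j ≫ ·) (llDiff_eq D' j j' hj)) ?_
        refine Eq.trans ?_ (congrArg (· ≫ llMap φ j') (llDiff_eq D j j' hj)).symm
        exact llMap_d φ j j' hj }
  map_id D := by
    ext j : 1
    refine ll_hom_ext fun a => ?_
    rw [llIncl_map]
    refine Eq.trans ?_ (Category.comp_id _).symm
    rw [DM.id_f, HomologicalComplex.id_f, CategoryTheory.Functor.map_id, Category.id_comp]
  map_comp φ ψ := by
    ext j : 1
    refine ll_hom_ext fun a => ?_
    rw [HomologicalComplex.comp_f, llIncl_map, ← Category.assoc, llIncl_map, Category.assoc,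
      llIncl_map, DM.comp_f, HomologicalComplex.comp_f, Functor.map_comp, Category.assoc]

/-! ### The truncation -/

/-- The degree `a` part of the truncation `D' = ⨁_{a ≤ 0} D_{(a; j)}`, where `a ≤ 0` means that
`-a` is effective: the whole space if `a ≤ 0`, and zero otherwise. -/
def truncSub (a : A) (V : Type u) [AddCommGroup V] [Module k V] : Submodule k V where
  carrier := {x | x ≠ 0 → -a ∈ X.Eff}
  zero_mem' h := absurd rfl h
  add_mem' {x y} hx hy h := by
    by_cases hx0 : x = 0
    · refine hy fun hy0 => h ?_
      rw [hx0, hy0, add_zero]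
    · exact hx hx0
  smul_mem' r x hx h := hx fun h0 => h (by rw [h0, smul_zero])

variable {k}

/-- The degree `a` part of the truncation, as an object of the category of vector spaces. -/
def truncObj (a : A) (V : ModuleCat.{u} k) : ModuleCat.{u} k := ModuleCat.of k (X.truncSub k a V)

/-- The restriction of a linear map to truncations. -/
def truncMap {a b : A} (h : -a ∈ X.Eff → -b ∈ X.Eff) {V W : ModuleCat.{u} k} (f : V ⟶ W) :
    X.truncObj a V ⟶ X.truncObj b W :=
  ModuleCat.ofHom (f.hom.restrict (p := X.truncSub k a V) (q := X.truncSub k b W)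
    fun x hx hfx => h (hx fun h0 => hfx (by rw [h0, map_zero])))

theorem neg_mem_Eff {i : ι} {a b : A} (h : b + X.deg i = a) (ha : -a ∈ X.Eff) : -b ∈ X.Eff := by
  have : -b = -a + X.deg i := by rw [← h]; abel
  rw [this]
  exact add_mem ha (X.deg_mem_Eff i)

variable (k)

/-- The functor that sends a differential `E`-module `D` to its submodule
`D' = ⨁_{a ≤ 0} D_{(a; j)}`, where `a ≤ 0` means that `-a` is effective. -/
def trunc : DM X.deg (ModuleCat.{u} k) ⥤ DM X.deg (ModuleCat.{u} k) where
  obj D :=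
    { cx := fun a =>
        { X := fun j => X.truncObj a ((D.cx a).X j)
          d := fun j j' => X.truncMap id ((D.cx a).d j j')
          shape := fun j j' h => congrArg (X.truncMap id) ((D.cx a).shape j j' h)
          d_comp_d' := fun j j' j'' _ _ =>
            congrArg (X.truncMap id) ((D.cx a).d_comp_d j j' j'') }
      act := fun i _ _ h j j' hj => X.truncMap (X.neg_mem_Eff h) (D.act i h j j' hj)
      act_sq := fun i _ _ _ h h' j j' j'' hj hj' =>
        congrArg (X.truncMap (X.neg_mem_Eff h' ∘ X.neg_mem_Eff h)) (D.act_sq i h h' j j' j'' hj hj')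
      act_anticomm := fun i l _ _ _ _ h h' g g' j j' j'' hj hj' =>
        congrArg (X.truncMap (X.neg_mem_Eff h' ∘ X.neg_mem_Eff h))
          (D.act_anticomm i l h h' g g' j j' j'' hj hj')
      act_d := fun i _ _ h j j' j'' hj hj' =>
        congrArg (X.truncMap (X.neg_mem_Eff h)) (D.act_d i h j j' j'' hj hj') }
  map φ :=
    { f := fun a =>
        { f := fun j => X.truncMap id ((φ.f a).f j)
          comm' := fun j j' _ => congrArg (X.truncMap id) ((φ.f a).comm j j') }
      comm := fun i _ _ h j j' hj =>
        congrArg (X.truncMap (X.neg_mem_Eff h)) (φ.comm i h j j' hj) }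
  map_id _ := rfl
  map_comp _ _ := rfl

/-- The functor `U` from differential `E`-modules to complexes of sheaves: it sends `D` to the
complex of sheaves associated with the complex `LL(D')` of graded `S`-modules, where
`D' = ⨁_{a ≤ 0} D_{(a; j)}`. -/
def functorU : DM X.deg (ModuleCat.{u} k) ⥤ ChainComplex (X.Mod k) ℤ :=
  X.trunc k ⋙ X.LL k ⋙ (X.sheafify k).mapHomologicalComplex _

end

section

variable {ι A P : Type} [Fintype ι] [LinearOrder ι] [AddCommGroup A] [SemilatticeInf P]
  (X : CoxData ι A P) {k : Type u} [Field k]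

/-- A Tate resolution `T(F)` of a sheaf `F`: a minimal free differential `E`-module together with a
homotopy equivalence with `R π₂_*(π₁^* F ⊗ 𝒦)`. -/
structure TateResolution {K : Type} [Finite K] (c : K → P) (F : X.Mod k) where
  D : DM X.deg (ModuleCat.{u} k)
  isFree : D.IsFree
  isMinimal : D.IsMinimal
  equiv : DM.HtpyEquiv D ((X.transformK k c).obj F)

end

end CoxData
/-! ## The functors of a toric stack -/

namespace Fan

variable {N ι : Type} [AddCommGroup N] [Fintype ι] [LinearOrder ι] (Φ : Fan N ι)
  (k : Type u) [Field k]

/-- The covering of the stack by the charts of the maximal cones. -/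
def maxChart (σ : Φ.MaxCone) : Φ.Cone := σ.1

/-- The category of coherent sheaves on the toric stack. -/
abbrev CohStack : Type (u + 1) := Φ.stack.Coh k

/-- The Fourier–Mukai transform `Φ_𝒦` from coherent sheaves to differential `E`-modules. -/
def PhiK : Φ.CohStack k ⥤ DM Φ.coxDeg (ModuleCat.{u} k) :=
  (Φ.stack.coherent k).ι ⋙ Φ.stack.transformK k Φ.maxChart

/-- The Fourier–Mukai transform `Φ_ℛ` whose kernel is the toric resolution of the diagonal. -/
def PhiR : Φ.CohStack k ⥤ ChainComplex (Φ.stack.Mod k) ℤ :=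
  (Φ.stack.coherent k).ι ⋙ Φ.stack.transformR k Φ.maxChart

/-- The functor `U` from differential `E`-modules to complexes of sheaves on the toric stack. -/
def U : DM Φ.coxDeg (ModuleCat.{u} k) ⥤ ChainComplex (Φ.stack.Mod k) ℤ :=
  Φ.stack.functorU k

variable {k} in
/-- The Tate resolutions `T(F)` of a coherent sheaf. -/
abbrev Tate (F : Φ.CohStack k) : Type (u + 1) :=
  Φ.stack.TateResolution Φ.maxChart F.obj

end Fan

end ToricBGG

end

noncomputable section

namespace ToricBGG

namespace DM

variable {ι A : Type} [AddCommGroup A] {deg : ι → A}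

section

variable {V : Type*} [Category V] [Preadditive V] (D : DM deg V)

theorem actList_cons (i : ι) (l : List ι) {a b b' : A} (h : b + ((i :: l).map deg).sum = a)
    {j j' j'' : ℤ} (hj : j' + ((i :: l).length : ℕ) = j) (h1 : b' + deg i = a) (h2 : b + (l.map deg).sum = b')
    (hj1 : j'' + 1 = j) (hj2 : j' + l.length = j'') :
    D.actList (i :: l) h hj = D.act i h1 j j'' hj1 ≫ D.actList l h2 hj2 := by
  subst h2 hj2
  rfl

theorem actList_nil {a : A} (h : a + (([] : List ι).map deg).sum = a) {j : ℤ}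
    (hj : j + (([] : List ι).length : ℕ) = j) : D.actList [] h hj = 𝟙 _ := rfl

theorem actList_append (l l' : List ι) : ∀ {a b b' : A} (h : b + ((l ++ l').map deg).sum = a)
    {j j' j'' : ℤ} (hj : j' + ((l ++ l').length : ℕ) = j) (h1 : b' + (l.map deg).sum = a)
    (h2 : b + (l'.map deg).sum = b') (hj1 : j'' + (l.length : ℕ) = j)
    (hj2 : j' + (l'.length : ℕ) = j''),
    D.actList (l ++ l') h hj = D.actList l h1 hj1 ≫ D.actList l' h2 hj2 := by
  induction l with
  | nil =>
    intro a b b' h j j' j'' hj h1 h2 hj1 hj2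
    obtain rfl : b' = a := by simpa using h1
    obtain rfl : j'' = j := by simpa using hj1
    rw [D.actList_nil, Category.id_comp]
    rfl
  | cons i l ih =>
    intro a b b' h j j' j'' hj h1 h2 hj1 hj2
    have e1 : b + ((l ++ l').map deg).sum = b' + (l.map deg).sum := by
      rw [← h2]; simp; abel
    have e2 : j' + ((l ++ l').length : ℕ) = j'' + (l.length : ℕ) := by
      rw [← hj2]; simp; ring
    have e3 : b' + (l.map deg).sum + deg i = a := by
      rw [← h1]; simp; abel
    have e4 : j'' + (l.length : ℕ) + 1 = j := by
      rw [← hj1]; simp; ring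
    rw [D.actList_cons i l h1 hj1 e3 rfl e4 rfl, Category.assoc,
      ← ih e1 e2 rfl h2 rfl hj2]
    exact D.actList_cons i (l ++ l') h hj e3 e1 e4 e2

theorem actList_perm {l l' : List ι} (p : l.Perm l') : ∃ ε : ℤˣ, ∀ {a b : A}
    (h : b + (l.map deg).sum = a) (h' : b + (l'.map deg).sum = a) {j j' : ℤ}
    (hj : j' + (l.length : ℕ) = j) (hj' : j' + (l'.length : ℕ) = j),
    D.actList l h hj = ε • D.actList l' h' hj' := by
  induction p with
  | nil => exact ⟨1, fun _ _ _ _ _ _ => (one_smul _ _).symm⟩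
  | @cons i l l' p ih =>
    obtain ⟨ε, ih⟩ := ih
    refine ⟨ε, fun {a b} h h' {j j'} hj hj' => ?_⟩
    have e0 : (l.map deg).sum = (l'.map deg).sum := (p.map deg).sum_eq
    have e3 : b + (l.map deg).sum + deg i = a := by rw [← h]; simp; abel
    have e4 : j' + (l.length : ℕ) + 1 = j := by rw [← hj]; simp; ring
    rw [D.actList_cons i l h hj e3 rfl e4 rfl,
      D.actList_cons i l' h' hj' e3 (by rw [e0]) e4 (by rw [p.length_eq]),
      ih rfl (by rw [e0]) rfl (by rw [p.length_eq]), Linear.comp_units_smul]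
  | swap i m l =>
    refine ⟨-1, fun {a b} h h' {j j'} hj hj' => ?_⟩
    have e1 : b + (l.map deg).sum + deg i + deg m = a := by rw [← h]; simp; abel
    have e2 : b + (l.map deg).sum + deg m + deg i = a := by rw [← h]; simp; abel
    have e3 : j' + (l.length : ℕ) + 1 + 1 = j := by rw [← hj]; simp; ring
    have c1 : b + ((i :: l).map deg).sum = b + (l.map deg).sum + deg i := by simp; abel
    have c2 : b + ((m :: l).map deg).sum = b + (l.map deg).sum + deg m := by simp; abel
    have c3 : ∀ x : ι, j' + ((x :: l).length : ℕ) = j' + (l.length : ℕ) + 1 := by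
      intro x; simp; ring
    rw [D.actList_cons m (i :: l) h hj e1 c1 e3 (c3 i),
      D.actList_cons i (m :: l) h' hj' e2 c2 e3 (c3 m),
      D.actList_cons i l c1 (c3 i) rfl rfl rfl rfl,
      D.actList_cons m l c2 (c3 m) rfl rfl rfl rfl, ← Category.assoc,
      D.act_anticomm m i e1 rfl e2 rfl]
    simp
  | @trans l₁ l₂ l₃ p p' ih ih' =>
    obtain ⟨ε, ih⟩ := ih
    obtain ⟨ε', ih'⟩ := ih'
    refine ⟨ε * ε', fun {a b} h h' {j j'} hj hj' => ?_⟩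
    have e : b + (l₂.map deg).sum = a := by rw [(p'.map deg).sum_eq]; exact h'
    have e' : j' + (l₂.length : ℕ) = j := by rw [p'.length_eq]; exact hj'
    rw [ih h e hj e', ih' e h' e' hj', smul_smul]

theorem actList_eq_zero {l : List ι} (hl : ¬ l.Nodup) {a b : A} (h : b + (l.map deg).sum = a)
    {j j' : ℤ} (hj : j' + (l.length : ℕ) = j) : D.actList l h hj = 0 := by
  obtain ⟨i, hi⟩ := List.exists_duplicate_iff_not_nodup.2 hl
  obtain ⟨m, p⟩ := (List.duplicate_iff_sublist.1 hi).exists_perm_append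
  obtain ⟨ε, hε⟩ := D.actList_perm p
  have h' : b + ((i :: i :: m).map deg).sum = a := by
    rw [← h, (p.map deg).sum_eq]; rfl
  have hj' : j' + ((i :: i :: m).length : ℕ) = j := by
    rw [← hj, p.length_eq]; rfl
  rw [hε h h' hj hj']
  have e1 : b + (m.map deg).sum + deg i + deg i = a := by rw [← h']; simp; abel
  have e3 : j' + (m.length : ℕ) + 1 + 1 = j := by rw [← hj']; simp; ring
  have c1 : b + ((i :: m).map deg).sum = b + (m.map deg).sum + deg i := by simp; abel
  have c3 : j' + ((i :: m).length : ℕ) = j' + (m.length : ℕ) + 1 := by simp; ring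
  have e : D.actList (i :: i :: m) h' hj' = 0 := by
    rw [D.actList_cons i (i :: m) h' hj' e1 c1 e3 c3, D.actList_cons i m c1 c3 rfl rfl rfl rfl,
      ← Category.assoc, D.act_sq, zero_comp]
  exact (congrArg (ε • ·) e).trans (smul_zero _)

end

section

variable {k : Type u} [Field k] [Fintype ι] [LinearOrder ι] (D : DM deg (ModuleCat.{u} k))

/-- The list of the elements of a finite set, in increasing order. -/
abbrev sorted (I : Finset ι) : List ι := I.sort (· ≤ ·)

theorem actList_eq_sorted (l : List ι) (hl : l.Nodup) : ∃ ε : ℤˣ, ∀ {a b : A}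
    (h : b + (l.map deg).sum = a) (h' : b + ((sorted l.toFinset).map deg).sum = a) {j j' : ℤ}
    (hj : j' + (l.length : ℕ) = j) (hj' : j' + ((sorted l.toFinset).length : ℕ) = j),
    D.actList l h hj = ε • D.actList (sorted l.toFinset) h' hj' :=
  D.actList_perm (List.perm_of_nodup_nodup_toFinset_eq hl (Finset.sort_nodup _ _) (by simp))

/-- The submodule of `D` generated by the products with `r` of the generators `e_i`. -/
def radPow (r : ℕ) (a : A) (j : ℤ) : Submodule k ((D.cx a).X j) :=
  Submodule.span k {y | ∃ (l : List ι) (_ : l.length = r)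
    (z : (D.cx (a + (l.map deg).sum)).X (j + (l.length : ℕ))), y = D.actList l rfl rfl z}

theorem actList_mem_radPow {l : List ι} {r : ℕ} (hl : l.length = r) {a b : A}
    (h : b + (l.map deg).sum = a) {j j' : ℤ} (hj : j' + (l.length : ℕ) = j) (z : (D.cx a).X j) :
    D.actList l h hj z ∈ D.radPow r b j' := by
  subst h hj
  exact Submodule.subset_span ⟨l, hl, z, rfl⟩

theorem radPow_induction {r : ℕ} {b : A} {j' : ℤ} (S : Submodule k ((D.cx b).X j'))
    (hS : ∀ (l : List ι) (_ : l.length = r) (a : A) (j : ℤ) (h : b + (l.map deg).sum = a)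
      (hj : j' + (l.length : ℕ) = j) (z : (D.cx a).X j), D.actList l h hj z ∈ S) :
    D.radPow r b j' ≤ S := by
  refine Submodule.span_le.2 ?_
  rintro y ⟨l, hl, z, rfl⟩
  exact hS l hl _ _ rfl rfl z

theorem radPow_eq_bot {r : ℕ} (hr : Fintype.card ι < r) (a : A) (j : ℤ) :
    D.radPow r a j = ⊥ := by
  refine le_bot_iff.1 (D.radPow_induction _ fun l hl a j h hj z => ?_)
  rw [D.actList_eq_zero (fun hn => ?_) h hj]
  · exact Submodule.zero_mem _
  · have := hn.length_le_card
    omega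

theorem radPow_zero (a : A) (j : ℤ) : D.radPow 0 a j = ⊤ := by
  refine eq_top_iff.2 fun x _ => ?_
  exact D.actList_mem_radPow (l := []) rfl (by simp) (by simp) x

/-- The submodule of `D` generated by the products with the generators `e_i`. -/
def rad (a : A) (j : ℤ) : Submodule k ((D.cx a).X j) :=
  Submodule.span k {y | ∃ (i : ι) (z : (D.cx (a + deg i)).X (j + 1)),
    y = D.act i rfl (j + 1) j rfl z}

theorem act_mem_rad (i : ι) {a b : A} (h : b + deg i = a) {j j' : ℤ} (hj : j' + 1 = j)
    (z : (D.cx a).X j) : D.act i h j j' hj z ∈ D.rad b j' := by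
  subst h hj
  exact Submodule.subset_span ⟨i, z, rfl⟩

theorem rad_induction {b : A} {j' : ℤ} (S : Submodule k ((D.cx b).X j'))
    (hS : ∀ (i : ι) (a : A) (j : ℤ) (h : b + deg i = a) (hj : j' + 1 = j) (z : (D.cx a).X j),
      D.act i h j j' hj z ∈ S) : D.rad b j' ≤ S := by
  refine Submodule.span_le.2 ?_
  rintro y ⟨i, z, rfl⟩
  exact hS i _ _ rfl rfl z

theorem actList_rad_mem_radPow {l : List ι} {r : ℕ} (hl : l.length = r) {a b : A}
    (h : b + (l.map deg).sum = a) {j j' : ℤ} (hj : j' + (l.length : ℕ) = j) {x : (D.cx a).X j}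
    (hx : x ∈ D.rad a j) : D.actList l h hj x ∈ D.radPow (r + 1) b j' := by
  have : D.rad a j ≤ (D.radPow (r + 1) b j').comap (D.actList l h hj).hom := by
    refine D.rad_induction _ fun i a' m h' hm z => ?_
    have e1 : b + ((i :: l).map deg).sum = a' := by rw [← h', ← h]; simp; abel
    have e2 : j' + ((i :: l).length : ℕ) = m := by rw [← hm, ← hj]; simp; ring
    have e := D.actList_mem_radPow (l := i :: l) (r := r + 1) (by simp [hl]) e1 e2 z
    rw [D.actList_cons i l e1 e2 h' h hm hj] at e
    exact e
  exact this hx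

/-- A family of maps that commutes with the action of the exterior algebra commutes with the
action of products. -/
theorem actList_comm {D D' : DM deg (ModuleCat.{u} k)}
    (f : ∀ a j, (D.cx a).X j ⟶ (D'.cx a).X j)
    (hf : ∀ (i : ι) {a b : A} (h : b + deg i = a) (j j' : ℤ) (hj : j' + 1 = j),
      D.act i h j j' hj ≫ f b j' = f a j ≫ D'.act i h j j' hj) (l : List ι) :
    ∀ {a b : A} (h : b + (l.map deg).sum = a) {j j' : ℤ} (hj : j' + (l.length : ℕ) = j),
      D.actList l h hj ≫ f b j' = f a j ≫ D'.actList l h hj := by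
  induction l with
  | nil =>
    intro a b h j j' hj
    obtain rfl : b = a := by simpa using h
    obtain rfl : j' = j := by simpa using hj
    rw [D.actList_nil, D'.actList_nil, Category.id_comp, Category.comp_id]
  | cons i l ih =>
    intro a b h j j' hj
    have e3 : b + (l.map deg).sum + deg i = a := by rw [← h]; simp; abel
    have e4 : j' + (l.length : ℕ) + 1 = j := by rw [← hj]; simp; ring
    rw [D.actList_cons i l h hj e3 rfl e4 rfl, Category.assoc, ih rfl rfl, ← Category.assoc,
      hf i e3 _ _ e4, Category.assoc, D'.actList_cons i l h hj e3 rfl e4 rfl]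

/-- A family of maps that commutes with the action of the exterior algebra and that maps `D` to
the submodule generated by the `e_i` raises the filtration by the submodules `radPow`. -/
theorem radPow_map (f : ∀ a j, (D.cx a).X j ⟶ (D.cx a).X j)
    (hf : ∀ (i : ι) {a b : A} (h : b + deg i = a) (j j' : ℤ) (hj : j' + 1 = j),
      D.act i h j j' hj ≫ f b j' = f a j ≫ D.act i h j j' hj)
    (hr : ∀ a j x, f a j x ∈ D.rad a j) (r : ℕ) (a : A) (j : ℤ) (x : (D.cx a).X j)
    (hx : x ∈ D.radPow r a j) : f a j x ∈ D.radPow (r + 1) a j := by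
  have : D.radPow r a j ≤ (D.radPow (r + 1) a j).comap (f a j).hom := by
    refine D.radPow_induction _ fun l hl b m h hm z => ?_
    have e : f a j (D.actList l h hm z) = D.actList l h hm (f b m z) :=
      congrArg (fun g => g z) (actList_comm f hf l h hm)
    have e' : f a j (D.actList l h hm z) ∈ D.radPow (r + 1) a j := by
      rw [e]
      exact D.actList_rad_mem_radPow hl h _ (hr b m z)
    exact e'
  exact this hx

end

end DM

end ToricBGG

namespace ToricBGG

namespace DM

variable {ι A : Type} [AddCommGroup A] {deg : ι → A} {k : Type u} [Field k] [Fintype ι]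
  [LinearOrder ι] (D : DM deg (ModuleCat.{u} k))

/-- The elements of `D` that are killed by the product of all the `e_i` lie in the submodule
generated by the `e_i`. -/
def SocleProperty : Prop :=
  ∀ {a b : A} {j j' : ℤ} (h : b + ((sorted (Finset.univ : Finset ι)).map deg).sum = a)
    (hj : j' + ((sorted (Finset.univ : Finset ι)).length : ℕ) = j) (x : (D.cx a).X j),
    D.actList (sorted Finset.univ) h hj x = 0 → x ∈ D.rad a j

/-- The index set of a basis of the quotient of `D` by the submodule generated by the `e_i`. -/
abbrev TopIndex (a : A) (j : ℤ) : Type u :=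
  Module.Basis.ofVectorSpaceIndex k ((D.cx a).X j ⧸ D.rad a j)

/-- Lifts of the elements of a basis of the quotient of `D` by the submodule generated by the
`e_i`. -/
def topLift (a : A) (j : ℤ) (i : D.TopIndex a j) : (D.cx a).X j :=
  ((D.rad a j).mkQ_surjective (Module.Basis.ofVectorSpace k ((D.cx a).X j ⧸ D.rad a j) i)).choose

theorem mkQ_topLift (a : A) (j : ℤ) (i : D.TopIndex a j) : (D.rad a j).mkQ (D.topLift a j i) =
    Module.Basis.ofVectorSpace k ((D.cx a).X j ⧸ D.rad a j) i :=
  ((D.rad a j).mkQ_surjective _).choose_spec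

theorem exists_topLift (a : A) (j : ℤ) (x : (D.cx a).X j) : ∃ c : D.TopIndex a j →₀ k,
    x - Finsupp.linearCombination k (D.topLift a j) c ∈ D.rad a j := by
  refine ⟨(Module.Basis.ofVectorSpace k _).repr ((D.rad a j).mkQ x), ?_⟩
  refine (Submodule.Quotient.mk_eq_zero _).1 ?_
  rw [← Submodule.mkQ_apply, map_sub, sub_eq_zero, Finsupp.apply_linearCombination]
  have e : (D.rad a j).mkQ ∘ D.topLift a j = Module.Basis.ofVectorSpace k _ :=
    funext fun i => D.mkQ_topLift a j i
  rw [e, Module.Basis.linearCombination_repr]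

theorem topLift_eq_zero (a : A) (j : ℤ) (c : D.TopIndex a j →₀ k)
    (hc : Finsupp.linearCombination k (D.topLift a j) c ∈ D.rad a j) : c = 0 := by
  replace hc := (Submodule.Quotient.mk_eq_zero _).2 hc
  rw [← Submodule.mkQ_apply, Finsupp.apply_linearCombination] at hc
  have e : (D.rad a j).mkQ ∘ D.topLift a j = Module.Basis.ofVectorSpace k _ :=
    funext fun i => D.mkQ_topLift a j i
  rw [e] at hc
  exact linearIndependent_iff.1 (Module.Basis.ofVectorSpace k _).linearIndependent c hc

/-- The degrees at which the products `g e_I` of the lifts contribute. -/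
abbrev TopProd (a : A) (j : ℤ) : Type u :=
  {x : (Σ z : A × ℤ, D.TopIndex z.1 z.2) × Finset ι //
    a + ((sorted x.2).map deg).sum = x.1.1.1 ∧ j + ((sorted x.2).length : ℕ) = x.1.1.2}

/-- The products `g e_I` of the lifts. -/
def topProd (a : A) (j : ℤ) (x : D.TopProd a j) : (D.cx a).X j :=
  D.actList (sorted x.1.2) x.2.1 x.2.2 (D.topLift x.1.1.1.1 x.1.1.1.2 x.1.1.2)

theorem radPow_le_span_topProd (d : ℕ) : ∀ (r : ℕ), Fintype.card ι + 1 ≤ r + d →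
    ∀ (a : A) (j : ℤ), D.radPow r a j ≤ Submodule.span k (Set.range (D.topProd a j)) := by
  induction d with
  | zero =>
    intro r hr a j
    rw [D.radPow_eq_bot (by omega)]
    exact bot_le
  | succ d ih =>
    intro r hr a j
    refine D.radPow_induction _ fun l hl b m h hm z => ?_
    obtain ⟨c, hc⟩ := D.exists_topLift b m z
    have h1 : D.actList l h hm z = D.actList l h hm (z - Finsupp.linearCombination k (D.topLift b m) c) +
        D.actList l h hm (Finsupp.linearCombination k (D.topLift b m) c) := by
      rw [← map_add, sub_add_cancel]
    rw [h1]
    refine Submodule.add_mem _ (ih (r + 1) (by omega) a j (D.actList_rad_mem_radPow hl h hm hc)) ?_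
    have h2 : D.actList l h hm (Finsupp.linearCombination k (D.topLift b m) c) =
        Finsupp.linearCombination k (fun i => D.actList l h hm (D.topLift b m i)) c :=
      Finsupp.apply_linearCombination k (D.actList l h hm).hom _ c
    rw [h2, Finsupp.linearCombination_apply, Finsupp.sum]
    refine Submodule.sum_mem _ fun i _ => Submodule.smul_mem _ _ ?_
    by_cases hn : l.Nodup
    · obtain ⟨ε, hε⟩ := D.actList_eq_sorted l hn
      have p : l.Perm (sorted l.toFinset) :=
        List.perm_of_nodup_nodup_toFinset_eq hn (Finset.sort_nodup _ _) (by simp)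
      have h' : a + ((sorted l.toFinset).map deg).sum = b := by
        rw [← h, (p.map deg).sum_eq]
      have hm' : j + ((sorted l.toFinset).length : ℕ) = m := by
        rw [← hm, p.length_eq]
      have e : D.actList l h hm (D.topLift b m i) =
          ε • D.topProd a j ⟨(⟨(b, m), i⟩, l.toFinset), h', hm'⟩ := by
        rw [hε h h' hm hm']
        rfl
      rw [e]
      rcases Int.units_eq_one_or ε with rfl | rfl
      · rw [one_smul]
        exact Submodule.subset_span ⟨_, rfl⟩
      · rw [Units.neg_smul, one_smul]
        exact Submodule.neg_mem _ (Submodule.subset_span ⟨_, rfl⟩)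
    · rw [D.actList_eq_zero hn h hm]
      exact Submodule.zero_mem _

theorem span_topProd (a : A) (j : ℤ) :
    Submodule.span k (Set.range (D.topProd a j)) = ⊤ := by
  refine top_unique ?_
  rw [← D.radPow_zero a j]
  exact D.radPow_le_span_topProd (Fintype.card ι + 1) 0 (by omega) a j

set_option maxHeartbeats 2000000 in
theorem linearIndependent_topProd (hD : D.SocleProperty) (a : A) (j : ℤ) :
    LinearIndependent k (D.topProd a j) := by
  rw [linearIndependent_iff]
  intro c hc
  by_contra hne
  obtain ⟨x₀, hx₀, hmin⟩ := Finset.exists_min_image c.support (fun x => x.1.2.card)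
    (Finsupp.support_nonempty_iff.2 hne)
  obtain ⟨⟨⟨⟨a', j'⟩, i₀⟩, I⟩, ha', hj'⟩ := x₀
  dsimp only at ha' hj' i₀
  subst ha' hj'
  set m := sorted Iᶜ with hm
  let e : D.TopIndex (a + ((sorted I).map deg).sum) (j + ((sorted I).length : ℕ)) →
    D.TopProd a j := fun i => ⟨(⟨(a + ((sorted I).map deg).sum, j + ((sorted I).length : ℕ)), i⟩, I), rfl, rfl⟩
  have he : Function.Injective e := by
    intro i i' h
    simpa [e] using h
  let b := a - (m.map deg).sum
  let n := j - (m.length : ℕ)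
  have hb : b + (m.map deg).sum = a := sub_add_cancel _ _
  have hn : n + (m.length : ℕ) = j := sub_add_cancel _ _
  have p : (sorted I ++ m).Perm (sorted Finset.univ) := by
    refine List.perm_of_nodup_nodup_toFinset_eq ?_ (Finset.sort_nodup _ _) ?_
    · refine List.Nodup.append (Finset.sort_nodup _ _) (Finset.sort_nodup _ _) ?_
      intro i hi hi'
      simp [hm] at hi hi'
      exact hi' hi
    · ext i
      simp [hm]
  obtain ⟨ε, hε⟩ := D.actList_perm p
  have sum0 : ∑ x ∈ c.support, c x • D.actList m hb hn (D.topProd a j x) = 0 := by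
    have := congrArg (D.actList m hb hn) hc
    rw [map_zero, Finsupp.linearCombination_apply, Finsupp.sum, map_sum] at this
    rw [← this]
    exact Finset.sum_congr rfl fun x _ => (map_smul _ _ _).symm
  have act_e : ∀ x : D.TopProd a j, D.actList m hb hn (D.topProd a j x) =
      D.actList (sorted x.1.2 ++ m) (b := b) (j' := n)
        (by rw [← x.2.1, List.map_append, List.sum_append, ← add_assoc, add_right_comm, hb])
        (by have := x.2.2; rw [List.length_append]; push_cast; omega)
        (D.topLift x.1.1.1.1 x.1.1.1.2 x.1.1.2) := by
    intro x
    rw [D.actList_append (sorted x.1.2) m _ _ x.2.1 hb x.2.2 hn]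
    rfl
  let c' : D.TopIndex (a + ((sorted I).map deg).sum) (j + ((sorted I).length : ℕ)) →₀ k :=
    c.comapDomain e he.injOn
  have hsum : ∑ i ∈ c'.support, c' i • D.actList m hb hn (D.topProd a j (e i)) = 0 := by
    rw [← sum0]
    refine Finset.sum_of_injOn e he.injOn ?_ ?_ ?_
    · intro i hi
      simpa [c'] using hi
    · rintro ⟨⟨⟨⟨a', j'⟩, i⟩, I'⟩, ha', hj'⟩ hx hxe
      dsimp only at ha' hj' i
      subst ha' hj'
      have hII : I' ≠ I := by
        rintro rfl
        refine hxe ⟨i, ?_, rfl⟩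
        simpa [c', e] using hx
      rw [act_e, D.actList_eq_zero]
      · exact smul_zero (c _)
      intro hnd
      have hdis := List.disjoint_of_nodup_append hnd
      refine hII (Finset.eq_of_subset_of_card_le (fun i hi => ?_) (hmin _ hx))
      by_contra hi'
      exact hdis (a := i) (by simpa using hi) (by simpa [hm] using hi')
    · intro i _
      rfl
  have hzero : D.actList (sorted Finset.univ) (b := b) (j' := n)
      (a := a + ((sorted I).map deg).sum) (j := j + ((sorted I).length : ℕ))
      (by rw [← (p.map deg).sum_eq, ← hb]; simp; abel)
      (by rw [← p.length_eq, ← hn]; simp; ring)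
      (Finsupp.linearCombination k (D.topLift _ _) c') = 0 := by
    rw [Finsupp.linearCombination_apply, Finsupp.sum, map_sum]
    have h3 : ∑ i ∈ c'.support, c' i • D.actList m hb hn (D.topProd a j (e i)) =
      ε • ∑ i ∈ c'.support, D.actList (sorted Finset.univ) (b := b) (j' := n)
      (a := a + ((sorted I).map deg).sum) (j := j + ((sorted I).length : ℕ))
      (by rw [← (p.map deg).sum_eq, ← hb]; simp; abel)
      (by rw [← p.length_eq, ← hn]; simp; ring) (c' i • D.topLift _ _ i) := by
      rw [Finset.smul_sum]
      refine Finset.sum_congr rfl fun i _ => ?_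
      rw [act_e, map_smul, smul_comm ε]
      congr 1
      dsimp only [e]
      rw [hε _ (by rw [← (p.map deg).sum_eq, ← hb]; simp; abel) _
        (by rw [← p.length_eq, ← hn]; simp; ring)]
      rfl
    rw [hsum] at h3
    exact (smul_eq_zero_iff_eq ε).1 h3.symm
  have hc' : c' = 0 := D.topLift_eq_zero _ _ c' (hD _ _ _ hzero)
  have : c' i₀ = 0 := by rw [hc']; rfl
  exact Finsupp.mem_support_iff.1 hx₀ this

theorem isFree_of_socleProperty (hD : D.SocleProperty) : D.IsFree :=
  ⟨Σ z : A × ℤ, D.TopIndex z.1 z.2, fun β => β.1.1, fun β => β.1.2,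
    fun β => D.topLift β.1.1 β.1.2 β.2,
    fun a j => ⟨D.linearIndependent_topProd hD a j, D.span_topProd a j⟩⟩

end DM

end ToricBGG

namespace ToricBGG

namespace DM

variable {ι A : Type} [AddCommGroup A] {deg : ι → A} {k : Type u} [Field k]

section

variable (D : DM deg (ModuleCat.{u} k)) (S : ∀ a j, Submodule k ((D.cx a).X j))
  (hd : ∀ a j j' x, x ∈ S a j → (D.cx a).d j j' x ∈ S a j')
  (hact : ∀ (i : ι) {a b : A} (h : b + deg i = a) (j j' : ℤ) (hj : j' + 1 = j) (x : (D.cx a).X j),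
    x ∈ S a j → D.act i h j j' hj x ∈ S b j')

/-- The differential submodule formed by a family of subspaces. -/
def sub : DM deg (ModuleCat.{u} k) where
  cx a :=
    { X := fun j => ModuleCat.of k (S a j)
      d := fun j j' => ModuleCat.ofHom (((D.cx a).d j j').hom.restrict (hd a j j'))
      shape := fun j j' h => by
        ext x
        have : (D.cx a).d j j' x.1 = 0 := by rw [(D.cx a).shape j j' h]; rfl
        exact this
      d_comp_d' := fun j j' j'' _ _ => by
        ext x
        have : ((D.cx a).d j j' ≫ (D.cx a).d j' j'') x.1 = 0 := by
          rw [(D.cx a).d_comp_d]; rfl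
        exact this }
  act i a b h j j' hj := ModuleCat.ofHom ((D.act i h j j' hj).hom.restrict (hact i h j j' hj))
  act_sq i a b c h h' j j' j'' hj hj' := by
    ext x
    exact congrArg (fun f => f x.1) (D.act_sq i h h' j j' j'' hj hj')
  act_anticomm i l a b b' c h h' g g' j j' j'' hj hj' := by
    ext x
    exact congrArg (fun f => f x.1) (D.act_anticomm i l h h' g g' j j' j'' hj hj')
  act_d i a b h j j' j'' hj hj' := by
    ext x
    exact congrArg (fun f => f x.1) (D.act_d i h j j' j'' hj hj')

/-- The inclusion of a differential submodule. -/
def subIncl : D.sub S hd hact ⟶ D where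
  f a :=
    { f := fun j => ModuleCat.ofHom (S a j).subtype
      comm' := fun _ _ _ => rfl }
  comm _ _ _ _ _ _ _ := rfl

/-- A morphism with values in a differential submodule. -/
def subLift {D' : DM deg (ModuleCat.{u} k)} (φ : D' ⟶ D) (hφ : ∀ a j x, (φ.f a).f j x ∈ S a j) :
    D' ⟶ D.sub S hd hact where
  f a :=
    { f := fun j => ModuleCat.ofHom (((φ.f a).f j).hom.codRestrict (S a j) (hφ a j))
      comm' := fun j j' _ => by
        ext x
        refine Subtype.ext ?_
        exact congrArg (fun f => f x) ((φ.f a).comm j j') }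
  comm i a b h j j' hj := by
    ext x
    refine Subtype.ext ?_
    exact congrArg (fun f => f x) (φ.comm i h j j' hj)

end

theorem map_mem_rad [Fintype ι] [LinearOrder ι] {D D' : DM deg (ModuleCat.{u} k)} (f : ∀ a j, (D.cx a).X j ⟶ (D'.cx a).X j)
    (hf : ∀ (i : ι) {a b : A} (h : b + deg i = a) (j j' : ℤ) (hj : j' + 1 = j),
      D.act i h j j' hj ≫ f b j' = f a j ≫ D'.act i h j j' hj) (a : A) (j : ℤ) (x : (D.cx a).X j)
    (hx : x ∈ D.rad a j) : f a j x ∈ D'.rad a j := by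
  have : D.rad a j ≤ (D'.rad a j).comap (f a j).hom := by
    refine D.rad_induction _ fun i b m h hm z => ?_
    have e : f a j (D.act i h m j hm z) = D'.act i h m j hm (f b m z) :=
      congrArg (fun g => g z) (hf i h m j hm)
    have e' : f a j (D.act i h m j hm z) ∈ D'.rad a j := by
      rw [e]
      exact D'.act_mem_rad i h hm _
    exact e'
  exact this hx

open Polynomial in
/-- A polynomial which maps to an idempotent modulo a power of `X - X ^ 2`. -/
def idemPoly (n : ℕ) : ℤ[X] := 1 - (1 - X ^ n) ^ n

open Polynomial in
theorem exists_idemPoly_eq (n : ℕ) (hn : 0 < n) : ∃ Q : ℤ[X], idemPoly n = Q * X := by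
  have h1 : (X : ℤ[X]) ∣ 1 - (1 - X ^ n) := by
    rw [sub_sub_cancel]
    exact dvd_pow_self _ hn.ne'
  have h2 := h1.trans (sub_dvd_pow_sub_pow 1 (1 - X ^ n : ℤ[X]) n)
  rw [one_pow] at h2
  obtain ⟨Q, hQ⟩ := h2
  exact ⟨Q, hQ.trans (mul_comm _ _)⟩

open Polynomial in
theorem exists_one_sub_idemPoly_eq (n : ℕ) (hn : 0 < n) :
    ∃ R : ℤ[X], 1 - idemPoly n = (1 - X) * R := by
  have h2 := sub_dvd_pow_sub_pow 1 (X : ℤ[X]) n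
  rw [one_pow] at h2
  obtain ⟨Q, hQ⟩ := h2.trans (dvd_pow_self (1 - X ^ n : ℤ[X]) hn.ne')
  refine ⟨Q, ?_⟩
  rw [← hQ, idemPoly, sub_sub_cancel]

open Polynomial in
theorem exists_idemPoly_mul_eq (n : ℕ) :
    ∃ R : ℤ[X], idemPoly n * (1 - idemPoly n) = R * (X - X ^ 2) ^ n := by
  have h2 := sub_dvd_pow_sub_pow 1 (X : ℤ[X]) n
  rw [one_pow] at h2
  obtain ⟨Q, hQ⟩ := pow_dvd_pow_of_dvd h2 n
  have h1 : (X : ℤ[X]) ^ n ∣ 1 - (1 - X ^ n) ^ n := by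
    have := sub_dvd_pow_sub_pow 1 (1 - X ^ n : ℤ[X]) n
    rwa [one_pow, sub_sub_cancel] at this
  obtain ⟨Q', hQ'⟩ := h1
  refine ⟨Q' * Q, ?_⟩
  have e : (X - X ^ 2 : ℤ[X]) ^ n = X ^ n * (1 - X) ^ n := by
    rw [← mul_pow]; congr 1; ring
  rw [idemPoly, sub_sub_cancel, hQ', hQ, e]
  ring

section

variable [Fintype ι] [LinearOrder ι] {D : DM deg (ModuleCat.{u} k)}

/-- Apply a polynomial to an endomorphism. -/
def polyEnd (φ : D ⟶ D) (P : Polynomial ℤ) (a : A) : End (D.cx a) :=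
  Polynomial.aeval (R := ℤ) (A := End (D.cx a)) (φ.f a) P

theorem polyEnd_mul (φ : D ⟶ D) (P Q : Polynomial ℤ) (a : A) :
    polyEnd φ (P * Q) a = (polyEnd φ Q a ≫ polyEnd φ P a : D.cx a ⟶ D.cx a) := map_mul _ _ _

theorem polyEnd_comm (φ : D ⟶ D) (P : Polynomial ℤ) (i : ι) {a b : A} (h : b + deg i = a)
    (j j' : ℤ) (hj : j' + 1 = j) :
    D.act i h j j' hj ≫ HomologicalComplex.Hom.f (polyEnd φ P b) j' =
      HomologicalComplex.Hom.f (polyEnd φ P a) j ≫ D.act i h j j' hj := by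
  induction P using Polynomial.induction_on' with
  | add P Q hP hQ =>
    have e : ∀ c m, HomologicalComplex.Hom.f (polyEnd φ (P + Q) c) m =
        HomologicalComplex.Hom.f (polyEnd φ P c) m + HomologicalComplex.Hom.f (polyEnd φ Q c) m := by
      intro c m
      rw [← HomologicalComplex.add_f_apply]
      exact congrArg (fun f => HomologicalComplex.Hom.f f m) 
        (map_add (Polynomial.aeval (R := ℤ) (A := End (D.cx c)) (φ.f c)) P Q)
    rw [e, e, Preadditive.comp_add, Preadditive.add_comp, hP, hQ]
  | monomial n z =>
    induction n with
    | zero =>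
      have e : ∀ c m, HomologicalComplex.Hom.f (polyEnd φ (Polynomial.monomial 0 z) c) m =
          z • 𝟙 ((D.cx c).X m) := by
        intro c m
        have : polyEnd φ (Polynomial.monomial 0 z) c = z • (1 : End (D.cx c)) := by
          simp [polyEnd]
        rw [this]
        rfl
      rw [e, e, Preadditive.comp_zsmul, Preadditive.zsmul_comp, Category.id_comp, Category.comp_id]
    | succ n ih =>
      have e : ∀ c m, HomologicalComplex.Hom.f (polyEnd φ (Polynomial.monomial (n + 1) z) c) m =
          (φ.f c).f m ≫ HomologicalComplex.Hom.f (polyEnd φ (Polynomial.monomial n z) c) m := by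
        intro c m
        rw [← Polynomial.monomial_mul_X, polyEnd_mul]
        simp [polyEnd]
      rw [e, e, ← Category.assoc, φ.comm, Category.assoc, ih, Category.assoc]

theorem polyEnd_X (φ : D ⟶ D) (a : A) : polyEnd φ Polynomial.X a = φ.f a := by
  simp [polyEnd]

theorem polyEnd_one (φ : D ⟶ D) (a : A) : polyEnd φ 1 a = 𝟙 (D.cx a) := map_one _

theorem polyEnd_sub (φ : D ⟶ D) (P Q : Polynomial ℤ) (a : A) : polyEnd φ (P - Q) a =
    (polyEnd φ P a - polyEnd φ Q a : D.cx a ⟶ D.cx a) := map_sub _ _ _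

/-- The endomorphism of differential modules given by a polynomial in an endomorphism. -/
def polyHom (φ : D ⟶ D) (P : Polynomial ℤ) : D ⟶ D where
  f := polyEnd φ P
  comm i _ _ h j j' hj := polyEnd_comm φ P i h j j' hj

theorem pow_mem_radPow (φ : D ⟶ D) (hφ : ∀ a j x, (φ.f a).f j x - (φ.f a).f j ((φ.f a).f j x) ∈
    D.rad a j) (n : ℕ) (a : A) (j : ℤ) (x : (D.cx a).X j) :
    HomologicalComplex.Hom.f (polyEnd φ ((Polynomial.X - Polynomial.X ^ 2) ^ n) a) j x ∈
      D.radPow n a j := by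
  induction n with
  | zero =>
    rw [D.radPow_zero]
    trivial
  | succ n ih =>
    rw [pow_succ', polyEnd_mul]
    refine D.radPow_map (fun a j => HomologicalComplex.Hom.f (polyEnd φ
      (Polynomial.X - Polynomial.X ^ 2) a) j) (fun i a b h j j' hj => polyEnd_comm φ _ i h j j' hj)
      (fun a j x => ?_) n a j _ ih
    rw [polyEnd_sub, pow_two, polyEnd_mul, polyEnd_X]
    exact hφ a j x

end

end DM

end ToricBGG

namespace ToricBGG

namespace DM

variable {ι A : Type} [AddCommGroup A] {deg : ι → A} {k : Type u} [Field k] [Fintype ι]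
  [LinearOrder ι]

/-- A homotopy operator on a differential module that splits the differential modulo the submodule
generated by the `e_i`. -/
structure Splitting (D : DM deg (ModuleCat.{u} k)) where
  h : ∀ (a : A) (j j' : ℤ), (D.cx a).X j ⟶ (D.cx a).X j'
  zero : ∀ a j j', ¬ (ComplexShape.down ℤ).Rel j' j → h a j j' = 0
  comm : ∀ (i : ι) {a b : A} (hd : b + deg i = a) (j j' : ℤ) (hj : j' + 1 = j),
    D.act i hd j j' hj ≫ h b j' (j' + 1) =
      h a j (j + 1) ≫ D.act i hd (j + 1) (j' + 1) (by rw [hj])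
  sq : ∀ a j (x : (D.cx a).X j), h a (j + 1) (j + 1 + 1) (h a j (j + 1) x) = 0
  rad : ∀ a j (x : (D.cx a).X (j + 1)), (D.cx a).d (j + 1) j x -
    (D.cx a).d (j + 1) j (h a j (j + 1) ((D.cx a).d (j + 1) j x)) ∈ D.rad a j

namespace Splitting

variable {D : DM deg (ModuleCat.{u} k)} (s : D.Splitting)

theorem comm' (i : ι) {a b : A} (hd : b + deg i = a) (j j' m m' : ℤ) (hj : j' + 1 = j)
    (hm : j + 1 = m) (hm' : j' + 1 = m') :
    D.act i hd j j' hj ≫ s.h b j' m' = s.h a j m ≫ D.act i hd m m' (by rw [← hm, ← hm', hj]) := by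
  subst hm hm'
  exact s.comm i hd j j' hj

/-- The endomorphism `d h + h d`. -/
def endo : D ⟶ D where
  f a := Homotopy.nullHomotopicMap (s.h a)
  comm i a b hd j j' hj := by
    subst hj
    have e : ∀ a (j : ℤ), (Homotopy.nullHomotopicMap (s.h a)).f (j + 1) =
        (D.cx a).d (j + 1) j ≫ s.h a j (j + 1) +
          s.h a (j + 1) (j + 1 + 1) ≫ (D.cx a).d (j + 1 + 1) (j + 1) := by
      intro a j
      simp only [Homotopy.nullHomotopicMap]
      rw [dNext_eq (i := j + 1) (i' := j) _ (by simp),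
        prevD_eq (j := j + 1) (j' := j + 1 + 1) _ (by simp)]
    obtain ⟨m, rfl⟩ : ∃ m, j' = m + 1 := ⟨j' - 1, by ring⟩
    rw [e, e, Preadditive.comp_add, Preadditive.add_comp, Category.assoc, Category.assoc,
      ← Category.assoc, D.act_d i hd _ _ m _ rfl, Category.assoc,
      s.comm' i hd (m + 1) m (m + 1 + 1) (m + 1) rfl rfl rfl, ← Category.assoc,
      ← Category.assoc, s.comm' i hd (m + 1 + 1) (m + 1) (m + 1 + 1 + 1) (m + 1 + 1) rfl rfl rfl,
      Category.assoc, Category.assoc, D.act_d i hd _ _ (m + 1) _ rfl]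

theorem endo_apply (a : A) (j : ℤ) (x : (D.cx a).X (j + 1)) : (s.endo.f a).f (j + 1) x =
    s.h a j (j + 1) ((D.cx a).d (j + 1) j x) +
      (D.cx a).d (j + 1 + 1) (j + 1) (s.h a (j + 1) (j + 1 + 1) x) := by
  have e : (s.endo.f a).f (j + 1) = (D.cx a).d (j + 1) j ≫ s.h a j (j + 1) +
      s.h a (j + 1) (j + 1 + 1) ≫ (D.cx a).d (j + 1 + 1) (j + 1) := by
    simp only [endo, Homotopy.nullHomotopicMap]
    rw [dNext_eq (i := j + 1) (i' := j) _ (by simp),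
      prevD_eq (j := j + 1) (j' := j + 1 + 1) _ (by simp)]
  rw [e]
  rfl

theorem d_d (a : A) (j j' j'' : ℤ) (x : (D.cx a).X j) :
    (D.cx a).d j' j'' ((D.cx a).d j j' x) = 0 := by
  have := congrArg (fun f => f x) ((D.cx a).d_comp_d j j' j'')
  exact this

theorem h_mem_rad (a : A) (j : ℤ) (x : (D.cx a).X j) (hx : x ∈ D.rad a j) :
    s.h a j (j + 1) x ∈ D.rad a (j + 1) := by
  have : D.rad a j ≤ (D.rad a (j + 1)).comap (s.h a j (j + 1)).hom := by
    refine D.rad_induction _ fun i b m h hm z => ?_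
    have e : s.h a j (j + 1) (D.act i h m j hm z) =
        D.act i h (m + 1) (j + 1) (by rw [← hm]) (s.h b m (m + 1) z) :=
      congrArg (fun g => g z) (s.comm i h m j hm)
    have e' : s.h a j (j + 1) (D.act i h m j hm z) ∈ D.rad a (j + 1) := by
      rw [e]
      exact D.act_mem_rad i h _ _
    exact e'
  exact this hx

theorem endo_sub_mem_rad (a : A) (j : ℤ) (x : (D.cx a).X j) :
    (s.endo.f a).f j x - (s.endo.f a).f j ((s.endo.f a).f j x) ∈ D.rad a j := by
  obtain ⟨j, rfl⟩ : ∃ m, j = m + 1 := ⟨j - 1, by ring⟩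
  have e : (s.endo.f a).f (j + 1) x - (s.endo.f a).f (j + 1) ((s.endo.f a).f (j + 1) x) =
      s.h a j (j + 1) ((D.cx a).d (j + 1) j x -
        (D.cx a).d (j + 1) j (s.h a j (j + 1) ((D.cx a).d (j + 1) j x))) +
      ((D.cx a).d (j + 1 + 1) (j + 1) (s.h a (j + 1) (j + 1 + 1) x) -
        (D.cx a).d (j + 1 + 1) (j + 1) (s.h a (j + 1) (j + 1 + 1)
          ((D.cx a).d (j + 1 + 1) (j + 1) (s.h a (j + 1) (j + 1 + 1) x)))) := by
    rw [s.endo_apply, s.endo_apply, map_add, map_add, map_add, map_sub, d_d, map_zero, s.sq,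
      zero_add, add_zero]
    abel
  rw [e]
  exact Submodule.add_mem _ (s.h_mem_rad _ _ _ (s.rad _ _ _)) (s.rad _ _ _)

theorem d_sub_endo_mem_rad (a : A) (j : ℤ) (x : (D.cx a).X (j + 1)) :
    (D.cx a).d (j + 1) j (x - (s.endo.f a).f (j + 1) x) ∈ D.rad a j := by
  rw [s.endo_apply, map_sub, map_add, d_d, add_zero]
  exact s.rad a j x

/-- The idempotent endomorphism whose kernel is a minimal model. -/
abbrev idem : D ⟶ D := polyHom s.endo (idemPoly (Fintype.card ι + 1))

/-- The complementary idempotent. -/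
abbrev coidem : D ⟶ D := polyHom s.endo (1 - idemPoly (Fintype.card ι + 1))

theorem coidem_apply (a : A) (j : ℤ) (x : (D.cx a).X j) :
    (s.coidem.f a).f j x = x - (s.idem.f a).f j x := by
  have : s.coidem.f a = 𝟙 (D.cx a) - s.idem.f a := by
    change polyEnd _ _ a = _
    rw [polyEnd_sub, polyEnd_one]
    rfl
  rw [this]
  rfl

theorem idem_coidem (a : A) (j : ℤ) (x : (D.cx a).X j) :
    (s.idem.f a).f j ((s.coidem.f a).f j x) = 0 := by
  obtain ⟨R, hR⟩ := exists_idemPoly_mul_eq (Fintype.card ι + 1)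
  have e : s.coidem.f a ≫ s.idem.f a =
      polyEnd s.endo ((Polynomial.X - Polynomial.X ^ 2) ^ (Fintype.card ι + 1)) a ≫
        polyEnd s.endo R a := by
    rw [← polyEnd_mul, ← hR, polyEnd_mul]
    rfl
  have e' := congrArg (fun f : D.cx a ⟶ D.cx a => f.f j x) e
  refine e'.trans ?_
  have h0 := pow_mem_radPow s.endo s.endo_sub_mem_rad (Fintype.card ι + 1) a j x
  rw [D.radPow_eq_bot (by omega), Submodule.mem_bot] at h0
  refine Eq.trans ?_ (map_zero (HomologicalComplex.Hom.f (polyEnd s.endo R a) j).hom)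
  exact congrArg (HomologicalComplex.Hom.f (polyEnd s.endo R a) j) h0

/-- The minimal model, as a family of subspaces. -/
def ker (a : A) (j : ℤ) : Submodule k ((D.cx a).X j) := LinearMap.ker ((s.idem.f a).f j).hom

/-- The minimal model. -/
def model : DM deg (ModuleCat.{u} k) :=
  D.sub s.ker (fun a j j' x hx => by
      have e := congrArg (fun f => f x) ((s.idem.f a).comm j j')
      have e' : (s.idem.f a).f j' ((D.cx a).d j j' x) = (D.cx a).d j j' ((s.idem.f a).f j x) :=
        e.symm
      change (s.idem.f a).f j' ((D.cx a).d j j' x) = 0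
      rw [e', show (s.idem.f a).f j x = 0 from hx, map_zero])
    (fun i a b h j j' hj x hx => by
      have e' : (s.idem.f b).f j' (D.act i h j j' hj x) = D.act i h j j' hj ((s.idem.f a).f j x) :=
        congrArg (fun f => f x) (s.idem.comm i h j j' hj)
      change (s.idem.f b).f j' (D.act i h j j' hj x) = 0
      rw [e', show (s.idem.f a).f j x = 0 from hx, map_zero])

/-- The inclusion of the minimal model. -/
def incl : s.model ⟶ D := D.subIncl _ _ _

/-- The projection to the minimal model. -/
def proj : D ⟶ s.model := D.subLift _ _ _ s.coidem fun a j x => s.idem_coidem a j x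

theorem incl_proj : s.incl ≫ s.proj = 𝟙 s.model := by
  ext a j x
  have h : (s.idem.f a).f j x.1 = 0 := x.2
  refine Subtype.ext ((s.coidem_apply a j x.1).trans ?_)
  rw [h, sub_zero]
  rfl

theorem proj_apply_of_mem (a : A) (j : ℤ) (x : (s.model.cx a).X j) :
    (s.proj.f a).f j ((s.incl.f a).f j x) = x :=
  congrArg (fun φ : s.model ⟶ s.model => (DM.Hom.f φ a).f j x) s.incl_proj

theorem model_socleProperty (hD : D.SocleProperty) : s.model.SocleProperty := by
  intro a b j j' h hj x hx
  have e : (s.incl.f b).f j' (s.model.actList (sorted Finset.univ) h hj x) =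
      D.actList (sorted Finset.univ) h hj ((s.incl.f a).f j x) :=
    congrArg (fun f => f x) (actList_comm (fun a j => (s.incl.f a).f j)
      (fun i a b h j j' hj => s.incl.comm i h j j' hj) (sorted Finset.univ) h hj)
  rw [hx, map_zero] at e
  have h1 := map_mem_rad (fun a j => (s.proj.f a).f j)
    (fun i a b h j j' hj => s.proj.comm i h j j' hj) a j _ (hD h hj _ e.symm)
  rwa [s.proj_apply_of_mem] at h1

theorem model_isMinimal : s.model.IsMinimal := by
  intro a j j' hj x
  obtain rfl : j' + 1 = j := hj
  change _ ∈ s.model.rad a j'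
  obtain ⟨R, hR⟩ := exists_one_sub_idemPoly_eq (Fintype.card ι + 1) (by omega)
  have e1 : (s.coidem.f a).f (j' + 1) ((s.incl.f a).f (j' + 1) x) = (s.incl.f a).f (j' + 1) x :=
    congrArg (fun y => (s.incl.f a).f (j' + 1) y) (s.proj_apply_of_mem a (j' + 1) x)
  have e2 : s.coidem.f a = polyEnd s.endo R a ≫ (𝟙 _ - s.endo.f a) := by
    change polyEnd _ _ a = _
    rw [hR, polyEnd_mul, polyEnd_sub, polyEnd_one, polyEnd_X]
  rw [e2] at e1
  have e3 := s.d_sub_endo_mem_rad a j' (HomologicalComplex.Hom.f (polyEnd s.endo R a) (j' + 1)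
    ((s.incl.f a).f (j' + 1) x))
  have e4 : (D.cx a).d (j' + 1) j' ((s.incl.f a).f (j' + 1) x) ∈ D.rad a j' := by
    rw [← e1]
    exact e3
  have h1 := map_mem_rad (fun a j => (s.proj.f a).f j)
    (fun i a b h j j' hj => s.proj.comm i h j j' hj) a j' _ e4
  have e5 : (s.incl.f a).f j' ((s.model.cx a).d (j' + 1) j' x) =
      (D.cx a).d (j' + 1) j' ((s.incl.f a).f (j' + 1) x) := rfl
  rwa [← e5, s.proj_apply_of_mem] at h1

theorem exists_htpyEquiv : Nonempty (HtpyEquiv s.model D) := by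
  obtain ⟨Q, hQ⟩ := exists_idemPoly_eq (Fintype.card ι + 1) (by omega)
  have e2 : ∀ a, s.idem.f a = s.endo.f a ≫ polyEnd s.endo Q a := by
    intro a
    change polyEnd _ _ a = _
    rw [hQ, polyEnd_mul, polyEnd_X]
  let H : ∀ a, Homotopy (s.endo.f a ≫ polyEnd s.endo Q a) (0 ≫ polyEnd s.endo Q a) := fun a =>
    (Homotopy.nullHomotopy (s.h a) (s.zero a)).compRight (polyEnd s.endo Q a)
  have e3 : ∀ a, HomologicalComplex.Hom.f ((s.proj ≫ s.incl).f a) =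
      fun j => 𝟙 _ - (s.idem.f a).f j := by
    intro a
    funext j
    ext x
    exact s.coidem_apply a j x
  refine ⟨{ hom := s.incl, inv := s.proj, homInv := ?_, invHom := ?_ }⟩
  · exact
      { htpy := fun a => Homotopy.ofEq (congrArg (fun φ => DM.Hom.f φ a) s.incl_proj)
        comm := fun i a b h j j' hj => by simp }
  · refine
      { htpy := fun a =>
          { hom := fun j j' => - (H a).hom j j'
            zero := fun j j' hj => by rw [(H a).zero j j' hj, neg_zero]
            comm := fun j => ?_ }
        comm := fun i a b h j j' hj => ?_ }
    · have hc := (H a).comm j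
      have e4 : dNext j (fun j j' => - (H a).hom j j') = - dNext j (H a).hom :=
        map_neg (dNext j) (H a).hom
      have e5 : prevD j (fun j j' => - (H a).hom j j') = - prevD j (H a).hom :=
        map_neg (prevD j) (H a).hom
      rw [e3, e4, e5, e2]
      refine (congrArg (𝟙 _ - ·) hc).trans ?_
      have hz : (0 ≫ polyEnd s.endo Q a : D.cx a ⟶ D.cx a).f j = 0 := by rw [zero_comp]; rfl
      rw [hz, add_zero]
      change _ = _ + 𝟙 _
      abel
    · change D.act i h j j' hj ≫ (- (s.h b j' (j' + 1) ≫ HomologicalComplex.Hom.f (polyEnd s.endo Q b) (j' + 1))) =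
        (- (s.h a j (j + 1) ≫ HomologicalComplex.Hom.f (polyEnd s.endo Q a) (j + 1))) ≫ _
      rw [Preadditive.comp_neg, Preadditive.neg_comp, ← Category.assoc, s.comm, Category.assoc,
        Category.assoc, polyEnd_comm]

end Splitting

/-- A differential module with a splitting of the differential has a minimal free model. -/
theorem exists_minimal_model {D : DM deg (ModuleCat.{u} k)} (s : D.Splitting)
    (hD : D.SocleProperty) : ∃ T : DM deg (ModuleCat.{u} k), T.IsFree ∧ T.IsMinimal ∧
      Nonempty (HtpyEquiv T D) :=
  ⟨s.model, s.model.isFree_of_socleProperty (s.model_socleProperty hD), s.model_isMinimal,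
    s.exists_htpyEquiv⟩

end DM

end ToricBGG

namespace ToricBGG

section

variable {V W : Type*} [Category V] [Preadditive V] [HasCountableCoproducts V]

/-- The projection of a total complex to one of the terms of the bicomplex. -/
def totProj (L : Bicomplex V) (p : ℤ) (q : ℕ) (n : ℤ) : (tot L).X n ⟶ (L.X p).X q :=
  L.totalDesc fun p' q' _ => if h : p' = p ∧ q' = q then
    eqToHom (by rw [h.1, h.2]) else 0

theorem ι_totProj (L : Bicomplex V) (p : ℤ) (q : ℕ) (n : ℤ) (hpq) :
    L.ιTotal (ComplexShape.down ℤ) p q n hpq ≫ totProj L p q n = 𝟙 _ := by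
  refine (HomologicalComplex₂.ι_totalDesc _ _ _ _ _).trans ?_
  simp

theorem ι_totProj_ne (L : Bicomplex V) {p p' : ℤ} {q q' : ℕ} (n : ℤ) (hpq)
    (h : ¬ (p' = p ∧ q' = q)) :
    L.ιTotal (ComplexShape.down ℤ) p' q' n hpq ≫ totProj L p q n = 0 := by
  refine (HomologicalComplex₂.ι_totalDesc _ _ _ _ _).trans ?_
  simp [h]

theorem totProj_ι (L : Bicomplex V) (N : ℕ)
    (hN : ∀ (p : ℤ) (q : ℕ), (p < 0 ∨ (N : ℤ) < p) → IsZero ((L.X p).X q)) (n : ℤ) :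
    ∑ p ∈ Finset.range (N + 1), totProj L p ((p : ℤ) - n).toNat n ≫
      L.ιTotalOrZero (ComplexShape.down ℤ) p ((p : ℤ) - n).toNat n = 𝟙 _ := by
  refine HomologicalComplex₂.total.hom_ext _ fun p q hpq => ?_
  rw [Preadditive.comp_sum, Category.comp_id]
  by_cases hp : p < 0 ∨ (N : ℤ) < p
  · exact (hN p q hp).eq_of_src _ _
  · have h' : p - q = n := hpq
    rw [not_or] at hp
    obtain ⟨m, rfl⟩ : ∃ m : ℕ, p = m := ⟨p.toNat, by omega⟩
    rw [Finset.sum_eq_single m]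
    · obtain rfl : q = ((m : ℤ) - n).toNat := by omega
      rw [← Category.assoc, ι_totProj, Category.id_comp,
        HomologicalComplex₂.ιTotalOrZero_eq _ _ _ _ _ hpq]
    · intro m' _ hne
      rw [← Category.assoc, ι_totProj_ne, zero_comp]
      rintro ⟨h1, _⟩
      exact hne (by exact_mod_cast h1.symm)
    · intro hm
      exact absurd (Finset.mem_range.2 (by omega)) hm

theorem ιTotal_d (L : Bicomplex V) {p p' n n' : ℤ} {q : ℕ} (hp : p' + 1 = p) (hn : n' + 1 = n)
    (hpq : ComplexShape.π (ComplexShape.down ℤ) (ComplexShape.up ℕ) (ComplexShape.down ℤ)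
      (p, q) = n) :
    L.ιTotal (ComplexShape.down ℤ) p q n hpq ≫ (tot L).d n n' =
      (-1 : ℤˣ) ^ q • ((L.d p p').f q ≫ L.ιTotal (ComplexShape.down ℤ) p' q n' (pi_pred hp hn hpq)) +
        (L.X p).d q (q + 1) ≫ L.ιTotal (ComplexShape.down ℤ) p (q + 1) n' (pi_succ hn hpq) := by
  have r1 : (ComplexShape.down ℤ).Rel p p' := hp
  have r3 : (ComplexShape.up ℕ).Rel q (q + 1) := rfl
  rw [HomologicalComplex₂.total_d, Preadditive.comp_add, HomologicalComplex₂.ι_D₁,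
    HomologicalComplex₂.ι_D₂, HomologicalComplex₂.d₁_eq _ _ r1 _ _ (pi_pred hp hn hpq),
    HomologicalComplex₂.d₂_eq _ _ _ r3 _ (pi_succ hn hpq)]
  congr 1
  exact one_smul ℤˣ _

/-- The map to a total complex given by a map to one of the terms of the bicomplex. -/
def totInc (L : Bicomplex V) {p : ℤ} {q : ℕ} {Y : V} (a : Y ⟶ (L.X p).X q) (n : ℤ)
    (h : p - q = n) : Y ⟶ (tot L).X n := a ≫ L.ιTotal (ComplexShape.down ℤ) p q n h

theorem comp_totInc (L : Bicomplex V) {p : ℤ} {q : ℕ} {Y Y' : V} (b : Y' ⟶ Y)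
    (a : Y ⟶ (L.X p).X q) (n : ℤ) (h : p - q = n) :
    b ≫ totInc L a n h = totInc L (b ≫ a) n h := (Category.assoc _ _ _).symm

theorem totInc_zero (L : Bicomplex V) {p : ℤ} {q : ℕ} {Y : V} (n : ℤ) (h : p - q = n) :
    totInc L (0 : Y ⟶ (L.X p).X q) n h = 0 := zero_comp

theorem totInc_add (L : Bicomplex V) {p : ℤ} {q : ℕ} {Y : V} (a b : Y ⟶ (L.X p).X q) (n : ℤ)
    (h : p - q = n) : totInc L (a + b) n h = totInc L a n h + totInc L b n h :=
  Preadditive.add_comp _ _ _ _ _ _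

/-- The map `totInc`, as a homomorphism of groups. -/
def totIncHom (L : Bicomplex V) (p : ℤ) (q : ℕ) (Y : V) (n : ℤ) (h : p - q = n) :
    (Y ⟶ (L.X p).X q) →+ (Y ⟶ (tot L).X n) where
  toFun a := totInc L a n h
  map_zero' := totInc_zero L n h
  map_add' a b := totInc_add L a b n h

theorem totInc_sum (L : Bicomplex V) {p : ℤ} {q : ℕ} {Y : V} {J : Type*} (s : Finset J)
    (a : J → (Y ⟶ (L.X p).X q)) (n : ℤ) (h : p - q = n) :
    totInc L (∑ i ∈ s, a i) n h = ∑ i ∈ s, totInc L (a i) n h :=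
  map_sum (totIncHom L p q Y n h) _ _

theorem totInc_zsmul (L : Bicomplex V) {p : ℤ} {q : ℕ} {Y : V} (z : ℤ) (a : Y ⟶ (L.X p).X q)
    (n : ℤ) (h : p - q = n) : totInc L (z • a) n h = z • totInc L a n h :=
  map_zsmul (totIncHom L p q Y n h) _ _

theorem totInc_totProj (L : Bicomplex V) {p : ℤ} {q : ℕ} {Y : V} (a : Y ⟶ (L.X p).X q) (n : ℤ)
    (h : p - q = n) : totInc L a n h ≫ totProj L p q n = a := by
  unfold totInc
  rw [Category.assoc, ι_totProj, Category.comp_id]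

theorem totInc_totProj_ne (L : Bicomplex V) {p p' : ℤ} {q q' : ℕ} {Y : V} (a : Y ⟶ (L.X p').X q')
    (n : ℤ) (h : p' - q' = n) (hne : ¬ (p' = p ∧ q' = q)) :
    totInc L a n h ≫ totProj L p q n = 0 := by
  unfold totInc
  rw [Category.assoc, ι_totProj_ne _ _ _ hne, comp_zero]

theorem totInc_totalDesc (L : Bicomplex V) {p : ℤ} {q : ℕ} {Y Z : V} (a : Y ⟶ (L.X p).X q) (n : ℤ)
    (h : p - q = n) (f : ∀ (p : ℤ) (q : ℕ) (_ : ComplexShape.π (ComplexShape.down ℤ)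
      (ComplexShape.up ℕ) (ComplexShape.down ℤ) (p, q) = n), (L.X p).X q ⟶ Z) :
    totInc L a n h ≫ L.totalDesc f = a ≫ f p q h := by
  unfold totInc
  rw [Category.assoc]
  exact congrArg (a ≫ ·) (HomologicalComplex₂.ι_totalDesc _ _ _ _ _)

theorem totInc_totAct {L L' : Bicomplex V} (f : ∀ p p' : ℤ, p' + 1 = p → (L.X p ⟶ L'.X p'))
    {p p' : ℤ} {q : ℕ} {Y : V} (a : Y ⟶ (L.X p).X q) (n n' : ℤ) (hn : n' + 1 = n) (h : p - q = n)
    (hp : p' + 1 = p) :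
    totInc L a n h ≫ totAct f n n' hn = totInc L' (a ≫ (f p p' hp).f q) n' (by omega) := by
  unfold totInc
  rw [Category.assoc, ι_totAct f n n' hn p p' q hp, Category.assoc]

theorem totInc_map {L L' : Bicomplex V} (f : L ⟶ L') {p : ℤ} {q : ℕ} {Y : V}
    (a : Y ⟶ (L.X p).X q) (n : ℤ) (h : p - q = n) :
    totInc L a n h ≫ (HomologicalComplex₂.total.map f (ComplexShape.down ℤ)).f n =
      totInc L' (a ≫ (f.f p).f q) n h := by
  unfold totInc
  rw [Category.assoc, Category.assoc]
  exact congrArg (a ≫ ·) (HomologicalComplex₂.ιTotal_map _ _ _ _ _ _ _ _)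

theorem totInc_d (L : Bicomplex V) {p p' : ℤ} {q : ℕ} {Y : V} (a : Y ⟶ (L.X p).X q) (n n' : ℤ)
    (h : p - q = n) (hp : p' + 1 = p) (hn : n' + 1 = n) :
    totInc L a n h ≫ (tot L).d n n' =
      (-1 : ℤ) ^ q • totInc L (a ≫ (L.d p p').f q) n' (by omega) +
        totInc L (a ≫ (L.X p).d q (q + 1)) n' (by push_cast; omega) := by
  unfold totInc
  rw [Category.assoc, ιTotal_d L hp hn h, Preadditive.comp_add, Category.assoc, Category.assoc,
    Linear.comp_units_smul]
  congr 1

theorem totInc_hom_ext (L : Bicomplex V) {n : ℤ} {Z : V} {f g : (tot L).X n ⟶ Z}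
    (H : ∀ (p : ℤ) (q : ℕ) (h : p - q = n),
      totInc L (𝟙 ((L.X p).X q)) n h ≫ f = totInc L (𝟙 ((L.X p).X q)) n h ≫ g) : f = g := by
  refine HomologicalComplex₂.total.hom_ext _ fun p q hpq => ?_
  have := H p q hpq
  unfold totInc at this
  rwa [Category.id_comp] at this

end

section

variable {V W : Type*} [Category V] [Preadditive V] [HasFiniteBiproducts V] [Category W]
  [Preadditive W]

/-- Maps out of the image of a biproduct under an additive functor are determined by their
restrictions to the summands. -/
theorem map_biproduct_hom_ext (G : V ⥤ W) [G.Additive] {J : Type} [Finite J] {F : J → V} {Y : W}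
    {f g : G.obj (⨁ F) ⟶ Y} (h : ∀ j, G.map (biproduct.ι F j) ≫ f = G.map (biproduct.ι F j) ≫ g) :
    f = g := by
  have := Fintype.ofFinite J
  rw [← Category.id_comp f, ← Category.id_comp g, ← G.map_id, ← biproduct.total, G.map_sum,
    Preadditive.sum_comp, Preadditive.sum_comp]
  refine Finset.sum_congr rfl fun j _ => ?_
  rw [G.map_comp, Category.assoc, Category.assoc, h]

end

/-- A contracting homotopy of a complex of vector spaces onto its homology. -/
theorem exists_split_cochainComplex {k : Type u} [Field k] (C : CochainComplex (ModuleCat.{u} k) ℕ) :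
    ∃ h : ∀ q, C.X (q + 1) ⟶ C.X q, (∀ q, C.d q (q + 1) ≫ h q ≫ C.d q (q + 1) = C.d q (q + 1)) ∧
      ∀ q, h (q + 1) ≫ h q = 0 := by
  have key : ∀ q, ∃ g : C.X (q + 1) ⟶ C.X q, C.d q (q + 1) ≫ g ≫ C.d q (q + 1) = C.d q (q + 1) := by
    intro q
    obtain ⟨s, hs⟩ := (C.d q (q + 1)).hom.rangeRestrict.exists_rightInverse_of_surjective
      (LinearMap.range_rangeRestrict _)
    obtain ⟨g, hg⟩ := LinearMap.exists_extend s
    refine ⟨ModuleCat.ofHom g, ?_⟩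
    ext x
    have h1 : g (C.d q (q + 1) x) = s ((C.d q (q + 1)).hom.rangeRestrict x) :=
      LinearMap.congr_fun hg ((C.d q (q + 1)).hom.rangeRestrict x)
    have h2 := LinearMap.congr_fun hs ((C.d q (q + 1)).hom.rangeRestrict x)
    change C.d q (q + 1) (g (C.d q (q + 1) x)) = _
    rw [h1]
    exact congrArg Subtype.val h2
  choose g hg using key
  refine ⟨fun q => (𝟙 _ - C.d (q + 1) (q + 1 + 1) ≫ g (q + 1)) ≫ g q ≫ C.d q (q + 1) ≫ g q,
    fun q => ?_, fun q => ?_⟩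
  · simp [Preadditive.sub_comp, hg]
  · have e : C.d (q + 1) (q + 1 + 1) ≫ g (q + 1) ≫
        (𝟙 _ - C.d (q + 1) (q + 1 + 1) ≫ g (q + 1)) = 0 := by
      rw [Preadditive.comp_sub, Preadditive.comp_sub, Category.comp_id,
        reassoc_of% hg (q + 1), sub_self]
    simp only [Category.assoc]
    rw [reassoc_of% e, zero_comp, comp_zero, comp_zero]

end ToricBGG

namespace ToricBGG

namespace KoszulTotal

variable {ι A : Type} [Fintype ι] [LinearOrder ι] [AddCommGroup A] {deg : ι → A}
  {V : Type*} [Category V] [Preadditive V] [HasFiniteBiproducts V] {k : Type u} [Field k]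
  (G : V ⥤ CochainComplex (ModuleCat.{u} k) ℕ) [G.Additive] (M : GrObj deg V)

/-- The totalization of a Koszul complex. -/
abbrev dm : DM deg (ModuleCat.{u} k) := (totalizeDM G).obj M.koszulDM

/-- The bicomplex behind the totalization. -/
abbrev bi (c : A) : Bicomplex (ModuleCat.{u} k) := (G.mapHomologicalComplex _).obj (M.koszul c)

/-- The inclusion of the summand that belongs to a subset of `ι`. -/
def inc (c : A) {p : ℤ} (I : SubsetsOfCard ι p) (q : ℕ) (n : ℤ) (h : p - q = n) :
    (G.obj (M.obj (c - ∑ l ∈ I.1, deg l))).X q ⟶ ((dm G M).cx c).X n :=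
  totInc (bi G M c) (p := p) (q := q)
    ((G.map (biproduct.ι (fun I : SubsetsOfCard ι p => M.obj (c - ∑ l ∈ I.1, deg l)) I)).f q) n h

theorem inc_injective (c : A) {p : ℤ} (I : SubsetsOfCard ι p) (q : ℕ) (n : ℤ) (h : p - q = n)
    (x : (G.obj (M.obj (c - ∑ l ∈ I.1, deg l))).X q) (hx : inc G M c I q n h x = 0) : x = 0 := by
  have e1 := totInc_totProj (bi G M c) (p := p) (q := q)
    ((G.map (biproduct.ι (fun I : SubsetsOfCard ι p => M.obj (c - ∑ l ∈ I.1, deg l)) I)).f q) n h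
  have e2 : (G.map (biproduct.ι (fun I : SubsetsOfCard ι p =>
      M.obj (c - ∑ l ∈ I.1, deg l)) I)).f q ≫ (G.map (biproduct.π _ I)).f q = 𝟙 _ := by
    rw [← HomologicalComplex.comp_f, ← G.map_comp, biproduct.ι_π_self, G.map_id]
    rfl
  have e3 := congrArg (fun f => f x) e1
  have e4 := congrArg (fun f => f x) e2
  have e5 : totProj (bi G M c) p q n (inc G M c I q n h x) =
      (G.map (biproduct.ι (fun I : SubsetsOfCard ι p =>
        M.obj (c - ∑ l ∈ I.1, deg l)) I)).f q x := e3
  have e7 := e5.symm.trans ((congrArg (totProj (bi G M c) p q n) hx).trans (map_zero _))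
  have e6 : (G.map (biproduct.π _ I)).f q ((G.map (biproduct.ι (fun I : SubsetsOfCard ι p =>
        M.obj (c - ∑ l ∈ I.1, deg l)) I)).f q x) = x := e4
  rw [← e6]
  exact (congrArg _ e7).trans (map_zero _)

variable {G M} in
theorem hom_ext {c : A} {n : ℤ} {Y : ModuleCat.{u} k} {f g : ((dm G M).cx c).X n ⟶ Y}
    (H : ∀ (p : ℤ) (I : SubsetsOfCard ι p) (q : ℕ) (h : p - q = n),
      inc G M c I q n h ≫ f = inc G M c I q n h ≫ g) : f = g := by
  refine totInc_hom_ext (bi G M c) fun p q hpq => ?_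
  refine map_biproduct_hom_ext (G ⋙ HomologicalComplex.eval _ _ q)
    (F := fun I : SubsetsOfCard ι p => M.obj (c - ∑ l ∈ I.1, deg l)) fun I => ?_
  have r : ∀ u : ((dm G M).cx c).X n ⟶ Y,
      (G.map (biproduct.ι (fun I : SubsetsOfCard ι p => M.obj (c - ∑ l ∈ I.1, deg l)) I)).f q ≫
        totInc (bi G M c) (𝟙 (((bi G M c).X p).X q)) n hpq ≫ u = inc G M c I q n hpq ≫ u :=
    fun u => (Category.assoc _ _ _).symm.trans (congrArg (· ≫ u) ((comp_totInc _ _ _ _ _).trans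
      (congrArg (fun a => totInc (bi G M c) a n hpq) (Category.comp_id _))))
  exact (r f).trans ((H p I q hpq).trans (r g).symm)

variable {G M} in
theorem mem_of_inc {c : A} {n : ℤ} (S : Submodule k (((dm G M).cx c).X n))
    (H : ∀ (p : ℤ) (I : SubsetsOfCard ι p) (q : ℕ) (h : p - q = n) y,
      inc G M c I q n h y ∈ S) (x : ((dm G M).cx c).X n) : x ∈ S := by
  have : ModuleCat.ofHom S.mkQ = 0 := by
    refine hom_ext fun p I q h => ?_
    ext y
    exact (Submodule.Quotient.mk_eq_zero S).2 (H p I q h y)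
  refine (Submodule.Quotient.mk_eq_zero S).1 ?_
  exact congrArg (fun f => f x) this

theorem inc_act (c c' : A) (i : ι) (hd : c' + deg i = c) {p p' : ℤ} (I : SubsetsOfCard ι p)
    (q : ℕ) (n n' : ℤ) (hp : p' + 1 = p) (hn : n' + 1 = n) (h : p - q = n) :
    inc G M c I q n h ≫ (dm G M).act i hd n n' hn =
      if hi : i ∈ I.1 then (p.negOnePow : ℤ) • contractSign i I.1 •
        ((G.map (eqToHom (congrArg M.obj (GrObj.wt_erase_act hi hd)))).f q ≫
          inc G M c' (p := p') ⟨I.1.erase i, card_erase_eq hp I hi⟩ q n' (by omega)) else 0 := by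
  have e2 : biproduct.ι (fun I : SubsetsOfCard ι p => M.obj (c - ∑ l ∈ I.1, deg l)) I ≫
      M.rightContract i hd p p' hp = if hi : i ∈ I.1 then (p.negOnePow : ℤ) • contractSign i I.1 •
        (eqToHom (congrArg M.obj (GrObj.wt_erase_act hi hd)) ≫
          biproduct.ι (fun I : SubsetsOfCard ι p' => M.obj (c' - ∑ l ∈ I.1, deg l))
            ⟨I.1.erase i, card_erase_eq hp I hi⟩) else 0 := by
    unfold GrObj.rightContract GrObj.contract contraction
    rw [Linear.comp_units_smul, biproduct.ι_desc]
    split_ifs with hi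
    · rfl
    · exact smul_zero _
  refine (totInc_totAct (L := bi G M c) (L' := bi G M c')
    (fun p p' hp => G.map (M.rightContract i hd p p' hp)) _ n n' hn h hp).trans ?_
  have e3 := congrArg (fun f => HomologicalComplex.Hom.f f q)
    ((G.map_comp _ _).symm.trans (congrArg G.map e2))
  refine (congrArg (fun a => totInc (bi G M c') a n' _) e3).trans ?_
  split_ifs with hi
  · rw [G.map_zsmul, G.map_zsmul, G.map_comp]
    refine (totInc_zsmul _ _ _ _ _).trans (congrArg _ ((totInc_zsmul _ _ _ _ _).trans
      (congrArg _ ?_)))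
    exact (comp_totInc _ _ _ _ _).symm
  · rw [G.map_zero]
    exact totInc_zero _ _ _

theorem inc_d (c : A) {p p' : ℤ} (I : SubsetsOfCard ι p) (q : ℕ) (n n' : ℤ) (hp : p' + 1 = p)
    (hn : n' + 1 = n) (h : p - q = n) :
    inc G M c I q n h ≫ ((dm G M).cx c).d n n' =
      (-1 : ℤ) ^ q • (∑ i, if hi : i ∈ I.1 then contractSign i I.1 •
        ((G.map (M.mul i (GrObj.wt_erase_mul hi c))).f q ≫
          inc G M c (p := p') ⟨I.1.erase i, card_erase_eq hp I hi⟩ q n' (by omega)) else 0) +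
      (G.obj (M.obj (c - ∑ l ∈ I.1, deg l))).d q (q + 1) ≫
        inc G M c I (q + 1) n' (by push_cast; omega) := by
  refine (totInc_d (bi G M c) (p := p) (q := q) _ n n' h hp hn).trans ?_
  congr 2
  · have e2 : biproduct.ι (fun I : SubsetsOfCard ι p => M.obj (c - ∑ l ∈ I.1, deg l)) I ≫
      M.koszulD c p p' = ∑ i, if hi : i ∈ I.1 then contractSign i I.1 •
        (M.mul i (GrObj.wt_erase_mul hi c) ≫
          biproduct.ι (fun I : SubsetsOfCard ι p' => M.obj (c - ∑ l ∈ I.1, deg l))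
            ⟨I.1.erase i, card_erase_eq hp I hi⟩) else 0 := by
      rw [M.koszulD_eq c p p' hp, Preadditive.comp_sum]
      refine Finset.sum_congr rfl fun i _ => ?_
      unfold GrObj.mulContract contraction
      rw [biproduct.ι_desc]
    have e3 := congrArg (fun f => HomologicalComplex.Hom.f f q)
      ((G.map_comp _ _).symm.trans (congrArg G.map e2))
    refine (congrArg (fun a => totInc (bi G M c) a n' _) e3).trans ?_
    rw [G.map_sum]
    refine (congrArg (fun a => totInc (bi G M c) a n' _)
      ((HomologicalComplex.eval _ _ q).map_sum _ _)).trans ?_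
    refine (totInc_sum _ _ _ _ _).trans ?_
    refine Finset.sum_congr rfl fun i _ => ?_
    split_ifs with hi
    · rw [G.map_zsmul, G.map_comp]
      refine (totInc_zsmul _ _ _ _ _).trans (congrArg _ ?_)
      exact (comp_totInc _ _ _ _ _).symm
    · rw [G.map_zero]
      exact totInc_zero _ _ _
  · refine Eq.trans ?_ (comp_totInc _ _ _ _ _).symm
    exact congrArg (fun a => totInc (bi G M c) a n' _) ((G.map _).comm q (q + 1))

variable {G M} in
/-- The map out of a term of the total complex given by maps out of its summands. -/
def desc {c : A} {n : ℤ} {Y : ModuleCat.{u} k}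
    (f : ∀ (p : ℤ) (I : SubsetsOfCard ι p) (q : ℕ) (_ : p - q = n),
      (G.obj (M.obj (c - ∑ l ∈ I.1, deg l))).X q ⟶ Y) : ((dm G M).cx c).X n ⟶ Y :=
  (bi G M c).totalDesc fun p q h => ∑ I : SubsetsOfCard ι p,
    (G.map (biproduct.π (fun I : SubsetsOfCard ι p => M.obj (c - ∑ l ∈ I.1, deg l)) I)).f q ≫
      f p I q h

theorem inc_desc {c : A} {n : ℤ} {Y : ModuleCat.{u} k}
    (f : ∀ (p : ℤ) (I : SubsetsOfCard ι p) (q : ℕ) (_ : p - q = n),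
      (G.obj (M.obj (c - ∑ l ∈ I.1, deg l))).X q ⟶ Y) {p : ℤ} (I : SubsetsOfCard ι p) (q : ℕ)
    (h : p - q = n) : inc G M c I q n h ≫ desc f = f p I q h := by
  refine (totInc_totalDesc (bi G M c) (p := p) (q := q) _ n h _).trans ?_
  refine (Preadditive.comp_sum _ _ _).trans ?_
  rw [Finset.sum_eq_single I]
  · have e : (G.map (biproduct.ι (fun I : SubsetsOfCard ι p =>
        M.obj (c - ∑ l ∈ I.1, deg l)) I)).f q ≫ (G.map (biproduct.π _ I)).f q = 𝟙 _ := by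
      rw [← HomologicalComplex.comp_f, ← G.map_comp, biproduct.ι_π_self, G.map_id]
      rfl
    exact (Category.assoc _ _ _).symm.trans ((congrArg (· ≫ f p I q h) e).trans
      (Category.id_comp _))
  · intro J _ hJ
    have e : (G.map (biproduct.ι (fun I : SubsetsOfCard ι p =>
        M.obj (c - ∑ l ∈ I.1, deg l)) I)).f q ≫ (G.map (biproduct.π _ J)).f q = 0 := by
      rw [← HomologicalComplex.comp_f, ← G.map_comp, biproduct.ι_π_ne _ hJ.symm, G.map_zero]
      rfl
    exact (Category.assoc _ _ _).symm.trans ((congrArg (· ≫ f p J q h) e).trans zero_comp)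
  · intro h
    exact absurd (Finset.mem_univ I) h

theorem inc_mem_rad (c : A) {p p' : ℤ} (J : SubsetsOfCard ι p') (I : SubsetsOfCard ι p) {i : ι}
    (hi : i ∈ I.1) (hp : p' + 1 = p) (e : J.1 = I.1.erase i) (q : ℕ) (n : ℤ) (h : p' - q = n)
    (y : (G.obj (M.obj (c - ∑ l ∈ J.1, deg l))).X q) :
    inc G M c J q n h y ∈ (dm G M).rad c n := by
  obtain rfl : J = ⟨I.1.erase i, card_erase_eq hp I hi⟩ := Subtype.ext e
  have e1 := inc_act G M (c + deg i) c i rfl I q (n + 1) n hp rfl (by omega)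
  rw [dif_pos hi] at e1
  let z := (G.map (eqToHom (congrArg M.obj
    (GrObj.wt_erase_act hi (rfl : c + deg i = c + deg i)).symm))).f q y
  have hz : (G.map (eqToHom (congrArg M.obj
      (GrObj.wt_erase_act hi (rfl : c + deg i = c + deg i))))).f q z = y := by
    have e : (G.map (eqToHom (congrArg M.obj
      (GrObj.wt_erase_act hi (rfl : c + deg i = c + deg i)).symm))).f q ≫ (G.map (eqToHom
      (congrArg M.obj (GrObj.wt_erase_act hi (rfl : c + deg i = c + deg i))))).f q = 𝟙 _ := by
      rw [← HomologicalComplex.comp_f, ← G.map_comp, eqToHom_trans, eqToHom_refl, G.map_id]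
      rfl
    exact congrArg (fun f => f y) e
  have e2 : (dm G M).act i rfl (n + 1) n rfl (inc G M (c + deg i) I q (n + 1) (by omega) z) =
      (p.negOnePow : ℤ) • contractSign i I.1 •
        inc G M c (p := p') ⟨I.1.erase i, card_erase_eq hp I hi⟩ q n h y := by
    refine (congrArg (fun f => f z) e1).trans ?_
    change (p.negOnePow : ℤ) • contractSign i I.1 • inc G M c (p := p')
      ⟨I.1.erase i, card_erase_eq hp I hi⟩ q n h ((G.map (eqToHom (congrArg M.obj
      (GrObj.wt_erase_act hi (rfl : c + deg i = c + deg i))))).f q z) = _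
    rw [hz]
  have e3 := (dm G M).act_mem_rad i rfl rfl
    (inc G M (c + deg i) I q (n + 1) (by omega) z)
  have e4 : contractSign i I.1 • (p.negOnePow : ℤ) • (dm G M).act i rfl (n + 1) n rfl
      (inc G M (c + deg i) I q (n + 1) (by omega) z) = inc G M c (p := p')
        ⟨I.1.erase i, card_erase_eq hp I hi⟩ q n h y := by
    rw [e2, smul_comm, smul_smul, smul_smul, smul_smul]
    have h1 : contractSign i I.1 * contractSign i I.1 = 1 := by
      unfold contractSign
      rw [← mul_pow]
      norm_num
    have h2 : (p.negOnePow : ℤ) * (p.negOnePow : ℤ) = 1 := Int.units_coe_mul_self _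
    rw [show (p.negOnePow : ℤ) * contractSign i I.1 * (p.negOnePow : ℤ) * contractSign i I.1 =
      ((p.negOnePow : ℤ) * (p.negOnePow : ℤ)) * (contractSign i I.1 * contractSign i I.1) by ring,
      h1, h2, one_mul, one_smul]
  rw [← e4]
  exact zsmul_mem (zsmul_mem e3 _) _

/-- A homotopy operator on the rows of the bicomplex behind `dm G M`. -/
def rowHomotopy (hh : ∀ a q, (G.obj (M.obj a)).X (q + 1) ⟶ (G.obj (M.obj a)).X q) (c : A)
    (j j' : ℤ) : ((dm G M).cx c).X j ⟶ ((dm G M).cx c).X j' :=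
  if e : j + 1 = j' then desc fun p I q hpq =>
    match q, hpq with
    | 0, _ => 0
    | q + 1, hpq => hh _ q ≫ inc G M c I q j' (by push_cast at hpq; omega)
  else 0

section

variable (hh : ∀ a q, (G.obj (M.obj a)).X (q + 1) ⟶ (G.obj (M.obj a)).X q)

theorem inc_zero_rowHomotopy (c : A) {p : ℤ} (I : SubsetsOfCard ι p) (j j' : ℤ)
    (h : p - (0 : ℕ) = j) : inc G M c I 0 j h ≫ rowHomotopy G M hh c j j' = 0 := by
  unfold rowHomotopy
  split_ifs with e
  · exact inc_desc G M _ I 0 h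
  · exact comp_zero

theorem inc_succ_rowHomotopy (c : A) {p : ℤ} (I : SubsetsOfCard ι p) (q : ℕ) (j j' : ℤ)
    (h : p - (q + 1 : ℕ) = j) (e : j + 1 = j') :
    inc G M c I (q + 1) j h ≫ rowHomotopy G M hh c j j' =
      hh _ q ≫ inc G M c I q j' (by push_cast at h; omega) := by
  unfold rowHomotopy
  rw [dif_pos e]
  exact inc_desc G M _ I (q + 1) h

theorem eqToHom_comp_hh {a b : A} (e : a = b) (q : ℕ) :
    (G.map (eqToHom (congrArg M.obj e))).f (q + 1) ≫ hh b q =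
      hh a q ≫ (G.map (eqToHom (congrArg M.obj e))).f q := by
  subst e
  simp

theorem act_rowHomotopy (i : ι) {a b : A} (hd : b + deg i = a) (j j' : ℤ) (hj : j' + 1 = j) :
    (dm G M).act i hd j j' hj ≫ rowHomotopy G M hh b j' (j' + 1) =
      rowHomotopy G M hh a j (j + 1) ≫ (dm G M).act i hd (j + 1) (j' + 1) (by rw [hj]) := by
  refine hom_ext fun p I q hpq => ?_
  rw [← Category.assoc, ← Category.assoc, inc_act G M a b i hd I q j j' (sub_add_cancel p 1) hj hpq]
  cases q with
  | zero =>
    rw [inc_zero_rowHomotopy, zero_comp]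
    split_ifs with hi
    · rw [Preadditive.zsmul_comp, Preadditive.zsmul_comp, Category.assoc, inc_zero_rowHomotopy,
        comp_zero, smul_zero, smul_zero]
    · exact zero_comp
  | succ q =>
    rw [inc_succ_rowHomotopy G M hh a I q j (j + 1) hpq rfl, Category.assoc,
      inc_act G M a b i hd I q (j + 1) (j' + 1) (sub_add_cancel p 1) (by rw [hj])]
    split_ifs with hi
    · rw [Preadditive.zsmul_comp, Preadditive.zsmul_comp, Category.assoc,
        inc_succ_rowHomotopy G M hh b _ q j' (j' + 1) _ rfl, Preadditive.comp_zsmul,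
        Preadditive.comp_zsmul, ← Category.assoc, ← Category.assoc,
        eqToHom_comp_hh G M hh (GrObj.wt_erase_act hi hd) q]
    · rw [zero_comp, comp_zero]

theorem rowHomotopy_sq (hz : ∀ a q, hh a (q + 1) ≫ hh a q = 0) (c : A) (j : ℤ) :
    rowHomotopy G M hh c j (j + 1) ≫ rowHomotopy G M hh c (j + 1) (j + 1 + 1) = 0 := by
  refine hom_ext fun p I q hpq => ?_
  rw [comp_zero, ← Category.assoc]
  cases q with
  | zero => rw [inc_zero_rowHomotopy, zero_comp]
  | succ q =>
    rw [inc_succ_rowHomotopy G M hh c I q j (j + 1) hpq rfl, Category.assoc]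
    cases q with
    | zero => rw [inc_zero_rowHomotopy, comp_zero]
    | succ q => rw [inc_succ_rowHomotopy G M hh c I q (j + 1) _ _ rfl, reassoc_of% hz, zero_comp]

end

end KoszulTotal

end ToricBGG

namespace ToricBGG

theorem DM.d_mem_rad {ι A : Type} [AddCommGroup A] {deg : ι → A} {k : Type u} [Field k] [Fintype ι]
    [LinearOrder ι] (D : DM deg (ModuleCat.{u} k)) {a : A} {j : ℤ} (j' : ℤ) {x : (D.cx a).X j}
    (hx : x ∈ D.rad a j) : (D.cx a).d j j' x ∈ D.rad a j' := by
  by_cases hj : j' + 1 = j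
  · have : D.rad a j ≤ (D.rad a j').comap ((D.cx a).d j j').hom := by
      refine D.rad_induction _ fun i b m h hm z => ?_
      have e : (D.cx a).d j j' (D.act i h m j hm z) =
          D.act i h j j' hj ((D.cx b).d m j z) :=
        congrArg (fun g => g z) (D.act_d i h m j j' hm hj)
      exact Submodule.mem_comap.2 (e ▸ D.act_mem_rad i h hj _)
    exact this hx
  · have e : (D.cx a).d j j' x = 0 := congrArg (fun g => g x) ((D.cx a).shape j j' hj)
    rw [e]
    exact Submodule.zero_mem _

namespace KoszulTotal

variable {ι A : Type} [Fintype ι] [LinearOrder ι] [AddCommGroup A] {deg : ι → A}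
  {V : Type*} [Category V] [Preadditive V] [HasFiniteBiproducts V] {k : Type u} [Field k]
  (G : V ⥤ CochainComplex (ModuleCat.{u} k) ℕ) [G.Additive] (M : GrObj deg V)

section

variable (hh : ∀ a q, (G.obj (M.obj a)).X (q + 1) ⟶ (G.obj (M.obj a)).X q)

theorem rowHomotopy_mem_rad (c : A) (j : ℤ) {x : ((dm G M).cx c).X j}
    (hx : x ∈ (dm G M).rad c j) :
    rowHomotopy G M hh c j (j + 1) x ∈ (dm G M).rad c (j + 1) := by
  have : (dm G M).rad c j ≤
      ((dm G M).rad c (j + 1)).comap (rowHomotopy G M hh c j (j + 1)).hom := by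
    refine (dm G M).rad_induction _ fun i b m h hm z => ?_
    have e : rowHomotopy G M hh c j (j + 1) ((dm G M).act i h m j hm z) =
        (dm G M).act i h (m + 1) (j + 1) (by rw [← hm]) (rowHomotopy G M hh b m (m + 1) z) :=
      congrArg (fun g => g z) (act_rowHomotopy G M hh i h m j hm)
    exact Submodule.mem_comap.2 (e ▸ (dm G M).act_mem_rad i h _ _)
  exact this hx

theorem inc_d_sub_mem_rad (c : A) {p : ℤ} (I : SubsetsOfCard ι p) (q : ℕ) (n n' : ℤ)
    (h : p - q = n) (hn : n' + 1 = n) (y : (G.obj (M.obj (c - ∑ l ∈ I.1, deg l))).X q) :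
    ((dm G M).cx c).d n n' (inc G M c I q n h y) - inc G M c I (q + 1) n' (by push_cast; omega)
      ((G.obj (M.obj (c - ∑ l ∈ I.1, deg l))).d q (q + 1) y) ∈ (dm G M).rad c n' := by
  have e := congrArg (fun f => f - (G.obj (M.obj (c - ∑ l ∈ I.1, deg l))).d q (q + 1) ≫
    inc G M c I (q + 1) n' (by push_cast; omega))
    (inc_d G M c I q n n' (sub_add_cancel p 1) hn h)
  simp only [add_sub_cancel_right] at e
  have e' := congrArg (fun f => f y) e
  refine (congrArg (· ∈ (dm G M).rad c n') e').mpr ?_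
  have key : ∀ f : (G.obj (M.obj (c - ∑ l ∈ I.1, deg l))).X q ⟶ ((dm G M).cx c).X n',
      f y ∈ (dm G M).rad c n' → ((-1 : ℤ) ^ q • f) y ∈ (dm G M).rad c n' :=
    fun f hf => zsmul_mem hf ((-1 : ℤ) ^ q)
  refine key _ ?_
  have key' : ∀ f : ι → ((G.obj (M.obj (c - ∑ l ∈ I.1, deg l))).X q ⟶ ((dm G M).cx c).X n'),
      (∀ i, f i y ∈ (dm G M).rad c n') → (∑ i, f i) y ∈ (dm G M).rad c n' := by
    intro f hf
    change (∑ i, f i).hom y ∈ _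
    rw [ModuleCat.hom_sum, LinearMap.sum_apply]
    exact Submodule.sum_mem _ fun i _ => hf i
  refine key' _ fun i => ?_
  split_ifs with hi
  · exact zsmul_mem (inc_mem_rad G M c _ I hi (sub_add_cancel p 1) rfl q n' _ _)
      (contractSign i I.1)
  · exact Submodule.zero_mem _

theorem d_sub_mem_rad (hd : ∀ a q, (G.obj (M.obj a)).d q (q + 1) ≫ hh a q ≫
    (G.obj (M.obj a)).d q (q + 1) = (G.obj (M.obj a)).d q (q + 1)) (c : A) (j : ℤ)
    (x : ((dm G M).cx c).X (j + 1)) :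
    ((dm G M).cx c).d (j + 1) j x - ((dm G M).cx c).d (j + 1) j
      (rowHomotopy G M hh c j (j + 1) (((dm G M).cx c).d (j + 1) j x)) ∈ (dm G M).rad c j := by
  let d := ((dm G M).cx c).d (j + 1) j
  let r := rowHomotopy G M hh c j (j + 1)
  refine mem_of_inc (((dm G M).rad c j).comap (d - d ≫ r ≫ d).hom) (fun p I q h y => ?_) x
  have h1 := inc_d_sub_mem_rad G M c I q (j + 1) j h rfl y
  set u := d (inc G M c I q (j + 1) h y) with hu
  set v := inc G M c I (q + 1) j (by push_cast; omega)
    ((G.obj (M.obj (c - ∑ l ∈ I.1, deg l))).d q (q + 1) y) with hv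
  change u - v ∈ _ at h1
  have h2 : v - d (r v) ∈ (dm G M).rad c j := by
    have e1 : r v = inc G M c I q (j + 1) h (hh _ q
        ((G.obj (M.obj (c - ∑ l ∈ I.1, deg l))).d q (q + 1) y)) :=
      congrArg (fun f => f ((G.obj (M.obj (c - ∑ l ∈ I.1, deg l))).d q (q + 1) y))
        (inc_succ_rowHomotopy G M hh c I q j (j + 1) (by push_cast; omega) rfl)
    have e2 : (G.obj (M.obj (c - ∑ l ∈ I.1, deg l))).d q (q + 1) (hh _ q
        ((G.obj (M.obj (c - ∑ l ∈ I.1, deg l))).d q (q + 1) y)) =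
        (G.obj (M.obj (c - ∑ l ∈ I.1, deg l))).d q (q + 1) y := congrArg (fun f => f y) (hd _ q)
    have h3 := inc_d_sub_mem_rad G M c I q (j + 1) j h rfl (hh _ q
        ((G.obj (M.obj (c - ∑ l ∈ I.1, deg l))).d q (q + 1) y))
    rw [e2] at h3
    have h4 := neg_mem h3
    rw [neg_sub] at h4
    rw [e1]
    exact h4
  have h5 : d (r (u - v)) ∈ (dm G M).rad c j :=
    (dm G M).d_mem_rad j (rowHomotopy_mem_rad G M hh c j h1)
  rw [map_sub, map_sub] at h5
  have h6 : u - d (r u) ∈ (dm G M).rad c j := by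
    have : u - d (r u) = (u - v) + (v - d (r v)) - (d (r u) - d (r v)) := by abel
    rw [this]
    exact sub_mem (add_mem h1 h2) h5
  exact h6

end

theorem exists_splitting : Nonempty (dm G M).Splitting := by
  choose hh h1 h2 using fun a => exists_split_cochainComplex (G.obj (M.obj a))
  exact ⟨⟨rowHomotopy G M hh, fun a j j' hj => dif_neg hj,
    fun i a b hd j j' hj => act_rowHomotopy G M hh i hd j j' hj,
    fun a j x => congrArg (fun f => f x) (rowHomotopy_sq G M hh h2 a j),
    fun a j x => d_sub_mem_rad G M hh h1 a j x⟩⟩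

theorem eq_zero_of_zsmul_eq_zero {W : Type*} [AddCommGroup W] {z : ℤ} (hz : z * z = 1) {w : W}
    (h : z • w = 0) : w = 0 := by
  rw [← one_smul ℤ w, ← hz, mul_smul, h, smul_zero]

theorem eq_zero_of_map_eqToHom {a b : A} (e : a = b) (q : ℕ) (y : (G.obj (M.obj a)).X q)
    (h : (G.map (eqToHom (congrArg M.obj e))).f q y = 0) : y = 0 := by
  subst e
  have e : (G.map (eqToHom (congrArg M.obj (Eq.refl a)))).f q = 𝟙 _ := by
    rw [eqToHom_refl, G.map_id]
    rfl
  exact (congrArg (fun f => f y) e).symm.trans h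

theorem act_inc_apply {c c' : A} {i : ι} (hd : c' + deg i = c) {p : ℤ} (I : SubsetsOfCard ι p)
    (hi : i ∈ I.1) (q : ℕ) (n n' : ℤ) (hn : n' + 1 = n) (h : p - q = n)
    (y : (G.obj (M.obj (c - ∑ l ∈ I.1, deg l))).X q) :
    ∃ y', (dm G M).act i hd n n' hn (inc G M c I q n h y) = inc G M c' (p := p - 1)
      ⟨I.1.erase i, card_erase_eq (sub_add_cancel p 1) I hi⟩ q n' (by omega) y' ∧
        (y' = 0 → y = 0) := by
  have e := inc_act G M c c' i hd I q n n' (sub_add_cancel p 1) hn h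
  rw [dif_pos hi] at e
  have e' := congrArg (fun f => f y) e
  set v := inc G M c' (p := p - 1)
    ⟨I.1.erase i, card_erase_eq (sub_add_cancel p 1) I hi⟩ q n' (by omega)
  refine ⟨(p.negOnePow : ℤ) • contractSign i I.1 •
    (G.map (eqToHom (congrArg M.obj (GrObj.wt_erase_act hi hd)))).f q y, e'.trans ?_, fun h0 => ?_⟩
  · exact ((map_zsmul v.hom _ _).trans (congrArg _ (map_zsmul v.hom _ _))).symm
  · have h2 : contractSign i I.1 * contractSign i I.1 = 1 := by
      unfold contractSign
      rw [← mul_pow]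
      norm_num
    exact eq_zero_of_map_eqToHom G M (GrObj.wt_erase_act hi hd) q y (eq_zero_of_zsmul_eq_zero h2
      (eq_zero_of_zsmul_eq_zero (Int.units_coe_mul_self _) h0))

theorem actList_inc (l : List ι) (hl : l.Nodup) : ∀ (c c' : A) {p : ℤ} (I : SubsetsOfCard ι p)
    (_ : ∀ i ∈ l, i ∈ I.1) (q : ℕ) (n n' : ℤ) (h : p - q = n)
    (hc : c' + (l.map deg).sum = c) (hn : n' + (l.length : ℕ) = n)
    (y : (G.obj (M.obj (c - ∑ l ∈ I.1, deg l))).X q),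
    ∃ (p' : ℤ) (I' : SubsetsOfCard ι p') (h' : p' - q = n')
      (y' : (G.obj (M.obj (c' - ∑ l ∈ I'.1, deg l))).X q),
      (dm G M).actList l hc hn (inc G M c I q n h y) = inc G M c' I' q n' h' y' ∧
        (y' = 0 → y = 0) := by
  induction l with
  | nil =>
    intro c c' p I _ q n n' h hc hn y
    obtain rfl : c' = c := by simpa using hc
    obtain rfl : n' = n := by simpa using hn
    exact ⟨p, I, h, y, rfl, id⟩
  | cons i l ih =>
    intro c c' p I hI q n n' h hc hn y
    have hi : i ∈ I.1 := hI i (by simp)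
    have e3 : c' + (l.map deg).sum + deg i = c := by rw [← hc]; simp; abel
    have e4 : n' + (l.length : ℕ) + 1 = n := by rw [← hn]; simp; ring
    obtain ⟨z, hz, hz'⟩ := act_inc_apply G M e3 I hi q n _ e4 h y
    let f := (dm G M).actList l (a := c' + (l.map deg).sum) (b := c') rfl
      (j := n' + (l.length : ℕ)) (j' := n') rfl
    obtain ⟨hl1, hl2⟩ := List.nodup_cons.1 hl
    obtain ⟨p', I', h', y', hy, hy'⟩ := ih hl2 (c' + (l.map deg).sum) c' (p := p - 1)
      ⟨I.1.erase i, card_erase_eq (sub_add_cancel p 1) I hi⟩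
      (fun j hj => Finset.mem_erase.2 ⟨fun e => hl1 (e ▸ hj), hI j (by simp [hj])⟩) q
      (n' + (l.length : ℕ)) n' (by omega) rfl rfl z
    change f _ = _ at hy
    refine ⟨p', I', h', y', ?_, fun h0 => hz' (hy' h0)⟩
    refine (congrArg (fun f => f (inc G M c I q n h y))
      ((dm G M).actList_cons i l hc hn e3 rfl e4 rfl)).trans (Eq.trans ?_ hy)
    exact congrArg f hz

theorem socleProperty : (dm G M).SocleProperty := by
  intro a b j j' h hj x hx
  have hl : (DM.sorted (Finset.univ : Finset ι)).length = Fintype.card ι := by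
    rw [Finset.length_sort, Finset.card_univ]
  have hrad : ∀ y ∈ (dm G M).rad a j, (dm G M).actList (DM.sorted Finset.univ) h hj y = 0 := by
    intro y hy
    have := (dm G M).actList_rad_mem_radPow hl h hj hy
    rwa [(dm G M).radPow_eq_bot (Nat.lt_succ_self _), Submodule.mem_bot] at this
  have hproper : ∀ {p : ℤ} (I : SubsetsOfCard ι p) (q : ℕ) (hpq : p - q = j) y,
      I.1 ≠ Finset.univ → inc G M a I q j hpq y ∈ (dm G M).rad a j := by
    intro p I q hpq y hI
    obtain ⟨i, hi⟩ : ∃ i, i ∉ I.1 := by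
      by_contra hcon
      push Not at hcon
      exact hI (Finset.eq_univ_iff_forall.2 hcon)
    refine inc_mem_rad G M a I (p := p + 1) ⟨insert i I.1, ?_⟩ (Finset.mem_insert_self _ _) rfl
      (Finset.erase_insert hi).symm q j hpq y
    rw [Finset.card_insert_of_notMem hi]
    push_cast
    rw [I.2]
  by_cases hq : ∃ q : ℕ, (Fintype.card ι : ℤ) - q = j
  · obtain ⟨q, hq⟩ := hq
    let U : SubsetsOfCard ι (Fintype.card ι : ℤ) := ⟨Finset.univ, by rw [Finset.card_univ]⟩
    have hS : x ∈ (dm G M).rad a j ⊔ LinearMap.range (inc G M a U q j hq).hom := by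
      refine mem_of_inc _ (fun p I q' hpq y => ?_) x
      by_cases hI : I.1 = Finset.univ
      · obtain rfl : p = (Fintype.card ι : ℤ) := by rw [← I.2, hI, Finset.card_univ]
        obtain rfl : q' = q := by omega
        obtain rfl : I = U := Subtype.ext hI
        exact Submodule.mem_sup_right ⟨y, rfl⟩
      · exact Submodule.mem_sup_left (hproper I q' hpq y hI)
    obtain ⟨r, hr, _, ⟨y, rfl⟩, rfl⟩ := Submodule.mem_sup.1 hS
    rw [map_add, hrad r hr, zero_add] at hx
    obtain ⟨p', I', h', y', e, hy⟩ := actList_inc G M (DM.sorted Finset.univ)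
      (Finset.sort_nodup _ _) a b U (fun i _ => Finset.mem_univ i) q j j' hq h hj y
    have hy' : y = 0 := hy (inc_injective G M b I' q j' h' y' (e.symm.trans hx))
    subst hy'
    rw [map_zero, add_zero]
    exact hr
  · refine mem_of_inc _ (fun p I q' hpq y => hproper I q' hpq y fun hI => hq ⟨q', ?_⟩) x
    rw [← Finset.card_univ, ← hI, I.2, hpq]

/-- The totalization of a Koszul complex has a minimal free model. -/
theorem exists_minimal_free_model : ∃ T : DM deg (ModuleCat.{u} k), T.IsFree ∧ T.IsMinimal ∧
    Nonempty (DM.HtpyEquiv T (dm G M)) := by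
  obtain ⟨s⟩ := exists_splitting G M
  exact DM.exists_minimal_model s (socleProperty G M)

end KoszulTotal

end ToricBGG

namespace ToricBGG

namespace DM

variable {ι A : Type} [AddCommGroup A] {deg : ι → A} {V : Type*} [Category V] [Preadditive V]

theorem Htpy.eq_add {D D' : DM deg V} {φ ψ : D ⟶ D'} (h : Htpy φ ψ) (a : A) (j j' m : ℤ)
    (hj : j' + 1 = j) (hm : j + 1 = m) : (φ.f a).f j =
      (D.cx a).d j j' ≫ (h.htpy a).hom j' j + (h.htpy a).hom j m ≫ (D'.cx a).d m j +
        (ψ.f a).f j := by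
  have := (h.htpy a).comm j
  rwa [dNext_eq (i := j) (i' := j') _ hj, prevD_eq (j := j) (j' := m) _ hm] at this

end DM

namespace CoxData

variable {ι A P : Type} [Fintype ι] [DecidableEq ι] [AddCommGroup A] [SemilatticeInf P]
  (X : CoxData ι A P) {k : Type u} [Field k]

variable {X} in
/-- The truncation of a homotopy. -/
def truncHtpy {D D' : DM X.deg (ModuleCat.{u} k)} {φ ψ : D ⟶ D'} (h : DM.Htpy φ ψ) :
    DM.Htpy ((X.trunc k).map φ) ((X.trunc k).map ψ) where
  htpy a :=
    { hom := fun j j' => X.truncMap id ((h.htpy a).hom j j')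
      zero := fun j j' hj => congrArg (X.truncMap id) ((h.htpy a).zero j j' hj)
      comm := fun j => congrArg (X.truncMap id) ((h.htpy a).comm j) }
  comm i _ _ hd j j' hj := congrArg (X.truncMap (X.neg_mem_Eff hd)) (h.comm i hd j j' hj)

section

variable {D D' : DM X.deg (ModuleCat.{u} k)} {φ ψ : D ⟶ D'} (h : DM.Htpy φ ψ)

/-- The map of degree one between the complexes `LL(D)` and `LL(D')` induced by a homotopy. -/
def llHtpy (j j' : ℤ) : llObj D j ⟶ llObj D' j' :=
  Sigma.desc fun a => -((X.freeS k a).map ((h.htpy a).hom j j') ≫ llIncl D' j' a)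

theorem llIncl_htpy (j j' : ℤ) (a : A) : llIncl D j a ≫ X.llHtpy h j j' =
    -((X.freeS k a).map ((h.htpy a).hom j j') ≫ llIncl D' j' a) :=
  Sigma.ι_desc _ _

theorem llMul_htpy (i : ι) {a b : A} (hd : b + X.deg i = a) (j j' m m' : ℤ) (hj : j' + 1 = j)
    (hm : j + 1 = m) (hm' : j' + 1 = m') :
    llMul D i hd j j' hj ≫ (X.freeS k b).map ((h.htpy b).hom j' m') =
      -((X.freeS k a).map ((h.htpy a).hom j m) ≫ llMul D' i hd m m' (by omega)) := by
  subst hm hm'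
  unfold llMul
  rw [Category.assoc, ← Functor.map_comp, NatTrans.naturality_assoc, ← Functor.map_comp,
    ← Preadditive.comp_neg, ← Functor.map_neg]
  congr 2
  simp [DM.leftAct, h.comm i hd j j' hj, Int.negOnePow_succ]

theorem llHtpy_comm (j j' m : ℤ) (hj : j' + 1 = j) (hm : j + 1 = m) :
    llMap φ j = llD D j j' hj ≫ X.llHtpy h j' j + X.llHtpy h j m ≫ llD D' m j hm + llMap ψ j := by
  refine ll_hom_ext fun a => ?_
  rw [Preadditive.comp_add, Preadditive.comp_add, llIncl_map, llIncl_map, ← Category.assoc,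
    ← Category.assoc, llIncl_d, llIncl_htpy, Preadditive.sub_comp, Preadditive.neg_comp,
    Category.assoc, Category.assoc, llIncl_d, llIncl_htpy, Preadditive.comp_sub,
    Preadditive.comp_sum, Preadditive.sum_comp]
  have e : ∀ i, (llMul D i (sub_add_cancel a (X.deg i)) j j' hj ≫ llIncl D j' (a - X.deg i)) ≫
      X.llHtpy h j' j = (X.freeS k a).map ((h.htpy a).hom j m) ≫
        llMul D' i (sub_add_cancel a (X.deg i)) m j hm ≫ llIncl D' j (a - X.deg i) := by
    intro i
    rw [Category.assoc, llIncl_htpy, Preadditive.comp_neg, ← Category.assoc,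
      X.llMul_htpy h i _ j j' m j hj hm hj, Preadditive.neg_comp, neg_neg, Category.assoc]
  rw [Finset.sum_congr rfl fun i _ => e i, Preadditive.comp_neg, ← Category.assoc,
    ← Category.assoc, ← Functor.map_comp, ← Functor.map_comp, h.eq_add a j j' m hj hm,
    Functor.map_add, Functor.map_add, Preadditive.add_comp, Preadditive.add_comp]
  abel

/-- The functor `LL` preserves homotopies. -/
def mapHtpyLL : Homotopy ((X.LL k).map φ) ((X.LL k).map ψ) where
  hom := X.llHtpy h
  zero j j' hj := ll_hom_ext fun a => by
    refine Eq.trans ?_ comp_zero.symm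
    rw [llIncl_htpy, (h.htpy a).zero j j' hj, Functor.map_zero, zero_comp, neg_zero]
  comm j := by
    let H : ∀ i j, ((X.LL k).obj D).X i ⟶ ((X.LL k).obj D').X j := X.llHtpy h
    change _ = dNext j H + prevD j H + _
    rw [dNext_eq (i := j) (i' := j - 1) _ (sub_add_cancel j 1),
      prevD_eq (j := j) (j' := j + 1) _ rfl]
    refine (X.llHtpy_comm h j (j - 1) (j + 1) (sub_add_cancel j 1) rfl).trans ?_
    rw [← llDiff_eq, ← llDiff_eq]
    rfl

end

/-- The functor `U` preserves homotopies. -/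
def mapHtpyU {D D' : DM X.deg (ModuleCat.{u} k)} {φ ψ : D ⟶ D'} (h : DM.Htpy φ ψ) :
    Homotopy ((X.functorU k).map φ) ((X.functorU k).map ψ) :=
  (X.sheafify k).mapHomotopy (X.mapHtpyLL (truncHtpy h))

/-- The functor `U` sends homotopy equivalences to homotopy equivalences. -/
def mapHtpyEquivU {D D' : DM X.deg (ModuleCat.{u} k)} (e : DM.HtpyEquiv D D') :
    HomotopyEquiv ((X.functorU k).obj D) ((X.functorU k).obj D') where
  hom := (X.functorU k).map e.hom
  inv := (X.functorU k).map e.inv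
  homotopyHomInvId := (Homotopy.ofEq ((X.functorU k).map_comp _ _).symm).trans
    ((X.mapHtpyU e.homInv).trans (Homotopy.ofEq ((X.functorU k).map_id _)))
  homotopyInvHomId := (Homotopy.ofEq ((X.functorU k).map_comp _ _).symm).trans
    ((X.mapHtpyU e.invHom).trans (Homotopy.ofEq ((X.functorU k).map_id _)))

theorem quasiIso_map_functorU {D D' : DM X.deg (ModuleCat.{u} k)} (e : DM.HtpyEquiv D D') :
    QuasiIso ((X.functorU k).map e.hom) := (X.mapHtpyEquivU e).quasiIso_hom

end CoxData

namespace CoxData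

variable {ι A P : Type} [Fintype ι] [LinearOrder ι] [AddCommGroup A] [SemilatticeInf P]
  (X : CoxData ι A P) {k : Type u} [Field k]

theorem nonempty_tateResolution {K : Type} [Finite K] (c : K → P) (F : X.Mod k) :
    Nonempty (X.TateResolution c F) := by
  obtain ⟨T, h1, h2, ⟨e⟩⟩ := KoszulTotal.exists_minimal_free_model (X.atDegree k 0 ⋙ cech c)
    ((X.twists k).obj F)
  exact ⟨⟨T, h1, h2, e⟩⟩

end CoxData

end ToricBGG

namespace ToricBGG

section

variable {k : Type u} [Field k]

theorem sum_hom_apply {M M' : ModuleCat.{u} k} {J : Type*} (s : Finset J) (f : J → (M ⟶ M'))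
    (x : M) : (∑ i ∈ s, f i) x = ∑ i ∈ s, f i x := by
  change (∑ i ∈ s, f i).hom x = _
  rw [ModuleCat.hom_sum, LinearMap.sum_apply]

/-- An elementwise form of the condition that a map of complexes is a quasi-isomorphism. -/
def ElemQuasiIso {C D : ChainComplex (ModuleCat.{u} k) ℤ} (φ : C ⟶ D) : Prop :=
  ∀ (j j' j'' : ℤ) (_ : j' + 1 = j) (_ : j'' + 1 = j') (x : C.X j') (y : D.X j),
    C.d j' j'' x = 0 → φ.f j' x = D.d j j' y →
      ∃ (w : C.X j) (v : D.X (j + 1)), C.d j j' w = x ∧ y - φ.f j w = D.d (j + 1) j v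

theorem ElemQuasiIso.quasiIso {C D : ChainComplex (ModuleCat.{u} k) ℤ} {φ : C ⟶ D}
    (h : ElemQuasiIso φ) : QuasiIso φ := by
  refine ⟨fun j => ?_⟩
  rw [quasiIsoAt_iff_isIso_homologyMap, ConcreteCategory.isIso_iff_bijective]
  have hπ : ∀ (E : ChainComplex (ModuleCat.{u} k) ℤ),
      Function.Surjective (E.homologyπ j) := fun E =>
    (ModuleCat.epi_iff_surjective _).1 inferInstance
  have hi : ∀ (E : ChainComplex (ModuleCat.{u} k) ℤ),
      Function.Injective (E.iCycles j) := fun E =>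
    (ModuleCat.mono_iff_injective _).1 inferInstance
  have hprev : (ComplexShape.down ℤ).prev j = j + 1 := by simp
  have hnext : (ComplexShape.down ℤ).next j = j - 1 := by simp
  have htc : ∀ (E : ChainComplex (ModuleCat.{u} k) ℤ) (v : E.X (j + 1)),
      E.iCycles j (E.toCycles (j + 1) j v) = E.d (j + 1) j v := fun E v =>
    congrArg (fun f => f v) (E.toCycles_i (j + 1) j)
  have htπ : ∀ (E : ChainComplex (ModuleCat.{u} k) ℤ) (v : E.X (j + 1)),
      E.homologyπ j (E.toCycles (j + 1) j v) = 0 := fun E v =>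
    congrArg (fun f => f v) (E.toCycles_comp_homologyπ (j + 1) j)
  have hdi : ∀ (E : ChainComplex (ModuleCat.{u} k) ℤ) (z : E.cycles j) (m : ℤ),
      E.d j m (E.iCycles j z) = 0 := fun E z m =>
    congrArg (fun f => f z) (E.iCycles_d j m)
  have hci : ∀ z : C.cycles j, D.iCycles j (HomologicalComplex.cyclesMap φ j z) =
      φ.f j (C.iCycles j z) := fun z =>
    congrArg (fun f => f z) (HomologicalComplex.cyclesMap_i φ j)
  have hπn : ∀ z : C.cycles j, HomologicalComplex.homologyMap φ j (C.homologyπ j z) =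
      D.homologyπ j (HomologicalComplex.cyclesMap φ j z) := fun z =>
    congrArg (fun f => f z) (HomologicalComplex.homologyπ_naturality φ j)
  constructor
  · rw [injective_iff_map_eq_zero]
    intro x hx
    obtain ⟨z, rfl⟩ := hπ C x
    rw [hπn] at hx
    have hex : ∃ v : D.X (j + 1), D.toCycles (j + 1) j v =
        HomologicalComplex.cyclesMap φ j z := by
      have h1 := ShortComplex.exact_of_g_is_cokernel
        (ShortComplex.mk _ _ (D.toCycles_comp_homologyπ (j + 1) j))
        (D.homologyIsCokernel (j + 1) j hprev)
      exact (ShortComplex.moduleCat_exact_iff _).1 h1 _ hx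
    obtain ⟨v, hv⟩ := hex
    obtain ⟨w, -, hw, -⟩ := h (j + 1) j (j - 1) rfl (sub_add_cancel j 1) (C.iCycles j z) v
      (hdi C z _) (by rw [← hci, ← hv, htc])
    have : C.toCycles (j + 1) j w = z := hi C (by rw [htc, hw])
    rw [← this, htπ]
  · intro y
    obtain ⟨z, rfl⟩ := hπ D y
    obtain ⟨w, v, hw, hv⟩ := h j (j - 1) (j - 1 - 1) (sub_add_cancel j 1) (sub_add_cancel _ 1) 0
      (D.iCycles j z) (map_zero _) ((map_zero _).trans (hdi D z _).symm)
    let c := C.liftCycles (ModuleCat.ofHom (LinearMap.toSpanSingleton k _ w)) (j - 1) hnext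
      (by
        ext
        change C.d j (j - 1) ((1 : k) • w) = 0
        rw [one_smul, hw])
    have hc : C.iCycles j (c 1) = w := by
      have := congrArg (fun f => f (1 : k)) (C.liftCycles_i
        (ModuleCat.ofHom (LinearMap.toSpanSingleton k _ w)) (j - 1) hnext (by
        ext
        change C.d j (j - 1) ((1 : k) • w) = 0
        rw [one_smul, hw]))
      exact this.trans (one_smul k w)
    refine ⟨C.homologyπ j (c 1), ?_⟩
    have e : z = HomologicalComplex.cyclesMap φ j (c 1) + D.toCycles (j + 1) j v :=
      hi D (by rw [map_add, hci, hc, htc, ← hv]; abel)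
    rw [hπn]
    conv_rhs => rw [e]
    rw [map_add, htπ, add_zero]

end

section

variable {V : Type*} [Category V] [Preadditive V] [HasCountableCoproducts V]

theorem totProj_d (L : Bicomplex V) (p p' : ℤ) (q q' : ℕ) (n n' : ℤ) (hp : p' + 1 = p)
    (hq : q + 1 = q') (hn : n' + 1 = n) (h : p - q' = n) :
    (tot L).d n n' ≫ totProj L p' q' n' =
      (-1 : ℤ) ^ q' • totProj L p q' n ≫ (L.d p p').f q' +
        totProj L p' q n ≫ (L.X p').d q q' := by
  subst hq
  refine totInc_hom_ext L fun r s hrs => ?_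
  rw [← Category.assoc, totInc_d L _ n n' hrs (sub_add_cancel r 1) hn, Preadditive.add_comp,
    Preadditive.zsmul_comp, Preadditive.comp_add, Preadditive.comp_zsmul, ← Category.assoc,
    ← Category.assoc, Category.id_comp, Category.id_comp]
  congr 1
  · by_cases hr : r = p
    · subst hr
      obtain rfl : p' = r - 1 := by omega
      obtain rfl : s = q + 1 := by omega
      rw [totInc_totProj, totInc_totProj, Category.id_comp]
    · rw [totInc_totProj_ne _ _ _ _ (by omega), totInc_totProj_ne _ _ _ _ (by omega), zero_comp,
        smul_zero, smul_zero]
  · by_cases hr : r = p'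
    · subst hr
      obtain rfl : s = q := by omega
      rw [totInc_totProj, totInc_totProj, Category.id_comp]
    · rw [totInc_totProj_ne _ _ _ _ (by omega), totInc_totProj_ne _ _ _ _ (by omega), zero_comp]

theorem totProj_d_zero (L : Bicomplex V) (p p' : ℤ) (n n' : ℤ) (hp : p' + 1 = p)
    (hn : n' + 1 = n) (h : p - (0 : ℕ) = n) :
    (tot L).d n n' ≫ totProj L p' 0 n' = totProj L p 0 n ≫ (L.d p p').f 0 := by
  refine totInc_hom_ext L fun r s hrs => ?_
  rw [← Category.assoc, totInc_d L _ n n' hrs (sub_add_cancel r 1) hn, Preadditive.add_comp,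
    Preadditive.zsmul_comp, ← Category.assoc,
    Category.id_comp, Category.id_comp]
  rw [totInc_totProj_ne L ((L.X r).d s (s + 1)) n' (by push_cast; omega)
    (fun h => Nat.succ_ne_zero s h.2), add_zero]
  by_cases hr : r = p
  · subst hr
    obtain rfl : p' = r - 1 := by omega
    obtain rfl : s = 0 := by omega
    rw [totInc_totProj, totInc_totProj, Category.id_comp, pow_zero, one_smul]
  · rw [totInc_totProj_ne _ _ _ _ (by omega), totInc_totProj_ne _ _ _ _ (by omega), zero_comp,
      smul_zero]

theorem totProj_map {L L' : Bicomplex V} (f : L ⟶ L') (p : ℤ) (q : ℕ) (n : ℤ) :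
    (HomologicalComplex₂.total.map f (ComplexShape.down ℤ)).f n ≫ totProj L' p q n =
      totProj L p q n ≫ (f.f p).f q := by
  refine totInc_hom_ext L fun r s hrs => ?_
  rw [← Category.assoc, totInc_map, ← Category.assoc, Category.id_comp]
  by_cases hr : r = p ∧ s = q
  · obtain ⟨rfl, rfl⟩ := hr
    rw [totInc_totProj, totInc_totProj, Category.id_comp]
  · rw [totInc_totProj_ne _ _ _ _ hr, totInc_totProj_ne _ _ _ _ hr, zero_comp]

end

section

variable {V : Type*} [Category V] [Preadditive V] [HasCountableCoproducts V] {k : Type u} [Field k]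
  (E : V ⥤ ModuleCat.{u} k) [E.Additive]

/-- The component of an element of a total complex. -/
def totComp (L : Bicomplex V) (n : ℤ) (q : ℕ) (x : E.obj ((tot L).X n)) :
    E.obj ((L.X (n + q)).X q) := E.map (totProj L (n + q) q n) x

theorem totComp_sub (L : Bicomplex V) (n : ℤ) (q : ℕ) (x y : E.obj ((tot L).X n)) :
    totComp E L n q (x - y) = totComp E L n q x - totComp E L n q y := map_sub _ _ _

theorem totComp_zero (L : Bicomplex V) (n : ℤ) (q : ℕ) :
    totComp E L n q 0 = 0 := map_zero _

theorem totComp_eq_zero (L : Bicomplex V) (N : ℕ)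
    (hN : ∀ (p : ℤ) (q : ℕ), (p < 0 ∨ (N : ℤ) < p) → IsZero ((L.X p).X q)) (n : ℤ)
    (x : E.obj ((tot L).X n)) (hx : ∀ q, totComp E L n q x = 0) : x = 0 := by
  have e1 : ∀ f : (tot L).X n ⟶ (tot L).X n, f = 𝟙 _ → E.map f x = x := by
    rintro _ rfl
    rw [E.map_id]
    rfl
  have e := e1 _ (totProj_ι L N hN n)
  rw [E.map_sum, sum_hom_apply] at e
  rw [← e]
  refine Finset.sum_eq_zero fun p _ => ?_
  rw [E.map_comp]
  by_cases hp : (p : ℤ) - ((p : ℤ) - n).toNat = n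
  · have h1 : E.map (totProj L p ((p : ℤ) - n).toNat n) x = 0 := by
      have := hx ((p : ℤ) - n).toNat
      unfold totComp at this
      have h2 : n + ((p : ℤ) - n).toNat = p := by omega
      rw [h2] at this
      exact this
    have h3 := congrArg (E.map (L.ιTotalOrZero (ComplexShape.down ℤ) p ((p : ℤ) - n).toNat n)) h1
    exact h3.trans (map_zero _)
  · rw [HomologicalComplex₂.ιTotalOrZero_eq_zero _ _ _ _ _ hp, E.map_zero, comp_zero]
    rfl

theorem totComp_d (L : Bicomplex V) (n n' : ℤ) (hn : n' + 1 = n) (q : ℕ)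
    (x : E.obj ((tot L).X n)) (hx : ∀ q' < q, totComp E L n q' x = 0) :
    totComp E L n' q (E.map ((tot L).d n n') x) =
      (-1 : ℤ) ^ q • E.map ((L.d (n + q) (n' + q)).f q) (totComp E L n q x) := by
  unfold totComp
  cases q with
  | zero =>
    have e := congrArg (fun f => E.map f x) (totProj_d_zero L (n + (0 : ℕ)) (n' + (0 : ℕ)) n n'
      (by rw [← hn]; ring) hn (by simp))
    simp only [E.map_comp] at e
    rw [pow_zero, one_smul]
    exact e
  | succ q =>
    have e := congrArg (fun f => E.map f x) (totProj_d L (n + (q + 1 : ℕ)) (n' + (q + 1 : ℕ)) q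
      (q + 1) n n' (by rw [← hn]; ring) rfl hn (by simp))
    simp only [E.map_comp, E.map_add, E.map_zsmul] at e
    refine e.trans ?_
    have h0 : E.map (totProj L (n' + (q + 1 : ℕ)) q n) x = 0 := by
      have := hx q (Nat.lt_succ_self q)
      unfold totComp at this
      rw [show n' + ((q + 1 : ℕ) : ℤ) = n + q by rw [← hn]; push_cast; ring]
      exact this
    have h1 : E.map ((L.X (n' + (q + 1 : ℕ))).d q (q + 1))
        (E.map (totProj L (n' + (q + 1 : ℕ)) q n) x) = 0 := (congrArg _ h0).trans (map_zero _)
    exact (congrArg (_ + ·) h1).trans (add_zero _)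

theorem totComp_d_eq_zero (L : Bicomplex V) (n n' : ℤ) (hn : n' + 1 = n) (q : ℕ)
    (x : E.obj ((tot L).X n)) (hx : ∀ q' ≤ q, totComp E L n q' x = 0) :
    totComp E L n' q (E.map ((tot L).d n n') x) = 0 := by
  rw [totComp_d E L n n' hn q x fun q' h => hx q' h.le, hx q le_rfl]
  exact (congrArg _ (map_zero _)).trans (smul_zero _)

theorem totComp_map {L L' : Bicomplex V} (f : L ⟶ L') (n : ℤ) (q : ℕ) (x : E.obj ((tot L).X n)) :
    totComp E L' n q (E.map ((HomologicalComplex₂.total.map f (ComplexShape.down ℤ)).f n) x) =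
      E.map ((f.f (n + q)).f q) (totComp E L n q x) := by
  have e := congrArg (fun f => E.map f x) (totProj_map f (n + q) q n)
  simp only [E.map_comp] at e
  exact e

/-- The inclusion of a component in a total complex. -/
def totIn (L : Bicomplex V) (n : ℤ) (q : ℕ) (x : E.obj ((L.X (n + q)).X q)) :
    E.obj ((tot L).X n) := E.map (totInc L (𝟙 _) n (by ring)) x

theorem totComp_totIn (L : Bicomplex V) (n : ℤ) (q : ℕ) (x : E.obj ((L.X (n + q)).X q)) :
    totComp E L n q (totIn E L n q x) = x := by
  have e := congrArg (fun f => E.map f x) (totInc_totProj L (𝟙 ((L.X (n + q)).X q)) n (by ring))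
  simp only [E.map_comp, E.map_id] at e
  exact e

theorem totComp_totIn_ne (L : Bicomplex V) (n : ℤ) {q q' : ℕ} (h : q' ≠ q)
    (x : E.obj ((L.X (n + q)).X q)) : totComp E L n q' (totIn E L n q x) = 0 := by
  have e := congrArg (fun f => E.map f x) (totInc_totProj_ne L (p := n + q') (q := q')
    (𝟙 ((L.X (n + q)).X q)) n (by ring) (fun h' => h h'.2.symm))
  simp only [E.map_comp, E.map_zero] at e
  exact e

/-- A map of bicomplexes with bounded rows that is a quasi-isomorphism on the rows induces a
quasi-isomorphism of total complexes. -/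
theorem elemQuasiIso_total {L L' : Bicomplex V} (f : L ⟶ L') (N : ℕ)
    (hN : ∀ (p : ℤ) (q : ℕ), (p < 0 ∨ (N : ℤ) < p) → IsZero ((L.X p).X q))
    (hN' : ∀ (p : ℤ) (q : ℕ), (p < 0 ∨ (N : ℤ) < p) → IsZero ((L'.X p).X q))
    (H : ∀ (q : ℕ) (p p' p'' : ℤ) (_ : p' + 1 = p) (_ : p'' + 1 = p')
      (x : E.obj ((L.X p').X q)) (y : E.obj ((L'.X p).X q)), E.map ((L.d p' p'').f q) x = 0 →
      E.map ((f.f p').f q) x = E.map ((L'.d p p').f q) y →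
      ∃ (w : E.obj ((L.X p).X q)) (v : E.obj ((L'.X (p + 1)).X q)),
        E.map ((L.d p p').f q) w = x ∧
          y - E.map ((f.f p).f q) w = E.map ((L'.d (p + 1) p).f q) v) :
    ElemQuasiIso ((E.mapHomologicalComplex _).map
      (HomologicalComplex₂.total.map f (ComplexShape.down ℤ))) := by
  intro n n' n'' hn hn' x y hx hy
  let φ := HomologicalComplex₂.total.map f (ComplexShape.down ℤ)
  obtain ⟨x, rfl⟩ : ∃ x' : E.obj ((tot L).X n'), x' = x := ⟨x, rfl⟩
  obtain ⟨y, rfl⟩ : ∃ y' : E.obj ((tot L').X n), y' = y := ⟨y, rfl⟩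
  change E.map ((tot L).d n' n'') x = 0 at hx
  change E.map (φ.f n') x = E.map ((tot L').d n n') y at hy
  change ∃ (w : E.obj ((tot L).X n)) (v : E.obj ((tot L').X (n + 1))),
    E.map ((tot L).d n n') w = x ∧ y - E.map (φ.f n) w = E.map ((tot L').d (n + 1) n) v
  have hdd : ∀ (M : Bicomplex V) (a b c : ℤ) (z : E.obj ((tot M).X a)),
      E.map ((tot M).d b c) (E.map ((tot M).d a b) z) = 0 := by
    intro M a b c z
    have e := congrArg (fun f => E.map f z) ((tot M).d_comp_d a b c)
    simp only [E.map_comp, E.map_zero] at e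
    exact e
  have hφd : ∀ (a b : ℤ) (z : E.obj ((tot L).X a)),
      E.map (φ.f b) (E.map ((tot L).d a b) z) = E.map ((tot L').d a b) (E.map (φ.f a) z) := by
    intro a b z
    have e := congrArg (fun f => E.map f z) (φ.comm a b)
    simp only [E.map_comp] at e
    exact e.symm
  have key : ∀ (m : ℕ) (q : ℕ) (_ : (N : ℤ) < n' + (q + m : ℕ)) (x : E.obj ((tot L).X n'))
      (y : E.obj ((tot L').X n)) (_ : ∀ q' < q, totComp E L n' q' x = 0)
      (_ : ∀ q' < q, totComp E L' n q' y = 0) (_ : E.map ((tot L).d n' n'') x = 0)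
      (_ : E.map (φ.f n') x = E.map ((tot L').d n n') y),
      ∃ (w : E.obj ((tot L).X n)) (v : E.obj ((tot L').X (n + 1))),
        E.map ((tot L).d n n') w = x ∧ y - E.map (φ.f n) w = E.map ((tot L').d (n + 1) n) v := by
    intro m
    induction m with
    | zero =>
      intro q hq x y hx0 hy0 _ _
      have hx' : x = 0 := by
        refine totComp_eq_zero E L N hN n' x fun q' => ?_
        by_cases h : q' < q
        · exact hx0 q' h
        · have : Subsingleton (E.obj ((L.X (n' + q')).X q')) :=
            ModuleCat.subsingleton_of_isZero (E.map_isZero (hN _ _ (Or.inr (by omega))))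
          exact Subsingleton.elim _ _
      have hy' : y = 0 := by
        refine totComp_eq_zero E L' N hN' n y fun q' => ?_
        by_cases h : q' < q
        · exact hy0 q' h
        · have : Subsingleton (E.obj ((L'.X (n + q')).X q')) :=
            ModuleCat.subsingleton_of_isZero (E.map_isZero (hN' _ _ (Or.inr (by omega))))
          exact Subsingleton.elim _ _
      refine ⟨0, 0, ?_, ?_⟩
      · rw [hx', map_zero]
      · rw [hy', map_zero, map_zero, sub_zero]
    | succ m ih =>
      intro q hq x y hx0 hy0 hx hy
      have hε : ∀ {W : Type u} [AddCommGroup W] (w : W), (-1 : ℤ) ^ q • (-1 : ℤ) ^ q • w = w := by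
        intro W _ w
        rw [smul_smul, ← mul_pow]
        simp
      have h1 : E.map ((L.d (n' + q) (n'' + q)).f q) (totComp E L n' q x) = 0 := by
        have e := totComp_d E L n' n'' hn' q x hx0
        rw [hx, totComp_zero] at e
        rw [← hε (E.map ((L.d (n' + q) (n'' + q)).f q) (totComp E L n' q x)), ← e, smul_zero]
      have h2 : E.map ((f.f (n' + q)).f q) (totComp E L n' q x) =
          E.map ((L'.d (n + q) (n' + q)).f q) ((-1 : ℤ) ^ q • totComp E L' n q y) := by
        rw [map_zsmul, ← totComp_map, ← totComp_d E L' n n' hn q y hy0, ← hy]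
      obtain ⟨w, v, hw, hv⟩ := H q (n + q) (n' + q) (n'' + q) (by rw [← hn]; ring)
        (by rw [← hn']; ring) _ _ h1 h2
      let w' := totIn E L n q ((-1 : ℤ) ^ q • w)
      obtain ⟨v, rfl⟩ : ∃ v' : E.obj ((L'.X (n + 1 + q)).X q), v =
          E.map (eqToHom (by rw [add_right_comm])) v' :=
        ⟨E.map (eqToHom (by rw [add_right_comm])) v, by
          have : ∀ {A B : V} (e : A = B) (e' : B = A) (z : E.obj A),
              E.map (eqToHom e') (E.map (eqToHom e) z) = z := by
            rintro A _ rfl _ z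
            simp
          exact (this _ _ _).symm⟩
      have hv' : E.map ((L'.d (n + q + 1) (n + q)).f q) (E.map (eqToHom (by rw [add_right_comm])) v)
          = E.map ((L'.d (n + 1 + q) (n + q)).f q) v := by
        have : ∀ {a b : ℤ} (e : a = b) (e' : (L'.X a).X q = (L'.X b).X q)
            (z : E.obj ((L'.X a).X q)), E.map ((L'.d b (n + q)).f q) (E.map (eqToHom e') z) =
              E.map ((L'.d a (n + q)).f q) z := by
          rintro a _ rfl _ z
          simp
        exact this (add_right_comm n 1 q) _ v
      rw [hv'] at hv
      let v' := totIn E L' (n + 1) q v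
      have hw'0 : ∀ q' < q, totComp E L n q' w' = 0 := fun q' h => totComp_totIn_ne E L n h.ne _
      have hv'0 : ∀ q' < q, totComp E L' (n + 1) q' v' = 0 := fun q' h =>
        totComp_totIn_ne E L' _ h.ne _
      obtain ⟨w₁, v₁, hw₁, hv₁⟩ := ih (q + 1) (by rw [add_right_comm]; exact hq)
        (x - E.map ((tot L).d n n') w')
        (y - E.map (φ.f n) w' - E.map ((tot L').d (n + 1) n) v')
        (fun q' h => by
          rw [totComp_sub]
          rcases Nat.lt_succ_iff_lt_or_eq.1 h with h | rfl
          · rw [hx0 q' h, totComp_d_eq_zero E L n n' hn q' w' fun q'' h' => hw'0 q'' (by omega),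
              sub_zero]
          · rw [totComp_d E L n n' hn q' w' hw'0, totComp_totIn, map_zsmul, hw, hε, sub_self])
        (fun q' h => by
          rw [totComp_sub, totComp_sub, totComp_map]
          rcases Nat.lt_succ_iff_lt_or_eq.1 h with h | rfl
          · rw [hy0 q' h, hw'0 q' h, totComp_d_eq_zero E L' (n + 1) n rfl q' v'
              fun q'' h' => hv'0 q'' (by omega), map_zero, sub_zero, sub_zero]
          · rw [totComp_d E L' (n + 1) n rfl q' v' hv'0, totComp_totIn, totComp_totIn, ← hv,
              smul_sub, hε, map_zsmul]
            abel)
        (by rw [map_sub, hx, hdd, sub_zero])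
        (by rw [map_sub, map_sub, map_sub, hdd, hφd, hy, sub_zero])
      refine ⟨w' + w₁, v' + v₁, ?_, ?_⟩
      · rw [map_add, hw₁]
        abel
      · rw [map_add, map_add, ← hv₁]
        abel
  obtain ⟨m, hm⟩ : ∃ m : ℕ, (N : ℤ) < n' + (0 + m : ℕ) := ⟨((N : ℤ) + 1 - n').toNat, by omega⟩
  exact key m 0 hm x y (fun q h => absurd h (Nat.not_lt_zero q))
    (fun q h => absurd h (Nat.not_lt_zero q)) hx hy

end

end ToricBGG

namespace ToricBGG

section

variable {V : Type*} [Category V] {k : Type u} [Field k] (E : V ⥤ ModuleCat.{u} k) {J : Type*}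
  (H : J → V)

theorem map_sigma_hom_ext [HasCoproduct H] [PreservesColimit (Discrete.functor H) E]
    {Y : ModuleCat.{u} k} {f g : E.obj (∐ H) ⟶ Y}
    (h : ∀ j, E.map (Sigma.ι H j) ≫ f = E.map (Sigma.ι H j) ≫ g) : f = g :=
  (isColimitOfHasCoproductOfPreservesColimit E H).hom_ext fun ⟨j⟩ => h j

/-- The map out of the image of a coproduct under a functor that preserves it. -/
def mapSigmaDesc [HasCoproduct H] [PreservesColimit (Discrete.functor H) E]
    {Y : ModuleCat.{u} k} (f : ∀ j, E.obj (H j) ⟶ Y) : E.obj (∐ H) ⟶ Y :=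
  (isColimitOfHasCoproductOfPreservesColimit E H).desc (Cofan.mk Y f)

theorem map_ι_mapSigmaDesc [HasCoproduct H] [PreservesColimit (Discrete.functor H) E]
    {Y : ModuleCat.{u} k} (f : ∀ j, E.obj (H j) ⟶ Y) (j : J) :
    E.map (Sigma.ι H j) ≫ mapSigmaDesc E H f = f j :=
  (isColimitOfHasCoproductOfPreservesColimit E H).fac (Cofan.mk Y f) ⟨j⟩

theorem map_pi_hom_ext [HasProduct H] [PreservesLimit (Discrete.functor H) E]
    {Y : ModuleCat.{u} k} {f g : Y ⟶ E.obj (∏ᶜ H)}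
    (h : ∀ j, f ≫ E.map (Pi.π H j) = g ≫ E.map (Pi.π H j)) : f = g :=
  (isLimitOfHasProductOfPreservesLimit E H).hom_ext fun ⟨j⟩ => h j

theorem map_pi_ext [HasProduct H] [PreservesLimit (Discrete.functor H) E]
    {x y : E.obj (∏ᶜ H)} (h : ∀ j, E.map (Pi.π H j) x = E.map (Pi.π H j) y) : x = y := by
  have e : ModuleCat.ofHom (LinearMap.toSpanSingleton k _ x) =
      ModuleCat.ofHom (LinearMap.toSpanSingleton k _ y) := by
    refine map_pi_hom_ext E H fun j => ?_
    ext
    have e1 : ∀ v : E.obj (∏ᶜ H), E.map (Pi.π H j) ((1 : k) • v) = E.map (Pi.π H j) v := by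
      intro v
      rw [one_smul]
    exact (e1 x).trans ((h j).trans (e1 y).symm)
  have e2 := congrArg (fun f => f (1 : k)) e
  exact (one_smul k x).symm.trans (e2.trans (one_smul k y))

/-- The map into the image of a product under a functor that preserves it. -/
def mapPiLift [HasProduct H] [PreservesLimit (Discrete.functor H) E]
    {Y : ModuleCat.{u} k} (f : ∀ j, Y ⟶ E.obj (H j)) : Y ⟶ E.obj (∏ᶜ H) :=
  (isLimitOfHasProductOfPreservesLimit E H).lift (Limits.Fan.mk Y f)

theorem mapPiLift_π [HasProduct H] [PreservesLimit (Discrete.functor H) E]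
    {Y : ModuleCat.{u} k} (f : ∀ j, Y ⟶ E.obj (H j)) (j : J) :
    mapPiLift E H f ≫ E.map (Pi.π H j) = f j :=
  (isLimitOfHasProductOfPreservesLimit E H).fac (Limits.Fan.mk Y f) ⟨j⟩

/-- The element of the image of a product with given components. -/
def mapPiMk [HasProduct H] [PreservesLimit (Discrete.functor H) E] (x : ∀ j, E.obj (H j)) :
    E.obj (∏ᶜ H) :=
  mapPiLift E H (Y := ModuleCat.of k k)
    (fun j => ModuleCat.ofHom (LinearMap.toSpanSingleton k _ (x j))) (1 : k)

theorem π_mapPiMk [HasProduct H] [PreservesLimit (Discrete.functor H) E]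
    (x : ∀ j, E.obj (H j)) (j : J) : E.map (Pi.π H j) (mapPiMk E H x) = x j := by
  have e := congrArg (fun f => f (1 : k)) (mapPiLift_π E H (Y := ModuleCat.of k k)
    (fun j => ModuleCat.ofHom (LinearMap.toSpanSingleton k _ (x j))) j)
  exact e.trans (one_smul k (x j))

end

namespace CoxData

variable {ι A P : Type} [Fintype ι] [LinearOrder ι] [AddCommGroup A] [SemilatticeInf P]
  (X : CoxData ι A P) {k : Type u} [Field k] (F : X.Mod k)

/-- The terms of the complex `π₁^* F ⊗ ℛ`. -/
abbrev RObj (p : ℤ) : (X.prod X).Mod k :=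
  ((X.tensorR k).obj ((X.pullbackFst X k).obj F)).X p

/-- The sum of the degrees of the elements of a set. -/
abbrev wtSum (I : Finset ι) : A := ∑ l ∈ I, X.deg l

/-- The degree of a Laurent monomial. -/
abbrev wtExp (m : ι → ℤ) : A := ∑ i, m i • X.deg i

/-- The condition that there are summands `F(p) · x^m ⊗ y_I` of the sections of the sheaf
`RObj F p`, where `F(p)` is taken in degree `w`. -/
structure GenValid (z : (X.prod X).Loc) (p : ℤ) (I : Finset ι) (m : ι → ℤ) (w : A) : Prop where
  card : (I.card : ℤ) = p
  nonneg : ∀ i ∈ X.supp z.chart.2, 0 ≤ m i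
  eff : X.wtExp m - z.wt.2 ∈ X.Eff
  wt : w = 0 - X.wtSum I - (X.wtExp m - z.wt.2) + z.wt.1

/-- The inclusion `F(p) ⟶ π₁^* F`, `t ↦ t ⊗ x^m`. -/
def tensorMono (z : (X.prod X).Loc) (m : X.Monomial z.chart.2 z.wt.2) :
    F.obj ⟨z.chart.1, z.wt.1⟩ ⟶ ((X.pullbackFst X k).obj F).obj z :=
  ModuleCat.ofHom ((TensorProduct.mk k (F.obj ⟨z.chart.1, z.wt.1⟩) (X.Monomial z.chart.2 z.wt.2 →₀ k)).flip
    (Finsupp.single m 1))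

variable {X F} in
theorem tensorMono_hom_ext {z : (X.prod X).Loc} {Y : ModuleCat.{u} k}
    {f g : ((X.pullbackFst X k).obj F).obj z ⟶ Y}
    (h : ∀ m, X.tensorMono F z m ≫ f = X.tensorMono F z m ≫ g) : f = g := by
  refine ModuleCat.hom_ext (TensorProduct.ext' fun t s => ?_)
  induction s using Finsupp.induction_linear with
  | zero => exact (congrArg f.hom (TensorProduct.tmul_zero _ t)).trans ((map_zero f.hom).trans
      ((map_zero g.hom).symm.trans (congrArg g.hom (TensorProduct.tmul_zero _ t).symm)))
  | add s s' hs hs' =>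
    exact (congrArg f.hom (TensorProduct.tmul_add t s s')).trans ((map_add f.hom _ _).trans
      ((congrArg₂ (· + ·) hs hs').trans ((map_add g.hom _ _).symm.trans
        (congrArg g.hom (TensorProduct.tmul_add t s s').symm))))
  | single m c =>
    have e : t ⊗ₜ[k] (Finsupp.single m c) = (c • t) ⊗ₜ[k] (Finsupp.single m (1 : k)) := by
      rw [TensorProduct.smul_tmul, Finsupp.smul_single, smul_eq_mul, mul_one]
    exact (congrArg f.hom e).trans ((congrArg (fun f => f (c • t)) (h m)).trans
      (congrArg g.hom e).symm)

/-- The map out of `π₁^* F` given by maps out of the summands `F(p) · x^m`. -/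
def tensorDesc (z : (X.prod X).Loc) {Y : ModuleCat.{u} k}
    (f : X.Monomial z.chart.2 z.wt.2 → (F.obj ⟨z.chart.1, z.wt.1⟩ ⟶ Y)) :
    ((X.pullbackFst X k).obj F).obj z ⟶ Y :=
  ModuleCat.ofHom (TensorProduct.lift (LinearMap.flip
    (Finsupp.lsum k fun m => LinearMap.toSpanSingleton k _ (f m).hom)))

theorem tensorMono_desc (z : (X.prod X).Loc) {Y : ModuleCat.{u} k}
    (f : X.Monomial z.chart.2 z.wt.2 → (F.obj ⟨z.chart.1, z.wt.1⟩ ⟶ Y))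
    (m : X.Monomial z.chart.2 z.wt.2) : X.tensorMono F z m ≫ X.tensorDesc F z f = f m := by
  ext t
  change TensorProduct.lift (LinearMap.flip
    (Finsupp.lsum k fun m => LinearMap.toSpanSingleton k _ (f m).hom)) (t ⊗ₜ Finsupp.single m 1) = _
  rw [TensorProduct.lift.tmul, LinearMap.flip_apply, Finsupp.lsum_apply, Finsupp.sum_single_index]
  · simp
  · simp

theorem tensorMono_map {z z' : (X.prod X).Loc} (f : z ⟶ z') (m : X.Monomial z.chart.2 z.wt.2) :
    X.tensorMono F z m ≫ ((X.pullbackFst X k).obj F).map f =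
      F.map ((X.prodFst X).map f) ≫ X.tensorMono F z' (m.map ((X.prodSnd X).map f)) := by
  ext t
  have e : Finsupp.lmapDomain k k (Monomial.map ((X.prodSnd X).map f)) (Finsupp.single m 1) =
      Finsupp.single (m.map ((X.prodSnd X).map f)) 1 := Finsupp.mapDomain_single
  exact congrArg (fun s => (F.map ((X.prodFst X).map f) t : F.obj ⟨z'.chart.1, z'.wt.1⟩) ⊗ₜ[k] s) e

end CoxData

end ToricBGG

namespace ToricBGG

namespace CoxData

variable {ι A P : Type} [Fintype ι] [LinearOrder ι] [AddCommGroup A] [SemilatticeInf P]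
  (X : CoxData ι A P)

variable {X} in
/-- The identity of a piece of a sheaf, as a morphism between equal degrees. -/
def eqHom (p : P) {w w' : A} (h : w = w') : (⟨p, w⟩ : X.Loc) ⟶ ⟨p, w'⟩ :=
  ⟨le_rfl, 0, fun _ _ => le_rfl, by simpa using h⟩

/-- Multiplication by a variable. -/
def varHom (i : ι) (p : P) (w : A) : (⟨p, w⟩ : X.Loc) ⟶ ⟨p, w + X.deg i⟩ :=
  ⟨le_rfl, Pi.single i 1, fun j _ => by
      by_cases hj : j = i
      · subst hj; simp
      · simp [hj], by
    refine congrArg (w + ·) ?_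
    rw [Finset.sum_eq_single i] <;> simp +contextual⟩

theorem wtExp_add (m m' : ι → ℤ) : X.wtExp (m + m') = X.wtExp m + X.wtExp m' := by
  simp [wtExp, add_smul, Finset.sum_add_distrib]

theorem wtExp_single (i : ι) (n : ℤ) : X.wtExp (Pi.single i n) = n • X.deg i := by
  unfold wtExp
  rw [Finset.sum_eq_single i] <;> simp +contextual

variable {k : Type u} [Field k] (F : X.Mod k)

/-- The map attached to a Laurent monomial. -/
def monHom {p q : P} (h : q ≤ p) (e : ι → ℤ) (he : ∀ i ∈ X.supp q, 0 ≤ e i) {w w' : A}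
    (hw : w + X.wtExp e = w') : (⟨p, w⟩ : X.Loc) ⟶ ⟨q, w'⟩ := ⟨h, e, he, hw⟩

theorem exp_add_eq {x y : X.Loc} (f : x ⟶ y) : x.wt + X.wtExp f.exp = y.wt := f.wt_add

/-- The inclusion `t ↦ (t ⊗ x^m) u^d` of a summand of the sections of `diagObj`. -/
def summand (z : (X.prod X).Loc) (b : A) (d : X.Eff) (m : ι → ℤ)
    (hm : ∀ i ∈ X.supp z.chart.2, 0 ≤ m i) (hw : X.wtExp m = d.1 + z.wt.2) :
    F.obj ⟨z.chart.1, b - d.1 + z.wt.1⟩ ⟶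
      (X.diagObj ((X.pullbackFst X k).obj F) b).obj z :=
  X.tensorMono F (((X.prod X).shift (b - d.1, d.1)).obj z) ⟨m, hm, hw⟩ ≫
    (X.diagIncl ((X.pullbackFst X k).obj F) b d).app z

variable {X F} in
theorem summand_hom_ext {z : (X.prod X).Loc} {b : A} {Y : ModuleCat.{u} k}
    {f g : (X.diagObj ((X.pullbackFst X k).obj F) b).obj z ⟶ Y}
    (h : ∀ d m hm hw, X.summand F z b d m hm hw ≫ f = X.summand F z b d m hm hw ≫ g) : f = g := by
  refine map_sigma_hom_ext ((evaluation _ _).obj z) (fun d : X.Eff =>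
    ((X.prod X).twist (b - d.1, d.1)).obj ((X.pullbackFst X k).obj F)) fun d => ?_
  refine tensorMono_hom_ext (z := ((X.prod X).shift (b - d.1, d.1)).obj z) fun m => ?_
  exact h d m.exp m.nonneg m.wt

theorem exists_summand_desc (z : (X.prod X).Loc) (b : A) {Y : ModuleCat.{u} k}
    (g : ∀ (d : X.Eff) (_ : ι → ℤ), F.obj ⟨z.chart.1, b - d.1 + z.wt.1⟩ ⟶ Y) :
    ∃ f : (X.diagObj ((X.pullbackFst X k).obj F) b).obj z ⟶ Y, ∀ d m hm hw,
      X.summand F z b d m hm hw ≫ f = g d m := by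
  refine ⟨mapSigmaDesc ((evaluation _ _).obj z) (fun d : X.Eff =>
      ((X.prod X).twist (b - d.1, d.1)).obj ((X.pullbackFst X k).obj F)) fun d =>
        X.tensorDesc F (((X.prod X).shift (b - d.1, d.1)).obj z) fun m => g d m.exp,
    fun d m hm hw => ?_⟩
  have e := congrArg (X.tensorMono F (((X.prod X).shift (b - d.1, d.1)).obj z) ⟨m, hm, hw⟩ ≫ ·)
    (map_ι_mapSigmaDesc ((evaluation _ _).obj z) (fun d : X.Eff =>
      ((X.prod X).twist (b - d.1, d.1)).obj ((X.pullbackFst X k).obj F)) (fun d =>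
        X.tensorDesc F (((X.prod X).shift (b - d.1, d.1)).obj z) fun m => g d m.exp) d)
  exact e.trans (X.tensorMono_desc F _ _ _)

theorem summand_map {z z' : (X.prod X).Loc} (f : z ⟶ z') (b : A) (d : X.Eff) (m : ι → ℤ)
    (hm : ∀ i ∈ X.supp z.chart.2, 0 ≤ m i) (hw : X.wtExp m = d.1 + z.wt.2) {m' : ι → ℤ}
    (hm' : ∀ i ∈ X.supp z'.chart.2, 0 ≤ m' i) (hw' : X.wtExp m' = d.1 + z'.wt.2)
    (hmm : m' = m + f.exp ∘ Sum.inr)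
    (g : (⟨z.chart.1, b - d.1 + z.wt.1⟩ : X.Loc) ⟶ ⟨z'.chart.1, b - d.1 + z'.wt.1⟩)
    (hg : g.exp = f.exp ∘ Sum.inl) :
    X.summand F z b d m hm hw ≫ (X.diagObj ((X.pullbackFst X k).obj F) b).map f =
      F.map g ≫ X.summand F z' b d m' hm' hw' := by
  subst hmm
  have e1 := congrArg (X.tensorMono F (((X.prod X).shift (b - d.1, d.1)).obj z) ⟨m, hm, hw⟩ ≫ ·)
    ((X.diagIncl ((X.pullbackFst X k).obj F) b d).naturality f)
  have e2 := congrArg (· ≫ (X.diagIncl ((X.pullbackFst X k).obj F) b d).app z')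
    (X.tensorMono_map F (((X.prod X).shift (b - d.1, d.1)).map f) ⟨m, hm, hw⟩)
  have e3 : (X.prodFst X).map (((X.prod X).shift (b - d.1, d.1)).map f) = g :=
    X.loc_hom_ext hg.symm
  refine e1.symm.trans (e2.trans ?_)
  rw [e3]
  rfl

theorem summand_mul (z : (X.prod X).Loc) {b b' : A} (i : ι) (h : b + X.deg i = b') (d d' : X.Eff)
    (hd : d' = X.addDeg d i) (m m' : ι → ℤ)
    (hm : ∀ i ∈ X.supp z.chart.2, 0 ≤ m i) (hw : X.wtExp m = d.1 + z.wt.2)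
    (hm' : ∀ i ∈ X.supp z.chart.2, 0 ≤ m' i) (hw' : X.wtExp m' = d'.1 + z.wt.2)
    (hmm : m' = m + Pi.single i 1)
    (g : (⟨z.chart.1, b - d.1 + z.wt.1⟩ : X.Loc) ⟶ ⟨z.chart.1, b' - d.1 + z.wt.1⟩)
    (hg : g.exp = Pi.single i 1)
    (g' : (⟨z.chart.1, b - d.1 + z.wt.1⟩ : X.Loc) ⟶ ⟨z.chart.1, b' - d'.1 + z.wt.1⟩)
    (hg' : g'.exp = 0) :
    X.summand F z b d m hm hw ≫ (X.diagMul ((X.pullbackFst X k).obj F) i h).app z =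
      F.map g ≫ X.summand F z b' d m hm hw - F.map g' ≫ X.summand F z b' d' m' hm' hw' := by
  subst hd hmm
  let H := (X.pullbackFst X k).obj F
  have e0 := congrArg (fun α => X.tensorMono F (((X.prod X).shift (b - d.1, d.1)).obj z)
    ⟨m, hm, hw⟩ ≫ NatTrans.app α z) (X.diagIncl_mul H i h d)
  have e1 := congrArg (· ≫ (X.diagIncl H b' d).app z) (X.tensorMono_map F
    (((X.prod X).mulVar (Sum.inl i) (X.wt_inl i h d.1)).app z) ⟨m, hm, hw⟩)
  have e2 := congrArg (· ≫ (X.diagIncl H b' (X.addDeg d i)).app z) (X.tensorMono_map F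
    (((X.prod X).mulVar (Sum.inr i) (X.wt_inr i h d.1)).app z) ⟨m, hm, hw⟩)
  have f1 : (X.prodFst X).map (((X.prod X).mulVar (Sum.inl i) (X.wt_inl i h d.1)).app z) = g := by
    refine X.loc_hom_ext (Eq.trans ?_ hg.symm)
    funext l
    change (Pi.single (Sum.inl i) (1 : ℤ) : ι ⊕ ι → ℤ) (Sum.inl l) = _
    by_cases hl : l = i
    · subst hl; simp
    · simp [hl]
  have f2 : (X.prodFst X).map (((X.prod X).mulVar (Sum.inr i) (X.wt_inr i h d.1)).app z) = g' := by
    refine X.loc_hom_ext (Eq.trans ?_ hg'.symm)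
    funext l
    change (Pi.single (Sum.inr i) (1 : ℤ) : ι ⊕ ι → ℤ) (Sum.inl l) = _
    simp
  have f3 : Monomial.map ((X.prodSnd X).map (((X.prod X).mulVar (Sum.inl i)
      (X.wt_inl i h d.1)).app z)) (⟨m, hm, hw⟩ : X.Monomial z.chart.2 (d.1 + z.wt.2)) =
      ⟨m, hm, hw⟩ := by
    refine Monomial.ext ?_
    funext l
    change m l + (Pi.single (Sum.inl i) (1 : ℤ) : ι ⊕ ι → ℤ) (Sum.inr l) = _
    simp
  have f4 : Monomial.map ((X.prodSnd X).map (((X.prod X).mulVar (Sum.inr i)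
      (X.wt_inr i h d.1)).app z)) (⟨m, hm, hw⟩ : X.Monomial z.chart.2 (d.1 + z.wt.2)) =
      ⟨m + Pi.single i 1, hm', hw'⟩ := by
    refine Monomial.ext ?_
    funext l
    change m l + (Pi.single (Sum.inr i) (1 : ℤ) : ι ⊕ ι → ℤ) (Sum.inr l) = m l + _
    by_cases hl : l = i
    · subst hl; simp
    · simp [hl]
  refine e0.trans ?_
  refine (Preadditive.comp_sub _ _ _).trans ?_
  refine congrArg₂ (· - ·) (e1.trans ?_) (e2.trans ?_)
  · refine congrArg₂ (fun a b => (F.map a ≫ X.tensorMono F _ b) ≫ _) f1 f3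
  · refine congrArg₂ (fun a b => (F.map a ≫ X.tensorMono F _ b) ≫ _) f2 f4

theorem summand_naturality {F' : X.Mod k} (φ : F ⟶ F') (z : (X.prod X).Loc) (b : A) (d : X.Eff)
    (m : ι → ℤ) (hm : ∀ i ∈ X.supp z.chart.2, 0 ≤ m i) (hw : X.wtExp m = d.1 + z.wt.2) :
    X.summand F z b d m hm hw ≫ (X.diagMap ((X.pullbackFst X k).map φ) b).app z =
      φ.app _ ≫ X.summand F' z b d m hm hw :=
  congrArg (fun α => X.tensorMono F (((X.prod X).shift (b - d.1, d.1)).obj z) ⟨m, hm, hw⟩ ≫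
    NatTrans.app α z) (X.diagIncl_map ((X.pullbackFst X k).map φ) b d)

/-- The inclusion of a summand of `RObj F p`. -/
def rIncl {p : ℤ} (I : SubsetsOfCard ι p) :
    X.diagObj ((X.pullbackFst X k).obj F) (0 - X.wtSum I.1) ⟶ X.RObj F p :=
  biproduct.ι (fun I : SubsetsOfCard ι p =>
    X.diagObj ((X.pullbackFst X k).obj F) (0 - X.wtSum I.1)) I

/-- The inclusion of the summand `F(p) · x^m ⊗ y_I` of the sections of `RObj F p`, where `F(p)` is
taken in degree `w`; this is zero if there is no such summand. -/
def gen (z : (X.prod X).Loc) (p : ℤ) (I : Finset ι) (m : ι → ℤ) (w : A) :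
    F.obj ⟨z.chart.1, w⟩ ⟶ (X.RObj F p).obj z :=
  open Classical in
  if h : X.GenValid z p I m w then
    F.map (eqHom z.chart.1 h.wt) ≫
      X.summand F z (0 - X.wtSum I) ⟨_, h.eff⟩ m h.nonneg (sub_add_cancel _ _).symm ≫
      (X.rIncl F ⟨I, h.card⟩).app z
  else 0

theorem gen_of_not_valid {z : (X.prod X).Loc} {p : ℤ} {I : Finset ι} {m : ι → ℤ} {w : A}
    (h : ¬ X.GenValid z p I m w) : X.gen F z p I m w = 0 := dif_neg h

theorem summand_rIncl (z : (X.prod X).Loc) {p : ℤ} (I : SubsetsOfCard ι p) (d : X.Eff)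
    (m : ι → ℤ) (hm : ∀ i ∈ X.supp z.chart.2, 0 ≤ m i) (hmw : X.wtExp m = d.1 + z.wt.2) {w : A}
    (f : (⟨z.chart.1, w⟩ : X.Loc) ⟶ ⟨z.chart.1, 0 - X.wtSum I.1 - d.1 + z.wt.1⟩)
    (hf : f.exp = 0) :
    F.map f ≫ X.summand F z (0 - X.wtSum I.1) d m hm hmw ≫ (X.rIncl F I).app z =
      X.gen F z p I.1 m w := by
  obtain ⟨d, hd⟩ := d
  have hmw' : X.wtExp m = d + z.wt.2 := hmw
  obtain rfl : d = X.wtExp m - z.wt.2 := by rw [hmw', add_sub_cancel_right]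
  have hw : w = 0 - X.wtSum I.1 - (X.wtExp m - z.wt.2) + z.wt.1 := by
    have h1 := f.wt_add
    rw [hf] at h1
    exact (by simp : w = w + ∑ i, (0 : ι → ℤ) i • X.deg i).trans h1
  have hv : X.GenValid z p I.1 m w := ⟨I.2, hm, hd, hw⟩
  unfold gen
  rw [dif_pos hv]
  have hf' : f = eqHom z.chart.1 hw := X.loc_hom_ext hf
  rw [hf']

theorem summand_rIncl' (z : (X.prod X).Loc) {p : ℤ} (I : SubsetsOfCard ι p) (d : X.Eff)
    (m : ι → ℤ) (hm : ∀ i ∈ X.supp z.chart.2, 0 ≤ m i) (hmw : X.wtExp m = d.1 + z.wt.2) :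
    X.summand F z (0 - X.wtSum I.1) d m hm hmw ≫ (X.rIncl F I).app z =
      X.gen F z p I.1 m (0 - X.wtSum I.1 - d.1 + z.wt.1) := by
  rw [← X.summand_rIncl F z I d m hm hmw (𝟙 _) rfl, F.map_id, Category.id_comp]

variable {X F}

theorem GenValid.of_summand {z : (X.prod X).Loc} {p : ℤ} (I : SubsetsOfCard ι p) (d : X.Eff)
    (m : ι → ℤ) (hm : ∀ i ∈ X.supp z.chart.2, 0 ≤ m i) (hmw : X.wtExp m = d.1 + z.wt.2) :
    X.GenValid z p I.1 m (0 - X.wtSum I.1 - d.1 + z.wt.1) := by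
  refine ⟨I.2, hm, ?_, ?_⟩
  · rw [hmw, add_sub_cancel_right]
    exact d.2
  · rw [hmw, add_sub_cancel_right]

theorem gen_hom_ext {z : (X.prod X).Loc} {p : ℤ} {Y : ModuleCat.{u} k}
    {f g : (X.RObj F p).obj z ⟶ Y}
    (h : ∀ I m w, X.GenValid z p I m w → X.gen F z p I m w ≫ f = X.gen F z p I m w ≫ g) :
    f = g := by
  refine map_biproduct_hom_ext ((evaluation _ _).obj z) (F := fun I : SubsetsOfCard ι p =>
        X.diagObj ((X.pullbackFst X k).obj F) (0 - X.wtSum I.1)) fun I => ?_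
  refine summand_hom_ext fun d m hm hw => ?_
  have e : ∀ u : (X.RObj F p).obj z ⟶ Y, X.summand F z (0 - X.wtSum I.1) d m hm hw ≫
      (X.rIncl F I).app z ≫ u = X.gen F z p I.1 m _ ≫ u := fun u => by
    rw [← Category.assoc, summand_rIncl']
  exact (e f).trans ((h _ _ _ (GenValid.of_summand I d m hm hw)).trans (e g).symm)

/-- The map out of the sections of `RObj F p` with given restrictions to the summands. -/
theorem exists_gen_desc (z : (X.prod X).Loc) (p : ℤ) {Y : ModuleCat.{u} k}
    (g : ∀ (_ : Finset ι) (_ : ι → ℤ) (w : A), F.obj ⟨z.chart.1, w⟩ ⟶ Y) :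
    ∃ f : (X.RObj F p).obj z ⟶ Y, ∀ I m w, X.GenValid z p I m w →
      X.gen F z p I m w ≫ f = g I m w := by
  let B := fun I : SubsetsOfCard ι p => X.diagObj ((X.pullbackFst X k).obj F) (0 - X.wtSum I.1)
  choose fI hfI using fun I : SubsetsOfCard ι p =>
    X.exists_summand_desc F z (0 - X.wtSum I.1) (fun d m => g I.1 m _)
  refine ⟨∑ I, (biproduct.π B I).app z ≫ fI I, fun I m w hv => ?_⟩
  have hI : (X.rIncl F ⟨I, hv.card⟩).app z ≫ ∑ J, (biproduct.π B J).app z ≫ fI J =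
      fI ⟨I, hv.card⟩ := by
    rw [Preadditive.comp_sum, Finset.sum_eq_single ⟨I, hv.card⟩]
    · refine (Category.assoc _ _ _).symm.trans ?_
      refine (congrArg (fun α => NatTrans.app α z ≫ fI ⟨I, hv.card⟩)
        (biproduct.ι_π_self B ⟨I, hv.card⟩)).trans ?_
      exact Category.id_comp _
    · intro J _ hJ
      refine (Category.assoc _ _ _).symm.trans ?_
      refine (congrArg (fun α => NatTrans.app α z ≫ fI J) (biproduct.ι_π_ne B hJ.symm)).trans ?_
      exact zero_comp
    · intro h
      exact absurd (Finset.mem_univ _) h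
  unfold gen
  rw [dif_pos hv, Category.assoc, Category.assoc, hI]
  refine (congrArg (F.map (eqHom z.chart.1 hv.wt) ≫ ·) (hfI ⟨I, hv.card⟩ ⟨_, hv.eff⟩ m hv.nonneg
    (sub_add_cancel _ _).symm)).trans ?_
  have key : ∀ {w' : A} (e : w = w'), F.map (eqHom z.chart.1 e) ≫ g I m w' = g I m w := by
    rintro _ rfl
    exact (congrArg (· ≫ g I m w) (F.map_id _)).trans (Category.id_comp _)
  exact key hv.wt

theorem map_gen (z : (X.prod X).Loc) (p : ℤ) (I : Finset ι) (m : ι → ℤ) {w w' : A}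
    (f : (⟨z.chart.1, w⟩ : X.Loc) ⟶ ⟨z.chart.1, w'⟩) (hf : f.exp = 0) :
    F.map f ≫ X.gen F z p I m w' = X.gen F z p I m w := by
  have h : w = w' := by
    have := f.wt_add
    rw [hf] at this
    simpa using this
  subst h
  obtain rfl : f = 𝟙 _ := X.loc_hom_ext hf
  rw [F.map_id, Category.id_comp]

theorem gen_map {z z' : (X.prod X).Loc} (f : z ⟶ z') {p : ℤ} {I : Finset ι} {m : ι → ℤ} {w w' : A}
    (hv : X.GenValid z p I m w) (f₁ : (⟨z.chart.1, w⟩ : X.Loc) ⟶ ⟨z'.chart.1, w'⟩)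
    (hf₁ : f₁.exp = f.exp ∘ Sum.inl) {m' : ι → ℤ} (hm' : m' = m + f.exp ∘ Sum.inr) :
    X.gen F z p I m w ≫ (X.RObj F p).map f = F.map f₁ ≫ X.gen F z' p I m' w' := by
  have hw1 : z.wt.1 + X.wtExp (f.exp ∘ Sum.inl) = z'.wt.1 := ((X.prodFst X).map f).wt_add
  have hw2 : z.wt.2 + X.wtExp (f.exp ∘ Sum.inr) = z'.wt.2 := ((X.prodSnd X).map f).wt_add
  have hw : w' = (0 - X.wtSum I - (X.wtExp m - z.wt.2)) + z'.wt.1 := by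
    have h1 := f₁.wt_add
    rw [hf₁] at h1
    change w + X.wtExp (f.exp ∘ Sum.inl) = w' at h1
    rw [← h1, ← hw1, hv.wt]
    abel
  have hn : ∀ i ∈ X.supp z'.chart.2, 0 ≤ m' i := fun i hi => by
    rw [hm']
    exact add_nonneg (hv.nonneg i (X.supp_mono f.chart_le.2 hi))
      (((X.prodSnd X).map f).nonneg i hi)
  have hmm : X.wtExp m' = (X.wtExp m - z.wt.2) + z'.wt.2 := by
    rw [hm', wtExp_add, ← hw2]; abel
  have e1 := X.summand_rIncl F z' ⟨I, hv.card⟩ ⟨_, hv.eff⟩ m' hn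
    hmm (w := w') (eqHom z'.chart.1 hw) rfl
  have e0 : X.gen F z p I m w = F.map (eqHom z.chart.1 hv.wt) ≫
      X.summand F z (0 - X.wtSum I) ⟨_, hv.eff⟩ m hv.nonneg (sub_add_cancel _ _).symm ≫
      (X.rIncl F ⟨I, hv.card⟩).app z := dif_pos hv
  have e3 := (X.rIncl F ⟨I, hv.card⟩).naturality f
  let g : (⟨z.chart.1, 0 - X.wtSum I - (X.wtExp m - z.wt.2) + z.wt.1⟩ : X.Loc) ⟶
      ⟨z'.chart.1, 0 - X.wtSum I - (X.wtExp m - z.wt.2) + z'.wt.1⟩ :=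
    ⟨f.chart_le.1, f.exp ∘ Sum.inl, ((X.prodFst X).map f).nonneg, by
      refine (add_assoc _ _ _).trans ?_
      exact congrArg _ hw1⟩
  have e4 := X.summand_map F f (0 - X.wtSum I) ⟨_, hv.eff⟩ m hv.nonneg (sub_add_cancel _ _).symm
    hn hmm hm' g rfl
  rw [← e1, e0, Category.assoc, Category.assoc, ← e3, reassoc_of% e4, ← Category.assoc,
    ← F.map_comp, ← Category.assoc (F.map f₁), ← F.map_comp]
  refine congrArg (fun h => F.map h ≫ _) (X.loc_hom_ext ?_)
  rw [comp_exp, comp_exp, hf₁]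
  exact (zero_add _).trans (add_zero _).symm

theorem GenValid.mul {z : (X.prod X).Loc} {p p' : ℤ} (hp : p' + 1 = p) {I : Finset ι} {m : ι → ℤ}
    {w : A} (hv : X.GenValid z p I m w) {i : ι} (hi : i ∈ I) :
    X.GenValid z p' (I.erase i) m (w + X.deg i) ∧
      X.GenValid z p' (I.erase i) (m + Pi.single i 1) w := by
  have hc : ((I.erase i).card : ℤ) = p' := card_erase_eq hp ⟨I, hv.card⟩ hi
  have hs : X.wtSum I = X.wtSum (I.erase i) + X.deg i := (Finset.sum_erase_add I X.deg hi).symm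
  refine ⟨⟨hc, hv.nonneg, hv.eff, ?_⟩, ⟨hc, fun l hl => ?_, ?_, ?_⟩⟩
  · rw [hv.wt, hs]; abel
  · refine add_nonneg (hv.nonneg l hl) ?_
    rw [Pi.single_apply]
    split_ifs <;> simp
  · rw [wtExp_add, wtExp_single, one_smul, add_sub_right_comm]
    exact add_mem hv.eff (X.deg_mem_Eff i)
  · rw [hv.wt, hs, wtExp_add, wtExp_single, one_smul]; abel

theorem rIncl_d {p p' : ℤ} (hp : p' + 1 = p) (I : SubsetsOfCard ι p) :
    X.rIncl F I ≫ ((X.tensorR k).obj ((X.pullbackFst X k).obj F)).d p p' =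
      ∑ i, if h : i ∈ I.1 then contractSign i I.1 •
        (X.diagMul ((X.pullbackFst X k).obj F) i (GrObj.wt_erase_mul h 0) ≫
          X.rIncl F ⟨I.1.erase i, card_erase_eq hp I h⟩) else 0 := by
  have e := ((X.diagonalModule k).obj ((X.pullbackFst X k).obj F)).koszulD_eq 0 p p' hp
  refine (congrArg (X.rIncl F I ≫ ·) e).trans ?_
  refine (Preadditive.comp_sum _ _ _).trans ?_
  exact Finset.sum_congr rfl fun i _ => biproduct.ι_desc _ _

theorem gen_d {z : (X.prod X).Loc} {p p' : ℤ} (hp : p' + 1 = p) {I : Finset ι} {m : ι → ℤ}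
    {w : A} (hv : X.GenValid z p I m w) :
    X.gen F z p I m w ≫ (((X.tensorR k).obj ((X.pullbackFst X k).obj F)).d p p').app z =
      ∑ i ∈ I, contractSign i I • (F.map (varHom X i z.chart.1 w) ≫
        X.gen F z p' (I.erase i) m (w + X.deg i) -
          X.gen F z p' (I.erase i) (m + Pi.single i 1) w) := by
  have e0 : X.gen F z p I m w = F.map (eqHom z.chart.1 hv.wt) ≫
      X.summand F z (0 - X.wtSum I) ⟨_, hv.eff⟩ m hv.nonneg (sub_add_cancel _ _).symm ≫
      (X.rIncl F ⟨I, hv.card⟩).app z := dif_pos hv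
  have e1 := congrArg (fun α => NatTrans.app α z) (rIncl_d (F := F) hp ⟨I, hv.card⟩)
  rw [e0, Category.assoc, Category.assoc]
  refine (congrArg (fun f => F.map (eqHom z.chart.1 hv.wt) ≫ X.summand F z (0 - X.wtSum I)
    ⟨_, hv.eff⟩ m hv.nonneg (sub_add_cancel _ _).symm ≫ f) e1).trans ?_
  rw [NatTrans.app_sum, Preadditive.comp_sum, Preadditive.comp_sum, ← Finset.sum_subset (Finset.subset_univ I)]
  · refine Finset.sum_congr rfl fun i hi => ?_
    have hc : ((I.erase i).card : ℤ) = p' := card_erase_eq hp ⟨I, hv.card⟩ hi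
    obtain ⟨hv1, hv2⟩ := hv.mul hp hi
    rw [dif_pos hi, NatTrans.app_zsmul, NatTrans.comp_app, Preadditive.comp_zsmul,
      Preadditive.comp_zsmul]
    congr 1
    let g : (⟨z.chart.1, 0 - X.wtSum I - (X.wtExp m - z.wt.2) + z.wt.1⟩ : X.Loc) ⟶
        ⟨z.chart.1, 0 - X.wtSum (I.erase i) - (X.wtExp m - z.wt.2) + z.wt.1⟩ :=
      X.monHom le_rfl (Pi.single i 1) (varHom X i z.chart.1 w).nonneg (by
        rw [wtExp_single, one_smul, ← GrObj.wt_erase_mul hi 0]; abel)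
    have hs : X.wtSum I = X.wtSum (I.erase i) + X.deg i := (Finset.sum_erase_add I X.deg hi).symm
    let g' : (⟨z.chart.1, 0 - X.wtSum I - (X.wtExp m - z.wt.2) + z.wt.1⟩ : X.Loc) ⟶
        ⟨z.chart.1, 0 - X.wtSum (I.erase i) - (X.addDeg ⟨_, hv.eff⟩ i).1 + z.wt.1⟩ :=
      eqHom z.chart.1 (by
        change _ = 0 - X.wtSum (I.erase i) - ((X.wtExp m - z.wt.2) + X.deg i) + z.wt.1
        rw [hs]; abel)
    have hmm : X.wtExp (m + Pi.single i 1) = (X.addDeg ⟨_, hv.eff⟩ i).1 + z.wt.2 := by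
      change _ = ((X.wtExp m - z.wt.2) + X.deg i) + z.wt.2
      rw [wtExp_add, wtExp_single, one_smul]; abel
    have e2 := X.summand_mul F z i (GrObj.wt_erase_mul hi 0) ⟨_, hv.eff⟩ _ rfl m _ hv.nonneg
      (sub_add_cancel _ _).symm hv2.nonneg hmm rfl g rfl g' rfl
    rw [reassoc_of% e2]
    rw [Preadditive.sub_comp, Preadditive.comp_sub, Category.assoc, Category.assoc,
      ← Category.assoc, ← F.map_comp, ← Category.assoc (F.map _) (F.map g'), ← F.map_comp]
    refine congrArg₂ (· - ·) ?_ ?_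
    · have e3 := X.summand_rIncl F z ⟨I.erase i, hc⟩ ⟨_, hv.eff⟩ m hv.nonneg
        (sub_add_cancel _ _).symm (w := w + X.deg i) (eqHom z.chart.1 hv1.wt) rfl
      rw [← e3, ← Category.assoc (F.map _) (F.map _), ← F.map_comp]
      refine congrArg (fun h => F.map h ≫ _) (X.loc_hom_ext ?_)
      rw [comp_exp, comp_exp]
      exact (zero_add _).trans (add_zero _).symm
    · exact X.summand_rIncl F z ⟨I.erase i, hc⟩ _ _ hv2.nonneg hmm _ (add_zero _)
  · intro i _ hi
    rw [dif_neg hi]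
    exact (congrArg _ comp_zero).trans comp_zero

theorem gen_naturality {F' : X.Mod k} (φ : F ⟶ F') {z : (X.prod X).Loc} {p : ℤ} {I : Finset ι}
    {m : ι → ℤ} {w : A} :
    X.gen F z p I m w ≫ (((X.tensorR k).map ((X.pullbackFst X k).map φ)).f p).app z =
      φ.app _ ≫ X.gen F' z p I m w := by
  by_cases hv : X.GenValid z p I m w
  · have e0 : ∀ F : X.Mod k, X.gen F z p I m w = F.map (eqHom z.chart.1 hv.wt) ≫
        X.summand F z (0 - X.wtSum I) ⟨_, hv.eff⟩ m hv.nonneg (sub_add_cancel _ _).symm ≫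
        (X.rIncl F ⟨I, hv.card⟩).app z := fun F => dif_pos hv
    have e1 : X.rIncl F ⟨I, hv.card⟩ ≫ ((X.tensorR k).map ((X.pullbackFst X k).map φ)).f p =
        X.diagMap ((X.pullbackFst X k).map φ) (0 - X.wtSum I) ≫ X.rIncl F' ⟨I, hv.card⟩ :=
      biproduct.ι_map (fun I : SubsetsOfCard ι p =>
        X.diagMap ((X.pullbackFst X k).map φ) (0 - X.wtSum I.1)) ⟨I, hv.card⟩
    have e2 := congrArg (fun α => NatTrans.app α z) e1
    rw [e0, e0, Category.assoc, Category.assoc]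
    refine (congrArg (fun f => F.map (eqHom z.chart.1 hv.wt) ≫ X.summand F z (0 - X.wtSum I)
      ⟨_, hv.eff⟩ m hv.nonneg (sub_add_cancel _ _).symm ≫ f) e2).trans ?_
    rw [NatTrans.comp_app, reassoc_of% (X.summand_naturality F φ), ← Category.assoc,
      φ.naturality, Category.assoc]
  · rw [gen_of_not_valid X F hv, gen_of_not_valid X F' hv]
    exact zero_comp.trans comp_zero.symm

end CoxData

end ToricBGG

namespace ToricBGG

theorem contractSign_mul_self {ι : Type} [Fintype ι] [LinearOrder ι] (i : ι) (I : Finset ι) :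
    contractSign i I * contractSign i I = 1 := by
  unfold contractSign
  rw [← mul_pow]
  simp

theorem contractSign_insert {ι : Type} [Fintype ι] [LinearOrder ι] {i l : ι} {I : Finset ι} (hi : i ∉ I)
    (hl : l ∈ I) : contractSign i (insert i I) * contractSign l (insert i I) =
      - (contractSign l I * contractSign i (insert i (I.erase l))) := by
  have hil : i ≠ l := fun h => hi (h ▸ hl)
  have e := contractSign_anticomm (Finset.mem_insert_self i I) (Finset.mem_insert_of_mem hl) hil
  have e1 : (insert i I).erase i = I := Finset.erase_insert hi
  have e2 : (insert i I).erase l = insert i (I.erase l) := Finset.erase_insert_of_ne hil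
  rw [e1, e2] at e
  have h1 := contractSign_mul_self l I
  have h2 := contractSign_mul_self l (insert i I)
  linear_combination (contractSign l I * contractSign l (insert i I)) * e -
    contractSign i (insert i I) * contractSign l (insert i I) * h1 -
    contractSign i (insert i (I.erase l)) * contractSign l I * h2

namespace CoxData

variable {ι A P : Type} [Fintype ι] [LinearOrder ι] [AddCommGroup A] [SemilatticeInf P]
  (X : CoxData ι A P) {k : Type u} [Field k] (F : X.Mod k)

/-- The composition of the multiplication by the monomial with exponent `r` and `gen`. -/
def genMul (z : (X.prod X).Loc) (p : ℤ) (I : Finset ι) (m : ι → ℤ) (w : A) (r : ι → ℤ) :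
    F.obj ⟨z.chart.1, w⟩ ⟶ (X.RObj F p).obj z :=
  open Classical in
  if h : ∀ i ∈ X.supp z.chart.1, 0 ≤ r i then
    F.map (X.monHom le_rfl r h rfl) ≫ X.gen F z p I m (w + X.wtExp r) else 0

/-- The differential of the sections of `π₁^* F ⊗ ℛ`. -/
abbrev rD (z : (X.prod X).Loc) (p p' : ℤ) : (X.RObj F p).obj z ⟶ (X.RObj F p').obj z :=
  (((X.tensorR k).obj ((X.pullbackFst X k).obj F)).d p p').app z

variable {X F}

theorem map_gen_congr {z : (X.prod X).Loc} {p : ℤ} {I : Finset ι} {m : ι → ℤ} {w w₁ w₂ : A}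
    (f : (⟨z.chart.1, w⟩ : X.Loc) ⟶ ⟨z.chart.1, w₁⟩) (g : (⟨z.chart.1, w⟩ : X.Loc) ⟶ ⟨z.chart.1, w₂⟩)
    (h : f.exp = g.exp) : F.map f ≫ X.gen F z p I m w₁ = F.map g ≫ X.gen F z p I m w₂ := by
  have hw : w₁ = w₂ := by
    have h1 := f.wt_add
    have h2 := g.wt_add
    rw [h] at h1
    exact h1.symm.trans h2
  subst hw
  rw [X.loc_hom_ext h]

theorem map_gen_eq_genMul {z : (X.prod X).Loc} {p : ℤ} {I : Finset ι} {m : ι → ℤ} {w w₁ : A}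
    (f : (⟨z.chart.1, w⟩ : X.Loc) ⟶ ⟨z.chart.1, w₁⟩) {r : ι → ℤ} (h : f.exp = r) :
    F.map f ≫ X.gen F z p I m w₁ = X.genMul F z p I m w r := by
  subst h
  unfold genMul
  rw [dif_pos f.nonneg]
  exact map_gen_congr _ _ rfl

theorem genMul_zero (z : (X.prod X).Loc) (p : ℤ) (I : Finset ι) (m : ι → ℤ) (w : A) :
    X.genMul F z p I m w 0 = X.gen F z p I m w := by
  rw [← map_gen_eq_genMul (𝟙 _) (X.id_exp _), F.map_id, Category.id_comp]

theorem map_genMul {z : (X.prod X).Loc} {p : ℤ} {I : Finset ι} {m : ι → ℤ} {w w₁ : A}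
    (f : (⟨z.chart.1, w⟩ : X.Loc) ⟶ ⟨z.chart.1, w₁⟩) {r : ι → ℤ}
    (hr : ∀ i ∈ X.supp z.chart.1, 0 ≤ r i) {r' : ι → ℤ} (h : r' = f.exp + r) :
    F.map f ≫ X.genMul F z p I m w₁ r = X.genMul F z p I m w r' := by
  subst h
  unfold genMul
  have h' : ∀ i ∈ X.supp z.chart.1, 0 ≤ (f.exp + r) i := fun i hi =>
    add_nonneg (f.nonneg i hi) (hr i hi)
  rw [dif_pos hr, dif_pos h', ← Category.assoc,
    ← F.map_comp]
  exact map_gen_congr _ _ rfl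

theorem single_nonneg (i l : ι) : 0 ≤ (Pi.single i 1 : ι → ℤ) l := by
  rw [Pi.single_apply]
  split_ifs <;> simp

theorem genMul_d {z : (X.prod X).Loc} {p p' : ℤ} (hp : p' + 1 = p) {I : Finset ι} {m : ι → ℤ}
    {w : A} {r : ι → ℤ} (hr : ∀ i ∈ X.supp z.chart.1, 0 ≤ r i)
    (hv : X.GenValid z p I m (w + X.wtExp r)) :
    X.genMul F z p I m w r ≫ X.rD F z p p' = ∑ i ∈ I, contractSign i I •
      (X.genMul F z p' (I.erase i) m w (r + Pi.single i 1) -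
        X.genMul F z p' (I.erase i) (m + Pi.single i 1) w r) := by
  have e : X.genMul F z p I m w r = F.map (X.monHom le_rfl r hr rfl) ≫
    X.gen F z p I m (w + X.wtExp r) := dif_pos hr
  rw [e, Category.assoc, gen_d hp hv, Preadditive.comp_sum]
  refine Finset.sum_congr rfl fun i _ => ?_
  rw [Preadditive.comp_zsmul, Preadditive.comp_sub]
  congr 2
  · rw [← Category.assoc, ← F.map_comp]
    exact map_gen_eq_genMul _ rfl
  · exact map_gen_eq_genMul _ rfl

variable (F) in
/-- The condition that the `h p (p + 1)` are the homotopy operators attached to a variable `i`,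
to a translation `c` of the exponents, and to the multiplication by the monomial with
exponent `r`, restricted to the summands that satisfy `C`. -/
def IsShiftHomotopy (z : (X.prod X).Loc) (i : ι) (c r : ι → ℤ) (C : (ι → ℤ) → Prop)
    (h : ∀ p p' : ℤ, (X.RObj F p).obj z ⟶ (X.RObj F p').obj z) : Prop :=
  ∀ (p p' : ℤ) (I : Finset ι) (m : ι → ℤ) (w : A), X.GenValid z p I m w →
        (i ∈ I → X.gen F z p I m w ≫ h p p' = 0) ∧
        (C m → i ∉ I → X.gen F z p I m w ≫ h p p' =
          contractSign i (insert i I) • X.genMul F z p' (insert i I) (m + c) w r) ∧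
        (¬ C m → X.gen F z p I m w ≫ h p p' = 0)

theorem exists_shiftHomotopy (z : (X.prod X).Loc) (i : ι) (c r : ι → ℤ) (C : (ι → ℤ) → Prop) :
    ∃ h, X.IsShiftHomotopy F z i c r C h := by
  classical
  choose h hh using fun p p' : ℤ => exists_gen_desc (F := F) (Y := (X.RObj F p').obj z) z p
    (fun I m w => if C m ∧ i ∉ I then
      contractSign i (insert i I) • X.genMul F z p' (insert i I) (m + c) w r else 0)
  refine ⟨h, fun p p' I m w hv => ⟨fun hi => ?_, fun hC hi => ?_, fun hC => ?_⟩⟩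
  · rw [hh p p' I m w hv, if_neg (fun h => h.2 hi)]
  · rw [hh p p' I m w hv, if_pos ⟨hC, hi⟩]
  · rw [hh p p' I m w hv, if_neg (fun h => hC h.1)]

variable {z : (X.prod X).Loc} {i : ι} {c r : ι → ℤ} {C : (ι → ℤ) → Prop}
  {h : ∀ p p' : ℤ, (X.RObj F p).obj z ⟶ (X.RObj F p').obj z}

theorem IsShiftHomotopy.comm_of_mem (hh : X.IsShiftHomotopy F z i c r C h)
    (hr : ∀ i ∈ X.supp z.chart.1, 0 ≤ r i) {p p' : ℤ} (hp : p' + 1 = p) {I : Finset ι} {m : ι → ℤ} {w : A}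
    (hv : X.GenValid z p I m w) (hi : i ∈ I) [Decidable (C m)]
    [Decidable (C (m + Pi.single i 1))] :
    X.gen F z p I m w ≫ (h p (p + 1) ≫ X.rD F z (p + 1) p + X.rD F z p p' ≫ h p' p) =
      (if C m then X.genMul F z p I (m + c) w (r + Pi.single i 1) else 0) -
        if C (m + Pi.single i 1) then X.genMul F z p I (m + Pi.single i 1 + c) w r else 0 := by
  rw [Preadditive.comp_add, ← Category.assoc, (hh p (p + 1) I m w hv).1 hi, zero_comp, zero_add,
    ← Category.assoc, gen_d hp hv, Preadditive.sum_comp, Finset.sum_eq_single i]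
  · obtain ⟨hv1, hv2⟩ := hv.mul hp hi
    have hn : i ∉ I.erase i := Finset.notMem_erase i I
    have hI : insert i (I.erase i) = I := Finset.insert_erase hi
    have hsq : ∀ {M N : ModuleCat.{u} k} (f : M ⟶ N),
        contractSign i I • contractSign i I • f = f := fun f => by
      rw [smul_smul, contractSign_mul_self, one_smul]
    rw [Preadditive.zsmul_comp, Preadditive.sub_comp, smul_sub]
    congr 1
    · rw [Category.assoc]
      split_ifs with hc
      · rw [(hh p' p _ _ _ hv1).2.1 hc hn, hI, Preadditive.comp_zsmul, hsq]
        exact map_genMul _ hr (add_comm _ _)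
      · rw [((hh p' p _ _ _ hv1).2.2 hc), comp_zero, smul_zero]
    · split_ifs with hc
      · rw [((hh p' p _ _ _ hv2).2.1 hc hn), hI, hsq]
      · rw [((hh p' p _ _ _ hv2).2.2 hc), smul_zero]
  · intro l hl hli
    obtain ⟨hv1, hv2⟩ := hv.mul hp hl
    have hm : i ∈ I.erase l := Finset.mem_erase.2 ⟨hli.symm, hi⟩
    rw [Preadditive.zsmul_comp, Preadditive.sub_comp, Category.assoc, (hh p' p _ _ _ hv1).1 hm,
      (hh p' p _ _ _ hv2).1 hm, comp_zero, sub_zero, smul_zero]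
  · exact fun hi' => absurd hi hi'

theorem IsShiftHomotopy.comm_of_notMem (hh : X.IsShiftHomotopy F z i c r C h)
    (hr : ∀ i ∈ X.supp z.chart.1, 0 ≤ r i)
    (hC : ∀ m l, l ≠ i → (C (m + Pi.single l 1) ↔ C m)) {p p' : ℤ} (hp : p' + 1 = p) {I : Finset ι} {m : ι → ℤ} {w : A}
    (hv : X.GenValid z p I m w) (hi : i ∉ I) [Decidable (C m)]
    (hv' : C m → X.GenValid z (p + 1) (insert i I) (m + c) (w + X.wtExp r)) :
    X.gen F z p I m w ≫ (h p (p + 1) ≫ X.rD F z (p + 1) p + X.rD F z p p' ≫ h p' p) =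
      if C m then X.genMul F z p I (m + c) w (r + Pi.single i 1) -
        X.genMul F z p I (m + c + Pi.single i 1) w r else 0 := by
  rw [Preadditive.comp_add, ← Category.assoc, ← Category.assoc, gen_d hp hv, Preadditive.sum_comp]
  have hl : ∀ l ∈ I, l ≠ i := fun l hl h => hi (h ▸ hl)
  split_ifs with hc
  · rw [(hh p (p + 1) I m w hv).2.1 hc hi, Preadditive.zsmul_comp, genMul_d rfl hr (hv' hc),
      Finset.sum_insert hi, smul_add, smul_smul, contractSign_mul_self, one_smul,
      Finset.erase_insert hi, add_assoc]
    refine add_eq_left.2 ?_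
    rw [Finset.smul_sum, ← Finset.sum_add_distrib]
    refine Finset.sum_eq_zero fun l hl' => ?_
    obtain ⟨hv1, hv2⟩ := hv.mul hp hl'
    have hn : i ∉ I.erase l := fun h => hi (Finset.mem_of_mem_erase h)
    rw [Preadditive.zsmul_comp, Preadditive.sub_comp, Category.assoc,
      (hh p' p _ _ _ hv1).2.1 hc hn, (hh p' p _ _ _ hv2).2.1 ((hC m l (hl l hl')).2 hc) hn,
      Preadditive.comp_zsmul, map_genMul _ hr (add_comm r (Pi.single l 1)), ← smul_sub, smul_smul,
      smul_smul, contractSign_insert hi hl',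
      Finset.erase_insert_of_ne (hl l hl').symm, add_right_comm m, neg_smul]
    exact neg_add_cancel _
  · rw [(hh p (p + 1) I m w hv).2.2 hc, zero_comp, zero_add]
    refine Finset.sum_eq_zero fun l hl' => ?_
    obtain ⟨hv1, hv2⟩ := hv.mul hp hl'
    rw [Preadditive.zsmul_comp, Preadditive.sub_comp, Category.assoc,
      (hh p' p _ _ _ hv1).2.2 hc, (hh p' p _ _ _ hv2).2.2 (fun h => hc ((hC m l (hl l hl')).1 h)),
      comp_zero, sub_zero, smul_zero]

end CoxData

end ToricBGG

namespace ToricBGG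

namespace CoxData

variable {ι A P : Type} [Fintype ι] [LinearOrder ι] [AddCommGroup A] [SemilatticeInf P]
  (X : CoxData ι A P) {k : Type u} [Field k] (F : X.Mod k)

/-- The span of the summands of the sections of `RObj F p` that satisfy a condition. -/
def genSpan (z : (X.prod X).Loc) (p : ℤ) (π : Finset ι → (ι → ℤ) → Prop) :
    Submodule k ((X.RObj F p).obj z) :=
  Submodule.span k {x | ∃ I m w, X.GenValid z p I m w ∧ π I m ∧ ∃ t, x = X.gen F z p I m w t}

/-- Every cycle in the span of the summands that satisfy `π` is homologous to an element of the
span of the summands that satisfy `π'`. -/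
def Reduces (z : (X.prod X).Loc) (π π' : Finset ι → (ι → ℤ) → Prop) : Prop :=
  ∀ (p p' : ℤ) (_ : p' + 1 = p) (x : (X.RObj F p).obj z), x ∈ X.genSpan F z p π →
    X.rD F z p p' x = 0 → ∃ u, x - X.rD F z (p + 1) p u ∈ X.genSpan F z p π'

variable {X F}

theorem genSpan_mono {z : (X.prod X).Loc} {p : ℤ} {π π' : Finset ι → (ι → ℤ) → Prop}
    (h : ∀ I m, π I m → π' I m) : X.genSpan F z p π ≤ X.genSpan F z p π' :=
  Submodule.span_mono fun _ ⟨I, m, w, hv, hπ, t, ht⟩ => ⟨I, m, w, hv, h I m hπ, t, ht⟩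

theorem gen_mem_genSpan {z : (X.prod X).Loc} {p : ℤ} {π : Finset ι → (ι → ℤ) → Prop}
    {I : Finset ι} {m : ι → ℤ} {w : A} (h : π I m) (t : F.obj ⟨z.chart.1, w⟩) :
    X.gen F z p I m w t ∈ X.genSpan F z p π := by
  by_cases hv : X.GenValid z p I m w
  · exact Submodule.subset_span ⟨I, m, w, hv, h, t, rfl⟩
  · rw [gen_of_not_valid X F hv]
    exact zero_mem _

theorem genMul_mem_genSpan {z : (X.prod X).Loc} {p : ℤ} {π : Finset ι → (ι → ℤ) → Prop}
    {I : Finset ι} {m : ι → ℤ} {w : A} (h : π I m) (r : ι → ℤ) (t : F.obj ⟨z.chart.1, w⟩) :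
    X.genMul F z p I m w r t ∈ X.genSpan F z p π := by
  unfold genMul
  split_ifs with hr
  · exact gen_mem_genSpan h _
  · exact zero_mem _

theorem rD_rD (z : (X.prod X).Loc) (p p' p'' : ℤ) (x : (X.RObj F p).obj z) :
    X.rD F z p' p'' (X.rD F z p p' x) = 0 :=
  congrArg (fun f : X.RObj F p ⟶ X.RObj F p'' => f.app z x)
    (((X.tensorR k).obj ((X.pullbackFst X k).obj F)).d_comp_d p p' p'')

theorem Reduces.refl {z : (X.prod X).Loc} {π π' : Finset ι → (ι → ℤ) → Prop}
    (h : ∀ I m, π I m → π' I m) : X.Reduces F z π π' := fun p _ _ x hx _ =>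
  ⟨0, by rw [map_zero, sub_zero]; exact genSpan_mono h hx⟩

theorem Reduces.trans {z : (X.prod X).Loc} {π π' π'' : Finset ι → (ι → ℤ) → Prop}
    (h : X.Reduces F z π π') (h' : X.Reduces F z π' π'') : X.Reduces F z π π'' := by
  intro p p' hp x hx hdx
  obtain ⟨u, hu⟩ := h p p' hp x hx hdx
  obtain ⟨v, hv⟩ := h' p p' hp _ hu (by rw [map_sub, hdx, rD_rD, sub_zero])
  exact ⟨u + v, by rwa [map_add, ← sub_sub]⟩

theorem Reduces.of_homotopy {z : (X.prod X).Loc} {π π' : Finset ι → (ι → ℤ) → Prop}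
    (h : ∀ p p' : ℤ, (X.RObj F p).obj z ⟶ (X.RObj F p').obj z) (ε : ℤ)
    (H : ∀ (p p' : ℤ) (_ : p' + 1 = p) I m w, X.GenValid z p I m w → π I m → ∀ t,
      (X.gen F z p I m w - ε • (X.gen F z p I m w ≫
        (h p (p + 1) ≫ X.rD F z (p + 1) p + X.rD F z p p' ≫ h p' p))) t ∈ X.genSpan F z p π') :
    X.Reduces F z π π' := by
  intro p p' hp x hx hdx
  let T : (X.RObj F p).obj z ⟶ (X.RObj F p).obj z :=
    𝟙 _ - ε • (h p (p + 1) ≫ X.rD F z (p + 1) p + X.rD F z p p' ≫ h p' p)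
  have hT : X.genSpan F z p π ≤ (X.genSpan F z p π').comap T.hom := by
    refine Submodule.span_le.2 ?_
    rintro _ ⟨I, m, w, hv, hπ, t, rfl⟩
    have := H p p' hp I m w hv hπ t
    rw [← Preadditive.comp_zsmul] at this
    exact this
  have hTx := hT hx
  refine ⟨ε • h p (p + 1) x, ?_⟩
  have e : T x = x - X.rD F z (p + 1) p (ε • h p (p + 1) x) := by
    have e1 : T x = x - ε • (X.rD F z (p + 1) p (h p (p + 1) x) +
      h p' p (X.rD F z p p' x)) := by
      change x - (ε • (h p (p + 1) ≫ X.rD F z (p + 1) p + X.rD F z p p' ≫ h p' p)) x = _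
      congr 1
    rw [e1, hdx, map_zero, add_zero, map_zsmul]
  rw [← e]
  exact hTx

theorem Reduces.raise {z : (X.prod X).Loc} {i : ι} (hi : i ∉ X.supp z.chart.1)
    {π π' : Finset ι → (ι → ℤ) → Prop} (h : ∀ I m, π I m → π' I (m + Pi.single i 1)) :
    X.Reduces F z π π' := by
  classical
  have hr : ∀ l ∈ X.supp z.chart.1, 0 ≤ (-Pi.single i 1 : ι → ℤ) l := fun l hl => by
    have : l ≠ i := fun h => hi (h ▸ hl)
    simp [this]
  obtain ⟨f, hf⟩ := exists_shiftHomotopy (F := F) z i 0 (-Pi.single i 1) (fun _ => True)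
  refine Reduces.of_homotopy f 1 fun p p' hp I m w hv hπ t => ?_
  have key : X.gen F z p I m w ≫ (f p (p + 1) ≫ X.rD F z (p + 1) p + X.rD F z p p' ≫ f p' p) =
      X.gen F z p I m w - X.genMul F z p I (m + Pi.single i 1) w (-Pi.single i 1) := by
    by_cases hiI : i ∈ I
    · rw [hf.comm_of_mem hr hp hv hiI, if_pos trivial, if_pos trivial, add_zero, add_zero,
        neg_add_cancel, genMul_zero]
    · rw [hf.comm_of_notMem hr (fun _ _ _ => Iff.rfl) hp hv hiI (fun _ => ?_), if_pos trivial,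
        add_zero, neg_add_cancel, genMul_zero]
      refine ⟨?_, fun l hl => ?_, ?_, ?_⟩
      · rw [Finset.card_insert_of_notMem hiI, ← hv.card]
        push_cast
        ring
      · rw [add_zero]; exact hv.nonneg l hl
      · rw [add_zero]; exact hv.eff
      · have e1 : X.wtExp (-Pi.single i 1) = - X.deg i := by
          simp [wtExp, Pi.single_apply]
        have e2 : X.wtSum (insert i I) = X.deg i + X.wtSum I := Finset.sum_insert hiI
        rw [add_zero, hv.wt, e1, e2]
        abel
  rw [key, one_smul, sub_sub_cancel]
  exact genMul_mem_genSpan (h I m hπ) _ _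

theorem eff_of_le {a : A} {v m : ι → ℤ} (hv : X.wtExp v - a ∈ X.Eff) (h : v ≤ m) :
    X.wtExp m - a ∈ X.Eff := by
  have e : X.wtExp m - a = (X.wtExp v - a) + ∑ i, (m i - v i).toNat • X.deg i := by
    have : ∑ i, (m i - v i).toNat • X.deg i = X.wtExp m - X.wtExp v := by
      unfold wtExp
      rw [← Finset.sum_sub_distrib]
      refine Finset.sum_congr rfl fun i _ => ?_
      rw [← natCast_zsmul, Int.toNat_of_nonneg (sub_nonneg.2 (h i)), sub_smul]
    rw [this]; abel
  rw [e]
  exact add_mem hv (sum_mem fun i _ => nsmul_mem (X.deg_mem_Eff i) _)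

theorem Reduces.lower {z : (X.prod X).Loc} {v : ι → ℤ} (hv0 : ∀ i ∈ X.supp z.chart.2, 0 ≤ v i)
    (hvE : X.wtExp v - z.wt.2 ∈ X.Eff) {i : ι} {π π' : Finset ι → (ι → ℤ) → Prop}
    (h0 : ∀ I m, π I m → v ≤ m)
    (h1 : ∀ I m, π I m → v i < m i → π' I (m - Pi.single i 1))
    (h2 : ∀ I m, π I m → v i = m i → i ∉ I → π' I m) :
    X.Reduces F z π π' := by
  classical
  have hr : ∀ l ∈ X.supp z.chart.1, 0 ≤ (0 : ι → ℤ) l := fun l hl => le_rfl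
  obtain ⟨f, hf⟩ := exists_shiftHomotopy (F := F) z i (-Pi.single i 1) 0 (fun m => v i < m i)
  refine Reduces.of_homotopy f (-1) fun p p' hp I m w hv hπ t => ?_
  have hvm := h0 I m hπ
  have hvi : v i < (m + Pi.single i 1 : ι → ℤ) i := by
    have := hvm i
    simp
    omega
  by_cases hiI : i ∈ I
  · rw [hf.comm_of_mem hr hp hv hiI, if_pos hvi, neg_smul, one_smul, sub_neg_eq_add,
      add_neg_cancel_right, genMul_zero, zero_add]
    split_ifs with hc
    · rw [add_sub_cancel]
      exact genMul_mem_genSpan (h1 I m hπ hc) _ _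
    · rw [zero_sub, add_neg_cancel]
      exact zero_mem _
  · rw [hf.comm_of_notMem hr (fun m l hl => by simp [hl.symm]) hp hv hiI
      (fun hc => ?_), neg_smul, one_smul, sub_neg_eq_add]
    · split_ifs with hc
      · rw [neg_add_cancel_right, genMul_zero, add_sub_cancel]
        exact genMul_mem_genSpan (h1 I m hπ hc) _ _
      · rw [add_zero]
        exact gen_mem_genSpan (h2 I m hπ (le_antisymm (hvm i) (not_lt.1 hc)) hiI) _
    · have hle : v ≤ m + -Pi.single i 1 := by
        intro l
        by_cases hl : l = i
        · subst hl
          simp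
          omega
        · simpa [hl] using hvm l
      refine ⟨?_, fun l hl => (hv0 l hl).trans (hle l), eff_of_le hvE hle, ?_⟩
      · rw [Finset.card_insert_of_notMem hiI, ← hv.card]
        push_cast
        ring
      · have e1 : X.wtExp (-Pi.single i 1) = - X.deg i := by
          simp [wtExp, Pi.single_apply]
        have e2 : X.wtSum (insert i I) = X.deg i + X.wtSum I := Finset.sum_insert hiI
        have e3 : X.wtExp (0 : ι → ℤ) = 0 := by simp [wtExp]
        rw [hv.wt, wtExp_add, e1, e2, e3]
        abel

theorem Reduces.raise_add {z : (X.prod X).Loc} (e : ι → ℕ) (he : ∀ i ∈ X.supp z.chart.1, e i = 0)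
    (u : ι → ℤ) : X.Reduces F z (fun _ m => u ≤ m) (fun _ m => u + (fun i => (e i : ℤ)) ≤ m) := by
  have hs : (fun i => (e i : ℤ)) = ∑ i, e i • (Pi.single i 1 : ι → ℤ) := by
    funext l
    simp [Finset.sum_apply, Pi.single_apply]
  have H : ∀ u : ι → ℤ, X.Reduces F z (fun _ m => u ≤ m)
      (fun _ m => u + ∑ i, e i • (Pi.single i 1 : ι → ℤ) ≤ m) := by
    refine Finset.sum_induction (fun i => e i • (Pi.single i 1 : ι → ℤ))
      (fun e => ∀ u, X.Reduces F z (fun _ m => u ≤ m) (fun _ m => u + e ≤ m)) ?_ ?_ ?_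
    · intro a b ha hb u
      rw [← add_assoc]
      exact (ha u).trans (hb (u + a))
    · intro u
      rw [add_zero]
      exact Reduces.refl fun _ _ => id
    · intro i _
      by_cases hi : i ∈ X.supp z.chart.1
      · intro u
        rw [he i hi, zero_smul, add_zero]
        exact Reduces.refl fun _ _ => id
      · induction e i with
        | zero =>
          intro u
          rw [zero_smul, add_zero]
          exact Reduces.refl fun _ _ => id
        | succ n ih =>
          intro u
          refine (ih u).trans (Reduces.raise hi fun _ m hm => ?_)
          rw [succ_nsmul, ← add_assoc]
          exact add_le_add_left hm _
  rw [hs]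
  exact H u

theorem Reduces.lower_to {z : (X.prod X).Loc} {v : ι → ℤ} (hv0 : ∀ i ∈ X.supp z.chart.2, 0 ≤ v i)
    (hvE : X.wtExp v - z.wt.2 ∈ X.Eff) (b : ι → ℤ) (S : Finset ι) :
    X.Reduces F z (fun _ m => v ≤ m ∧ m ≤ b)
      (fun I m => (v ≤ m ∧ m ≤ b) ∧ ∀ l ∈ S, l ∉ I ∧ v l = m l) := by
  have hsub : ∀ {m : ι → ℤ} {i : ι}, v ≤ m → v i < m i → v ≤ m - Pi.single i 1 := by
    intro m i hm hi l
    by_cases hl : l = i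
    · subst hl
      simp
      omega
    · simpa [hl] using hm l
  have hsub' : ∀ (m : ι → ℤ) (i : ι), m - Pi.single i 1 ≤ m := fun m i l => by
    have := single_nonneg i l
    simpa using this
  induction S using Finset.induction_on with
  | empty => exact Reduces.refl fun _ _ h => ⟨h, fun l hl => absurd hl (Finset.notMem_empty l)⟩
  | insert i S hi ih =>
    refine ih.trans ?_
    have step : ∀ n : ℕ, X.Reduces F z
        (fun I m => ((v ≤ m ∧ m ≤ b) ∧ ∀ l ∈ S, l ∉ I ∧ v l = m l) ∧ m i ≤ v i + n)
        (fun I m => (v ≤ m ∧ m ≤ b) ∧ ∀ l ∈ insert i S, l ∉ I ∧ v l = m l) := by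
      have hS : ∀ {I : Finset ι} {m : ι → ℤ}, (∀ l ∈ S, l ∉ I ∧ v l = m l) →
          ∀ l ∈ S, l ∉ I ∧ v l = (m - Pi.single i 1 : ι → ℤ) l := fun h l hl => by
        have hli : l ≠ i := fun h => hi (h ▸ hl)
        simpa [hli] using h l hl
      intro n
      induction n with
      | zero =>
        refine Reduces.lower hv0 hvE (i := i) (fun _ _ h => h.1.1.1) (fun I m h hlt => ?_)
          (fun I m h heq hiI => ⟨h.1.1, fun l hl => ?_⟩)
        · exact absurd h.2 (by push_cast; omega)
        · rcases Finset.mem_insert.1 hl with rfl | hl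
          · exact ⟨hiI, heq⟩
          · exact h.1.2 l hl
      | succ n ihn =>
        refine Reduces.trans (Reduces.lower hv0 hvE (i := i) (fun _ _ h => h.1.1.1)
          (fun I m h hlt => ⟨⟨⟨hsub h.1.1.1 hlt, (hsub' m i).trans h.1.1.2⟩, hS h.1.2⟩, ?_⟩)
          (fun I m h heq hiI => ⟨h.1, ?_⟩)) ihn
        · have := h.2
          push_cast at this
          simp
          omega
        · omega
    refine (Reduces.refl fun I m h => ⟨h, ?_⟩).trans (step (b i - v i).toNat)
    have h1 : m i ≤ b i := h.1.2 i
    have h2 : v i ≤ m i := h.1.1 i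
    omega

theorem exists_bounds {z : (X.prod X).Loc} {p : ℤ} (x : (X.RObj F p).obj z) :
    ∃ u b : ι → ℤ, (∀ i ∈ X.supp z.chart.2, 0 ≤ u i) ∧
      x ∈ X.genSpan F z p (fun _ m => u ≤ m ∧ m ≤ b) := by
  have htop : X.genSpan F z p (fun _ _ => True) = ⊤ := by
    by_contra hne
    have e : ModuleCat.ofHom (X.genSpan F z p (fun _ _ => True)).mkQ = 0 := by
      refine gen_hom_ext fun I m w hv => ?_
      ext t
      exact (Submodule.Quotient.mk_eq_zero _).2 (gen_mem_genSpan trivial t)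
    refine hne (eq_top_iff.2 fun y _ => ?_)
    have := congrArg (fun f => f y) e
    exact (Submodule.Quotient.mk_eq_zero _).1 this
  have hx : x ∈ X.genSpan F z p (fun _ _ => True) := by rw [htop]; trivial
  refine Submodule.span_induction ?_ ?_ ?_ ?_ hx
  · rintro _ ⟨I, m, w, hv, -, t, rfl⟩
    exact ⟨m, m, hv.nonneg, gen_mem_genSpan ⟨le_rfl, le_rfl⟩ t⟩
  · exact ⟨0, 0, fun _ _ => le_rfl, zero_mem _⟩
  · rintro x y - - ⟨u, b, hu, hx⟩ ⟨u', b', hu', hy⟩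
    refine ⟨u ⊓ u', b ⊔ b', fun i hi => le_inf (hu i hi) (hu' i hi), add_mem ?_ ?_⟩
    · exact genSpan_mono (fun _ m h => ⟨inf_le_left.trans h.1, h.2.trans le_sup_left⟩) hx
    · exact genSpan_mono (fun _ m h => ⟨inf_le_right.trans h.1, h.2.trans le_sup_right⟩) hy
  · rintro a x - ⟨u, b, hu, hx⟩
    exact ⟨u, b, hu, Submodule.smul_mem _ _ hx⟩

end CoxData

end ToricBGG

namespace ToricBGG

namespace CoxData

variable {ι A P : Type} [Fintype ι] [LinearOrder ι] [AddCommGroup A] [SemilatticeInf P]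
  (X : CoxData ι A P) {k : Type u} [Field k] (F : X.Mod k)

/-- The pullback of charts, degrees and monomials along the diagonal. -/
def diagonal : (X.prod X).Loc ⥤ X.Loc where
  obj z := ⟨z.chart.1 ⊓ z.chart.2, z.wt.1 + z.wt.2⟩
  map {z z'} f := ⟨inf_le_inf f.chart_le.1 f.chart_le.2,
    f.exp ∘ Sum.inl + f.exp ∘ Sum.inr, fun i hi => add_nonneg
      (((X.prodFst X).map f).nonneg i (X.supp_mono inf_le_left hi))
      (((X.prodSnd X).map f).nonneg i (X.supp_mono inf_le_right hi)), by
      have h1 : z.wt.1 + X.wtExp (f.exp ∘ Sum.inl) = z'.wt.1 := ((X.prodFst X).map f).wt_add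
      have h2 : z.wt.2 + X.wtExp (f.exp ∘ Sum.inr) = z'.wt.2 := ((X.prodSnd X).map f).wt_add
      change z.wt.1 + z.wt.2 + X.wtExp (f.exp ∘ Sum.inl + f.exp ∘ Sum.inr) = z'.wt.1 + z'.wt.2
      rw [wtExp_add, ← h1, ← h2]
      abel⟩
  map_id z := X.loc_hom_ext (add_zero _)
  map_comp f g := X.loc_hom_ext (by
    exact add_add_add_comm (f.exp ∘ Sum.inl) (g.exp ∘ Sum.inl) (f.exp ∘ Sum.inr)
      (g.exp ∘ Sum.inr))

/-- The pushforward of a sheaf along the diagonal. -/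
abbrev diagPush (k : Type u) [Field k] : X.Mod k ⥤ (X.prod X).Mod k :=
  (Functor.whiskeringLeft _ _ _).obj X.diagonal

variable {X} in
theorem GenValid.exists_hom {z : (X.prod X).Loc} {I : Finset ι} {m : ι → ℤ} {w : A}
    (hv : X.GenValid z 0 I m w) :
    ∃ g : (⟨z.chart.1, w⟩ : X.Loc) ⟶ X.diagonal.obj z, g.exp = m := by
  have hI : I = ∅ := Finset.card_eq_zero.1 (by exact_mod_cast hv.card)
  subst hI
  refine ⟨⟨inf_le_left, m, fun i hi => hv.nonneg i (X.supp_mono inf_le_right hi), ?_⟩, rfl⟩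
  have hs : X.wtSum ∅ = 0 := Finset.sum_empty
  change w + X.wtExp m = z.wt.1 + z.wt.2
  rw [hv.wt, hs]
  abel

theorem exists_aug : ∃ ε : X.RObj F 0 ⟶ (X.diagPush k).obj F,
    ∀ (z : (X.prod X).Loc) (I : Finset ι) (m : ι → ℤ) (w : A), X.GenValid z 0 I m w →
      ∀ g : (⟨z.chart.1, w⟩ : X.Loc) ⟶ X.diagonal.obj z, g.exp = m →
        X.gen F z 0 I m w ≫ ε.app z = F.map g := by
  classical
  choose ε hε using fun z => exists_gen_desc (F := F) (Y := F.obj (X.diagonal.obj z)) z 0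
    (fun _ m w => if h : ∃ g : (⟨z.chart.1, w⟩ : X.Loc) ⟶ X.diagonal.obj z, g.exp = m then
      F.map h.choose else 0)
  have key : ∀ (z : (X.prod X).Loc) (I : Finset ι) (m : ι → ℤ) (w : A), X.GenValid z 0 I m w →
      ∀ g : (⟨z.chart.1, w⟩ : X.Loc) ⟶ X.diagonal.obj z, g.exp = m →
        X.gen F z 0 I m w ≫ ε z = F.map g := by
    intro z I m w hv g hg
    have h : ∃ g : (⟨z.chart.1, w⟩ : X.Loc) ⟶ X.diagonal.obj z, g.exp = m := ⟨g, hg⟩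
    rw [hε z I m w hv, dif_pos h]
    exact congrArg F.map (X.loc_hom_ext (h.choose_spec.trans hg.symm))
  refine ⟨⟨ε, fun z z' f => gen_hom_ext fun I m w hv => ?_⟩, key⟩
  obtain ⟨g, hg⟩ := hv.exists_hom
  have hI : I = ∅ := Finset.card_eq_zero.1 (by exact_mod_cast hv.card)
  let f₁ : (⟨z.chart.1, w⟩ : X.Loc) ⟶ ⟨z'.chart.1, w + X.wtExp (f.exp ∘ Sum.inl)⟩ :=
    X.monHom f.chart_le.1 _ ((X.prodFst X).map f).nonneg rfl
  have hv' : X.GenValid z' 0 I (m + f.exp ∘ Sum.inr) (w + X.wtExp (f.exp ∘ Sum.inl)) := by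
    have hw1 : z.wt.1 + X.wtExp (f.exp ∘ Sum.inl) = z'.wt.1 := ((X.prodFst X).map f).wt_add
    have hw2 : z.wt.2 + X.wtExp (f.exp ∘ Sum.inr) = z'.wt.2 := ((X.prodSnd X).map f).wt_add
    have e : X.wtExp (m + f.exp ∘ Sum.inr) - z'.wt.2 = X.wtExp m - z.wt.2 := by
      rw [wtExp_add, ← hw2]; abel
    refine ⟨hv.card, fun i hi => add_nonneg (hv.nonneg i (X.supp_mono f.chart_le.2 hi))
      (((X.prodSnd X).map f).nonneg i hi), ?_, ?_⟩
    · rw [e]; exact hv.eff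
    · rw [e, hv.wt, ← hw1]; abel
  obtain ⟨g', hg'⟩ := hv'.exists_hom
  rw [← Category.assoc, gen_map f hv f₁ rfl rfl, Category.assoc, key z' _ _ _ hv' g' hg',
    ← Category.assoc, key z _ _ _ hv g hg, ← F.map_comp]
  refine Eq.trans ?_ (F.map_comp g (X.diagonal.map f))
  refine congrArg F.map (X.loc_hom_ext ?_)
  rw [comp_exp, comp_exp, hg, hg']
  change f.exp ∘ Sum.inl + (m + f.exp ∘ Sum.inr) = m + (f.exp ∘ Sum.inl + f.exp ∘ Sum.inr)
  abel

/-- The augmentation `π₁^* F ⊗ ℛ_0 ⟶ Δ_* F`. -/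
def aug : X.RObj F 0 ⟶ (X.diagPush k).obj F := (X.exists_aug F).choose

theorem gen_aug {z : (X.prod X).Loc} {I : Finset ι} {m : ι → ℤ} {w : A}
    (hv : X.GenValid z 0 I m w) (g : (⟨z.chart.1, w⟩ : X.Loc) ⟶ X.diagonal.obj z)
    (hg : g.exp = m) : X.gen F z 0 I m w ≫ (X.aug F).app z = F.map g :=
  (X.exists_aug F).choose_spec z I m w hv g hg

theorem d_aug : ((X.tensorR k).obj ((X.pullbackFst X k).obj F)).d 1 0 ≫ X.aug F = 0 := by
  ext z : 2
  refine gen_hom_ext fun I m w hv => ?_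
  refine (Category.assoc _ _ _).symm.trans ?_
  refine (congrArg (· ≫ (X.aug F).app z) (gen_d (p := 1) (p' := 0) rfl hv)).trans ?_
  refine (Preadditive.sum_comp _ _ _).trans ?_
  refine (Finset.sum_eq_zero fun i hi => ?_).trans comp_zero.symm
  obtain ⟨hv1, hv2⟩ := hv.mul (p' := 0) rfl hi
  obtain ⟨g1, hg1⟩ := hv1.exists_hom
  obtain ⟨g2, hg2⟩ := hv2.exists_hom
  rw [Preadditive.zsmul_comp, Preadditive.sub_comp, Category.assoc, X.gen_aug F hv1 g1 hg1,
    X.gen_aug F hv2 g2 hg2, ← F.map_comp]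
  have e : varHom X i z.chart.1 w ≫ g1 = g2 := by
    refine X.loc_hom_ext ?_
    rw [comp_exp, hg1, hg2]
    exact add_comm _ _
  rw [e, sub_self, smul_zero]

variable {X F}

theorem d_aug_apply {z : (X.prod X).Loc} (u : (X.RObj F 1).obj z) :
    (X.aug F).app z (X.rD F z 1 0 u) = 0 :=
  congrArg (fun f : X.RObj F 1 ⟶ (X.diagPush k).obj F => f.app z u) (X.d_aug F)

theorem rObj_subsingleton {z : (X.prod X).Loc} {p : ℤ} (hp : p < 0 ∨ (Fintype.card ι : ℤ) < p)
    (x : (X.RObj F p).obj z) : x = 0 := by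
  have e : 𝟙 ((X.RObj F p).obj z) = 0 := gen_hom_ext fun I m w hv => by
    have h1 := hv.card
    have h2 := Finset.card_le_univ I
    omega
  exact congrArg (fun f => f x) e

/-- The condition that every degree becomes effective after multiplication with a monomial that is
invertible on a given chart. -/
def EnoughUnits (X : CoxData ι A P) : Prop :=
  ∀ (p : P) (a : A), ∃ e : ι → ℕ, (∀ i ∈ X.supp p, e i = 0) ∧
    a + X.wtExp (fun i => (e i : ℤ)) ∈ X.Eff

/-- Every cycle is homologous to an element of a single summand. -/
theorem exists_homologous (hX : X.EnoughUnits) {z : (X.prod X).Loc} {p p' : ℤ} (hp : p' + 1 = p)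
    (x : (X.RObj F p).obj z) (hx : X.rD F z p p' x = 0) :
    ∃ v : ι → ℤ, (∀ i ∈ X.supp z.chart.2, 0 ≤ v i) ∧ X.wtExp v - z.wt.2 ∈ X.Eff ∧
      ∃ u, x - X.rD F z (p + 1) p u ∈ X.genSpan F z p (fun I m => I = ∅ ∧ m = v) := by
  obtain ⟨u, b, hu, hxu⟩ := exists_bounds x
  obtain ⟨e, he, heE⟩ := hX z.chart.1 (X.wtExp u - z.wt.2)
  let v : ι → ℤ := u + fun i => (e i : ℤ)
  have hv0 : ∀ i ∈ X.supp z.chart.2, 0 ≤ v i := fun i hi =>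
    add_nonneg (hu i hi) (Int.natCast_nonneg _)
  have hvE : X.wtExp v - z.wt.2 ∈ X.Eff := by
    rw [wtExp_add, add_sub_right_comm]
    exact heE
  refine ⟨v, hv0, hvE, ?_⟩
  obtain ⟨y, hy⟩ := Reduces.raise_add e he u p p' hp x (genSpan_mono (fun _ _ h => h.1) hxu) hx
  obtain ⟨b'', hb''⟩ : ∃ b'' : ι → ℤ,
      x - X.rD F z (p + 1) p y ∈ X.genSpan F z p (fun _ m => v ≤ m ∧ m ≤ b'') := by
    refine Submodule.span_induction ?_ ?_ ?_ ?_ hy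
    · rintro _ ⟨I, m, w, hv, hm, t, rfl⟩
      exact ⟨m, gen_mem_genSpan ⟨hm, le_rfl⟩ t⟩
    · exact ⟨0, zero_mem _⟩
    · rintro x y - - ⟨b, hx⟩ ⟨b', hy⟩
      exact ⟨b ⊔ b', add_mem (genSpan_mono (fun _ m h => ⟨h.1, h.2.trans le_sup_left⟩) hx)
        (genSpan_mono (fun _ m h => ⟨h.1, h.2.trans le_sup_right⟩) hy)⟩
    · rintro a x - ⟨b, hx⟩
      exact ⟨b, Submodule.smul_mem _ _ hx⟩
  obtain ⟨y', hy'⟩ := Reduces.lower_to hv0 hvE b'' Finset.univ p p' hp _ hb''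
    (by rw [map_sub, hx, rD_rD, sub_zero])
  refine ⟨y + y', ?_⟩
  rw [map_add, ← sub_sub]
  refine genSpan_mono (fun I m h => ⟨?_, ?_⟩) hy'
  · exact Finset.eq_empty_of_forall_notMem fun l => (h.2 l (Finset.mem_univ l)).1
  · exact funext fun l => ((h.2 l (Finset.mem_univ l)).2).symm

theorem exists_boundary_of_pos (hX : X.EnoughUnits) {z : (X.prod X).Loc} {p p' : ℤ}
    (hp : p' + 1 = p) (h0 : 0 < p) (x : (X.RObj F p).obj z) (hx : X.rD F z p p' x = 0) :
    ∃ u, X.rD F z (p + 1) p u = x := by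
  obtain ⟨v, -, -, u, hu⟩ := exists_homologous hX hp x hx
  refine ⟨u, (sub_eq_zero.1 ?_).symm⟩
  have : X.genSpan F z p (fun I m => I = ∅ ∧ m = v) ≤ ⊥ := by
    refine Submodule.span_le.2 ?_
    rintro _ ⟨I, m, w, hv, ⟨rfl, -⟩, t, rfl⟩
    have := hv.card
    simp at this
    omega
  exact (Submodule.mem_bot k).1 (this hu)

theorem mem_genSpan_single {z : (X.prod X).Loc} {p : ℤ} {v : ι → ℤ}
    {w : A} (hw : X.GenValid z p ∅ v w) {x : (X.RObj F p).obj z}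
    (hx : x ∈ X.genSpan F z p (fun I m => I = ∅ ∧ m = v)) : ∃ t, x = X.gen F z p ∅ v w t := by
  have : X.genSpan F z p (fun I m => I = ∅ ∧ m = v) ≤ LinearMap.range (X.gen F z p ∅ v w).hom := by
    refine Submodule.span_le.2 ?_
    rintro _ ⟨I, m, w', hv', ⟨rfl, rfl⟩, t, rfl⟩
    obtain rfl := hv'.wt.trans hw.wt.symm
    exact ⟨t, rfl⟩
  obtain ⟨t, ht⟩ := this hx
  exact ⟨t, ht.symm⟩

/-- Multiplications by monomials can be moved from one factor to the other up to boundaries. -/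
theorem genMul_sub_mem_range {z : (X.prod X).Loc} {w : A} (e : ι → ℕ) (m r : ι → ℤ)
    (hm : ∀ i ∈ X.supp z.chart.2, 0 ≤ m i) (hE : X.wtExp m - z.wt.2 ∈ X.Eff)
    (hw : w + X.wtExp r = z.wt.1 + z.wt.2 - X.wtExp m)
    (hr : ∀ i ∈ X.supp z.chart.1, (e i : ℤ) ≤ r i) (t : F.obj ⟨z.chart.1, w⟩) :
    X.genMul F z 0 ∅ m w r t - X.genMul F z 0 ∅ (m + fun i => (e i : ℤ)) w
      (r - fun i => (e i : ℤ)) t ∈ LinearMap.range (X.rD F z 1 0).hom := by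
  have hs : (fun i => (e i : ℤ)) = ∑ i, e i • (Pi.single i 1 : ι → ℤ) := by
    funext l
    simp [Finset.sum_apply, Pi.single_apply]
  let Q : (ι → ℤ) → Prop := fun e => 0 ≤ e ∧ ∀ (m r : ι → ℤ)
    (_ : ∀ i ∈ X.supp z.chart.2, 0 ≤ m i) (_ : X.wtExp m - z.wt.2 ∈ X.Eff)
    (_ : w + X.wtExp r = z.wt.1 + z.wt.2 - X.wtExp m)
    (_ : ∀ i ∈ X.supp z.chart.1, e i ≤ r i),
    X.genMul F z 0 ∅ m w r t - X.genMul F z 0 ∅ (m + e) w (r - e) t ∈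
      LinearMap.range (X.rD F z 1 0).hom
  have hQ0 : Q 0 := by
    refine ⟨le_rfl, fun m r _ _ _ _ => ?_⟩
    rw [add_zero, sub_zero, sub_self]
    exact zero_mem _
  have hQadd : ∀ a b, Q a → Q b → Q (a + b) := by
    intro a b ha hb
    refine ⟨add_nonneg ha.1 hb.1, fun m r hm hE hw hr => ?_⟩
    have h1 := ha.2 m r hm hE hw fun i hi =>
      le_trans (le_add_of_nonneg_right (hb.1 i)) (hr i hi)
    have hwt : w + X.wtExp (r - a) = z.wt.1 + z.wt.2 - X.wtExp (m + a) := by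
      have : X.wtExp r = X.wtExp (r - a) + X.wtExp a := by rw [← wtExp_add, sub_add_cancel]
      rw [this] at hw
      rw [wtExp_add, ← sub_sub, ← hw]
      abel
    have h2 := hb.2 (m + a) (r - a) (fun i hi => add_nonneg (hm i hi) (ha.1 i))
      (eff_of_le hE (le_add_of_nonneg_right ha.1)) hwt
      (fun i hi => le_sub_iff_add_le'.2 (hr i hi))
    have h3 := add_mem h1 h2
    rwa [sub_add_sub_cancel, add_assoc, sub_sub] at h3
  have hQi : ∀ i, Q (Pi.single i 1) := by
    intro i
    refine ⟨single_nonneg i, fun m r hm hE hw hr => ?_⟩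
    have hr' : ∀ l ∈ X.supp z.chart.1, 0 ≤ (r - Pi.single i 1 : ι → ℤ) l := fun l hl =>
      sub_nonneg.2 (hr l hl)
    have hv : X.GenValid z 1 {i} m (w + X.wtExp (r - Pi.single i 1)) := by
      refine ⟨by simp, hm, hE, ?_⟩
      have e1 : X.wtSum {i} = X.deg i := Finset.sum_singleton _ _
      have : X.wtExp r = X.wtExp (r - Pi.single i 1) + X.deg i := by
        have := wtExp_single (X := X) i 1
        rw [one_smul] at this
        rw [← this, ← wtExp_add, sub_add_cancel]
      rw [this, ← add_assoc] at hw
      rw [e1, eq_sub_of_add_eq hw]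
      abel
    have e := congrArg (fun f => f t) (genMul_d (F := F) (p := 1) (p' := 0) rfl hr' hv)
    refine ⟨X.genMul F z 1 {i} m w (r - Pi.single i 1) t, e.trans ?_⟩
    have e2 : contractSign i {i} = 1 := by
      unfold contractSign
      rw [Finset.filter_eq_empty_iff.2 (by simp)]
      simp
    have e3 : ({i} : Finset ι).erase i = ∅ := by simp
    rw [Finset.sum_singleton, e2, one_smul, e3, sub_add_cancel]
    rfl
  have hQ : Q (∑ i, e i • (Pi.single i 1 : ι → ℤ)) := by
    refine Finset.sum_induction _ Q hQadd hQ0 fun i _ => ?_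
    induction e i with
    | zero => rw [zero_smul]; exact hQ0
    | succ n ih => rw [succ_nsmul]; exact hQadd _ _ ih (hQi i)
  rw [← hs] at hQ
  exact hQ.2 m r hm hE hw hr

theorem exists_boundary_of_aug_eq_zero (hX : X.EnoughUnits) (hF : X.IsQuasicoherent F)
    {z : (X.prod X).Loc} (x : (X.RObj F 0).obj z) (hx : (X.aug F).app z x = 0) :
    ∃ u, X.rD F z 1 0 u = x := by
  have hx' : X.rD F z 0 (-1) x = 0 := rObj_subsingleton (Or.inl (by norm_num)) _
  obtain ⟨v, hv0, hvE, hu⟩ := exists_homologous hX (p' := -1) (neg_add_cancel 1) x hx'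
  obtain ⟨u, hu⟩ : ∃ u, x - X.rD F z 1 0 u ∈ X.genSpan F z 0 (fun I m => I = ∅ ∧ m = v) := hu
  obtain ⟨w, hw⟩ : ∃ w, X.GenValid z 0 ∅ v w := ⟨_, by simp, hv0, hvE, rfl⟩
  obtain ⟨t, ht⟩ := mem_genSpan_single hw hu
  suffices h : X.gen F z 0 ∅ v w t ∈ LinearMap.range (X.rD F z 1 0).hom by
    obtain ⟨y, hy⟩ := h
    refine ⟨u + y, ?_⟩
    have hy' : X.rD F z 1 0 y = X.gen F z 0 ∅ v w t := hy
    rw [map_add, hy', ← ht]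
    exact add_sub_cancel _ _
  obtain ⟨g, hg⟩ := hw.exists_hom
  have hgt : F.map g t = 0 := by
    have e1 : (X.aug F).app z (X.gen F z 0 ∅ v w t) = F.map g t :=
      congrArg (fun f => f t) (X.gen_aug F hw g hg)
    rw [← e1, ← ht, map_sub, hx, zero_sub, neg_eq_zero]
    exact d_aug_apply u
  classical
  have hsw : w + X.wtExp v = z.wt.1 + z.wt.2 := by
    rw [← hg]
    exact X.exp_add_eq g
  let ρ : ι → ℤ := fun i => if i ∈ X.supp z.chart.1 ∧ i ∈ X.supp z.chart.2 then v i else 0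
  have hρ : ∀ i, 0 ≤ ρ i := fun i => by
    change 0 ≤ ite _ _ _
    split_ifs with h
    · exact hv0 i h.2
    · exact le_rfl
  let a : (⟨z.chart.1, w⟩ : X.Loc) ⟶ ⟨z.chart.1, w + X.wtExp ρ⟩ :=
    X.monHom le_rfl ρ (fun i _ => hρ i) rfl
  have hsupp : ∀ i, i ∈ X.supp (z.chart.1 ⊓ z.chart.2) ↔
      i ∈ X.supp z.chart.1 ∧ i ∈ X.supp z.chart.2 := fun i => by
    rw [X.supp_inf, Finset.mem_inter]
  let b : X.diagonal.obj z ⟶ ⟨z.chart.1 ⊓ z.chart.2, w + X.wtExp ρ⟩ :=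
    X.monHom le_rfl (ρ - v) (fun i hi => by
      change 0 ≤ ite _ _ _ - v i
      rw [if_pos ((hsupp i).1 hi), sub_self]) (by
      rw [← hsw, add_assoc, ← wtExp_add, add_sub_cancel])
  have hab : a ≫ res inf_le_left (w + X.wtExp ρ) = g ≫ b := by
    refine X.loc_hom_ext ?_
    rw [comp_exp, comp_exp, hg]
    change ρ + 0 = v + (ρ - v)
    abel
  have h0 : F.map (res (inf_le_left : z.chart.1 ⊓ z.chart.2 ≤ z.chart.1) (w + X.wtExp ρ))
      (F.map a t) = 0 := by
    have e1 := congrArg (fun f => F.map f t) hab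
    simp only [F.map_comp] at e1
    refine Eq.trans e1 ?_
    exact (congrArg (F.map b) hgt).trans (map_zero _)
  obtain ⟨b', n, hn, hnt⟩ := (hF z.chart.1 (z.chart.1 ⊓ z.chart.2) inf_le_left _).1 _ h0
  obtain ⟨e, he, heE⟩ := hX z.chart.1 (X.wtExp (v - fun i =>
    if i ∈ X.supp z.chart.1 then ρ i + n.exp i else 0) - z.wt.2)
  let r : ι → ℤ := fun i => if i ∈ X.supp z.chart.1 then ρ i + n.exp i else -e i
  have hr0 : ∀ i ∈ X.supp z.chart.1, 0 ≤ r i := fun i hi => by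
    change 0 ≤ ite _ _ _
    rw [if_pos hi]
    exact add_nonneg (hρ i) (n.nonneg i hi)
  have hve : v - r = (v - fun i => if i ∈ X.supp z.chart.1 then ρ i + n.exp i else 0) +
      fun i => (e i : ℤ) := by
    funext i
    change v i - ite _ _ _ = v i - ite _ _ _ + _
    split_ifs with h
    · exact (by rw [he i h]; simp : v i - (ρ i + n.exp i) = v i - (ρ i + n.exp i) + (e i : ℤ))
    · simp
  have hE' : X.wtExp (v - r) - z.wt.2 ∈ X.Eff := by
    rw [hve, wtExp_add, add_sub_right_comm]
    exact heE
  have hvr : ∀ i ∈ X.supp z.chart.2, 0 ≤ (v - r) i := by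
    intro i hi
    change 0 ≤ v i - ite _ _ _
    split_ifs with h
    · have h1 : ρ i = v i := if_pos ⟨h, hi⟩
      rw [h1, hn i ((hsupp i).2 ⟨h, hi⟩)]
      simp
    · have := hv0 i hi
      omega
  have hz : X.genMul F z 0 ∅ (v - r) w r t = 0 := by
    let c : (⟨z.chart.1, b'⟩ : X.Loc) ⟶ ⟨z.chart.1, w + X.wtExp r⟩ :=
      X.monHom le_rfl (r - (ρ + n.exp)) (fun i hi => by
        change 0 ≤ ite _ _ _ - (ρ i + n.exp i)
        rw [if_pos hi, sub_self]) (by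
        have h1 := X.exp_add_eq n
        change w + X.wtExp ρ + X.wtExp n.exp = b' at h1
        refine (congrArg (· + X.wtExp (r - (ρ + n.exp))) h1.symm).trans ?_
        rw [add_assoc w, ← wtExp_add, add_assoc w, ← wtExp_add, add_sub_cancel])
    have hc : a ≫ n ≫ c = X.monHom le_rfl r hr0 rfl := by
      refine X.loc_hom_ext ?_
      rw [comp_exp, comp_exp]
      change ρ + (n.exp + (r - (ρ + n.exp))) = r
      abel
    have e1 : F.map (X.monHom le_rfl r hr0 rfl) t = 0 := by
      rw [← hc]
      simp only [F.map_comp]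
      exact (congrArg (F.map c) hnt).trans (map_zero _)
    unfold genMul
    rw [dif_pos hr0]
    exact (congrArg (X.gen F z 0 ∅ (v - r) (w + X.wtExp r)).hom e1).trans
      (map_zero (X.gen F z 0 ∅ (v - r) (w + X.wtExp r)).hom)
  have hmax1 : (v - r) + (fun i => ((r i).toNat : ℤ)) = v + fun i => ((-r i).toNat : ℤ) := by
    funext i
    change v i - r i + ((r i).toNat : ℤ) = v i + ((-r i).toNat : ℤ)
    omega
  have hmax2 : r - (fun i => ((r i).toNat : ℤ)) = 0 - fun i => ((-r i).toNat : ℤ) := by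
    funext i
    change r i - ((r i).toNat : ℤ) = 0 - ((-r i).toNat : ℤ)
    omega
  have h1 := genMul_sub_mem_range (F := F) (w := w) (fun i => (r i).toNat) (v - r) r hvr hE'
    (by
      rw [← hsw]
      have : X.wtExp v = X.wtExp (v - r) + X.wtExp r := by rw [← wtExp_add, sub_add_cancel]
      rw [this]; abel) (fun i hi => (Int.toNat_of_nonneg (hr0 i hi)).le) t
  have h2 := genMul_sub_mem_range (F := F) (w := w) (fun i => (-r i).toNat) v 0 hv0 hvE
    (by
      have : X.wtExp (0 : ι → ℤ) = 0 := by simp [wtExp]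
      rw [← hsw, this]; abel) (fun i hi => by
        have := hr0 i hi
        change ((-r i).toNat : ℤ) ≤ 0
        omega) t
  rw [hz, hmax1, hmax2, zero_sub, neg_mem_iff] at h1
  have h3 := add_mem h2 h1
  rwa [sub_add_cancel, genMul_zero] at h3

theorem aug_surjective (hX : X.EnoughUnits) (hF : X.IsQuasicoherent F) {z : (X.prod X).Loc}
    (s : F.obj (X.diagonal.obj z)) : ∃ x, (X.aug F).app z x = s := by
  classical
  obtain ⟨b, n, n', t, hn, hn', ht⟩ :=
    (hF z.chart.1 (z.chart.1 ⊓ z.chart.2) inf_le_left (z.wt.1 + z.wt.2)).2 s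
  let e₁ : ι → ℤ := fun i => if i ∈ X.supp z.chart.1 then 0 else |n.exp i|
  obtain ⟨e, he, heE⟩ := hX z.chart.1 (X.wtExp (e₁ - n.exp) - z.wt.2)
  have hsupp : ∀ i, i ∈ X.supp (z.chart.1 ⊓ z.chart.2) ↔
      i ∈ X.supp z.chart.1 ∧ i ∈ X.supp z.chart.2 := fun i => by
    rw [X.supp_inf, Finset.mem_inter]
  let e₂ : ι → ℤ := e₁ + fun i => (e i : ℤ)
  have he₂ : ∀ i ∈ X.supp z.chart.1, e₂ i = 0 := fun i hi => by
    change ite _ _ _ + (e i : ℤ) = 0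
    rw [if_pos hi, he i hi]
    rfl
  let c : (⟨z.chart.1, b⟩ : X.Loc) ⟶ ⟨z.chart.1, b + X.wtExp (-e₂)⟩ :=
    X.monHom le_rfl (-e₂) (fun i hi => by
      change 0 ≤ -e₂ i
      rw [he₂ i hi, neg_zero]) rfl
  have hb := X.exp_add_eq n
  change z.wt.1 + z.wt.2 + X.wtExp n.exp = b at hb
  have hadd : X.wtExp (-e₂) + X.wtExp n.exp + X.wtExp (e₂ - n.exp) = 0 := by
    rw [← wtExp_add, ← wtExp_add]
    have : -e₂ + n.exp + (e₂ - n.exp) = 0 := by abel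
    rw [this]
    simp [wtExp]
  have hv : X.GenValid z 0 ∅ (e₂ - n.exp) (b + X.wtExp (-e₂)) := by
    refine ⟨by simp, fun i hi => ?_, ?_, ?_⟩
    · change 0 ≤ (ite _ _ _ + (e i : ℤ)) - n.exp i
      split_ifs with h
      · rw [hn i ((hsupp i).2 ⟨h, hi⟩)]
        simp
      · have := le_abs_self (n.exp i)
        omega
    · have : e₂ - n.exp = (e₁ - n.exp) + fun i => (e i : ℤ) := by
        change e₁ + _ - _ = _
        abel
      rw [this, wtExp_add, add_sub_right_comm]
      exact heE
    · have hs : X.wtSum ∅ = 0 := Finset.sum_empty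
      rw [hs, ← sub_eq_zero]
      refine (congrArg (fun y => y + X.wtExp (-e₂) -
        (0 - 0 - (X.wtExp (e₂ - n.exp) - z.wt.2) + z.wt.1)) hb.symm).trans (Eq.trans ?_ hadd)
      abel
  obtain ⟨g, hg⟩ := hv.exists_hom
  refine ⟨X.gen F z 0 ∅ (e₂ - n.exp) (b + X.wtExp (-e₂)) (F.map c t), ?_⟩
  have e1 : (X.aug F).app z (X.gen F z 0 ∅ (e₂ - n.exp) (b + X.wtExp (-e₂)) (F.map c t)) =
      F.map g (F.map c t) := congrArg (fun f => f (F.map c t)) (X.gen_aug F hv g hg)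
  let d : (⟨z.chart.1 ⊓ z.chart.2, b⟩ : X.Loc) ⟶ X.diagonal.obj z :=
    X.monHom le_rfl (-n.exp) (fun i hi => by
      change 0 ≤ - n.exp i
      rw [hn i hi, neg_zero]) (by
      refine (congrArg (· + X.wtExp (-n.exp)) hb.symm).trans ?_
      rw [add_assoc, ← wtExp_add, add_neg_cancel]
      simp [wtExp])
  have h1 : c ≫ g = res inf_le_left b ≫ d := by
    refine X.loc_hom_ext ?_
    rw [comp_exp, comp_exp, hg]
    change -e₂ + (e₂ - n.exp) = 0 + -n.exp
    abel
  have h2 : n' ≫ d = 𝟙 _ := by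
    refine X.loc_hom_ext ?_
    rw [comp_exp, hn']
    exact add_neg_cancel _
  have e2 : F.map g (F.map c t) = F.map d (F.map (res inf_le_left b) t) := by
    have := congrArg (fun f => F.map f t) h1
    simp only [F.map_comp] at this
    exact this
  have e3 : F.map d (F.map n' s) = s := by
    have e : F.map n' ≫ F.map d = 𝟙 _ :=
      (F.map_comp n' d).symm.trans ((congrArg F.map h2).trans (F.map_id _))
    exact congrArg (fun f => f s) e
  rw [e1, e2, ht]
  exact e3

end CoxData

end ToricBGG

namespace ToricBGG

section

variable {J : Type} [SmallCategory J] {k : Type u} [Field k]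

theorem quasiIso_of_evaluation {C D : ChainComplex (J ⥤ ModuleCat.{u} k) ℤ} (φ : C ⟶ D)
    (h : ∀ y, QuasiIso ((((evaluation J (ModuleCat.{u} k)).obj y).mapHomologicalComplex _).map φ)) :
    QuasiIso φ := by
  refine ⟨fun j => ?_⟩
  rw [quasiIsoAt_iff_isIso_homologyMap, NatTrans.isIso_iff_isIso_app]
  intro y
  have e := ShortComplex.mapHomologyIso_hom_naturality
    ((HomologicalComplex.shortComplexFunctor (J ⥤ ModuleCat.{u} k) (ComplexShape.down ℤ) j).map φ)
    ((evaluation J (ModuleCat.{u} k)).obj y)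
  have h1 : IsIso (ShortComplex.homologyMap (((evaluation J (ModuleCat.{u} k)).obj y).mapShortComplex.map
      ((HomologicalComplex.shortComplexFunctor (J ⥤ ModuleCat.{u} k) (ComplexShape.down ℤ) j).map φ))) := by
    have := ((quasiIso_iff _).1 (h y)) j
    rw [quasiIsoAt_iff_isIso_homologyMap] at this
    exact this
  have h2 := IsIso.comp_isIso' h1 (inferInstance : IsIso (ShortComplex.mapHomologyIso
    ((HomologicalComplex.shortComplexFunctor (J ⥤ ModuleCat.{u} k) (ComplexShape.down ℤ) j).obj D)
    ((evaluation J (ModuleCat.{u} k)).obj y)).hom)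
  have h3 : IsIso ((ShortComplex.mapHomologyIso
      ((HomologicalComplex.shortComplexFunctor (J ⥤ ModuleCat.{u} k) (ComplexShape.down ℤ) j).obj C)
      ((evaluation J (ModuleCat.{u} k)).obj y)).hom ≫
      ((evaluation J (ModuleCat.{u} k)).obj y).map (HomologicalComplex.homologyMap φ j)) :=
    (congrArg (fun f => IsIso f) e).mp h2
  exact @IsIso.of_isIso_comp_left _ _ _ _ _ _ _ (Iso.isIso_hom _) h3

end

section

variable {P K V : Type*} [SemilatticeInf P] [Finite K] [Category V] [Preadditive V]
  [HasFiniteProducts V] (c : K → P)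

theorem cech_d (F : Pᵒᵖ ⥤ V) (q : ℕ) (s : Fin (q + 2) → K) :
    ((cech c).obj F).d q (q + 1) ≫
      Pi.π (fun s : Fin ((SimplexCategory.mk (q + 1)).len + 1) → K => F.obj (op (chartInf c s))) s =
      ∑ i : Fin (q + 2), (-1 : ℤ) ^ (i : ℕ) •
        (Pi.π (fun s : Fin ((SimplexCategory.mk q).len + 1) → K => F.obj (op (chartInf c s)))
          (s ∘ (SimplexCategory.δ i).toOrderHom) ≫
        F.map (homOfLE (chartInf_le c (SimplexCategory.δ i) s)).op) := by
  have e : ((cech c).obj F).d q (q + 1) =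
      ∑ i : Fin (q + 2), (-1 : ℤ) ^ (i : ℕ) • ((cechCosimplicial c).obj F).δ i :=
    CochainComplex.of_d (fun n => ((cechCosimplicial c).obj F).obj (SimplexCategory.mk n))
      (AlgebraicTopology.AlternatingCofaceMapComplex.objD ((cechCosimplicial c).obj F)) q
  refine (congrArg (· ≫ _) e).trans ((Preadditive.sum_comp _ _ _).trans ?_)
  refine Finset.sum_congr rfl fun i _ => ?_
  exact (Preadditive.zsmul_comp _ _ _).trans (congrArg _ (Pi.lift_π _ _))

end

namespace CoxData

variable {ι A P : Type} [Fintype ι] [LinearOrder ι] [AddCommGroup A] [SemilatticeInf P]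
  (X : CoxData ι A P) (k : Type u) [Field k] {T : Type} [Finite T] (cc : T → ChartPair P P)

/-- The Čech model of the derived pushforward along the second projection, for a family of
products of charts. -/
def pushCech : (X.prod X).Mod k ⥤ CochainComplex (X.Mod k) ℕ :=
  (Functor.whiskeringLeft _ _ _).obj (X.pushforwardIndex X) ⋙ Functor.curry ⋙ cech cc

instance : (X.pushCech k cc).Additive := by
  have : ((Functor.whiskeringLeft _ _ (ModuleCat.{u} k)).obj (X.pushforwardIndex X) ⋙
    Functor.curry).Additive := ⟨rfl⟩
  exact inferInstanceAs (((Functor.whiskeringLeft _ _ (ModuleCat.{u} k)).obj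
    (X.pushforwardIndex X) ⋙ Functor.curry) ⋙ cech cc).Additive

/-- The chart and the degree that belong to an index of a Čech cochain. -/
abbrev cechLoc {n : ℕ} (s : Fin (n + 1) → T) (y : X.Loc) : (X.prod X).Loc :=
  (X.pushforwardIndex X).obj (op (chartInf (n := SimplexCategory.mk n) cc s), y)

variable {k}

/-- The components of a Čech cochain. -/
def pushProj (H : (X.prod X).Mod k) (q : ℕ) (y : X.Loc) (s : Fin (q + 1) → T) :
    (((X.pushCech k cc).obj H).X q).obj y ⟶ H.obj (X.cechLoc cc s y) :=
  (Pi.π (fun s : Fin ((SimplexCategory.mk q).len + 1) → T =>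
    (Functor.curry.obj (X.pushforwardIndex X ⋙ H)).obj (op (chartInf cc s))) s).app y

variable {X cc} in
theorem push_ext {H : (X.prod X).Mod k} {q : ℕ} {y : X.Loc}
    {a b : (((X.pushCech k cc).obj H).X q).obj y}
    (h : ∀ s, X.pushProj cc H q y s a = X.pushProj cc H q y s b) : a = b :=
  map_pi_ext ((evaluation _ _).obj y) (fun s : Fin ((SimplexCategory.mk q).len + 1) → T =>
    (Functor.curry.obj (X.pushforwardIndex X ⋙ H)).obj (op (chartInf cc s))) h

variable {X cc} in
theorem push_hom_ext {H : (X.prod X).Mod k} {q : ℕ} {y : X.Loc} {Y : ModuleCat.{u} k}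
    {a b : Y ⟶ (((X.pushCech k cc).obj H).X q).obj y}
    (h : ∀ s, a ≫ X.pushProj cc H q y s = b ≫ X.pushProj cc H q y s) : a = b :=
  map_pi_hom_ext ((evaluation _ _).obj y) (fun s : Fin ((SimplexCategory.mk q).len + 1) → T =>
    (Functor.curry.obj (X.pushforwardIndex X ⋙ H)).obj (op (chartInf cc s))) h

/-- The Čech cochain with given components. -/
def pushMk (H : (X.prod X).Mod k) (q : ℕ) (y : X.Loc)
    (x : ∀ s : Fin (q + 1) → T, H.obj (X.cechLoc cc s y)) :
    (((X.pushCech k cc).obj H).X q).obj y :=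
  mapPiMk ((evaluation _ _).obj y) (fun s : Fin ((SimplexCategory.mk q).len + 1) → T =>
    (Functor.curry.obj (X.pushforwardIndex X ⋙ H)).obj (op (chartInf cc s))) x

theorem pushProj_mk (H : (X.prod X).Mod k) (q : ℕ) (y : X.Loc)
    (x : ∀ s : Fin (q + 1) → T, H.obj (X.cechLoc cc s y)) (s : Fin (q + 1) → T) :
    X.pushProj cc H q y s (X.pushMk cc H q y x) = x s :=
  π_mapPiMk ((evaluation _ _).obj y) (fun s : Fin ((SimplexCategory.mk q).len + 1) → T =>
    (Functor.curry.obj (X.pushforwardIndex X ⋙ H)).obj (op (chartInf cc s))) x s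

/-- The linear map to Čech cochains with given components. -/
def pushLift (H : (X.prod X).Mod k) (q : ℕ) (y : X.Loc) {Y : ModuleCat.{u} k}
    (x : ∀ s : Fin (q + 1) → T, Y ⟶ H.obj (X.cechLoc cc s y)) :
    Y ⟶ (((X.pushCech k cc).obj H).X q).obj y :=
  mapPiLift ((evaluation _ _).obj y) (fun s : Fin ((SimplexCategory.mk q).len + 1) → T =>
    (Functor.curry.obj (X.pushforwardIndex X ⋙ H)).obj (op (chartInf cc s))) x

theorem pushLift_proj (H : (X.prod X).Mod k) (q : ℕ) (y : X.Loc) {Y : ModuleCat.{u} k}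
    (x : ∀ s : Fin (q + 1) → T, Y ⟶ H.obj (X.cechLoc cc s y)) (s : Fin (q + 1) → T) :
    X.pushLift cc H q y x ≫ X.pushProj cc H q y s = x s :=
  mapPiLift_π ((evaluation _ _).obj y) (fun s : Fin ((SimplexCategory.mk q).len + 1) → T =>
    (Functor.curry.obj (X.pushforwardIndex X ⋙ H)).obj (op (chartInf cc s))) x s

theorem push_map_proj {H H' : (X.prod X).Mod k} (φ : H ⟶ H') (q : ℕ) (y : X.Loc)
    (s : Fin (q + 1) → T) :
    (((X.pushCech k cc).map φ).f q).app y ≫ X.pushProj cc H' q y s =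
      X.pushProj cc H q y s ≫ φ.app (X.cechLoc cc s y) :=
  congrArg (fun α => NatTrans.app α y) (Pi.lift_π (fun s : Fin ((SimplexCategory.mk q).len + 1) → T =>
    Pi.π (fun s => (Functor.curry.obj (X.pushforwardIndex X ⋙ H)).obj (op (chartInf cc s))) s ≫
      (Functor.curry.map (Functor.whiskerLeft (X.pushforwardIndex X) φ)).app (op (chartInf cc s))) s)

theorem push_map_chart_proj (H : (X.prod X).Mod k) (q : ℕ) {y y' : X.Loc} (f : y ⟶ y')
    (s : Fin (q + 1) → T) :
    (((X.pushCech k cc).obj H).X q).map f ≫ X.pushProj cc H q y' s =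
      X.pushProj cc H q y s ≫ H.map ((X.pushforwardIndex X).map
        ((𝟙 (op (chartInf (n := SimplexCategory.mk q) cc s)), f) :
          (op (chartInf (n := SimplexCategory.mk q) cc s), y) ⟶ (op (chartInf cc s), y'))) :=
  (Pi.π (fun s : Fin ((SimplexCategory.mk q).len + 1) → T =>
    (Functor.curry.obj (X.pushforwardIndex X ⋙ H)).obj (op (chartInf cc s))) s).naturality f

/-- The restriction between the charts of Čech cochains. -/
def cechRes {m n : ℕ} {s : Fin (m + 1) → T} {s' : Fin (n + 1) → T}
    (h : chartInf (n := SimplexCategory.mk n) cc s' ≤ chartInf (n := SimplexCategory.mk m) cc s)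
    (y : X.Loc) : X.cechLoc cc s y ⟶ X.cechLoc cc s' y :=
  (X.pushforwardIndex X).map (((homOfLE h).op, 𝟙 y) : (op (chartInf cc s), y) ⟶ (op (chartInf cc s'), y))

theorem push_d_proj (H : (X.prod X).Mod k) (q : ℕ) (y : X.Loc) (s : Fin (q + 2) → T) :
    (((X.pushCech k cc).obj H).d q (q + 1)).app y ≫ X.pushProj cc H (q + 1) y s =
      ∑ i : Fin (q + 2), (-1 : ℤ) ^ (i : ℕ) •
        (X.pushProj cc H q y (s ∘ (SimplexCategory.δ i).toOrderHom) ≫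
          H.map (X.cechRes cc (chartInf_le cc (SimplexCategory.δ i) s) y)) := by
  have e := congrArg (fun α => NatTrans.app α y)
    (cech_d cc (Functor.curry.obj (X.pushforwardIndex X ⋙ H)) q s)
  refine e.trans ?_
  rw [NatTrans.app_sum]
  refine Finset.sum_congr rfl fun i _ => ?_
  rw [NatTrans.app_zsmul]
  rfl

/-- A map of complexes of sheaves on the product that is a quasi-isomorphism over the charts of
the covering induces a quasi-isomorphism of total Čech complexes. -/
theorem elemQuasiIso_totalize {L L' : ChainComplex ((X.prod X).Mod k) ℤ} (φ : L ⟶ L') (N : ℕ)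
    (hL : ∀ p : ℤ, (p < 0 ∨ (N : ℤ) < p) → IsZero (L.X p))
    (hL' : ∀ p : ℤ, (p < 0 ∨ (N : ℤ) < p) → IsZero (L'.X p)) (y : X.Loc)
    (H : ∀ (q : ℕ) (s : Fin (q + 1) → T), ElemQuasiIso
      ((((evaluation _ _).obj (X.cechLoc cc s y)).mapHomologicalComplex _).map φ)) :
    ElemQuasiIso ((((evaluation _ _).obj y).mapHomologicalComplex _).map
      ((totalize (X.pushCech k cc)).map φ)) := by
  have hz : ∀ (M : (X.prod X).Mod k) (q : ℕ), IsZero M → IsZero (((X.pushCech k cc).obj M).X q) :=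
    fun M q h => (X.pushCech k cc ⋙ HomologicalComplex.eval _ _ q).map_isZero h
  refine elemQuasiIso_total ((evaluation _ _).obj y)
    (((X.pushCech k cc).mapHomologicalComplex _).map φ) N (fun p q h => hz _ q (hL p h))
    (fun p q h => hz _ q (hL' p h)) ?_
  intro q p p' p'' hp hp' a b ha hb
  obtain ⟨a, rfl⟩ : ∃ a' : (((X.pushCech k cc).obj (L.X p')).X q).obj y, a' = a := ⟨a, rfl⟩
  obtain ⟨b, rfl⟩ : ∃ b' : (((X.pushCech k cc).obj (L'.X p)).X q).obj y, b' = b := ⟨b, rfl⟩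
  change (((X.pushCech k cc).map (L.d p' p'')).f q).app y a = 0 at ha
  change (((X.pushCech k cc).map (φ.f p')).f q).app y a =
    (((X.pushCech k cc).map (L'.d p p')).f q).app y b at hb
  have hm : ∀ {M M' : (X.prod X).Mod k} (ψ : M ⟶ M') (c : (((X.pushCech k cc).obj M).X q).obj y)
      (s : Fin (q + 1) → T), X.pushProj cc M' q y s ((((X.pushCech k cc).map ψ).f q).app y c) =
        ψ.app (X.cechLoc cc s y) (X.pushProj cc M q y s c) := fun ψ c s =>
    congrArg (fun f => f c) (X.push_map_proj cc ψ q y s)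
  choose w v hw hv using fun s => H q s p p' p'' hp hp' (X.pushProj cc _ q y s a)
    (X.pushProj cc _ q y s b) (by
      refine (hm (L.d p' p'') a s).symm.trans ?_
      rw [ha, map_zero]
      rfl) (by
      refine (hm (φ.f p') a s).symm.trans ?_
      rw [hb]
      exact hm _ _ _)
  refine ⟨X.pushMk cc (L.X p) q y w, X.pushMk cc (L'.X (p + 1)) q y v, push_ext fun s => ?_,
    push_ext fun s => ?_⟩
  · refine (hm (L.d p p') _ s).trans ?_
    exact (congrArg ((L.d p p').app (X.cechLoc cc s y))
      (X.pushProj_mk cc (L.X p) q y w s)).trans (hw s)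
  · have e1 := (hm (φ.f p) (X.pushMk cc (L.X p) q y w) s).trans
      (congrArg ((φ.f p).app (X.cechLoc cc s y)) (X.pushProj_mk cc (L.X p) q y w s))
    have e2 := (hm (L'.d (p + 1) p) (X.pushMk cc (L'.X (p + 1)) q y v) s).trans
      (congrArg ((L'.d (p + 1) p).app (X.cechLoc cc s y)) (X.pushProj_mk cc (L'.X (p + 1)) q y v s))
    have e3 := (map_sub (X.pushProj cc (L'.X p) q y s).hom b
      ((((X.pushCech k cc).map (φ.f p)).f q).app y (X.pushMk cc (L.X p) q y w))).trans
      ((congrArg (fun v => (X.pushProj cc (L'.X p) q y s).hom b - v) e1).trans (hv s))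
    exact e3.trans e2.symm

end CoxData

end ToricBGG

namespace ToricBGG

section

variable {W : Type*} [Category W] [Preadditive W] {k : Type u} [Field k]
  (E : W ⥤ ModuleCat.{u} k) [E.Additive] [HasZeroObject W]

theorem map_single_subsingleton (M : W) {j : ℤ} (hj : j ≠ 0)
    (x : E.obj (((HomologicalComplex.single W (ComplexShape.down ℤ) 0).obj M).X j)) : x = 0 := by
  have : Subsingleton (E.obj (((HomologicalComplex.single W (ComplexShape.down ℤ) 0).obj M).X j)) :=
    ModuleCat.subsingleton_of_isZero (E.map_isZero
      (HomologicalComplex.isZero_single_obj_X (ComplexShape.down ℤ) 0 M j hj))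
  exact Subsingleton.elim _ _

theorem map_iso_hom_inv {A B : W} (e : A ≅ B) (x : E.obj A) : E.map e.inv (E.map e.hom x) = x := by
  have h := congrArg (fun f => E.map f x) e.hom_inv_id
  simp only [E.map_comp, E.map_id] at h
  exact h

end

section

variable {V : Type*} [Category V] [Preadditive V] [HasCountableCoproducts V] [HasZeroObject V]
  {k : Type u} [Field k] (E : V ⥤ ModuleCat.{u} k) [E.Additive] (L : Bicomplex V)

theorem eq_zero_of_row (hL : ∀ (p : ℤ) (q : ℕ), p ≠ 0 → IsZero ((L.X p).X q))
    (n : ℤ) (x : E.obj ((tot L).X n))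
    (hx : ∀ q : ℕ, (q : ℤ) = -n → E.map (totProj L 0 q n) x = 0) : x = 0 := by
  refine totComp_eq_zero E L 0 (fun p q hp => hL p q (by
    rcases hp with h | h
    · exact h.ne
    · exact (lt_of_le_of_lt (by simp) h).ne')) n x fun q => ?_
  by_cases hq : n + (q : ℤ) = 0
  · have : ∀ p, p = 0 → E.map (totProj L p q n) x = 0 := by
      rintro _ rfl
      exact hx q (by omega)
    exact this _ hq
  · have : Subsingleton (E.obj ((L.X (n + q)).X q)) :=
      ModuleCat.subsingleton_of_isZero (E.map_isZero (hL _ _ hq))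
    exact Subsingleton.elim _ _

theorem row_d (hL : ∀ (p : ℤ) (q : ℕ), p ≠ 0 → IsZero ((L.X p).X q))
    (q : ℕ) (n n' : ℤ) (hn : n' + 1 = n) (h : -(q : ℤ) = n) (x : E.obj ((tot L).X n)) :
    E.map (totProj L 0 (q + 1) n') (E.map ((tot L).d n n') x) =
      E.map ((L.X 0).d q (q + 1)) (E.map (totProj L 0 q n) x) := by
  have e := totProj_d L 1 0 q (q + 1) n n' rfl rfl hn (by push_cast; omega)
  rw [(hL 1 (q + 1) one_ne_zero).eq_of_src ((L.d 1 0).f (q + 1)) 0, comp_zero, smul_zero,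
    zero_add] at e
  have e2 := congrArg (fun f => E.map f x) e
  simp only [E.map_comp] at e2
  exact e2

/-- A criterion for a map to the total complex of a bicomplex with a single row to be a
quasi-isomorphism. -/
theorem elemQuasiIso_row (hL : ∀ (p : ℤ) (q : ℕ), p ≠ 0 → IsZero ((L.X p).X q))
    {B : V}
    (φ : (HomologicalComplex.single V (ComplexShape.down ℤ) 0).obj B ⟶ tot L)
    (a : B ⟶ (L.X 0).X 0) (hφ : φ.f 0 = (HomologicalComplex.singleObjXSelf _ 0 B).hom ≫
      totInc L a 0 rfl) (h1 : ∀ x, E.map a x = 0 → x = 0)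
    (h2 : ∀ z, E.map ((L.X 0).d 0 1) z = 0 → ∃ w, E.map a w = z)
    (h3 : ∀ (q : ℕ) z, E.map ((L.X 0).d (q + 1) (q + 1 + 1)) z = 0 →
      ∃ v, E.map ((L.X 0).d q (q + 1)) v = z) :
    ElemQuasiIso ((E.mapHomologicalComplex _).map φ) := by
  intro j j' j'' hj hj' x y hx hy
  let S := (HomologicalComplex.single V (ComplexShape.down ℤ) 0).obj B
  let e := HomologicalComplex.singleObjXSelf (ComplexShape.down ℤ) 0 B
  obtain ⟨x, rfl⟩ : ∃ x' : E.obj (S.X j'), x' = x := ⟨x, rfl⟩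
  obtain ⟨y, rfl⟩ : ∃ y' : E.obj ((tot L).X j), y' = y := ⟨y, rfl⟩
  change E.map (φ.f j') x = E.map ((tot L).d j j') y at hy
  change ∃ (w : E.obj (S.X j)) (v : E.obj ((tot L).X (j + 1))),
    E.map (S.d j j') w = x ∧ y - E.map (φ.f j) w = E.map ((tot L).d (j + 1) j) v
  have hS : ∀ w, E.map (S.d j j') w = 0 := by
    intro w
    have : S.d j j' = 0 := HomologicalComplex.single_obj_d _ _ _ _ _
    rw [this, E.map_zero]
    rfl
  have hφ' : ∀ w : E.obj (S.X 0), E.map (totProj L 0 0 0) (E.map (φ.f 0) w) =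
      E.map a (E.map e.hom w) := by
    intro w
    have e1 : φ.f 0 ≫ totProj L 0 0 0 = e.hom ≫ a := by
      rw [hφ, Category.assoc, totInc_totProj]
    have e2 := congrArg (fun f => E.map f w) e1
    simp only [E.map_comp] at e2
    exact e2
  have hx0 : x = 0 := by
    by_cases h : j' = 0
    · subst h
      have hy0 : y = 0 := eq_zero_of_row E L hL _ _ fun q hq => by omega
      have h4 := hφ' x
      rw [hy, hy0, map_zero, map_zero] at h4
      have h5 := congrArg (E.map e.inv) (h1 _ h4.symm)
      rwa [map_iso_hom_inv, map_zero] at h5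
    · exact map_single_subsingleton E B h x
  subst hx0
  rw [map_zero] at hy
  simp only [hS, true_and]
  rcases lt_trichotomy j 0 with h | rfl | h
  · obtain ⟨q, rfl⟩ : ∃ q : ℕ, j = -((q + 1 : ℕ) : ℤ) := ⟨(-j - 1).toNat, by omega⟩
    have h4 := row_d E L hL (q + 1) _ j' hj rfl y
    rw [← hy, map_zero] at h4
    obtain ⟨v, hv⟩ := h3 q _ h4.symm
    refine ⟨0, E.map (totInc L (𝟙 _) (p := 0) (q := q) _ (by push_cast; omega)) v, ?_⟩
    refine sub_eq_zero.1 (eq_zero_of_row E L hL _ _ fun q' hq' => ?_)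
    obtain rfl : q' = q + 1 := by omega
    rw [map_zero, sub_zero, map_sub, row_d E L hL q _ _ rfl (by push_cast; omega), ← hv]
    have e1 := congrArg (fun f => E.map f v) (totInc_totProj L (𝟙 ((L.X 0).X q))
      (-((q + 1 : ℕ) : ℤ) + 1) (by push_cast; omega))
    simp only [E.map_comp, E.map_id] at e1
    refine sub_eq_zero.2 (congrArg _ ?_)
    exact e1.symm
  · have h4 := row_d E L hL 0 0 j' hj rfl y
    rw [← hy, map_zero] at h4
    obtain ⟨w, hw⟩ := h2 _ h4.symm
    refine ⟨E.map e.inv w, 0, ?_⟩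
    rw [map_zero]
    refine eq_zero_of_row E L hL _ _ fun q hq => ?_
    obtain rfl : q = 0 := by omega
    rw [map_sub, hφ']
    have := map_iso_hom_inv E e.symm w
    refine sub_eq_zero.2 (hw.symm.trans (congrArg _ ?_))
    exact this.symm
  · refine ⟨0, 0, ?_⟩
    rw [map_zero, map_zero, sub_zero]
    exact eq_zero_of_row E L hL _ _ fun q hq => by omega

end

namespace CoxData

variable {ι A P : Type} [Fintype ι] [LinearOrder ι] [AddCommGroup A] [SemilatticeInf P]
  (X : CoxData ι A P) {k : Type u} [Field k]

/-- The sheaf on the diagonal, as a complex concentrated in degree zero. -/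
abbrev diagComplex (F : X.Mod k) : ChainComplex ((X.prod X).Mod k) ℤ :=
  (HomologicalComplex.single _ (ComplexShape.down ℤ) 0).obj ((X.diagPush k).obj F)

/-- The identification of the term of degree zero. -/
abbrev diagComplexIso (F : X.Mod k) : (X.diagComplex F).X 0 ≅ (X.diagPush k).obj F :=
  HomologicalComplex.singleObjXSelf (ComplexShape.down ℤ) 0 ((X.diagPush k).obj F)

/-- The augmentation of the resolution of the diagonal. -/
def augComplex (F : X.Mod k) : (X.tensorR k).obj ((X.pullbackFst X k).obj F) ⟶ X.diagComplex F :=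
  HomologicalComplex.mkHomToSingle (X.aug F) (by
    intro i hi
    obtain rfl : i = 1 := hi.symm
    exact X.d_aug F)

theorem augComplex_f (F : X.Mod k) :
    (X.augComplex F).f 0 = X.aug F ≫ (X.diagComplexIso F).inv :=
  HomologicalComplex.mkHomToSingle_f _ _

theorem elemQuasiIso_augComplex (hX : X.EnoughUnits) {F : X.Mod k} (hF : X.IsQuasicoherent F)
    (z : (X.prod X).Loc) :
    ElemQuasiIso ((((evaluation _ _).obj z).mapHomologicalComplex _).map (X.augComplex F)) := by
  let E : (X.prod X).Mod k ⥤ ModuleCat.{u} k := (evaluation _ _).obj z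
  intro j j' j'' hj hj' x y hx hy
  obtain ⟨x, rfl⟩ : ∃ x' : (X.RObj F j').obj z, x' = x := ⟨x, rfl⟩
  obtain ⟨y, rfl⟩ : ∃ y' : ((X.diagComplex F).X j).obj z, y' = y := ⟨y, rfl⟩
  change X.rD F z j' j'' x = 0 at hx
  change ∃ (w : (X.RObj F j).obj z) (v : ((X.diagComplex F).X (j + 1)).obj z),
    X.rD F z j j' w = x ∧ y - ((X.augComplex F).f j).app z w =
      ((X.diagComplex F).d (j + 1) j).app z v
  by_cases h0 : j = 0
  · subst h0
    obtain ⟨w, hw⟩ := aug_surjective hX hF ((X.diagComplexIso F).hom.app z y)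
    refine ⟨w, 0, ?_, ?_⟩
    · rw [rObj_subsingleton (Or.inl (by omega)) x]
      exact rObj_subsingleton (Or.inl (by omega)) _
    · refine (sub_eq_zero.2 ?_).trans (map_zero (((X.diagComplex F).d (0 + 1) 0).app z).hom).symm
      refine Eq.trans ?_ (congrArg (fun f : X.RObj F 0 ⟶ (X.diagComplex F).X 0 => f.app z w)
        (X.augComplex_f F)).symm
      refine Eq.trans ?_ (congrArg ((X.diagComplexIso F).inv.app z) hw).symm
      exact (map_iso_hom_inv E (X.diagComplexIso F) y).symm
  · have hsub : ∀ a b : ((X.diagComplex F).X j).obj z, a = b := fun a b =>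
      (map_single_subsingleton E _ h0 a).trans (map_single_subsingleton E _ h0 b).symm
    suffices h : ∃ w, X.rD F z j j' w = x by
      obtain ⟨w, hw⟩ := h
      exact ⟨w, 0, hw, hsub _ _⟩
    rcases lt_trichotomy j' 0 with h | rfl | h
    · exact ⟨0, (map_zero (X.rD F z j j').hom).trans
        (rObj_subsingleton (Or.inl h) x).symm⟩
    · obtain rfl : j = 1 := by omega
      refine exists_boundary_of_aug_eq_zero hX hF x ?_
      have e := congrArg (fun f : X.RObj F 0 ⟶ (X.diagComplex F).X 0 => f.app z x) (X.augComplex_f F)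
      have e1 : (X.diagComplexIso F).inv.app z ((X.aug F).app z x) = 0 := by
        refine e.symm.trans (Eq.trans hy ?_)
        rw [map_single_subsingleton E _ h0 y]
        exact map_zero (((X.diagComplex F).d 1 0).app z).hom
      have e2 := congrArg ((X.diagComplexIso F).hom.app z) e1
      exact ((map_iso_hom_inv E (X.diagComplexIso F).symm _).symm.trans e2).trans
        (map_zero ((X.diagComplexIso F).hom.app z).hom)
    · obtain ⟨u, hu⟩ := exists_boundary_of_pos hX hj' h x hx
      obtain rfl : j = j' + 1 := hj.symm
      exact ⟨u, hu⟩

section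

variable {T : Type} [Finite T] (cc : T → ChartPair P P)

theorem push_d_apply (H : (X.prod X).Mod k) (q : ℕ) (y : X.Loc) (s : Fin (q + 2) → T)
    (x : (((X.pushCech k cc).obj H).X q).obj y) :
    X.pushProj cc H (q + 1) y s ((((X.pushCech k cc).obj H).d q (q + 1)).app y x) =
      ∑ i : Fin (q + 2), (-1 : ℤ) ^ (i : ℕ) •
        H.map (X.cechRes cc (chartInf_le cc (SimplexCategory.δ i) s) y)
          (X.pushProj cc H q y (s ∘ (SimplexCategory.δ i).toOrderHom) x) := by
  refine (congrArg (fun f => f x) (X.push_d_proj cc H q y s)).trans ?_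
  exact sum_hom_apply _ _ _

theorem map_cechRes_comp (H : (X.prod X).Mod k) (y : X.Loc) {l m n : ℕ} {s : Fin (l + 1) → T}
    {s' : Fin (m + 1) → T} {s'' : Fin (n + 1) → T}
    (h : chartInf (n := SimplexCategory.mk m) cc s' ≤ chartInf (n := SimplexCategory.mk l) cc s)
    (h' : chartInf (n := SimplexCategory.mk n) cc s'' ≤ chartInf (n := SimplexCategory.mk m) cc s')
    (x : H.obj (X.cechLoc cc s y)) :
    H.map (X.cechRes cc h' y) (H.map (X.cechRes cc h y) x) =
      H.map (X.cechRes cc (h'.trans h) y) x := by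
  have e : X.cechRes cc h y ≫ X.cechRes cc h' y = X.cechRes cc (h'.trans h) y :=
    ((X.pushforwardIndex X).map_comp _ _).symm
  have e1 := congrArg (fun f => H.map f x) e
  simp only [H.map_comp] at e1
  exact e1

/-- The condition that an element of a covering contains everything. -/
def Absorbs (H : (X.prod X).Mod k) (y : X.Loc) (t : T) : Prop :=
  ∀ {m n : ℕ} {s : Fin (m + 1) → T} {s' : Fin (n + 1) → T}
    (h : chartInf (n := SimplexCategory.mk n) cc s' ≤ chartInf (n := SimplexCategory.mk m) cc s)
    (_ : ∀ i', s' i' = t ∨ ∃ i, s' i' = s i), Function.Bijective (H.map (X.cechRes cc h y))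

theorem chartInf_cons_le (t : T) {q : ℕ} (s : Fin (q + 1) → T) :
    chartInf (n := SimplexCategory.mk (q + 1)) cc (Fin.cons t s : Fin (q + 2) → T) ≤
      chartInf (n := SimplexCategory.mk q) cc s :=
  Finset.le_inf' _ _ fun j _ => Finset.inf'_le (cc ∘ (Fin.cons t s : Fin (q + 2) → T))
    (Finset.mem_univ j.succ)

theorem cons_absorbs {H : (X.prod X).Mod k} {y : X.Loc} {t : T} (ht : X.Absorbs cc H y t)
    {q : ℕ} (s : Fin (q + 1) → T) :
    Function.Bijective (H.map (X.cechRes cc (chartInf_cons_le cc t s) y)) :=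
  ht _ fun i' => Fin.cases (motive := fun i' => (Fin.cons t s : Fin (q + 2) → T) i' = t ∨
    ∃ i, (Fin.cons t s : Fin (q + 2) → T) i' = s i) (Or.inl rfl) (fun i => Or.inr ⟨i, rfl⟩) i'

theorem cech_exact_of_absorbs {H : (X.prod X).Mod k} {y : X.Loc} {t : T} (ht : X.Absorbs cc H y t)
    (q : ℕ) (z : (((X.pushCech k cc).obj H).X (q + 1)).obj y)
    (hz : (((X.pushCech k cc).obj H).d (q + 1) (q + 1 + 1)).app y z = 0) :
    ∃ v, (((X.pushCech k cc).obj H).d q (q + 1)).app y v = z := by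
  choose w hw using fun s : Fin (q + 1) → T => (X.cons_absorbs cc ht s).2
      (X.pushProj cc H (q + 1) y (Fin.cons t s : Fin (q + 2) → T) z)
  refine ⟨X.pushMk cc H q y w, push_ext fun s => ?_⟩
  refine (X.cons_absorbs cc ht s).1 ?_
  let r : Fin (q + 3) → T := Fin.cons t s
  have e1 := (X.push_d_apply cc H (q + 1) y r z).symm.trans
    ((congrArg _ hz).trans (map_zero (X.pushProj cc H (q + 1 + 1) y r).hom))
  rw [Fin.sum_univ_succ] at e1
  have e2 : ∀ s' s'' : Fin (q + 2) → T, s' = s'' → ∀ h' h'',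
      H.map (X.cechRes (m := q + 1) (n := q + 2) cc (s := s') (s' := r) h' y)
        (X.pushProj cc H (q + 1) y s' z) =
      H.map (X.cechRes (m := q + 1) (n := q + 2) cc (s := s'') (s' := r) h'' y)
        (X.pushProj cc H (q + 1) y s'' z) := by
    rintro s' _ rfl _ _
    rfl
  have e3 := e2 (r ∘ (SimplexCategory.δ 0).toOrderHom) s (funext fun i => rfl)
    (chartInf_le cc _ _) (chartInf_cons_le cc t s)
  have e4 : ∀ i : Fin (q + 2), H.map (X.cechRes cc (chartInf_cons_le cc t s) y)
      (H.map (X.cechRes cc (chartInf_le cc (SimplexCategory.δ i) s) y)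
        (X.pushProj cc H q y (s ∘ (SimplexCategory.δ i).toOrderHom) (X.pushMk cc H q y w))) =
      H.map (X.cechRes cc (chartInf_le cc (SimplexCategory.δ i.succ) r) y)
        (X.pushProj cc H (q + 1) y (r ∘ (SimplexCategory.δ i.succ).toOrderHom) z) := by
    intro i
    have hr : r ∘ (SimplexCategory.δ i.succ).toOrderHom =
        (Fin.cons t (s ∘ (SimplexCategory.δ i).toOrderHom) : Fin (q + 2) → T) := by
      funext l
      refine Fin.cases ?_ (fun l => ?_) l
      · rfl
      · change r (i.succ.succAbove l.succ) = s (i.succAbove l)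
        rw [Fin.succ_succAbove_succ]
        rfl
    have hle : chartInf (n := SimplexCategory.mk (q + 2)) cc r ≤ chartInf (n := SimplexCategory.mk (q + 1)) cc
        (Fin.cons t (s ∘ (SimplexCategory.δ i).toOrderHom) : Fin (q + 2) → T) :=
      hr ▸ chartInf_le cc (SimplexCategory.δ i.succ) r
    refine Eq.trans ?_ (e2 _ _ hr (chartInf_le cc (SimplexCategory.δ i.succ) r) hle).symm
    refine (congrArg (fun v => H.map _ (H.map _ v)) (X.pushProj_mk cc H q y w _)).trans ?_
    refine (X.map_cechRes_comp cc H y _ _ _).trans ?_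
    refine Eq.trans ?_ (congrArg (H.map (X.cechRes cc hle y)) (hw _))
    exact (X.map_cechRes_comp cc H y _ _ _).symm
  refine (congrArg (H.map _) (X.push_d_apply cc H q y s _)).trans ?_
  refine (map_sum (H.map (X.cechRes cc (chartInf_cons_le cc t s) y)).hom _ _).trans ?_
  refine (Finset.sum_congr rfl fun (i : Fin (q + 2)) _ => (map_zsmul (H.map (X.cechRes cc
    (chartInf_cons_le cc t s) y)).hom _ _).trans (congrArg ((-1 : ℤ) ^ (i : ℕ) • ·) (e4 i))).trans ?_
  refine Eq.trans ?_ e3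
  have e5 := eq_neg_of_add_eq_zero_left e1
  rw [Fin.val_zero, pow_zero, one_smul] at e5
  refine Eq.trans ?_ e5.symm
  rw [← Finset.sum_neg_distrib]
  refine Finset.sum_congr rfl fun i _ => ?_
  rw [Fin.val_succ, pow_succ, mul_neg_one, neg_smul, neg_neg]

theorem bijective_map_of_exp_eq_zero (F : X.Mod k) {y y' : X.Loc} (f : y ⟶ y')
    (hf : f.exp = 0) (h : y.chart ≤ y'.chart) : Function.Bijective (F.map f) := by
  let g : y' ⟶ y := ⟨h, 0, fun _ _ => le_rfl, by
    have := f.wt_add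
    rw [hf] at this
    simpa using this.symm⟩
  have h1 : f ≫ g = 𝟙 y := X.loc_hom_ext (by rw [comp_exp, hf]; exact add_zero _)
  have h2 : g ≫ f = 𝟙 y' := X.loc_hom_ext (by rw [comp_exp, hf]; exact add_zero _)
  refine Function.bijective_iff_has_inverse.2 ⟨F.map g, fun x => ?_, fun x => ?_⟩
  · have e := congrArg (fun f => F.map f x) h1
    simp only [F.map_comp, F.map_id] at e
    exact e
  · have e := congrArg (fun f => F.map f x) h2
    simp only [F.map_comp, F.map_id] at e
    exact e

theorem absorbs_diagPush (F : X.Mod k) {y : X.Loc} {t : T}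
    (ht : ((y.chart, y.chart) : ChartPair P P) ≤ cc t) :
    X.Absorbs cc ((X.diagPush k).obj F) y t := by
  intro m n s s' h hs
  refine X.bijective_map_of_exp_eq_zero F (X.diagonal.map (X.cechRes cc h y)) ?_ ?_
  · funext i
    exact add_zero (0 : ℤ)
  · let c := chartInf (n := SimplexCategory.mk m) cc s
    have h1 : c ⊓ ((y.chart, y.chart) : ChartPair P P) ≤ chartInf (n := SimplexCategory.mk n) cc s' := by
      refine Finset.le_inf' _ _ fun i' _ => ?_
      rcases hs i' with e | ⟨i, e⟩
      · exact inf_le_right.trans (ht.trans (le_of_eq (congrArg cc e.symm)))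
      · exact inf_le_left.trans ((Finset.inf'_le (cc ∘ s) (Finset.mem_univ i)).trans
          (le_of_eq (congrArg cc e.symm)))
    have h2 : ((c.1 ⊓ (c.2 ⊓ y.chart), c.1 ⊓ (c.2 ⊓ y.chart)) : ChartPair P P) ≤
        c ⊓ ((y.chart, y.chart) : ChartPair P P) :=
      ⟨le_inf inf_le_left (inf_le_right.trans inf_le_right),
        le_inf (inf_le_right.trans inf_le_left) (inf_le_right.trans inf_le_right)⟩
    have h3 := h2.trans h1
    exact le_inf h3.1 (le_inf h3.2 (inf_le_right.trans inf_le_right))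

variable {X} in
theorem Absorbs.of_iso {H H' : (X.prod X).Mod k} {y : X.Loc} {t : T} (ht : X.Absorbs cc H y t)
    (e : H ≅ H') : X.Absorbs cc H' y t := by
  intro m n s s' h hs
  have hb := ht h hs
  have e1 : ∀ x, H'.map (X.cechRes cc h y) x = e.hom.app (X.cechLoc cc s' y)
      (H.map (X.cechRes cc h y) (e.inv.app (X.cechLoc cc s y) x)) := fun x => by
    have e2 : H'.map (X.cechRes cc h y) = e.inv.app (X.cechLoc cc s y) ≫
        H.map (X.cechRes cc h y) ≫ e.hom.app (X.cechLoc cc s' y) := by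
      rw [e.hom.naturality, ← Category.assoc, ← NatTrans.comp_app, e.inv_hom_id]
      exact (Category.id_comp _).symm
    exact congrArg (fun f => f x) e2
  have hb1 : Function.Bijective (e.hom.app (X.cechLoc cc s' y)) :=
    (ConcreteCategory.isIso_iff_bijective _).1 inferInstance
  have hb2 : Function.Bijective (e.inv.app (X.cechLoc cc s y)) :=
    (ConcreteCategory.isIso_iff_bijective _).1 inferInstance
  have := hb1.comp (hb.comp hb2)
  rwa [show (H'.map (X.cechRes cc h y) : _ → _) = _ from funext e1]

/-- The restriction to the diagonal of a chart of the covering. -/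
def diagRes {n : ℕ} (s : Fin (n + 1) → T) (y : X.Loc) : y ⟶ X.diagonal.obj (X.cechLoc cc s y) :=
  ⟨inf_le_right.trans inf_le_right, 0, fun _ _ => le_rfl, by
    change y.wt + X.wtExp 0 = 0 + y.wt
    simp [wtExp]⟩

/-- The restriction of a sheaf to the diagonal. -/
def unitComp (F : X.Mod k) (s : Fin ((SimplexCategory.mk 0).len + 1) → T) :
    F ⟶ (Functor.curry.obj (X.pushforwardIndex X ⋙ (X.diagPush k).obj F)).obj
      (op (chartInf cc s)) where
  app y := F.map (X.diagRes cc s y)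
  naturality y y' f := by
    refine (F.map_comp _ _).symm.trans (Eq.trans (congrArg F.map ?_) (F.map_comp _ _))
    refine X.loc_hom_ext ?_
    funext i
    change f.exp i + 0 = 0 + (0 + f.exp i)
    ring

/-- The map from a sheaf to the Čech cochains of degree zero on the diagonal. -/
def unitHom (F : X.Mod k) : F ⟶ ((X.pushCech k cc).obj ((X.diagPush k).obj F)).X 0 :=
  Pi.lift (X.unitComp cc F)

theorem unitHom_proj (F : X.Mod k) (y : X.Loc) (s : Fin 1 → T) :
    (X.unitHom cc F).app y ≫ X.pushProj cc ((X.diagPush k).obj F) 0 y s =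
      F.map (X.diagRes cc (n := 0) s y) :=
  congrArg (fun α => NatTrans.app α y) (Pi.lift_π (X.unitComp cc F) s)

theorem unitHom_d (F : X.Mod k) :
    X.unitHom cc F ≫ ((X.pushCech k cc).obj ((X.diagPush k).obj F)).d 0 1 = 0 := by
  ext y : 2
  refine push_hom_ext (H := (X.diagPush k).obj F) (q := 1) fun s => ?_
  refine (Category.assoc _ _ _).trans ?_
  refine (congrArg ((X.unitHom cc F).app y ≫ ·)
    (X.push_d_proj cc ((X.diagPush k).obj F) 0 y s)).trans ?_
  refine (Preadditive.comp_sum _ _ _).trans ?_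
  have e : ∀ i : Fin 2, (X.unitHom cc F).app y ≫ ((-1 : ℤ) ^ (i : ℕ) •
      (X.pushProj cc ((X.diagPush k).obj F) 0 y (s ∘ (SimplexCategory.δ i).toOrderHom) ≫
        ((X.diagPush k).obj F).map (X.cechRes cc (chartInf_le cc (SimplexCategory.δ i) s) y))) =
      (-1 : ℤ) ^ (i : ℕ) • F.map (X.diagRes cc s y) := by
    intro i
    refine (Preadditive.comp_zsmul _ _ _).trans (congrArg _ ?_)
    refine (Category.assoc _ _ _).symm.trans ?_
    refine (congrArg (· ≫ ((X.diagPush k).obj F).map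
      (X.cechRes cc (chartInf_le cc (SimplexCategory.δ i) s) y)) (X.unitHom_proj cc F y _)).trans ?_
    refine (F.map_comp _ _).symm.trans (congrArg F.map ?_)
    refine X.loc_hom_ext ?_
    funext i
    change (0 : ℤ) + (0 + 0) = 0
    ring
  refine (Finset.sum_congr rfl fun i _ => e i).trans ?_
  rw [Fin.sum_univ_two]
  simp

theorem bijective_diagRes (F : X.Mod k) {y : X.Loc} {t : T}
    (ht : ((y.chart, y.chart) : ChartPair P P) ≤ cc t) :
    Function.Bijective (F.map (X.diagRes cc (n := 0) (fun _ => t) y)) := by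
  refine X.bijective_map_of_exp_eq_zero F _ rfl ?_
  have h : ((y.chart, y.chart) : ChartPair P P) ≤
      chartInf (n := SimplexCategory.mk 0) cc (fun _ => t) := Finset.le_inf' _ _ fun _ _ => ht
  exact le_inf h.1 (le_inf h.2 le_rfl)

theorem exists_unitHom_of_cocycle (F : X.Mod k) {y : X.Loc} {t : T}
    (ht : ((y.chart, y.chart) : ChartPair P P) ≤ cc t)
    (z : (((X.pushCech k cc).obj ((X.diagPush k).obj F)).X 0).obj y)
    (hz : (((X.pushCech k cc).obj ((X.diagPush k).obj F)).d 0 1).app y z = 0) :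
    ∃ w, (X.unitHom cc F).app y w = z := by
  let H := (X.diagPush k).obj F
  let s₀ : Fin 1 → T := fun _ => t
  obtain ⟨w, hw⟩ := (X.bijective_diagRes cc F ht).2 (X.pushProj cc H 0 y s₀ z)
  refine ⟨w, push_ext fun s => ?_⟩
  refine (X.cons_absorbs cc (X.absorbs_diagPush cc F ht) s).1 ?_
  let r : Fin 2 → T := Fin.cons t s
  have e1 := (X.push_d_apply cc H 0 y r z).symm.trans
    ((congrArg _ hz).trans (map_zero (X.pushProj cc H 1 y r).hom))
  rw [Fin.sum_univ_two, Fin.val_zero, Fin.val_one, pow_zero, pow_one, one_smul, neg_one_smul,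
    ← sub_eq_add_neg, sub_eq_zero] at e1
  have e2 : ∀ s' s'' : Fin 1 → T, s' = s'' → ∀ h' h'',
      H.map (X.cechRes (m := 0) (n := 1) cc (s := s') (s' := r) h' y)
        (X.pushProj cc H 0 y s' z) =
      H.map (X.cechRes (m := 0) (n := 1) cc (s := s'') (s' := r) h'' y)
        (X.pushProj cc H 0 y s'' z) := by
    rintro s' _ rfl _ _
    rfl
  have hr : r ∘ (SimplexCategory.δ (1 : Fin 2)).toOrderHom = s₀ := by
    funext (i : Fin 1)
    obtain rfl : i = 0 := Subsingleton.elim _ _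
    rfl
  have e3 := e2 (r ∘ (SimplexCategory.δ 0).toOrderHom) s (funext fun i => rfl)
    (chartInf_le cc _ _) (chartInf_cons_le cc t s)
  have hle : chartInf (n := SimplexCategory.mk 1) cc r ≤
      chartInf (n := SimplexCategory.mk 0) cc s₀ := hr ▸ chartInf_le cc (SimplexCategory.δ 1) r
  have e4 := e2 (r ∘ (SimplexCategory.δ 1).toOrderHom) s₀ hr (chartInf_le cc _ _) hle
  have e5 := e3.symm.trans (e1.trans e4)
  refine Eq.trans ?_ e5.symm
  refine (congrArg (H.map _) (congrArg (fun f => f w) (X.unitHom_proj cc F y s))).trans ?_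
  refine Eq.trans ?_ (congrArg (H.map (X.cechRes cc hle y)) hw)
  have e6 : ∀ (s' : Fin 1 → T) (h : chartInf (n := SimplexCategory.mk 1) cc r ≤
      chartInf (n := SimplexCategory.mk 0) cc s'),
      X.diagRes cc s' y ≫ X.diagonal.map (X.cechRes (m := 0) (n := 1) cc h y) =
        X.diagRes cc r y := by
    intro s' h
    refine X.loc_hom_ext ?_
    funext i
    change (0 : ℤ) + (0 + 0) = 0
    ring
  have e7 := congrArg (fun f => F.map f w) ((e6 s (chartInf_cons_le cc t s)).trans (e6 s₀ hle).symm)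
  simp only [F.map_comp] at e7
  exact e7

/-- The Čech resolution of a sheaf on the diagonal. -/
def unitComplex (F : X.Mod k) :
    (HomologicalComplex.single (X.Mod k) (ComplexShape.down ℤ) 0).obj F ⟶
      (totalize (X.pushCech k cc)).obj (X.diagComplex F) :=
  HomologicalComplex.mkHomFromSingle
    (totInc (((X.pushCech k cc).mapHomologicalComplex _).obj (X.diagComplex F)) (p := 0) (q := 0)
      (X.unitHom cc F ≫ ((X.pushCech k cc).map (X.diagComplexIso F).inv).f 0) 0 rfl) (by
    intro i hi
    obtain rfl : i = -1 := by
      have : i + 1 = 0 := hi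
      omega
    refine (totInc_d (((X.pushCech k cc).mapHomologicalComplex _).obj (X.diagComplex F))
      (p := 0) (p' := -1) (q := 0) _ 0 (-1) rfl rfl rfl).trans ?_
    have e1 : (((X.pushCech k cc).mapHomologicalComplex _).obj (X.diagComplex F)).d 0 (-1) = 0 :=
      (congrArg (X.pushCech k cc).map (HomologicalComplex.single_obj_d _ _ _ _ _)).trans
        ((X.pushCech k cc).map_zero _ _)
    have e2 := ((X.pushCech k cc).map (X.diagComplexIso F).inv).comm 0 1
    rw [e1]
    refine (congrArg₂ (· + ·) ((congrArg _ ((congrArg (fun f => totInc _ f _ _) comp_zero).trans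
      (totInc_zero _ _ _))).trans (smul_zero _)) ?_).trans (add_zero _)
    refine (congrArg (fun f => totInc _ f _ _) ?_).trans (totInc_zero _ _ _)
    refine (Category.assoc _ _ _).trans ((congrArg (X.unitHom cc F ≫ ·) e2).trans ?_)
    refine (Category.assoc _ _ _).symm.trans ?_
    exact (congrArg (· ≫ ((X.pushCech k cc).map (X.diagComplexIso F).inv).f 1)
      (X.unitHom_d cc F)).trans zero_comp)

theorem elemQuasiIso_unitComplex (F : X.Mod k) {y : X.Loc} {t : T}
    (ht : ((y.chart, y.chart) : ChartPair P P) ≤ cc t) :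
    ElemQuasiIso ((((evaluation _ _).obj y).mapHomologicalComplex _).map (X.unitComplex cc F)) := by
  let G := X.pushCech k cc
  let e := X.diagComplexIso F
  have hinj : Function.Injective (((G.map e.inv).f 0).app y) :=
    Function.LeftInverse.injective (g := ((G.map e.hom).f 0).app y) fun x =>
      map_iso_hom_inv (G ⋙ HomologicalComplex.eval _ _ 0 ⋙ (evaluation _ _).obj y) e.symm x
  refine elemQuasiIso_row ((evaluation _ _).obj y) ((G.mapHomologicalComplex _).obj (X.diagComplex F))
    (fun p q hp => (G ⋙ HomologicalComplex.eval _ _ q).map_isZero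
      (HomologicalComplex.isZero_single_obj_X _ _ _ _ hp)) (X.unitComplex cc F)
    (X.unitHom cc F ≫ (G.map e.inv).f 0) (HomologicalComplex.mkHomFromSingle_f _ _) ?_ ?_ ?_
  · intro x hx
    obtain ⟨x, rfl⟩ : ∃ x' : F.obj y, x' = x := ⟨x, rfl⟩
    have h1 : (X.unitHom cc F).app y x = 0 := hinj (Eq.trans hx (map_zero (((G.map e.inv).f 0).app y).hom).symm)
    refine (X.bijective_diagRes cc F ht).1 ?_
    refine (congrArg (fun f => f x) (X.unitHom_proj cc F y (fun _ => t))).symm.trans ?_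
    refine (congrArg (X.pushProj cc ((X.diagPush k).obj F) 0 y (fun _ => t)) h1).trans ?_
    exact (map_zero (X.pushProj cc ((X.diagPush k).obj F) 0 y (fun _ => t)).hom).trans
      (map_zero (F.map (X.diagRes cc (n := 0) (fun _ => t) y)).hom).symm
  · intro z hz
    obtain ⟨z, rfl⟩ : ∃ z' : ((G.obj ((X.diagComplex F).X 0)).X 0).obj y, z' = z := ⟨z, rfl⟩
    have h1 := congrArg (fun f : (G.obj ((X.diagComplex F).X 0)).X 0 ⟶
      (G.obj ((X.diagPush k).obj F)).X 1 => f.app y z) ((G.map e.hom).comm 0 1)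
    have h2 : ((G.obj ((X.diagPush k).obj F)).d 0 1).app y (((G.map e.hom).f 0).app y z) = 0 :=
      Eq.trans h1 ((congrArg (((G.map e.hom).f 1).app y) hz).trans
        (map_zero (((G.map e.hom).f 1).app y).hom))
    obtain ⟨w, hw⟩ := X.exists_unitHom_of_cocycle cc F ht _ h2
    refine ⟨w, ?_⟩
    refine (congrArg (((G.map e.inv).f 0).app y) hw).trans ?_
    exact map_iso_hom_inv (G ⋙ HomologicalComplex.eval _ _ 0 ⋙ (evaluation _ _).obj y) e z
  · intro q z hz
    exact X.cech_exact_of_absorbs cc (Absorbs.of_iso cc (X.absorbs_diagPush cc F ht) e.symm) q z hz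

end

end CoxData

end ToricBGG

namespace ToricBGG

section

variable {P K K' V : Type*} [SemilatticeInf P] [Finite K] [Finite K'] [Category V] [Preadditive V]
  [HasFiniteProducts V] (c : K → P) (v : K' → K)

theorem cechCosimplicial_map_π (F : Pᵒᵖ ⥤ V) {m n : SimplexCategory} (θ : m ⟶ n)
    (s : Fin (n.len + 1) → K) :
    ((cechCosimplicial c).obj F).map θ ≫ Pi.π (fun s : Fin (n.len + 1) → K =>
      F.obj (op (chartInf c s))) s =
      Pi.π (fun s : Fin (m.len + 1) → K => F.obj (op (chartInf c s))) (s ∘ θ.toOrderHom) ≫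
        F.map (homOfLE (chartInf_le c θ s)).op :=
  Pi.lift_π _ _

theorem cechCosimplicial_app_π {F F' : Pᵒᵖ ⥤ V} (φ : F ⟶ F') (n : SimplexCategory)
    (s : Fin (n.len + 1) → K) :
    ((cechCosimplicial c).map φ).app n ≫ Pi.π (fun s : Fin (n.len + 1) → K =>
      F'.obj (op (chartInf c s))) s =
      Pi.π (fun s : Fin (n.len + 1) → K => F.obj (op (chartInf c s))) s ≫
        φ.app (op (chartInf c s)) :=
  Pi.lift_π (fun s : Fin (n.len + 1) → K =>
    Pi.π (fun s : Fin (n.len + 1) → K => F.obj (op (chartInf c s))) s ≫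
      φ.app (op (chartInf c s))) s

/-- The restriction of Čech cochains to a subfamily of a covering. -/
def cechRestrictApp (F : Pᵒᵖ ⥤ V) (n : SimplexCategory) :
    ((cechCosimplicial c).obj F).obj n ⟶ ((cechCosimplicial (c ∘ v)).obj F).obj n :=
  Pi.lift fun s => Pi.π (fun s : Fin (n.len + 1) → K => F.obj (op (chartInf c s))) (v ∘ s)

theorem cechRestrictApp_π (F : Pᵒᵖ ⥤ V) (n : SimplexCategory) (s : Fin (n.len + 1) → K') :
    cechRestrictApp c v F n ≫ Pi.π (fun s : Fin (n.len + 1) → K' =>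
      F.obj (op (chartInf (c ∘ v) s))) s =
      Pi.π (fun s : Fin (n.len + 1) → K => F.obj (op (chartInf c s))) (v ∘ s) :=
  Pi.lift_π (fun s : Fin (n.len + 1) → K' =>
    Pi.π (fun s : Fin (n.len + 1) → K => F.obj (op (chartInf c s))) (v ∘ s)) s

/-- The restriction of Čech cochains to a subfamily of a covering, as a natural transformation. -/
def cechCosimplicialRestrict : cechCosimplicial (V := V) c ⟶ cechCosimplicial (c ∘ v) where
  app F :=
    { app := cechRestrictApp c v F
      naturality := fun m n θ => by
        refine Pi.hom_ext _ _ fun s => ?_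
        refine (Category.assoc _ _ _).trans ?_
        refine (congrArg (((cechCosimplicial c).obj F).map θ ≫ ·)
          (cechRestrictApp_π c v F n s)).trans ?_
        refine (cechCosimplicial_map_π c F θ (v ∘ s)).trans ?_
        refine Eq.trans ?_ (Category.assoc _ _ _).symm
        refine Eq.trans ?_ (congrArg (cechRestrictApp c v F m ≫ ·)
          (cechCosimplicial_map_π (c ∘ v) F θ s)).symm
        refine Eq.trans ?_ (Category.assoc _ _ _)
        exact (congrArg (· ≫ F.map (homOfLE (chartInf_le (c ∘ v) θ s)).op)
          (cechRestrictApp_π c v F m (s ∘ θ.toOrderHom))).symm }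
  naturality F F' φ := by
    refine NatTrans.ext (funext fun n => Pi.hom_ext _ _ fun s => ?_)
    refine (Category.assoc _ _ _).trans ?_
    refine (congrArg (((cechCosimplicial c).map φ).app n ≫ ·)
      (cechRestrictApp_π c v F' n s)).trans ?_
    refine (cechCosimplicial_app_π c φ n (v ∘ s)).trans ?_
    refine Eq.trans ?_ (Category.assoc _ _ _).symm
    refine Eq.trans ?_ (congrArg (cechRestrictApp c v F n ≫ ·)
      (cechCosimplicial_app_π (c ∘ v) φ n s)).symm
    refine Eq.trans ?_ (Category.assoc _ _ _)
    exact (congrArg (· ≫ φ.app (op (chartInf (c ∘ v) s))) (cechRestrictApp_π c v F n s)).symm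

/-- The restriction of Čech complexes to a subfamily of a covering. -/
def cechRestrict : cech (V := V) c ⟶ cech (c ∘ v) :=
  Functor.whiskerRight (cechCosimplicialRestrict c v) _

theorem cechRestrict_π (F : Pᵒᵖ ⥤ V) (q : ℕ) (s : Fin ((SimplexCategory.mk q).len + 1) → K') :
    ((cechRestrict c v).app F).f q ≫
      Pi.π (fun s : Fin ((SimplexCategory.mk q).len + 1) → K' => F.obj (op (chartInf (c ∘ v) s))) s =
    Pi.π (fun s : Fin ((SimplexCategory.mk q).len + 1) → K => F.obj (op (chartInf c s))) (v ∘ s) :=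
  cechRestrictApp_π c v F (SimplexCategory.mk q) s

end

section

variable {V W : Type*} [Category V] [Preadditive V] [HasCountableCoproducts V] [Category W]
  [Preadditive W] {G G' : W ⥤ CochainComplex V ℕ} [G.Additive] [G'.Additive] (r : G ⟶ G')

/-- The map of total complexes induced by a natural transformation. -/
def totalizeMap : totalize G ⟶ totalize G' where
  app C := HomologicalComplex₂.total.map ((NatTrans.mapHomologicalComplex r _).app C) _
  naturality C C' φ := by
    refine (HomologicalComplex₂.total.map_comp _ _ _).symm.trans
      (Eq.trans (congrArg (fun f => HomologicalComplex₂.total.map f _) ?_)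
        (HomologicalComplex₂.total.map_comp _ _ _))
    exact (NatTrans.mapHomologicalComplex r _).naturality φ

theorem totInc_totalizeMap (C : ChainComplex W ℤ) {p : ℤ} {q : ℕ} {Y : V}
    (a : Y ⟶ (G.obj (C.X p)).X q) (n : ℤ) (h : p - q = n) :
    totInc ((G.mapHomologicalComplex _).obj C) (p := p) (q := q) a n h ≫
      ((totalizeMap r).app C).f n =
      totInc ((G'.mapHomologicalComplex _).obj C) (p := p) (q := q) (a ≫ (r.app (C.X p)).f q) n h :=
  totInc_map ((NatTrans.mapHomologicalComplex r _).app C) a n h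

end

namespace CoxData

variable {ι A P : Type} [Fintype ι] [LinearOrder ι] [AddCommGroup A] [SemilatticeInf P]
  (X : CoxData ι A P) {k : Type u} [Field k] {T T' : Type} [Finite T] [Finite T']
  (cc : T → ChartPair P P) (v : T' → T)

theorem rObj_isZero (F : X.Mod k) {p : ℤ} (hp : p < 0 ∨ (Fintype.card ι : ℤ) < p) :
    IsZero (X.RObj F p) :=
  Functor.isZero _ fun z => by
    have : Subsingleton ((X.RObj F p).obj z) :=
      ⟨fun a b => (rObj_subsingleton hp a).trans (rObj_subsingleton hp b).symm⟩
    exact ModuleCat.isZero_of_subsingleton _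

/-- The evaluation of complexes of sheaves at a chart and a degree. -/
abbrev evalComplex (y : X.Loc) : ChainComplex (X.Mod k) ℤ ⥤ ChainComplex (ModuleCat.{u} k) ℤ :=
  ((evaluation X.Loc (ModuleCat.{u} k)).obj y).mapHomologicalComplex _

theorem quasiIso_totalize_aug (hX : X.EnoughUnits) {F : X.Mod k} (hF : X.IsQuasicoherent F)
    (y : X.Loc) : QuasiIso ((X.evalComplex y).map
      ((totalize (X.pushCech k cc)).map (X.augComplex F))) :=
  (X.elemQuasiIso_totalize cc (X.augComplex F) (Fintype.card ι) (fun p hp => X.rObj_isZero F hp)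
    (fun p hp => HomologicalComplex.isZero_single_obj_X _ _ _ _ (by omega)) y
    fun q s => elemQuasiIso_augComplex X hX hF _).quasiIso

variable (k) in
/-- The restriction of the Čech complexes to a subfamily of a covering. -/
def pushRestrict : X.pushCech k cc ⟶ X.pushCech k (cc ∘ v) :=
  Functor.whiskerLeft _ (Functor.whiskerLeft _ (cechRestrict cc v))

theorem pushRestrict_proj (H : (X.prod X).Mod k) (q : ℕ) (y : X.Loc) (s : Fin (q + 1) → T') :
    (((X.pushRestrict k cc v).app H).f q).app y ≫ X.pushProj (cc ∘ v) H q y s =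
      X.pushProj cc H q y (v ∘ s) :=
  congrArg (fun α => NatTrans.app α y)
    (cechRestrict_π cc v (Functor.curry.obj (X.pushforwardIndex X ⋙ H)) q s)

theorem unitHom_restrict (F : X.Mod k) :
    X.unitHom cc F ≫ ((X.pushRestrict k cc v).app ((X.diagPush k).obj F)).f 0 =
      X.unitHom (cc ∘ v) F := by
  ext y : 2
  refine push_hom_ext (H := (X.diagPush k).obj F) (q := 0) fun s => ?_
  refine (Category.assoc _ _ _).trans ?_
  refine (congrArg ((X.unitHom cc F).app y ≫ ·) (X.pushRestrict_proj cc v _ 0 y s)).trans ?_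
  exact (X.unitHom_proj cc F y _).trans (X.unitHom_proj (cc ∘ v) F y s).symm

theorem unitComplex_restrict (F : X.Mod k) :
    X.unitComplex cc F ≫ (totalizeMap (X.pushRestrict k cc v)).app (X.diagComplex F) =
      X.unitComplex (cc ∘ v) F := by
  refine HomologicalComplex.from_single_hom_ext ?_
  rw [HomologicalComplex.comp_f]
  refine (congrArg (· ≫ ((totalizeMap (X.pushRestrict k cc v)).app (X.diagComplex F)).f 0)
    (HomologicalComplex.mkHomFromSingle_f _ _)).trans ?_
  refine Eq.trans ?_ (HomologicalComplex.mkHomFromSingle_f _ _).symm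
  refine (Category.assoc _ _ _).trans (congrArg (_ ≫ ·) ?_)
  refine (totInc_totalizeMap (X.pushRestrict k cc v) (X.diagComplex F) _ 0 rfl).trans ?_
  refine congrArg (fun f => totInc _ f _ _) ?_
  refine (Category.assoc _ _ _).trans ?_
  have e := congrArg (fun f => HomologicalComplex.Hom.f f 0)
    ((X.pushRestrict k cc v).naturality (X.diagComplexIso F).inv)
  refine (congrArg (X.unitHom cc F ≫ ·) e).trans ?_
  refine (Category.assoc _ _ _).symm.trans ?_
  exact congrArg (· ≫ _) (X.unitHom_restrict cc v F)

theorem quasiIso_unitComplex (F : X.Mod k) {y : X.Loc} {t : T}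
    (ht : ((y.chart, y.chart) : ChartPair P P) ≤ cc t) :
    QuasiIso ((X.evalComplex y).map (X.unitComplex cc F)) :=
  (X.elemQuasiIso_unitComplex cc F ht).quasiIso

/-- The restriction to a subfamily of a covering that still covers a chart is a
quasi-isomorphism over this chart. -/
theorem quasiIso_totalize_restrict (hX : X.EnoughUnits) {F : X.Mod k} (hF : X.IsQuasicoherent F)
    {y : X.Loc} {t : T'} (ht : ((y.chart, y.chart) : ChartPair P P) ≤ cc (v t)) :
    QuasiIso ((X.evalComplex y).map ((totalizeMap (X.pushRestrict k cc v)).app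
      ((X.tensorR k).obj ((X.pullbackFst X k).obj F)))) := by
  have h1 := X.quasiIso_unitComplex cc F ht
  have h2 := X.quasiIso_unitComplex (cc ∘ v) F (t := t) ht
  have h3 := X.quasiIso_totalize_aug cc hX hF y
  have h4 := X.quasiIso_totalize_aug (cc ∘ v) hX hF y
  rw [← X.unitComplex_restrict cc v F, Functor.map_comp] at h2
  have h5 := quasiIso_of_comp_left _ _ (hφ := h1) (hφφ' := h2)
  have h6 := congrArg (X.evalComplex y).map
    ((totalizeMap (X.pushRestrict k cc v)).naturality (X.augComplex F))
  rw [Functor.map_comp, Functor.map_comp] at h6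
  have h7 := quasiIso_comp _ _ (hφ := h3) (hφ' := h5)
  rw [h6] at h7
  exact quasiIso_of_comp_right _ _ (hφ := h4) (hφφ' := h7)

end CoxData

end ToricBGG

namespace ToricBGG

namespace CoxData

section

variable {ι A P : Type} [Fintype ι] [DecidableEq ι] [AddCommGroup A] [SemilatticeInf P]
  {X : CoxData ι A P} {k : Type u} [Field k]

/-- The map from the pieces of a graded module to the sections of the associated sheaf that is
given by the multiplication by a Laurent monomial. -/
def lanGen (M : X.affine.Mod k) (y : X.Loc) {x : X.affine.Loc}
    (g : X.affineIncl.obj x ⟶ X.chartIncl.obj y) : M.obj x ⟶ ((X.sheafify k).obj M).obj y :=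
  (X.affineIncl.lanUnit.app M).app x ≫ (X.affineIncl.lan.obj M).map g

theorem lanGen_hom_ext {M : X.affine.Mod k} {y : X.Loc} {Y : ModuleCat.{u} k}
    {f f' : ((X.sheafify k).obj M).obj y ⟶ Y}
    (h : ∀ (x : X.affine.Loc) (g : X.affineIncl.obj x ⟶ X.chartIncl.obj y),
      lanGen M y g ≫ f = lanGen M y g ≫ f') : f = f' :=
  (X.affineIncl.isPointwiseLeftKanExtensionLeftKanExtensionUnit M (X.chartIncl.obj y)).hom_ext
    fun g => h g.left g.hom

theorem exists_lanGen_desc (M : X.affine.Mod k) (y : X.Loc) {Y : ModuleCat.{u} k}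
    (f : ∀ (x : X.affine.Loc) (_ : X.affineIncl.obj x ⟶ X.chartIncl.obj y), M.obj x ⟶ Y)
    (hf : ∀ {x x' : X.affine.Loc} (n : x' ⟶ x) (g : X.affineIncl.obj x ⟶ X.chartIncl.obj y),
      M.map n ≫ f x g = f x' (X.affineIncl.map n ≫ g)) :
    ∃ φ : ((X.sheafify k).obj M).obj y ⟶ Y, ∀ x g, lanGen M y g ≫ φ = f x g := by
  let c : Cocone (CostructuredArrow.proj X.affineIncl (X.chartIncl.obj y) ⋙ M) :=
    { pt := Y
      ι :=
        { app := fun g => f g.left g.hom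
          naturality := fun g g' n => by
            refine (hf n.left g'.hom).trans ?_
            rw [CostructuredArrow.w n]
            exact (Category.comp_id _).symm } }
  exact ⟨(X.affineIncl.isPointwiseLeftKanExtensionLeftKanExtensionUnit M (X.chartIncl.obj y)).desc c,
    fun x g => (X.affineIncl.isPointwiseLeftKanExtensionLeftKanExtensionUnit M
      (X.chartIncl.obj y)).fac c (CostructuredArrow.mk g)⟩

theorem map_lanGen (M : X.affine.Mod k) (y : X.Loc) {x x' : X.affine.Loc} (n : x' ⟶ x)
    (g : X.affineIncl.obj x ⟶ X.chartIncl.obj y) :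
    M.map n ≫ lanGen M y g = lanGen M y (X.affineIncl.map n ≫ g) := by
  unfold lanGen
  rw [Functor.map_comp]
  refine (Category.assoc _ _ _).symm.trans (Eq.trans ?_ (Category.assoc _ _ _))
  exact congrArg (· ≫ (X.affineIncl.lan.obj M).map g) ((X.affineIncl.lanUnit.app M).naturality n)

theorem lanGen_map (M : X.affine.Mod k) {y y' : X.Loc} (h : y ⟶ y') {x : X.affine.Loc}
    (g : X.affineIncl.obj x ⟶ X.chartIncl.obj y) :
    lanGen M y g ≫ ((X.sheafify k).obj M).map h = lanGen M y' (g ≫ X.chartIncl.map h) := by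
  refine (Category.assoc _ _ _).trans (congrArg (_ ≫ ·) ?_)
  exact ((X.affineIncl.lan.obj M).map_comp g (X.chartIncl.map h)).symm

theorem lanGen_naturality {M M' : X.affine.Mod k} (φ : M ⟶ M') (y : X.Loc) {x : X.affine.Loc}
    (g : X.affineIncl.obj x ⟶ X.chartIncl.obj y) :
    lanGen M y g ≫ ((X.sheafify k).map φ).app y = φ.app x ≫ lanGen M' y g := by
  have e1 := (X.affineIncl.lan.map φ).naturality g
  have e2 := congrArg (fun α => NatTrans.app α x) (X.affineIncl.lanUnit.naturality φ)
  refine (Category.assoc _ _ _).trans ((congrArg (_ ≫ ·) e1).trans ?_)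
  refine (Category.assoc _ _ _).symm.trans (Eq.trans ?_ (Category.assoc _ _ _))
  exact congrArg (· ≫ (X.affineIncl.lan.obj M').map g) e2.symm

variable (X) in
/-- The generators of a free graded module. -/
def freeGen (a : A) (V : ModuleCat.{u} k) : V ⟶ ((X.freeS k a).obj V).obj ⟨PUnit.unit, a⟩ :=
  ModuleCat.ofHom (Finsupp.lsingle (𝟙 (⟨PUnit.unit, a⟩ : X.affine.Loc)))

theorem freeGen_map (a : A) (V : ModuleCat.{u} k) {x : X.affine.Loc}
    (n : (⟨PUnit.unit, a⟩ : X.affine.Loc) ⟶ x) :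
    X.freeGen a V ≫ ((X.freeS k a).obj V).map n = ModuleCat.ofHom (Finsupp.lsingle n) := by
  ext v : 2
  refine (Finsupp.mapDomain_single (f := (· ≫ n))).trans ?_
  rw [Category.id_comp]
  rfl

theorem freeGen_naturality (a : A) {V V' : ModuleCat.{u} k} (f : V ⟶ V') :
    X.freeGen a V ≫ ((X.freeS k a).map f).app _ = f ≫ X.freeGen a V' := by
  ext v : 2
  exact Finsupp.mapRange_single (hf := map_zero f.hom)

/-- The monomial of a variable, as a morphism. -/
def affineVar (i : ι) {a b : A} (h : b + X.deg i = a) :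
    (⟨PUnit.unit, b⟩ : X.affine.Loc) ⟶ ⟨PUnit.unit, a⟩ :=
  ⟨le_rfl, Pi.single i 1, fun j _ => by
      by_cases hj : j = i
      · subst hj; simp
      · simp [hj], by
    rw [← h]
    refine congrArg (b + ·) ?_
    rw [Finset.sum_eq_single i]
    · simp [affine]
    · simp +contextual
    · simp⟩

theorem freeGen_freeSMul (i : ι) {a b : A} (h : b + X.deg i = a) (V : ModuleCat.{u} k) :
    X.freeGen a V ≫ ((X.freeSMul k i h).app V).app _ =
      X.freeGen b V ≫ ((X.freeS k b).obj V).map (affineVar i h) := by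
  rw [freeGen_map]
  ext v : 2
  refine (Finsupp.mapDomain_single (f := ((affineVar i h : (⟨PUnit.unit, b⟩ : X.affine.Loc) ⟶ _) ≫ ·))).trans ?_
  rw [Category.comp_id]
  rfl

theorem free_hom_ext {a : A} {V : ModuleCat.{u} k} {x : X.affine.Loc} {Y : ModuleCat.{u} k}
    {f f' : ((X.freeS k a).obj V).obj x ⟶ Y}
    (h : ∀ n, X.freeGen a V ≫ ((X.freeS k a).obj V).map n ≫ f =
      X.freeGen a V ≫ ((X.freeS k a).obj V).map n ≫ f') : f = f' := by
  refine ModuleCat.hom_ext (Finsupp.lhom_ext' fun n => ?_)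
  have e := h n
  rw [← Category.assoc, ← Category.assoc, freeGen_map] at e
  exact congrArg ModuleCat.Hom.hom e

/-- The multiples of the generators of the sheaf associated with a direct sum of free graded
modules. -/
def freeSheafGen (V : A → ModuleCat.{u} k) (y : X.Loc) (a : A)
    (g : X.affineIncl.obj ⟨PUnit.unit, a⟩ ⟶ X.chartIncl.obj y) :
    V a ⟶ ((X.sheafify k).obj (∐ fun a => (X.freeS k a).obj (V a))).obj y :=
  X.freeGen a (V a) ≫ (Sigma.ι (fun a => (X.freeS k a).obj (V a)) a).app _ ≫ lanGen _ y g

theorem freeSheafGen_hom_ext {V : A → ModuleCat.{u} k} {y : X.Loc} {Y : ModuleCat.{u} k}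
    {f f' : ((X.sheafify k).obj (∐ fun a => (X.freeS k a).obj (V a))).obj y ⟶ Y}
    (h : ∀ a g, freeSheafGen V y a g ≫ f = freeSheafGen V y a g ≫ f') : f = f' := by
  refine lanGen_hom_ext fun x g => ?_
  refine map_sigma_hom_ext ((evaluation _ _).obj x) (fun a => (X.freeS k a).obj (V a)) fun a => ?_
  refine free_hom_ext fun n => ?_
  have key : ∀ u : ((X.sheafify k).obj (∐ fun a => (X.freeS k a).obj (V a))).obj y ⟶ Y,
      X.freeGen a (V a) ≫ ((X.freeS k a).obj (V a)).map n ≫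
        (Sigma.ι (fun a => (X.freeS k a).obj (V a)) a).app x ≫ lanGen _ y g ≫ u =
      freeSheafGen V y a (X.affineIncl.map n ≫ g) ≫ u := by
    intro u
    unfold freeSheafGen
    rw [← map_lanGen]
    simp only [Category.assoc, NatTrans.naturality_assoc]
  exact (key f).trans ((h a _).trans (key f').symm)

theorem exists_freeSheafGen_desc (V : A → ModuleCat.{u} k) (y : X.Loc) {Y : ModuleCat.{u} k}
    (f : ∀ (a : A) (_ : X.affineIncl.obj ⟨PUnit.unit, a⟩ ⟶ X.chartIncl.obj y), V a ⟶ Y) :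
    ∃ φ : ((X.sheafify k).obj (∐ fun a => (X.freeS k a).obj (V a))).obj y ⟶ Y,
      ∀ a g, freeSheafGen V y a g ≫ φ = f a g := by
  let fr : ∀ (x : X.affine.Loc) (_ : X.affineIncl.obj x ⟶ X.chartIncl.obj y) (a : A),
      ((X.freeS k a).obj (V a)).obj x ⟶ Y := fun x g a =>
    ModuleCat.ofHom (Finsupp.lsum k fun n => (f a (X.affineIncl.map n ≫ g)).hom)
  have hfr : ∀ x g a (n : (⟨PUnit.unit, a⟩ : X.affine.Loc) ⟶ x),
      X.freeGen a (V a) ≫ ((X.freeS k a).obj (V a)).map n ≫ fr x g a =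
        f a (X.affineIncl.map n ≫ g) := by
    intro x g a n
    rw [← Category.assoc, freeGen_map]
    ext v : 2
    exact Finsupp.sum_single_index (map_zero _)
  let fs : ∀ (x : X.affine.Loc) (_ : X.affineIncl.obj x ⟶ X.chartIncl.obj y),
      (∐ fun a => (X.freeS k a).obj (V a)).obj x ⟶ Y := fun x g =>
    mapSigmaDesc ((evaluation _ _).obj x) (fun a => (X.freeS k a).obj (V a)) (fr x g)
  have hfs : ∀ x g a, (Sigma.ι (fun a => (X.freeS k a).obj (V a)) a).app x ≫ fs x g = fr x g a :=
    fun x g a => map_ι_mapSigmaDesc ((evaluation _ _).obj x) (fun a => (X.freeS k a).obj (V a)) _ a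
  obtain ⟨φ, hφ⟩ := exists_lanGen_desc (∐ fun a => (X.freeS k a).obj (V a)) y fs (by
    intro x x' n g
    refine map_sigma_hom_ext ((evaluation _ _).obj x') (fun a => (X.freeS k a).obj (V a))
      fun a => ?_
    refine free_hom_ext fun m => ?_
    refine (congrArg (fun f => _ ≫ _ ≫ f) (?_ : _ = ((X.freeS k a).obj (V a)).map n ≫ fr x g a)).trans ?_
    · refine (Category.assoc _ _ _).symm.trans ?_
      refine (congrArg (· ≫ fs x g) ((Sigma.ι (fun a => (X.freeS k a).obj (V a)) a).naturality n)).symm.trans ?_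
      exact (Category.assoc _ _ _).trans (congrArg (_ ≫ ·) (hfs x g a))
    · have e := hfr x g a (m ≫ n)
      rw [Functor.map_comp, Category.assoc] at e
      refine e.trans ?_
      refine Eq.trans ?_ (congrArg (fun f => X.freeGen a (V a) ≫ ((X.freeS k a).obj (V a)).map m ≫ f)
        (hfs x' _ a)).symm
      rw [hfr, Functor.map_comp, Category.assoc])
  refine ⟨φ, fun a g => ?_⟩
  have e := hfr _ g a (𝟙 _)
  rw [CategoryTheory.Functor.map_id, CategoryTheory.Functor.map_id, Category.id_comp,
    Category.id_comp] at e
  refine Eq.trans ?_ e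
  refine (Category.assoc _ _ _).trans (congrArg (_ ≫ ·) ?_)
  refine (Category.assoc _ _ _).trans ((congrArg (_ ≫ ·) (hφ _ g)).trans (hfs _ g a))

theorem freeSheafGen_map (V : A → ModuleCat.{u} k) {y y' : X.Loc} (h : y ⟶ y') (a : A)
    (g : X.affineIncl.obj ⟨PUnit.unit, a⟩ ⟶ X.chartIncl.obj y) :
    freeSheafGen V y a g ≫ ((X.sheafify k).obj (∐ fun a => (X.freeS k a).obj (V a))).map h =
      freeSheafGen V y' a (g ≫ X.chartIncl.map h) := by
  unfold freeSheafGen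
  rw [Category.assoc, Category.assoc, lanGen_map]

end

section

variable {ι A P : Type} [Fintype ι] [LinearOrder ι] [AddCommGroup A] [SemilatticeInf P]
  {X : CoxData ι A P} {k : Type u} [Field k]

/-- The monomials that act on the generators of degree `a` of the sheaf associated with a graded
module. -/
abbrev SpecHom (X : CoxData ι A P) (a : A) (y : X.Loc) : Type :=
  X.affineIncl.obj ⟨PUnit.unit, a⟩ ⟶ X.chartIncl.obj y

/-- The multiples of the generators of `U(D)`. -/
def uGen (D : DM X.deg (ModuleCat.{u} k)) (j : ℤ) (y : X.Loc) (a : A) (g : X.SpecHom a y) :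
    X.truncObj a ((D.cx a).X j) ⟶ (((X.functorU k).obj D).X j).obj y :=
  freeSheafGen (fun a => X.truncObj a ((D.cx a).X j)) y a g

theorem uGen_hom_ext {D : DM X.deg (ModuleCat.{u} k)} {j : ℤ} {y : X.Loc} {Y : ModuleCat.{u} k}
    {f f' : (((X.functorU k).obj D).X j).obj y ⟶ Y}
    (h : ∀ a g, uGen D j y a g ≫ f = uGen D j y a g ≫ f') : f = f' := freeSheafGen_hom_ext h

theorem exists_uGen_desc (D : DM X.deg (ModuleCat.{u} k)) (j : ℤ) (y : X.Loc)
    {Y : ModuleCat.{u} k} (f : ∀ (a : A) (_ : X.SpecHom a y), X.truncObj a ((D.cx a).X j) ⟶ Y) :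
    ∃ φ : (((X.functorU k).obj D).X j).obj y ⟶ Y, ∀ a g, uGen D j y a g ≫ φ = f a g :=
  exists_freeSheafGen_desc _ y f

theorem uGen_map (D : DM X.deg (ModuleCat.{u} k)) (j : ℤ) {y y' : X.Loc} (h : y ⟶ y') (a : A)
    (g : X.SpecHom a y) : uGen D j y a g ≫ (((X.functorU k).obj D).X j).map h =
      uGen D j y' a (g ≫ X.chartIncl.map h) := freeSheafGen_map _ h a g

theorem uGen_naturality {D D' : DM X.deg (ModuleCat.{u} k)} (φ : D ⟶ D') (j : ℤ) (y : X.Loc)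
    (a : A) (g : X.SpecHom a y) :
    uGen D j y a g ≫ (((X.functorU k).map φ).f j).app y =
      X.truncMap id ((φ.f a).f j) ≫ uGen D' j y a g := by
  refine (Category.assoc _ _ _).trans ((congrArg (_ ≫ ·) ((Category.assoc _ _ _).trans
    (congrArg (_ ≫ ·) (lanGen_naturality (llMap ((X.trunc k).map φ) j) y g)))).trans ?_)
  have e := congrArg (fun α => NatTrans.app α (⟨PUnit.unit, a⟩ : X.affine.Loc))
    (llIncl_map ((X.trunc k).map φ) j a)
  refine (congrArg (_ ≫ ·) ((Category.assoc _ _ _).symm.trans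
    (congrArg (· ≫ lanGen _ y g) e))).trans ?_
  refine (congrArg (_ ≫ ·) (Category.assoc _ _ _)).trans ?_
  refine (Category.assoc _ _ _).symm.trans ?_
  refine (congrArg (· ≫ _) (freeGen_naturality a _)).trans ?_
  exact Category.assoc _ _ _

/-- The sections of the sheaf associated with `LL(D')` that are obtained from the generators of
degree `a` by a map to `LL(D')`. -/
def uGenHom (D : DM X.deg (ModuleCat.{u} k)) (j : ℤ) (y : X.Loc) (a : A) (g : X.SpecHom a y)
    (V : ModuleCat.{u} k) : ((X.freeS k a).obj V ⟶ llObj ((X.trunc k).obj D) j) →+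
      (V ⟶ (((X.functorU k).obj D).X j).obj y) :=
  AddMonoidHom.mk' (fun α => X.freeGen a V ≫ α.app _ ≫ lanGen (llObj ((X.trunc k).obj D) j) y g)
    (fun _ _ => (congrArg (X.freeGen a V ≫ ·) (Preadditive.add_comp _ _ _ _ _ _)).trans
      (Preadditive.comp_add _ _ _ _ _ _))

theorem uGenHom_map_llIncl (D : DM X.deg (ModuleCat.{u} k)) (j : ℤ) (y : X.Loc) (a : A)
    (g : X.SpecHom a y) {V : ModuleCat.{u} k} (f : V ⟶ X.truncObj a ((D.cx a).X j)) :
    uGenHom D j y a g V ((X.freeS k a).map f ≫ llIncl ((X.trunc k).obj D) j a) =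
      f ≫ uGen D j y a g := by
  refine (congrArg (X.freeGen a V ≫ ·) (Category.assoc _ _ _)).trans ?_
  refine (Category.assoc _ _ _).symm.trans ?_
  refine (congrArg (· ≫ _) (freeGen_naturality a f)).trans ?_
  exact Category.assoc _ _ _

theorem uGenHom_freeSMul (D : DM X.deg (ModuleCat.{u} k)) (j : ℤ) (y : X.Loc) {a b : A}
    (i : ι) (h : b + X.deg i = a) (g : X.SpecHom a y) {V : ModuleCat.{u} k}
    (α : (X.freeS k b).obj V ⟶ llObj ((X.trunc k).obj D) j) :
    uGenHom D j y a g V ((X.freeSMul k i h).app V ≫ α) =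
      uGenHom D j y b (X.affineIncl.map (affineVar i h) ≫ g) V α := by
  refine (congrArg (X.freeGen a V ≫ ·) (Category.assoc _ _ _)).trans ?_
  refine (Category.assoc _ _ _).symm.trans ?_
  refine (congrArg (· ≫ _) (freeGen_freeSMul i h V)).trans ?_
  refine (Category.assoc _ _ _).trans (congrArg (_ ≫ ·) ?_)
  refine (Category.assoc _ _ _).symm.trans ?_
  refine (congrArg (· ≫ lanGen (llObj ((X.trunc k).obj D) j) y g) (α.naturality _)).trans ?_
  refine (Category.assoc _ _ _).trans (congrArg (_ ≫ ·) ?_)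
  exact map_lanGen (llObj ((X.trunc k).obj D) j) y (affineVar i h) g

theorem trunc_leftAct (D : DM X.deg (ModuleCat.{u} k)) (i : ι) {a b : A} (h : b + X.deg i = a)
    (j j' : ℤ) (hj : j' + 1 = j) : ((X.trunc k).obj D).leftAct i h j j' hj =
      X.truncMap (X.neg_mem_Eff h) (D.leftAct i h j j' hj) := by
  ext x : 3
  refine Subtype.ext ?_
  rcases Int.units_eq_one_or j.negOnePow with e | e <;> simp [DM.leftAct, e] <;> rfl

theorem uGen_d (D : DM X.deg (ModuleCat.{u} k)) {j j' : ℤ} (hj : j' + 1 = j) (y : X.Loc) (a : A)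
    (g : X.SpecHom a y) :
    uGen D j y a g ≫ (((X.functorU k).obj D).d j j').app y =
      ∑ i, X.truncMap (X.neg_mem_Eff (sub_add_cancel a (X.deg i)))
          (D.leftAct i (sub_add_cancel a (X.deg i)) j j' hj) ≫
        uGen D j' y (a - X.deg i) (X.affineIncl.map (affineVar i (sub_add_cancel a (X.deg i))) ≫ g) -
      X.truncMap id ((D.cx a).d j j') ≫ uGen D j' y a g := by
  let D' := (X.trunc k).obj D
  have e0 : llIncl D' j a ≫ llDiff D' j j' = _ :=
    (congrArg (llIncl D' j a ≫ ·) (llDiff_eq D' j j' hj)).trans (llIncl_d D' j j' hj a)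
  refine (Category.assoc _ _ _).trans ((congrArg (_ ≫ ·) ((Category.assoc _ _ _).trans
    (congrArg (_ ≫ ·) (lanGen_naturality (llDiff D' j j') y g)))).trans ?_)
  refine (congrArg (_ ≫ ·) (Category.assoc _ _ _).symm).trans ?_
  refine (congrArg (uGenHom D j' y a g _) e0).trans ?_
  refine (map_sub (uGenHom D j' y a g _) _ _).trans ?_
  refine congrArg₂ (· - ·) ?_ (uGenHom_map_llIncl D j' y a g _)
  refine (map_sum (uGenHom D j' y a g _) _ _).trans (Finset.sum_congr rfl fun i _ => ?_)
  refine (congrArg (uGenHom D j' y a g _) (Category.assoc _ _ _)).trans ?_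
  refine (uGenHom_freeSMul D j' y i _ g _).trans ?_
  refine (uGenHom_map_llIncl D j' y _ _ _).trans ?_
  exact congrArg (· ≫ _) (trunc_leftAct D i _ j j' hj)

end

end CoxData

end ToricBGG

namespace ToricBGG

namespace CoxData

variable {ι A P : Type} [Fintype ι] [LinearOrder ι] [AddCommGroup A] [SemilatticeInf P]
  {X : CoxData ι A P} {k : Type u} [Field k]

section

variable {K : Type} [Finite K] (c : K → P)

/-- The functor of Čech cochains of degree zero. -/
abbrev globalCech (X : CoxData ι A P) (k : Type u) [Field k] {K : Type} [Finite K] (c : K → P) :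
    X.Mod k ⥤ CochainComplex (ModuleCat.{u} k) ℕ := X.atDegree k 0 ⋙ cech c

/-- The Čech cochains of a twist. -/
abbrev cechTerm (F : X.Mod k) (w : A) (q : ℕ) : ModuleCat.{u} k :=
  ((globalCech X k c).obj (((X.twists k).obj F).obj w)).X q

/-- The components of a Čech cochain. -/
def cechProj (F : X.Mod k) (w : A) (q : ℕ) (s : Fin (q + 1) → K) :
    cechTerm c F w q ⟶ F.obj ⟨chartInf (n := SimplexCategory.mk q) c s, w⟩ :=
  Pi.π (fun s : Fin ((SimplexCategory.mk q).len + 1) → K =>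
    ((X.atDegree k 0).obj (((X.twists k).obj F).obj w)).obj (op (chartInf c s))) s ≫
    F.map (X.eqHom _ (add_zero w))

theorem cechProj_hom_ext {F : X.Mod k} {w : A} {q : ℕ} {Y : ModuleCat.{u} k}
    {f g : Y ⟶ cechTerm c F w q} (h : ∀ s, f ≫ cechProj c F w q s = g ≫ cechProj c F w q s) :
    f = g := by
  refine Pi.hom_ext _ _ fun s => ?_
  have e : F.map (X.eqHom (chartInf c s) (add_zero w)) ≫
      F.map (X.eqHom (chartInf c s) (add_zero w).symm) = 𝟙 _ := by
    rw [← F.map_comp, ← F.map_id]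
    exact congrArg F.map (X.loc_hom_ext (add_zero _))
  have e1 := congrArg (· ≫ F.map (X.eqHom (chartInf c s) (add_zero w).symm)) (h s)
  unfold cechProj at e1
  simp only [Category.assoc] at e1
  have e2 : ∀ f : Y ⟶ cechTerm c F w q, f ≫ Pi.π (fun s : Fin ((SimplexCategory.mk q).len + 1) → K =>
    ((X.atDegree k 0).obj (((X.twists k).obj F).obj w)).obj (op (chartInf c s))) s ≫
    F.map (X.eqHom _ (add_zero w)) ≫ F.map (X.eqHom (chartInf c s) (add_zero w).symm) =
      f ≫ Pi.π (fun s : Fin ((SimplexCategory.mk q).len + 1) → K =>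
    ((X.atDegree k 0).obj (((X.twists k).obj F).obj w)).obj (op (chartInf c s))) s := fun f =>
    congrArg (f ≫ ·) ((congrArg (_ ≫ ·) e).trans (Category.comp_id _))
  exact (e2 f).symm.trans (e1.trans (e2 g))

/-- The Čech cochain with given components. -/
def cechLift (F : X.Mod k) (w : A) (q : ℕ) {Y : ModuleCat.{u} k}
    (f : ∀ s : Fin (q + 1) → K, Y ⟶ F.obj ⟨chartInf (n := SimplexCategory.mk q) c s, w⟩) :
    Y ⟶ cechTerm c F w q :=
  Pi.lift fun s : Fin ((SimplexCategory.mk q).len + 1) → K =>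
    f s ≫ F.map (X.eqHom (chartInf c s) (add_zero w).symm)

theorem cechLift_proj (F : X.Mod k) (w : A) (q : ℕ) {Y : ModuleCat.{u} k}
    (f : ∀ s : Fin (q + 1) → K, Y ⟶ F.obj ⟨chartInf (n := SimplexCategory.mk q) c s, w⟩)
    (s : Fin (q + 1) → K) : cechLift c F w q f ≫ cechProj c F w q s = f s := by
  have e : F.map (X.eqHom (chartInf (n := SimplexCategory.mk q) c s) (add_zero w).symm) ≫
      F.map (X.eqHom (chartInf (n := SimplexCategory.mk q) c s) (add_zero w)) = 𝟙 _ := by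
    rw [← F.map_comp, ← F.map_id]
    exact congrArg F.map (X.loc_hom_ext (add_zero _))
  refine (Category.assoc _ _ _).symm.trans ((congrArg (· ≫ F.map
    (X.eqHom (chartInf (n := SimplexCategory.mk q) c s) (add_zero w))) (Pi.lift_π
      (fun s : Fin ((SimplexCategory.mk q).len + 1) → K =>
        f s ≫ F.map (X.eqHom (chartInf c s) (add_zero w).symm)) s)).trans ?_)
  exact (Category.assoc _ _ _).trans ((congrArg (f s ≫ ·) e).trans (Category.comp_id _))

theorem globalCech_map_proj {F : X.Mod k} {w w' : A} (i : ι) (h : w + X.deg i = w') (q : ℕ)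
    (s : Fin (q + 1) → K)
    (g : (⟨chartInf (n := SimplexCategory.mk q) c s, w⟩ : X.Loc) ⟶ ⟨chartInf c s, w'⟩)
    (hg : g.exp = Pi.single i 1) :
    ((globalCech X k c).map (((X.twists k).obj F).mul i h)).f q ≫ cechProj c F w' q s =
      cechProj c F w q s ≫ F.map g := by
  have e := cechCosimplicial_app_π c ((X.atDegree k 0).map (((X.twists k).obj F).mul i h))
    (SimplexCategory.mk q) s
  refine (Category.assoc _ _ _).symm.trans ((congrArg (· ≫ F.map
    (X.eqHom (chartInf (n := SimplexCategory.mk q) c s) (add_zero w'))) e).trans ?_)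
  refine (Category.assoc _ _ _).trans (Eq.trans (congrArg (_ ≫ ·) ?_) (Category.assoc _ _ _).symm)
  refine (F.map_comp _ _).symm.trans (Eq.trans (congrArg F.map ?_) (F.map_comp _ _))
  refine X.loc_hom_ext ?_
  change (Pi.single i 1 : ι → ℤ) + 0 = 0 + g.exp
  rw [hg, add_zero, zero_add]

theorem globalCech_d_proj {F : X.Mod k} {w : A} (q : ℕ) (s : Fin (q + 2) → K) :
    ((globalCech X k c).obj (((X.twists k).obj F).obj w)).d q (q + 1) ≫ cechProj c F w (q + 1) s =
      ∑ i : Fin (q + 2), (-1 : ℤ) ^ (i : ℕ) •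
        (cechProj c F w q (s ∘ (SimplexCategory.δ i).toOrderHom) ≫
          F.map (res (chartInf_le c (SimplexCategory.δ i) s) w)) := by
  have e := cech_d c ((X.atDegree k 0).obj (((X.twists k).obj F).obj w)) q s
  refine (Category.assoc _ _ _).symm.trans ((congrArg (· ≫ F.map
    (X.eqHom (chartInf (n := SimplexCategory.mk (q + 1)) c s) (add_zero w))) e).trans ?_)
  refine (Preadditive.sum_comp _ _ _).trans (Finset.sum_congr rfl fun i _ => ?_)
  refine (Preadditive.zsmul_comp _ _ _).trans (congrArg _ ?_)
  refine (Category.assoc _ _ _).trans (Eq.trans (congrArg (_ ≫ ·) ?_) (Category.assoc _ _ _).symm)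
  refine (F.map_comp _ _).symm.trans (Eq.trans (congrArg F.map ?_) (F.map_comp _ _))
  refine X.loc_hom_ext ?_
  rfl

theorem globalCech_naturality {F F' : X.Mod k} (φ : F ⟶ F') (w : A) (q : ℕ) (s : Fin (q + 1) → K) :
    ((globalCech X k c).map (((X.twists k).map φ).app w)).f q ≫ cechProj c F' w q s =
      cechProj c F w q s ≫ φ.app _ := by
  have e := cechCosimplicial_app_π c ((X.atDegree k 0).map (((X.twists k).map φ).app w))
    (SimplexCategory.mk q) s
  refine (Category.assoc _ _ _).symm.trans ((congrArg (· ≫ F'.map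
    (X.eqHom (chartInf (n := SimplexCategory.mk q) c s) (add_zero w))) e).trans ?_)
  refine (Category.assoc _ _ _).trans (Eq.trans (congrArg (_ ≫ ·) ?_) (Category.assoc _ _ _).symm)
  exact (φ.naturality _).symm

end

section

variable {T : Type} [Finite T] (cc : T → ChartPair P P)

/-- The inclusion of a term of the Čech bicomplex over a chart. -/
def pushInc (C : ChainComplex ((X.prod X).Mod k) ℤ) (p : ℤ) (q : ℕ) (j : ℤ) (h : p - q = j)
    (y : X.Loc) : (((X.pushCech k cc).obj (C.X p)).X q).obj y ⟶
      (((totalize (X.pushCech k cc)).obj C).X j).obj y :=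
  (totInc (((X.pushCech k cc).mapHomologicalComplex _).obj C) (p := p) (q := q) (𝟙 _) j h).app y

theorem pushInc_d (C : ChainComplex ((X.prod X).Mod k) ℤ) {p p' : ℤ} (q : ℕ) {j j' : ℤ}
    (h : p - q = j) (hp : p' + 1 = p) (hj : j' + 1 = j) (y : X.Loc) :
    pushInc cc C p q j h y ≫ (((totalize (X.pushCech k cc)).obj C).d j j').app y =
      (-1 : ℤ) ^ q • (((X.pushCech k cc).map (C.d p p')).f q).app y ≫
        pushInc cc C p' q j' (by omega) y +
      (((X.pushCech k cc).obj (C.X p)).d q (q + 1)).app y ≫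
        pushInc cc C p (q + 1) j' (by push_cast; omega) y := by
  have e := totInc_d (((X.pushCech k cc).mapHomologicalComplex _).obj C) (p := p) (q := q)
    (𝟙 _) j j' h hp hj
  have e1 : ∀ {p₁ p₂ : ℤ} {q₁ q₂ : ℕ} (f : ((X.pushCech k cc).obj (C.X p₁)).X q₁ ⟶
      ((X.pushCech k cc).obj (C.X p₂)).X q₂) (h : p₂ - q₂ = j'),
      totInc (((X.pushCech k cc).mapHomologicalComplex _).obj C) (p := p₂) (q := q₂)
        (𝟙 _ ≫ f) j' h = f ≫ totInc (((X.pushCech k cc).mapHomologicalComplex _).obj C)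
        (p := p₂) (q := q₂) (𝟙 _) j' h := by
    intro p₁ p₂ q₁ q₂ f h
    exact (congrArg (fun f => totInc (((X.pushCech k cc).mapHomologicalComplex _).obj C)
      (p := p₂) (q := q₂) f j' h) ((Category.id_comp f).trans (Category.comp_id f).symm)).trans
      (comp_totInc _ _ _ _ _).symm
  have e2 := e.trans (congrArg₂ (· + ·)
    (congrArg ((-1 : ℤ) ^ q • ·) (e1 (((X.pushCech k cc).map (C.d p p')).f q) (by omega)))
    (e1 (((X.pushCech k cc).obj (C.X p)).d q (q + 1)) (by push_cast; omega)))
  exact (congrArg (fun α => NatTrans.app α y) e2).trans ((NatTrans.app_add _ _ _).trans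
    (congrArg (· + _) (NatTrans.app_zsmul _ _ _)))

theorem pushInc_hom_ext {C : ChainComplex ((X.prod X).Mod k) ℤ} {j : ℤ} {y : X.Loc}
    {Y : ModuleCat.{u} k} {f g : (((totalize (X.pushCech k cc)).obj C).X j).obj y ⟶ Y} (N : ℕ)
    (hC : ∀ p : ℤ, (p < 0 ∨ (N : ℤ) < p) → IsZero (C.X p))
    (H : ∀ p q h, pushInc cc C p q j h y ≫ f = pushInc cc C p q j h y ≫ g) : f = g := by
  have e := totProj_ι (((X.pushCech k cc).mapHomologicalComplex _).obj C) N
    (fun p q h => (X.pushCech k cc ⋙ HomologicalComplex.eval _ _ q).map_isZero (hC p h)) j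
  have e1 := congrArg (fun α => NatTrans.app α y) e
  have e2 : ∀ f : (((totalize (X.pushCech k cc)).obj C).X j).obj y ⟶ Y, f =
      ∑ p ∈ Finset.range (N + 1), (totProj (((X.pushCech k cc).mapHomologicalComplex _).obj C) p
        ((p : ℤ) - j).toNat j).app y ≫ (HomologicalComplex₂.ιTotalOrZero
          (((X.pushCech k cc).mapHomologicalComplex _).obj C) (ComplexShape.down ℤ) p
          ((p : ℤ) - j).toNat j).app y ≫ f := by
    intro f
    refine (Category.id_comp f).symm.trans ((congrArg (· ≫ f) e1).symm.trans ?_)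
    refine (congrArg (· ≫ f) (NatTrans.app_sum _ _ _)).trans ((Preadditive.sum_comp _ _ _).trans ?_)
    exact Finset.sum_congr rfl fun p _ => Category.assoc _ _ _
  rw [e2 f, e2 g]
  refine Finset.sum_congr rfl fun p _ => congrArg (_ ≫ ·) ?_
  by_cases h : (p : ℤ) - ((p : ℤ) - j).toNat = j
  · rw [HomologicalComplex₂.ιTotalOrZero_eq _ _ _ _ _ h]
    have e3 := H p ((p : ℤ) - j).toNat h
    unfold pushInc totInc at e3
    rwa [Category.id_comp] at e3
  · rw [HomologicalComplex₂.ιTotalOrZero_eq_zero _ _ _ _ _ h]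
    exact zero_comp.trans zero_comp.symm

theorem pushInc_map (C : ChainComplex ((X.prod X).Mod k) ℤ) (p : ℤ) (q : ℕ) (j : ℤ)
    (h : p - q = j) {y y' : X.Loc} (g : y ⟶ y') :
    pushInc cc C p q j h y ≫ (((totalize (X.pushCech k cc)).obj C).X j).map g =
      (((X.pushCech k cc).obj (C.X p)).X q).map g ≫ pushInc cc C p q j h y' :=
  ((totInc (((X.pushCech k cc).mapHomologicalComplex _).obj C) (p := p) (q := q) (𝟙 _) j h).naturality
    g).symm

theorem pushInc_naturality {C C' : ChainComplex ((X.prod X).Mod k) ℤ} (φ : C ⟶ C') (p : ℤ) (q : ℕ)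
    (j : ℤ) (h : p - q = j) (y : X.Loc) :
    pushInc cc C p q j h y ≫ (((totalize (X.pushCech k cc)).map φ).f j).app y =
      (((X.pushCech k cc).map (φ.f p)).f q).app y ≫ pushInc cc C' p q j h y := by
  have e := totInc_map (((X.pushCech k cc).mapHomologicalComplex _).map φ) (p := p) (q := q)
    (𝟙 _) j h
  refine (congrArg (fun α => NatTrans.app α y) (e.trans ?_)).trans (NatTrans.comp_app _ _ _)
  exact (congrArg (fun f => totInc (((X.pushCech k cc).mapHomologicalComplex _).obj C')
      (p := p) (q := q) f j h) ((Category.id_comp _).trans (Category.comp_id _).symm)).trans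
      (comp_totInc _ _ _ _ _).symm

theorem pushInc_restrict {T' : Type} [Finite T'] (v : T' → T)
    (C : ChainComplex ((X.prod X).Mod k) ℤ) (p : ℤ) (q : ℕ) (j : ℤ) (h : p - q = j) (y : X.Loc) :
    pushInc cc C p q j h y ≫ (((totalizeMap (X.pushRestrict k cc v)).app C).f j).app y =
      (((X.pushRestrict k cc v).app (C.X p)).f q).app y ≫ pushInc (cc ∘ v) C p q j h y := by
  have e := totInc_totalizeMap (X.pushRestrict k cc v) C (p := p) (q := q) (𝟙 _) j h
  refine (congrArg (fun α => NatTrans.app α y) (e.trans ?_)).trans (NatTrans.comp_app _ _ _)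
  exact (congrArg (fun f => totInc (((X.pushCech k (cc ∘ v)).mapHomologicalComplex _).obj C)
      (p := p) (q := q) f j h) ((Category.id_comp _).trans (Category.comp_id _).symm)).trans
      (comp_totInc _ _ _ _ _).symm

end

end CoxData

end ToricBGG

namespace ToricBGG

namespace CoxData

variable {ι A P : Type} [Fintype ι] [LinearOrder ι] [AddCommGroup A] [SemilatticeInf P]
  {X : CoxData ι A P} {k : Type u} [Field k]

/-- The restriction to a smaller chart, followed by the inclusion of a summand of `RObj F p`. -/
def resGen (F : X.Mod k) (z : (X.prod X).Loc) {r : P} (h : z.chart.1 ≤ r) (p : ℤ) (I : Finset ι)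
    (m : ι → ℤ) (w : A) : F.obj ⟨r, w⟩ ⟶ (X.RObj F p).obj z :=
  F.map (res h w) ≫ X.gen F z p I m w

theorem resGen_d (F : X.Mod k) {z : (X.prod X).Loc} {r : P} (h : z.chart.1 ≤ r) {p p' : ℤ}
    (hp : p' + 1 = p) {I : Finset ι} {m : ι → ℤ} {w : A} (hv : X.GenValid z p I m w) :
    resGen F z h p I m w ≫ (((X.tensorR k).obj ((X.pullbackFst X k).obj F)).d p p').app z =
      ∑ i ∈ I, contractSign i I • (F.map (X.varHom i r w) ≫
        resGen F z h p' (I.erase i) m (w + X.deg i) -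
          resGen F z h p' (I.erase i) (m + Pi.single i 1) w) := by
  unfold resGen
  rw [Category.assoc, gen_d hp hv, Preadditive.comp_sum]
  refine Finset.sum_congr rfl fun i _ => ?_
  rw [Preadditive.comp_zsmul, Preadditive.comp_sub, ← Category.assoc, ← F.map_comp,
    ← Category.assoc, ← F.map_comp]
  refine congrArg (fun g => contractSign i I • (F.map g ≫ _ - _)) (X.loc_hom_ext ?_)
  exact add_comm _ _

theorem resGen_map (F : X.Mod k) {z z' : (X.prod X).Loc} (g : z ⟶ z') {r r' : P}
    (h : z.chart.1 ≤ r) (h' : z'.chart.1 ≤ r') (hr : r' ≤ r) {p : ℤ} {I : Finset ι}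
    {m m' : ι → ℤ} {w : A} (hv : X.GenValid z p I m w) (hg : g.exp ∘ Sum.inl = 0)
    (hm' : m' = m + g.exp ∘ Sum.inr) :
    resGen F z h p I m w ≫ (X.RObj F p).map g =
      F.map (res hr w) ≫ resGen F z' h' p I m' w := by
  unfold resGen
  rw [Category.assoc, gen_map (F := F) g hv (res g.chart_le.1 w) hg.symm hm', ← Category.assoc,
    ← F.map_comp, ← Category.assoc, ← F.map_comp]
  refine congrArg (fun g => F.map g ≫ _) (X.loc_hom_ext ?_)
  rfl

theorem resGen_naturality {F F' : X.Mod k} (φ : F ⟶ F') {z : (X.prod X).Loc} {r : P}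
    (h : z.chart.1 ≤ r) (p : ℤ) (I : Finset ι) (m : ι → ℤ) (w : A) :
    resGen F z h p I m w ≫ (((X.tensorR k).map ((X.pullbackFst X k).map φ)).f p).app z =
      φ.app _ ≫ resGen F' z h p I m w := by
  unfold resGen
  rw [Category.assoc, gen_naturality, ← Category.assoc, φ.naturality, Category.assoc]

variable {K T : Type} [Finite K] [Finite T] (c : K → P) (cc : T → ChartPair P P) (f : T → K)
  (hf : ∀ t, (cc t).1 ≤ c (f t))

variable {c cc f} in
theorem cechLoc_fst_le (hf : ∀ t, (cc t).1 ≤ c (f t)) {q : ℕ} (s : Fin (q + 1) → T) (y : X.Loc) :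
    (X.cechLoc cc s y).chart.1 ≤ chartInf (n := SimplexCategory.mk q) c (f ∘ s) :=
  Finset.le_inf' _ _ fun i hi => le_trans
    (Prod.le_def.1 (Finset.inf'_le (fun i => cc (s i)) hi :
      chartInf (n := SimplexCategory.mk q) cc s ≤ cc (s i))).1 (hf (s i))

variable (F : X.Mod k)

/-- The map from the Čech cochains of `F` to those of `π₁^* F ⊗ ℛ` that is induced by the inclusion
of the summand of the multiples of `x^m ⊗ y_I`. -/
def etaRow (y : X.Loc) (p : ℤ) (I : Finset ι) (m : ι → ℤ) (w : A) (q : ℕ) :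
    cechTerm c F w q ⟶ (((X.pushCech k cc).obj (X.RObj F p)).X q).obj y :=
  X.pushLift cc (X.RObj F p) q y fun s =>
    cechProj c F w q (f ∘ s) ≫ resGen F (X.cechLoc cc s y) (cechLoc_fst_le hf s y) p I m w

theorem etaRow_proj (y : X.Loc) (p : ℤ) (I : Finset ι) (m : ι → ℤ) (w : A) (q : ℕ)
    (s : Fin (q + 1) → T) :
    etaRow c cc f hf F y p I m w q ≫ X.pushProj cc (X.RObj F p) q y s =
      cechProj c F w q (f ∘ s) ≫ resGen F (X.cechLoc cc s y) (cechLoc_fst_le hf s y) p I m w := X.pushLift_proj cc _ q y _ s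

/-- The condition that the multiples of `x^m ⊗ y_I` give sections over the chart `y`. -/
abbrev EtaValid (X : CoxData ι A P) (y : X.Loc) (p : ℤ) (I : Finset ι) (m : ι → ℤ) (w : A) : Prop :=
  X.GenValid (⟨(y.chart, y.chart), (0, y.wt)⟩ : (X.prod X).Loc) p I m w

theorem EtaValid.cech {y : X.Loc} {p : ℤ} {I : Finset ι} {m : ι → ℤ} {w : A}
    (hv : X.EtaValid y p I m w) {q : ℕ} (s : Fin (q + 1) → T) :
    X.GenValid (X.cechLoc cc s y) p I m w :=
  ⟨hv.card, fun i hi => hv.nonneg i (X.supp_mono inf_le_right hi), hv.eff, hv.wt⟩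

theorem etaRow_map_d {y : X.Loc} {p p' : ℤ} (hp : p' + 1 = p) {I : Finset ι} {m : ι → ℤ} {w : A}
    (hv : X.EtaValid y p I m w) (q : ℕ) :
    etaRow c cc f hf F y p I m w q ≫ (((X.pushCech k cc).map
      (((X.tensorR k).obj ((X.pullbackFst X k).obj F)).d p p')).f q).app y =
      ∑ i ∈ I, contractSign i I •
        (((globalCech X k c).map (((X.twists k).obj F).mul i rfl)).f q ≫
          etaRow c cc f hf F y p' (I.erase i) m (w + X.deg i) q -
            etaRow c cc f hf F y p' (I.erase i) (m + Pi.single i 1) w q) := by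
  refine push_hom_ext fun s => ?_
  rw [Category.assoc]
  refine (congrArg (etaRow c cc f hf F y p I m w q ≫ ·) (X.push_map_proj cc _ q y s)).trans ?_
  rw [← Category.assoc, etaRow_proj, Preadditive.sum_comp, Category.assoc,
    resGen_d F _ hp (hv.cech cc s), Preadditive.comp_sum]
  refine Finset.sum_congr rfl fun i _ => ?_
  rw [Preadditive.comp_zsmul, Preadditive.zsmul_comp]
  refine congrArg _ ?_
  rw [Preadditive.comp_sub, Preadditive.sub_comp]
  refine congrArg₂ (· - ·) ?_ (etaRow_proj c cc f hf F y p' _ _ w q s).symm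
  refine Eq.trans ?_ (Category.assoc _ _ _).symm
  rw [etaRow_proj]
  have e := globalCech_map_proj c (F := F) i (rfl : w + X.deg i = _) q (f ∘ s) (X.varHom i _ w) rfl
  refine Eq.trans ?_ (Category.assoc _ _ _)
  rw [e, Category.assoc]

theorem etaRow_mul {y : X.Loc} {p : ℤ} {I : Finset ι} {m : ι → ℤ} {w w' : A} (i : ι)
    (h : w + X.deg i = w') (q : ℕ) :
    ((globalCech X k c).map (((X.twists k).obj F).mul i h)).f q ≫
      etaRow c cc f hf F y p I m w' q = ((globalCech X k c).map (((X.twists k).obj F).mul i rfl)).f q ≫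
        etaRow c cc f hf F y p I m (w + X.deg i) q := by
  subst h
  rfl

theorem eqToHom_etaRow {y : X.Loc} {p : ℤ} {I : Finset ι} {m : ι → ℤ} {w w' : A}
    (h : w = w') (q : ℕ) :
    ((globalCech X k c).map (eqToHom (congrArg ((X.twists k).obj F).obj h))).f q ≫
      etaRow c cc f hf F y p I m w' q = etaRow c cc f hf F y p I m w q := by
  subst h
  exact (congrArg (fun α => HomologicalComplex.Hom.f α q ≫ etaRow c cc f hf F y p I m w q)
    ((globalCech X k c).map_id _)).trans (Category.id_comp _)

theorem etaRow_d {y : X.Loc} {p : ℤ} {I : Finset ι} {m : ι → ℤ} {w : A}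
    (hv : X.EtaValid y p I m w) (q : ℕ) :
    etaRow c cc f hf F y p I m w q ≫ (((X.pushCech k cc).obj (X.RObj F p)).d q (q + 1)).app y =
      ((globalCech X k c).obj (((X.twists k).obj F).obj w)).d q (q + 1) ≫
        etaRow c cc f hf F y p I m w (q + 1) := by
  refine push_hom_ext fun s => ?_
  rw [Category.assoc, Category.assoc]
  refine (congrArg (etaRow c cc f hf F y p I m w q ≫ ·) (X.push_d_proj cc _ q y s)).trans ?_
  rw [etaRow_proj, Preadditive.comp_sum]
  refine Eq.trans ?_ (Category.assoc _ _ _)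
  refine Eq.trans ?_ (congrArg (· ≫ resGen F (X.cechLoc cc s y) (cechLoc_fst_le hf s y) p I m w) (globalCech_d_proj c q (f ∘ s))).symm
  rw [Preadditive.sum_comp]
  refine Finset.sum_congr rfl fun i _ => ?_
  rw [Preadditive.comp_zsmul, Preadditive.zsmul_comp]
  refine congrArg _ ?_
  rw [← Category.assoc, etaRow_proj, Category.assoc, Category.assoc]
  refine congrArg (cechProj c F w q ((f ∘ s) ∘ (SimplexCategory.δ i).toOrderHom) ≫ ·) ?_
  exact resGen_map F (X.cechRes cc (chartInf_le cc (SimplexCategory.δ i) s) y) _ _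
    (chartInf_le c (SimplexCategory.δ i) (f ∘ s))
    (hv.cech cc (s ∘ (SimplexCategory.δ i).toOrderHom)) rfl (add_zero m).symm

theorem etaRow_map {y y' : X.Loc} (h : y ⟶ y') {p : ℤ} {I : Finset ι} {m m' : ι → ℤ} {w : A}
    (hm : m' = m + h.exp) (hv : X.EtaValid y p I m w) (q : ℕ) :
    etaRow c cc f hf F y p I m w q ≫ (((X.pushCech k cc).obj (X.RObj F p)).X q).map h =
      etaRow c cc f hf F y' p I m' w q := by
  refine push_hom_ext fun s => ?_
  rw [Category.assoc, etaRow_proj]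
  refine (congrArg (etaRow c cc f hf F y p I m w q ≫ ·)
    (X.push_map_chart_proj cc _ q h s)).trans ?_
  rw [← Category.assoc, etaRow_proj, Category.assoc]
  refine congrArg (cechProj c F w q (f ∘ s) ≫ ·) ?_
  refine (resGen_map F _ _ (cechLoc_fst_le hf s y') le_rfl (hv.cech cc s) rfl hm).trans ?_
  exact (congrArg (· ≫ _) (F.map_id _)).trans (Category.id_comp _)

theorem etaRow_naturality {F F' : X.Mod k} (φ : F ⟶ F') (y : X.Loc) (p : ℤ) (I : Finset ι)
    (m : ι → ℤ) (w : A) (q : ℕ) :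
    etaRow c cc f hf F y p I m w q ≫
      (((X.pushCech k cc).map (((X.tensorR k).map ((X.pullbackFst X k).map φ)).f p)).f q).app y =
      ((globalCech X k c).map (((X.twists k).map φ).app w)).f q ≫
        etaRow c cc f hf F' y p I m w q := by
  refine push_hom_ext fun s => ?_
  rw [Category.assoc, Category.assoc]
  refine (congrArg (etaRow c cc f hf F y p I m w q ≫ ·) (X.push_map_proj cc _ q y s)).trans ?_
  rw [← Category.assoc, etaRow_proj, etaRow_proj]
  refine Eq.trans ?_ (Category.assoc _ _ _)
  rw [globalCech_naturality, Category.assoc, Category.assoc, resGen_naturality]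

theorem etaRow_restrict {T' : Type} [Finite T'] (v : T' → T) (y : X.Loc) (p : ℤ) (I : Finset ι)
    (m : ι → ℤ) (w : A) (q : ℕ) :
    etaRow c cc f hf F y p I m w q ≫ (((X.pushRestrict k cc v).app (X.RObj F p)).f q).app y =
      etaRow c (cc ∘ v) (f ∘ v) (fun t => hf (v t)) F y p I m w q := by
  refine push_hom_ext fun s => ?_
  rw [Category.assoc]
  refine (congrArg (etaRow c cc f hf F y p I m w q ≫ ·) (X.pushRestrict_proj cc v _ q y s)).trans ?_
  refine (etaRow_proj c cc f hf F y p I m w q (v ∘ s)).trans ?_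
  exact (etaRow_proj c (cc ∘ v) (f ∘ v) (fun t => hf (v t)) F y p I m w q s).symm

end CoxData

end ToricBGG

namespace ToricBGG

namespace CoxData

variable {ι A P : Type} [Fintype ι] [LinearOrder ι] [AddCommGroup A] [SemilatticeInf P]
  {X : CoxData ι A P} {k : Type u} [Field k]
  {K T : Type} [Finite K] [Finite T] (c : K → P) (cc : T → ChartPair P P) (f : T → K)
  (hf : ∀ t, (cc t).1 ≤ c (f t))

/-- The functor `F ↦ R π₂_*(π₁^* F ⊗ ℛ)`, computed with a covering by the charts `cc t`. -/
abbrev pushR (X : CoxData ι A P) (k : Type u) [Field k] {T : Type} [Finite T]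
    (cc : T → ChartPair P P) : X.Mod k ⥤ ChainComplex (X.Mod k) ℤ :=
  X.pullbackFst X k ⋙ X.tensorR k ⋙ totalize (X.pushCech k cc)

/-- The inclusion of a term of the bicomplex behind `pushR`. -/
abbrev pushRInc (F : X.Mod k) (p : ℤ) (q : ℕ) (j : ℤ) (h : p - q = j) (y : X.Loc) :
    (((X.pushCech k cc).obj (X.RObj F p)).X q).obj y ⟶ (((X.pushR k cc).obj F).X j).obj y :=
  pushInc cc ((X.tensorR k).obj ((X.pullbackFst X k).obj F)) p q j h y

/-- The inclusion of a term of the bicomplex behind `transformK`. -/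
abbrev kInc (F : X.Mod k) (a : A) {p : ℤ} (I : SubsetsOfCard ι p) (q : ℕ) (j : ℤ) (h : p - q = j) :
    cechTerm c F (a - X.wtSum I.1) q ⟶ (((X.transformK k c).obj F).cx a).X j :=
  KoszulTotal.inc (globalCech X k c) ((X.twists k).obj F) a I q j h

/-- The condition on a Laurent monomial and a degree `a` that the multiples of the generators of
degree `a` are nonzero sections over the chart `y` after truncation. -/
structure MonoValid (X : CoxData ι A P) (y : X.Loc) (a : A) (m : ι → ℤ) : Prop where
  nonneg : ∀ i ∈ X.supp y.chart, 0 ≤ m i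
  eff : -a ∈ X.Eff
  wt : a + X.wtExp m = y.wt

theorem MonoValid.etaValid {y : X.Loc} {a : A} {m : ι → ℤ} (hm : X.MonoValid y a m) {p : ℤ}
    (I : SubsetsOfCard ι p) : X.EtaValid y p I.1 m (a - X.wtSum I.1) := by
  have e : X.wtExp m - y.wt = -a := by rw [← hm.wt]; abel
  refine ⟨I.2, hm.nonneg, ?_, ?_⟩
  · rw [e]
    exact hm.eff
  · rw [e]
    change a - X.wtSum I.1 = 0 - X.wtSum I.1 - -a + 0
    abel

variable (F : X.Mod k)

/-- The component of the comparison map at the multiples by `x^m` of the generators of degree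
`a`. -/
def etaGen (y : X.Loc) (a : A) (m : ι → ℤ) (j : ℤ) :
    (((X.transformK k c).obj F).cx a).X j ⟶ (((X.pushR k cc).obj F).X j).obj y :=
  KoszulTotal.desc (G := globalCech X k c) (M := (X.twists k).obj F) fun p I q h =>
    etaRow c cc f hf F y p I.1 m (a - X.wtSum I.1) q ≫ pushRInc cc F p q j h y

theorem kInc_etaGen (y : X.Loc) (a : A) (m : ι → ℤ) {p : ℤ} (I : SubsetsOfCard ι p) (q : ℕ)
    (j : ℤ) (h : p - q = j) :
    kInc c F a I q j h ≫ etaGen c cc f hf F y a m j =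
      etaRow c cc f hf F y p I.1 m (a - X.wtSum I.1) q ≫ pushRInc cc F p q j h y :=
  KoszulTotal.inc_desc _ _ _ I q h

theorem kInc_d_etaGen (y : X.Loc) (a : A) (m : ι → ℤ) {p p' : ℤ} (hp : p' + 1 = p)
    (I : SubsetsOfCard ι p) (q : ℕ) {j j' : ℤ} (hj : j' + 1 = j) (h : p - q = j) :
    kInc c F a I q j h ≫ (((X.transformK k c).obj F).cx a).d j j' ≫
        etaGen c cc f hf F y a m j' =
      (-1 : ℤ) ^ q • ∑ i ∈ I.1, contractSign i I.1 •
        ((((globalCech X k c).map (((X.twists k).obj F).mul i rfl)).f q ≫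
          etaRow c cc f hf F y p' (I.1.erase i) m (a - X.wtSum I.1 + X.deg i) q) ≫
            pushRInc cc F p' q j' (by omega) y) +
      (((globalCech X k c).obj (((X.twists k).obj F).obj (a - X.wtSum I.1))).d q (q + 1) ≫
        etaRow c cc f hf F y p I.1 m (a - X.wtSum I.1) (q + 1)) ≫
          pushRInc cc F p (q + 1) j' (by push_cast; omega) y := by
  have e := KoszulTotal.inc_d (globalCech X k c) ((X.twists k).obj F) a I q j j' hp hj h
  refine (Category.assoc _ _ _).symm.trans ((congrArg (· ≫ etaGen c cc f hf F y a m j') e).trans ?_)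
  refine (Preadditive.add_comp _ _ _ _ _ _).trans (congrArg₂ (· + ·) ?_ ?_)
  · refine (Preadditive.zsmul_comp _ _ _).trans (congrArg _ ?_)
    refine (Preadditive.sum_comp _ _ _).trans ?_
    rw [← Finset.sum_subset (Finset.subset_univ I.1)]
    · refine Finset.sum_congr rfl fun i hi => ?_
      rw [dif_pos hi]
      refine (Preadditive.zsmul_comp _ _ _).trans (congrArg _ ?_)
      refine (Category.assoc _ _ _).trans ((congrArg (_ ≫ ·) (kInc_etaGen c cc f hf F y a m
        ⟨I.1.erase i, card_erase_eq hp I hi⟩ q j' (by omega))).trans ?_)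
      refine (Category.assoc _ _ _).symm.trans (congrArg (· ≫ _) ?_)
      exact etaRow_mul c cc f hf F i (GrObj.wt_erase_mul hi a) q
    · intro i _ hi
      rw [dif_neg hi]
      exact zero_comp
  · refine (Category.assoc _ _ _).trans ((congrArg (_ ≫ ·) (kInc_etaGen c cc f hf F y a m
      I (q + 1) j' (by push_cast; omega))).trans (Category.assoc _ _ _).symm)

theorem kInc_leftAct_etaGen (y : X.Loc) {a b : A} (i : ι) (hd : b + X.deg i = a) (m : ι → ℤ)
    {p p' : ℤ} (hp : p' + 1 = p) (I : SubsetsOfCard ι p) (q : ℕ) {j j' : ℤ} (hj : j' + 1 = j)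
    (h : p - q = j) :
    kInc c F a I q j h ≫ ((X.transformK k c).obj F).leftAct i hd j j' hj ≫
        etaGen c cc f hf F y b m j' =
      if i ∈ I.1 then (-1 : ℤ) ^ q • contractSign i I.1 •
        (etaRow c cc f hf F y p' (I.1.erase i) m (a - X.wtSum I.1) q ≫
            pushRInc cc F p' q j' (by omega) y) else 0 := by
  have e := KoszulTotal.inc_act (globalCech X k c) ((X.twists k).obj F) a b i hd I q j j' hp hj h
  have e1 : kInc c F a I q j h ≫ ((X.transformK k c).obj F).leftAct i hd j j' hj =
      (j.negOnePow : ℤ) • (kInc c F a I q j h ≫ ((X.transformK k c).obj F).act i hd j j' hj) :=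
    Preadditive.comp_zsmul _ _ _
  refine (Category.assoc _ _ _).symm.trans ((congrArg (· ≫ etaGen c cc f hf F y b m j')
    (e1.trans (congrArg ((j.negOnePow : ℤ) • ·) e))).trans ?_)
  split_ifs with hi
  · have hs : (j.negOnePow : ℤ) * (p.negOnePow : ℤ) = (-1) ^ q := by
      have h1 : j.negOnePow * p.negOnePow = (-1) ^ q := by
        rw [← Int.negOnePow_add, ← h, show p - (q : ℤ) + p = p + p + -q by ring,
          Int.negOnePow_add, Int.negOnePow_even _ ⟨p, rfl⟩, one_mul, Int.negOnePow_neg,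
          Int.negOnePow_def]
        rfl
      have h2 := congrArg (fun u : ℤˣ => (u : ℤ)) h1
      push_cast at h2
      exact h2
    refine (Preadditive.zsmul_comp _ _ _).trans ((congrArg ((j.negOnePow : ℤ) • ·)
      (Preadditive.zsmul_comp _ _ _)).trans ((smul_smul _ _ _).trans (congrArg₂ (· • ·) hs ?_)))
    refine (Preadditive.zsmul_comp _ _ _).trans (congrArg _ ?_)
    refine (Category.assoc _ _ _).trans ((congrArg (_ ≫ ·) (kInc_etaGen c cc f hf F y b m
        ⟨I.1.erase i, card_erase_eq hp I hi⟩ q j' (by omega))).trans ?_)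
    refine (Category.assoc _ _ _).symm.trans (congrArg (· ≫ _) ?_)
    exact eqToHom_etaRow c cc f hf F (GrObj.wt_erase_act hi hd) q
  · exact (congrArg (· ≫ _) (smul_zero _)).trans zero_comp

theorem etaGen_d {y : X.Loc} {a : A} {m : ι → ℤ} (hm : X.MonoValid y a m) {j j' : ℤ}
    (hj : j' + 1 = j) :
    etaGen c cc f hf F y a m j ≫ (((X.pushR k cc).obj F).d j j').app y =
      (((X.transformK k c).obj F).cx a).d j j' ≫ etaGen c cc f hf F y a m j' -
        ∑ i, ((X.transformK k c).obj F).leftAct i (sub_add_cancel a (X.deg i)) j j' hj ≫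
          etaGen c cc f hf F y (a - X.deg i) (m + Pi.single i 1) j' := by
  refine KoszulTotal.hom_ext (G := globalCech X k c) (M := (X.twists k).obj F) fun p I q h => ?_
  have e1 := kInc_d_etaGen c cc f hf F y a m (sub_add_cancel p 1) I q hj h
  have e2 := fun i => kInc_leftAct_etaGen c cc f hf F y i (sub_add_cancel a (X.deg i))
    (m + Pi.single i 1) (sub_add_cancel p 1) I q hj h
  have e3 := pushInc_d cc ((X.tensorR k).obj ((X.pullbackFst X k).obj F)) q h (sub_add_cancel p 1)
    hj y
  refine (Category.assoc _ _ _).symm.trans ((congrArg (· ≫ (((X.pushR k cc).obj F).d j j').app y)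
    (kInc_etaGen c cc f hf F y a m I q j h)).trans ?_)
  refine (Category.assoc _ _ _).trans ((congrArg (_ ≫ ·) e3).trans ?_)
  refine Eq.trans ?_ (Preadditive.comp_sub _ _ _).symm
  refine Eq.trans ?_ (congrArg₂ (· - ·) e1 ((Preadditive.comp_sum _ _ _).trans
    (Finset.sum_congr rfl fun i _ => e2 i))).symm
  rw [Finset.sum_ite_mem, Finset.univ_inter, add_sub_right_comm, ← Finset.smul_sum, ← smul_sub,
    ← Finset.sum_sub_distrib]
  refine (Preadditive.comp_add _ _ _ _ _ _).trans (congrArg₂ (· + ·) ?_ ?_)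
  · refine (Preadditive.comp_zsmul _ _ _).trans (congrArg _ ?_)
    refine (Category.assoc _ _ _).symm.trans ((congrArg (· ≫ pushRInc cc F (p - 1) q j' (by omega) y)
      (etaRow_map_d c cc f hf F (sub_add_cancel p 1) (hm.etaValid I) q)).trans ?_)
    refine (Preadditive.sum_comp _ _ _).trans (Finset.sum_congr rfl fun i _ => ?_)
    refine (Preadditive.zsmul_comp _ _ _).trans (Eq.trans (congrArg _ ?_) (smul_sub _ _ _))
    exact Preadditive.sub_comp _ _ _
  · exact (Category.assoc _ _ _).symm.trans ((congrArg (· ≫ _)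
      (etaRow_d c cc f hf F (hm.etaValid I) q)).trans rfl)

end CoxData

end ToricBGG

namespace ToricBGG

namespace CoxData

variable {ι A P : Type} [Fintype ι] [LinearOrder ι] [AddCommGroup A] [SemilatticeInf P]
  {X : CoxData ι A P} {k : Type u} [Field k]

/-- The inclusion of the truncation. -/
def truncIncl (X : CoxData ι A P) (a : A) (V : ModuleCat.{u} k) : X.truncObj a V ⟶ V :=
  ModuleCat.ofHom (X.truncSub k a V).subtype

theorem truncObj_hom_ext {a : A} {V W : ModuleCat.{u} k} {f g : X.truncObj a V ⟶ W}
    (h : -a ∈ X.Eff → f = g) : f = g := by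
  by_cases ha : -a ∈ X.Eff
  · exact h ha
  · ext x
    have hx : x = 0 := Subtype.ext (by_contra fun h0 => ha (x.2 h0))
    rw [hx, map_zero, map_zero]

theorem SpecHom.monoValid {y : X.Loc} {a : A} (ha : -a ∈ X.Eff) (g : X.SpecHom a y) :
    X.MonoValid y a g.exp := ⟨g.nonneg, ha, g.wt_add⟩

/-- The monomial attached to a Laurent monomial of the right degree. -/
def MonoValid.specHom {y : X.Loc} {a : A} {m : ι → ℤ} (h : X.MonoValid y a m) : X.SpecHom a y :=
  ⟨le_top, m, h.nonneg, h.wt⟩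

variable {K T : Type} [Finite K] [Finite T] (c : K → P) (cc : T → ChartPair P P) (f : T → K)
  (hf : ∀ t, (cc t).1 ≤ c (f t))

theorem etaGen_map (F : X.Mod k) {y y' : X.Loc} (h : y ⟶ y') {a : A} {m m' : ι → ℤ}
    (hm : X.MonoValid y a m) (hm' : m' = m + h.exp) (j : ℤ) :
    etaGen c cc f hf F y a m j ≫ (((X.pushR k cc).obj F).X j).map h =
      etaGen c cc f hf F y' a m' j := by
  refine KoszulTotal.hom_ext (G := globalCech X k c) (M := (X.twists k).obj F) fun p I q hq => ?_
  have e := pushInc_map cc ((X.tensorR k).obj ((X.pullbackFst X k).obj F)) p q j hq h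
  refine (Category.assoc _ _ _).symm.trans ((congrArg (· ≫ (((X.pushR k cc).obj F).X j).map h)
    (kInc_etaGen c cc f hf F y a m I q j hq)).trans ?_)
  refine Eq.trans ?_ (kInc_etaGen c cc f hf F y' a m' I q j hq).symm
  refine (Category.assoc _ _ _).trans ((congrArg (_ ≫ ·) e).trans ?_)
  exact (Category.assoc _ _ _).symm.trans (congrArg (· ≫ pushRInc cc F p q j hq y')
    (etaRow_map c cc f hf F h hm' (hm.etaValid I) q))

theorem kInc_map {F F' : X.Mod k} (φ : F ⟶ F') (a : A) {p : ℤ} (I : SubsetsOfCard ι p) (q : ℕ)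
    (j : ℤ) (h : p - q = j) :
    kInc c F a I q j h ≫ (((X.transformK k c).map φ).f a).f j =
      ((globalCech X k c).map (((X.twists k).map φ).app (a - X.wtSum I.1))).f q ≫
        kInc c F' a I q j h := by
  have e := totInc_map (L := KoszulTotal.bi (globalCech X k c) ((X.twists k).obj F) a)
    (L' := KoszulTotal.bi (globalCech X k c) ((X.twists k).obj F') a)
    (((globalCech X k c).mapHomologicalComplex _).map
      ((koszulFunctor.map ((X.twists k).map φ)).f a)) (p := p) (q := q)
    (((globalCech X k c).map (biproduct.ι (fun I : SubsetsOfCard ι p =>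
      ((X.twists k).obj F).obj (a - ∑ l ∈ I.1, X.deg l)) I)).f q) j h
  refine e.trans (Eq.trans ?_ (comp_totInc _ _ _ _ _).symm)
  refine congrArg (fun α => totInc (KoszulTotal.bi (globalCech X k c) ((X.twists k).obj F') a)
    (p := p) (q := q) α j h) ?_
  have e1 : biproduct.ι (fun I : SubsetsOfCard ι p =>
      ((X.twists k).obj F).obj (a - ∑ l ∈ I.1, X.deg l)) I ≫
      GrObj.koszulMap ((X.twists k).map φ) a p = ((X.twists k).map φ).app (a - X.wtSum I.1) ≫
      biproduct.ι (fun I : SubsetsOfCard ι p =>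
        ((X.twists k).obj F').obj (a - ∑ l ∈ I.1, X.deg l)) I := biproduct.ι_map
        (fun I : SubsetsOfCard ι p => ((X.twists k).map φ).app (a - ∑ l ∈ I.1, X.deg l)) I
  have e2 := congrArg (fun α => HomologicalComplex.Hom.f α q) (((globalCech X k c).map_comp _ _).symm.trans
    ((congrArg (globalCech X k c).map e1).trans ((globalCech X k c).map_comp _ _)))
  exact e2

theorem etaGen_naturality {F F' : X.Mod k} (φ : F ⟶ F') (y : X.Loc) (a : A) (m : ι → ℤ) (j : ℤ) :
    etaGen c cc f hf F y a m j ≫ (((X.pushR k cc).map φ).f j).app y =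
      (((X.transformK k c).map φ).f a).f j ≫ etaGen c cc f hf F' y a m j := by
  refine KoszulTotal.hom_ext (G := globalCech X k c) (M := (X.twists k).obj F) fun p I q hq => ?_
  have e := pushInc_naturality cc ((X.tensorR k).map ((X.pullbackFst X k).map φ)) p q j hq y
  refine (Category.assoc _ _ _).symm.trans ((congrArg (· ≫ (((X.pushR k cc).map φ).f j).app y)
    (kInc_etaGen c cc f hf F y a m I q j hq)).trans ?_)
  refine Eq.trans ?_ (Category.assoc _ _ _)
  refine Eq.trans ?_ (congrArg (· ≫ etaGen c cc f hf F' y a m j) (kInc_map c φ a I q j hq)).symm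
  refine Eq.trans ?_ (Category.assoc _ _ _).symm
  refine Eq.trans ?_ (congrArg (_ ≫ ·) (kInc_etaGen c cc f hf F' y a m I q j hq)).symm
  refine (Category.assoc _ _ _).trans ((congrArg (_ ≫ ·) e).trans ?_)
  exact (Category.assoc _ _ _).symm.trans ((congrArg (· ≫ pushRInc cc F' p q j hq y)
    (etaRow_naturality c cc f hf φ y p I.1 m (a - X.wtSum I.1) q)).trans (Category.assoc _ _ _))

/-- The restriction of `pushR` to a subfamily of a covering. -/
def pushRRestrict (X : CoxData ι A P) (k : Type u) [Field k] {T' : Type} [Finite T'] (v : T' → T) :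
    X.pushR k cc ⟶ X.pushR k (cc ∘ v) :=
  Functor.whiskerLeft (X.pullbackFst X k) (Functor.whiskerLeft (X.tensorR k)
    (totalizeMap (X.pushRestrict k cc v)))

theorem etaGen_restrict (F : X.Mod k) {T' : Type} [Finite T'] (v : T' → T) (y : X.Loc) (a : A)
    (m : ι → ℤ) (j : ℤ) :
    etaGen c cc f hf F y a m j ≫ (((pushRRestrict cc X k v).app F).f j).app y =
      etaGen c (cc ∘ v) (f ∘ v) (fun t => hf (v t)) F y a m j := by
  refine KoszulTotal.hom_ext (G := globalCech X k c) (M := (X.twists k).obj F) fun p I q hq => ?_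
  have e := pushInc_restrict cc v ((X.tensorR k).obj ((X.pullbackFst X k).obj F)) p q j hq y
  refine (Category.assoc _ _ _).symm.trans ((congrArg
    (· ≫ (((pushRRestrict cc X k v).app F).f j).app y)
    (kInc_etaGen c cc f hf F y a m I q j hq)).trans ?_)
  refine Eq.trans ?_ (kInc_etaGen c (cc ∘ v) (f ∘ v) (fun t => hf (v t)) F y a m I q j hq).symm
  refine (Category.assoc _ _ _).trans ((congrArg (_ ≫ ·) e).trans ?_)
  exact (Category.assoc _ _ _).symm.trans (congrArg (· ≫ pushRInc (cc ∘ v) F p q j hq y)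
    (etaRow_restrict c cc f hf F v y p I.1 m (a - X.wtSum I.1) q))

/-- The component of the comparison map at a truncated piece. -/
def etaTrunc (F : X.Mod k) (y : X.Loc) (a : A) (m : ι → ℤ) (j : ℤ) :
    X.truncObj a ((((X.transformK k c).obj F).cx a).X j) ⟶ (((X.pushR k cc).obj F).X j).obj y :=
  (j.negOnePow : ℤ) • (X.truncIncl a _ ≫ etaGen c cc f hf F y a m j)

theorem exists_eta (F : X.Mod k) : ∃ η : (X.functorU k).obj ((X.transformK k c).obj F) ⟶
    (X.pushR k cc).obj F, ∀ j y a g, uGen ((X.transformK k c).obj F) j y a g ≫ (η.f j).app y =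
      etaTrunc c cc f hf F y a g.exp j := by
  choose e he using fun j y => exists_uGen_desc ((X.transformK k c).obj F) j y
    (fun a g => etaTrunc c cc f hf F y a g.exp j)
  let η₀ : ∀ j, ((X.functorU k).obj ((X.transformK k c).obj F)).X j ⟶ ((X.pushR k cc).obj F).X j :=
    fun j =>
    { app := fun y => e j y
      naturality := fun y y' h => by
        refine uGen_hom_ext fun a g => ?_
        rw [← Category.assoc, ← Category.assoc, uGen_map, he, he]
        refine truncObj_hom_ext fun ha => ?_
        refine Eq.trans ?_ (Preadditive.zsmul_comp _ _ _).symm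
        refine congrArg ((j.negOnePow : ℤ) • ·) (Eq.trans ?_ (Category.assoc _ _ _).symm)
        exact congrArg (_ ≫ ·) (etaGen_map c cc f hf F h (g.monoValid ha) rfl j).symm }
  refine ⟨{ f := η₀, comm' := fun j j' hj => ?_ }, fun j y a g => he j y a g⟩
  change j' + 1 = j at hj
  ext y : 2
  refine uGen_hom_ext fun a g => ?_
  refine (Category.assoc _ _ _).symm.trans ((congrArg (· ≫ (((X.pushR k cc).obj F).d j j').app y)
    (he j y a g)).trans ?_)
  refine Eq.trans ?_ (Category.assoc _ _ _)
  refine Eq.trans ?_ (congrArg (· ≫ e j' y) (uGen_d ((X.transformK k c).obj F) hj y a g)).symm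
  refine truncObj_hom_ext fun ha => ?_
  refine Eq.trans ?_ (Preadditive.sub_comp _ _ _).symm
  refine Eq.trans ?_ (congrArg₂ (· - ·) (Preadditive.sum_comp _ _ _).symm rfl)
  have hs : (j.negOnePow : ℤ) = - (j'.negOnePow : ℤ) := by
    rw [← hj, Int.negOnePow_succ]
    rfl
  have e1 : (X.truncMap id ((((X.transformK k c).obj F).cx a).d j j') ≫
      uGen ((X.transformK k c).obj F) j' y a g) ≫ e j' y = (j'.negOnePow : ℤ) •
      (X.truncIncl a _ ≫ (((X.transformK k c).obj F).cx a).d j j' ≫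
        etaGen c cc f hf F y a g.exp j') :=
    (Category.assoc _ _ _).trans ((congrArg (_ ≫ ·) (he j' y a g)).trans
      (Preadditive.comp_zsmul _ _ _))
  have e2 : ∀ i, (X.truncMap (X.neg_mem_Eff (sub_add_cancel a (X.deg i)))
      (((X.transformK k c).obj F).leftAct i (sub_add_cancel a (X.deg i)) j j' hj) ≫
        uGen ((X.transformK k c).obj F) j' y (a - X.deg i)
          (X.affineIncl.map (affineVar i (sub_add_cancel a (X.deg i))) ≫ g)) ≫ e j' y =
      (j'.negOnePow : ℤ) • (X.truncIncl a _ ≫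
        ((X.transformK k c).obj F).leftAct i (sub_add_cancel a (X.deg i)) j j' hj ≫
          etaGen c cc f hf F y (a - X.deg i) (g.exp + Pi.single i 1) j') := fun i => by
    refine (Category.assoc _ _ _).trans ((congrArg (_ ≫ ·) (he j' y _ _)).trans
      ((Preadditive.comp_zsmul _ _ _).trans ?_))
    have : LocHom.exp (X.affineIncl.map (affineVar i (sub_add_cancel a (X.deg i))) ≫ g) =
        g.exp + Pi.single i 1 := add_comm _ _
    rw [this]
    rfl
  refine Eq.trans ?_ (congrArg₂ (· - ·) (Finset.sum_congr rfl fun i _ => (e2 i).symm) e1.symm)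
  refine (Preadditive.zsmul_comp _ _ _).trans ?_
  refine (congrArg ((j.negOnePow : ℤ) • ·) ((Category.assoc _ _ _).trans
    (congrArg (_ ≫ ·) (etaGen_d c cc f hf F (g.monoValid ha) hj)))).trans ?_
  rw [hs, Preadditive.comp_sub, Preadditive.comp_sum, neg_smul, smul_sub, neg_sub, Finset.smul_sum]

/-- The comparison map from the complex obtained from `transformK` to `pushR`. -/
def etaApp (F : X.Mod k) : (X.functorU k).obj ((X.transformK k c).obj F) ⟶ (X.pushR k cc).obj F :=
  (exists_eta c cc f hf F).choose

theorem uGen_etaApp (F : X.Mod k) (j : ℤ) (y : X.Loc) (a : A) (g : X.SpecHom a y) :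
    uGen ((X.transformK k c).obj F) j y a g ≫ ((etaApp c cc f hf F).f j).app y =
      etaTrunc c cc f hf F y a g.exp j :=
  (exists_eta c cc f hf F).choose_spec j y a g

/-- The comparison map as a natural transformation. -/
def eta : X.transformK k c ⋙ X.functorU k ⟶ X.pushR k cc where
  app := etaApp c cc f hf
  naturality F F' φ := by
    refine HomologicalComplex.hom_ext _ _ fun j => NatTrans.ext (funext fun y =>
      uGen_hom_ext (D := (X.transformK k c).obj F) fun a g => ?_)
    refine Eq.trans ((Category.assoc _ _ _).symm.trans ((congrArg
      (· ≫ ((etaApp c cc f hf F').f j).app y)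
      (uGen_naturality ((X.transformK k c).map φ) j y a g)).trans ((Category.assoc _ _ _).trans
      (congrArg (_ ≫ ·) (uGen_etaApp c cc f hf F' j y a g))))) ?_
    refine Eq.trans ?_ (Category.assoc _ _ _)
    refine Eq.trans ?_ (congrArg (· ≫ (((X.pushR k cc).map φ).f j).app y)
      (uGen_etaApp c cc f hf F j y a g)).symm
    refine (Preadditive.comp_zsmul _ _ _).trans (Eq.trans ?_ (Preadditive.zsmul_comp _ _ _).symm)
    refine congrArg ((j.negOnePow : ℤ) • ·) (Eq.trans ?_ (Category.assoc _ _ _).symm)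
    exact congrArg (X.truncIncl a _ ≫ ·) (etaGen_naturality c cc f hf φ y a g.exp j).symm

theorem etaApp_restrict (F : X.Mod k) {T' : Type} [Finite T'] (v : T' → T) :
    etaApp c cc f hf F ≫ (pushRRestrict cc X k v).app F =
      etaApp c (cc ∘ v) (f ∘ v) (fun t => hf (v t)) F := by
  refine HomologicalComplex.hom_ext _ _ fun j => NatTrans.ext (funext fun y =>
    uGen_hom_ext (D := (X.transformK k c).obj F) fun a g => ?_)
  refine Eq.trans ((Category.assoc _ _ _).symm.trans (congrArg
      (· ≫ (((pushRRestrict cc X k v).app F).f j).app y)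
      (uGen_etaApp c cc f hf F j y a g))) ?_
  refine Eq.trans ?_ (uGen_etaApp c (cc ∘ v) (f ∘ v) (fun t => hf (v t)) F j y a g).symm
  refine (Preadditive.zsmul_comp _ _ _).trans ?_
  refine congrArg ((j.negOnePow : ℤ) • ·) ((Category.assoc _ _ _).trans ?_)
  exact congrArg (X.truncIncl a _ ≫ ·) (etaGen_restrict c cc f hf F v y a g.exp j)

end CoxData

end ToricBGG

namespace ToricBGG

namespace CoxData

variable {ι A P : Type} [Fintype ι] [LinearOrder ι] [AddCommGroup A] [SemilatticeInf P]
  {X : CoxData ι A P} {k : Type u} [Field k]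

theorem exists_pushInc_desc {T : Type} [Finite T] (cc : T → ChartPair P P)
    (C : ChainComplex ((X.prod X).Mod k) ℤ) (N : ℕ)
    (hC : ∀ p : ℤ, (p < 0 ∨ (N : ℤ) < p) → IsZero (C.X p)) (j : ℤ) (y : X.Loc)
    {Y : ModuleCat.{u} k}
    (f : ∀ (p : ℤ) (q : ℕ) (_ : p - q = j), (((X.pushCech k cc).obj (C.X p)).X q).obj y ⟶ Y) :
    ∃ r : (((totalize (X.pushCech k cc)).obj C).X j).obj y ⟶ Y, ∀ p q h,
      pushInc cc C p q j h y ≫ r = f p q h := by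
  let L := ((X.pushCech k cc).mapHomologicalComplex (ComplexShape.down ℤ)).obj C
  let pr : ∀ n : ℕ, (((totalize (X.pushCech k cc)).obj C).X j).obj y ⟶
      (((X.pushCech k cc).obj (C.X n)).X ((n : ℤ) - j).toNat).obj y := fun n =>
    (totProj L (n : ℤ) ((n : ℤ) - j).toNat j).app y
  refine ⟨∑ n ∈ Finset.range (N + 1), if h : (n : ℤ) - ((n : ℤ) - j).toNat = j then
    pr n ≫ f n ((n : ℤ) - j).toNat h else 0, fun p q h => ?_⟩
  by_cases hp : p < 0 ∨ (N : ℤ) < p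
  · exact ((((evaluation _ _).obj y).map_isZero ((X.pushCech k cc ⋙
      HomologicalComplex.eval _ _ q).map_isZero (hC p hp)))).eq_of_src _ _
  · rw [not_or] at hp
    obtain ⟨m, rfl⟩ : ∃ m : ℕ, p = m := ⟨p.toNat, by omega⟩
    obtain rfl : q = ((m : ℤ) - j).toNat := by omega
    rw [Preadditive.comp_sum, Finset.sum_eq_single m]
    · rw [dif_pos h]
      refine (Category.assoc _ _ _).symm.trans ((congrArg (· ≫ f m ((m : ℤ) - j).toNat h)
        (congrArg (fun α => NatTrans.app α y) (totInc_totProj L (p := (m : ℤ))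
          (q := ((m : ℤ) - j).toNat) (𝟙 _) j h))).trans (Category.id_comp _))
    · intro n _ hne
      split_ifs with hn
      · refine (Category.assoc _ _ _).symm.trans ((congrArg (· ≫ f n ((n : ℤ) - j).toNat hn)
          (congrArg (fun α => NatTrans.app α y) (totInc_totProj_ne L (p := (n : ℤ))
          (q := ((n : ℤ) - j).toNat) (p' := (m : ℤ))
          (q' := ((m : ℤ) - j).toNat) (𝟙 _) j h fun e => hne (by exact_mod_cast e.1.symm)))).trans
          zero_comp)
      · exact comp_zero
    · intro hm
      exact absurd (Finset.mem_range.2 (by omega)) hm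

open Classical in
/-- The Čech cochain with a single component. -/
def pushSingle {T : Type} [Finite T] (cc : T → ChartPair P P) (H : (X.prod X).Mod k) (q : ℕ)
    (y : X.Loc) (s : Fin (q + 1) → T) :
    H.obj (X.cechLoc cc s y) ⟶ (((X.pushCech k cc).obj H).X q).obj y :=
  X.pushLift cc H q y fun s' => if h : s = s' then eqToHom (by rw [h]) else 0

theorem pushSingle_proj_self {T : Type} [Finite T] (cc : T → ChartPair P P)
    (H : (X.prod X).Mod k) (q : ℕ) (y : X.Loc) (s : Fin (q + 1) → T) :
    pushSingle cc H q y s ≫ X.pushProj cc H q y s = 𝟙 _ :=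
  (X.pushLift_proj cc H q y _ s).trans (dif_pos rfl)

theorem pushSingle_proj_ne {T : Type} [Finite T] (cc : T → ChartPair P P)
    (H : (X.prod X).Mod k) (q : ℕ) (y : X.Loc) {s s' : Fin (q + 1) → T} (h : s ≠ s') :
    pushSingle cc H q y s ≫ X.pushProj cc H q y s' = 0 :=
  (X.pushLift_proj cc H q y _ s').trans (dif_neg h)

theorem pushSingle_hom_ext {T : Type} [Finite T] {cc : T → ChartPair P P} {H : (X.prod X).Mod k}
    {q : ℕ} {y : X.Loc} {Y : ModuleCat.{u} k}
    {a b : (((X.pushCech k cc).obj H).X q).obj y ⟶ Y}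
    (h : ∀ s, pushSingle cc H q y s ≫ a = pushSingle cc H q y s ≫ b) : a = b := by
  have := Fintype.ofFinite (Fin (q + 1) → T)
  have e : ∑ s, X.pushProj cc H q y s ≫ pushSingle cc H q y s = 𝟙 _ := by
    refine push_hom_ext fun s => ?_
    rw [Preadditive.sum_comp, Finset.sum_eq_single s]
    · refine (Category.assoc _ _ _).trans ((congrArg (_ ≫ ·)
        (pushSingle_proj_self cc H q y s)).trans ((Category.comp_id _).trans
          (Category.id_comp _).symm))
    · intro s' _ hs
      exact (Category.assoc _ _ _).trans ((congrArg (_ ≫ ·)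
        (pushSingle_proj_ne cc H q y hs)).trans comp_zero)
    · intro h
      exact absurd (Finset.mem_univ _) h
  rw [← Category.id_comp a, ← Category.id_comp b, ← e, Preadditive.sum_comp, Preadditive.sum_comp]
  refine Finset.sum_congr rfl fun s _ => ?_
  rw [Category.assoc, Category.assoc, h]

open Classical in
/-- The Čech cochain with a single component. -/
def cechSingle {K : Type} [Finite K] (c : K → P) (F : X.Mod k) (w : A) (q : ℕ)
    (s : Fin (q + 1) → K) :
    F.obj ⟨chartInf (n := SimplexCategory.mk q) c s, w⟩ ⟶ cechTerm c F w q :=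
  cechLift c F w q fun s' => if h : s = s' then eqToHom (by rw [h]) else 0

theorem cechSingle_proj_self {K : Type} [Finite K] (c : K → P) (F : X.Mod k) (w : A) (q : ℕ)
    (s : Fin (q + 1) → K) : cechSingle c F w q s ≫ cechProj c F w q s = 𝟙 _ :=
  (cechLift_proj c F w q _ s).trans (dif_pos rfl)

theorem cechSingle_proj_ne {K : Type} [Finite K] (c : K → P) (F : X.Mod k) (w : A) (q : ℕ)
    {s s' : Fin (q + 1) → K} (h : s ≠ s') : cechSingle c F w q s ≫ cechProj c F w q s' = 0 :=
  (cechLift_proj c F w q _ s').trans (dif_neg h)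

theorem cechSingle_hom_ext {K : Type} [Finite K] {c : K → P} {F : X.Mod k} {w : A} {q : ℕ}
    {Y : ModuleCat.{u} k} {a b : cechTerm c F w q ⟶ Y}
    (h : ∀ s, cechSingle c F w q s ≫ a = cechSingle c F w q s ≫ b) : a = b := by
  have := Fintype.ofFinite (Fin (q + 1) → K)
  have e : ∑ s, cechProj c F w q s ≫ cechSingle c F w q s = 𝟙 _ := by
    refine cechProj_hom_ext c fun s => ?_
    rw [Preadditive.sum_comp, Finset.sum_eq_single s]
    · rw [Category.assoc, cechSingle_proj_self, Category.comp_id, Category.id_comp]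
    · intro s' _ hs
      rw [Category.assoc, cechSingle_proj_ne _ _ _ _ hs, comp_zero]
    · intro h
      exact absurd (Finset.mem_univ _) h
  rw [← Category.id_comp a, ← Category.id_comp b, ← e, Preadditive.sum_comp, Preadditive.sum_comp]
  refine Finset.sum_congr rfl fun s _ => ?_
  rw [Category.assoc, Category.assoc, h]

variable {K : Type} [Finite K] (c : K → P) (cc : K → ChartPair P P)
  (hf : ∀ t, (cc t).1 ≤ c (id t))

theorem cechSingle_etaRow (F : X.Mod k) (y : X.Loc) (p : ℤ) (I : Finset ι) (m : ι → ℤ) (w : A)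
    (q : ℕ) (s : Fin (q + 1) → K) :
    cechSingle c F w q s ≫ etaRow c cc id hf F y p I m w q =
      resGen F (X.cechLoc cc s y) (cechLoc_fst_le hf s y) p I m w ≫
        pushSingle cc (X.RObj F p) q y s := by
  refine push_hom_ext fun s' => ?_
  refine (Category.assoc _ _ _).trans ((congrArg (cechSingle c F w q s ≫ ·)
    (etaRow_proj c cc id hf F y p I m w q s')).trans ?_)
  refine Eq.trans ?_ (Category.assoc _ _ _).symm
  by_cases h : s = s'
  · subst h
    refine (Category.assoc _ _ _).symm.trans ((congrArg (· ≫ resGen F (X.cechLoc cc s y)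
      (cechLoc_fst_le hf s y) p I m w) (cechSingle_proj_self c F w q s)).trans ?_)
    exact (Category.id_comp _).trans ((congrArg (_ ≫ ·)
      (pushSingle_proj_self cc (X.RObj F p) q y s)).trans (Category.comp_id _)).symm
  · refine (Category.assoc _ _ _).symm.trans ((congrArg (· ≫ resGen F (X.cechLoc cc s' y)
      (cechLoc_fst_le hf s' y) p I m w) (cechSingle_proj_ne c F w q h)).trans ?_)
    exact zero_comp.trans ((congrArg (_ ≫ ·)
      (pushSingle_proj_ne cc (X.RObj F p) q y h)).trans comp_zero).symm

end CoxData

end ToricBGG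

namespace ToricBGG

namespace CoxData

variable {ι A P : Type} [Fintype ι] [LinearOrder ι] [AddCommGroup A] [SemilatticeInf P]
  {X : CoxData ι A P} {k : Type u} [Field k]

/-- The inverse of the inclusion of the truncation in effective degrees. -/
def truncInv {a : A} (ha : -a ∈ X.Eff) (V : ModuleCat.{u} k) : V ⟶ X.truncObj a V :=
  ModuleCat.ofHom (LinearMap.codRestrict (X.truncSub k a V) LinearMap.id fun _ _ => ha)

/-- The restriction to a smaller chart, with an equality of degrees. -/
def resEq {r r' : P} (h : r' ≤ r) {w w' : A} (hw : w = w') : (⟨r, w⟩ : X.Loc) ⟶ ⟨r', w'⟩ :=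
  ⟨h, 0, fun _ _ => le_rfl, by simpa using hw⟩

variable {K : Type} [Finite K] (c : K → P) (F : X.Mod k)

open Classical in
/-- The multiples by `x^m` of the generators of degree `a` of the complex attached to
`transformK`, with the sign of the comparison map. -/
def uPiece (y : X.Loc) (a : A) (m : ι → ℤ) (j : ℤ) :
    (((X.transformK k c).obj F).cx a).X j ⟶
      (((X.functorU k).obj ((X.transformK k c).obj F)).X j).obj y :=
  if h : X.MonoValid y a m then
    (j.negOnePow : ℤ) • (truncInv h.eff _ ≫ uGen ((X.transformK k c).obj F) j y a h.specHom)
  else 0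

theorem negOnePow_mul_self (j : ℤ) : (j.negOnePow : ℤ) * (j.negOnePow : ℤ) = 1 :=
  Int.units_coe_mul_self _

theorem uPiece_etaApp {T : Type} [Finite T] (cc : T → ChartPair P P) (f : T → K)
    (hf : ∀ t, (cc t).1 ≤ c (f t)) {y : X.Loc} {a : A} {m : ι → ℤ} (h : X.MonoValid y a m) (j : ℤ) :
    uPiece c F y a m j ≫ ((etaApp c cc f hf F).f j).app y = etaGen c cc f hf F y a m j := by
  unfold uPiece
  rw [dif_pos h]
  refine (Preadditive.zsmul_comp _ _ _).trans ((congrArg ((j.negOnePow : ℤ) • ·)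
    ((Category.assoc _ _ _).trans ((congrArg (truncInv h.eff _ ≫ ·)
      (uGen_etaApp c cc f hf F j y a h.specHom)).trans (Preadditive.comp_zsmul _ _ _)))).trans ?_)
  refine (smul_smul _ _ _).trans ?_
  rw [negOnePow_mul_self, one_smul]
  rfl

theorem truncIncl_uPiece {y : X.Loc} {a : A} (ha : -a ∈ X.Eff) (g : X.SpecHom a y) (j : ℤ) :
    X.truncIncl a _ ≫ uPiece c F y a g.exp j =
      (j.negOnePow : ℤ) • uGen ((X.transformK k c).obj F) j y a g := by
  unfold uPiece
  rw [dif_pos (g.monoValid ha)]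
  exact Preadditive.comp_zsmul _ _ _

theorem le_cechLoc_fst {cc : K → ChartPair P P} {c} (hc : ∀ t, c t ≤ (cc t).1) {q : ℕ}
    (s : Fin (q + 1) → K) (y : X.Loc) :
    chartInf (n := SimplexCategory.mk q) c s ≤ (X.cechLoc cc s y).chart.1 := by
  have h : (chartInf (n := SimplexCategory.mk q) c s, chartInf (n := SimplexCategory.mk q)
      (fun t => (cc t).2) s) ≤ (chartInf (n := SimplexCategory.mk q) cc s : P × P) :=
    Finset.le_inf' _ _ fun i hi => ⟨(Finset.inf'_le (fun i => c (s i)) hi).trans (hc (s i)),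
      Finset.inf'_le (fun i => (cc (s i)).2) hi⟩
  exact h.1

theorem le_cechLoc_snd {T : Type} {cc : T → ChartPair P P} {y : X.Loc}
    (hy : ∀ t, y.chart ≤ (cc t).2) {q : ℕ} (s : Fin (q + 1) → T) :
    y.chart ≤ (X.cechLoc cc s y).chart.2 := by
  have h : ((chartInf (n := SimplexCategory.mk q) (fun t => (cc t).1) s, y.chart) : P × P) ≤
      (chartInf (n := SimplexCategory.mk q) cc s : P × P) :=
    Finset.le_inf' _ _ fun i hi => ⟨Finset.inf'_le (fun i => (cc (s i)).1) hi, hy (s i)⟩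
  exact le_inf h.2 le_rfl

variable (cc : K → ChartPair P P) (hf : ∀ t, (cc t).1 ≤ c (id t))

open Classical in
/-- The map back from a summand of the sections of `RObj F p`. -/
def genBack (hc : ∀ t, c t ≤ (cc t).1) (y : X.Loc) (p : ℤ) (q : ℕ) (j : ℤ) (h : p - q = j) (s : Fin (q + 1) → K)
    (I : Finset ι) (m : ι → ℤ) (w : A) : F.obj ⟨(X.cechLoc cc s y).chart.1, w⟩ ⟶
      (((X.functorU k).obj ((X.transformK k c).obj F)).X j).obj y :=
  if e : (I.card : ℤ) = p ∧ w = y.wt - X.wtExp m - X.wtSum I then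
    F.map (resEq (le_cechLoc_fst hc s y) e.2) ≫ cechSingle c F _ q s ≫
      kInc c F (y.wt - X.wtExp m) ⟨I, e.1⟩ q j h ≫ uPiece c F y _ m j
  else 0

theorem genBack_eq (hc : ∀ t, c t ≤ (cc t).1) (y : X.Loc) {p : ℤ} (q : ℕ) (j : ℤ) (h : p - q = j) (s : Fin (q + 1) → K)
    (I : SubsetsOfCard ι p) (m : ι → ℤ) (w : A) (a : A) (ha : a + X.wtExp m = y.wt)
    (hw : w = a - X.wtSum I.1) :
    genBack c F cc hc y p q j h s I.1 m w =
      F.map (resEq (le_cechLoc_fst hc s y) hw) ≫ cechSingle c F _ q s ≫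
        kInc c F a I q j h ≫ uPiece c F y a m j := by
  obtain rfl : a = y.wt - X.wtExp m := by rw [← ha, add_sub_cancel_right]
  exact dif_pos ⟨I.2, hw⟩

theorem MonoValid.of_genValid {T : Type} {cc : T → ChartPair P P} {y : X.Loc}
    (hy : ∀ t, y.chart ≤ (cc t).2) {q : ℕ} {s : Fin (q + 1) → T} {p : ℤ} {I : Finset ι}
    {m : ι → ℤ} {w : A} (hv : X.GenValid (X.cechLoc cc s y) p I m w) :
    X.MonoValid y (y.wt - X.wtExp m) m := by
  refine ⟨fun i hi => hv.nonneg i (X.supp_mono (le_cechLoc_snd hy s) hi), ?_, sub_add_cancel _ _⟩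
  rw [neg_sub]
  exact hv.eff

/-- The comparison map is an isomorphism over the charts for which the covering is, in the second
factor, trivial. -/
theorem isIso_etaApp (hc : ∀ t, c t ≤ (cc t).1) {y : X.Loc} (hy : ∀ t, y.chart ≤ (cc t).2) (j : ℤ) :
    IsIso (((etaApp c cc id hf F).f j).app y) := by
  have hN : ∀ p : ℤ, (p < 0 ∨ (Fintype.card ι : ℤ) < p) →
      IsZero (((X.tensorR k).obj ((X.pullbackFst X k).obj F)).X p) := fun p hp =>
    X.rObj_isZero F hp
  choose D hD using fun (p : ℤ) (q : ℕ) (h : p - q = j) (s : Fin (q + 1) → K) =>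
    exists_gen_desc (F := F) (X.cechLoc cc s y) p (fun I m w => genBack c F cc hc y p q j h s I m w)
  have ft : ∀ q : ℕ, Fintype (Fin (q + 1) → K) := fun q => Fintype.ofFinite _
  obtain ⟨r, hr⟩ := exists_pushInc_desc cc ((X.tensorR k).obj ((X.pullbackFst X k).obj F))
    (Fintype.card ι) hN j y (fun p q h => ∑ s, X.pushProj cc (X.RObj F p) q y s ≫ D p q h s)
  have hs : ∀ p q h s, pushSingle cc (X.RObj F p) q y s ≫
      pushRInc cc F p q j h y ≫ r = D p q h s := by
    intro p q h s
    refine (congrArg (_ ≫ ·) (hr p q h)).trans ?_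
    rw [Preadditive.comp_sum, Finset.sum_eq_single s]
    · refine (Category.assoc _ _ _).symm.trans ((congrArg (· ≫ D p q h s)
        (pushSingle_proj_self cc (X.RObj F p) q y s)).trans (Category.id_comp _))
    · intro s' _ hne
      exact (Category.assoc _ _ _).symm.trans ((congrArg (· ≫ D p q h s')
        (pushSingle_proj_ne cc (X.RObj F p) q y hne.symm)).trans zero_comp)
    · intro h
      exact absurd (Finset.mem_univ _) h
  have h1 : ∀ a m, X.MonoValid y a m → etaGen c cc id hf F y a m j ≫ r = uPiece c F y a m j := by
    intro a m hm
    refine KoszulTotal.hom_ext (G := globalCech X k c) (M := (X.twists k).obj F) fun p I q hq => ?_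
    refine (Category.assoc _ _ _).symm.trans ((congrArg (· ≫ r)
      (kInc_etaGen c cc id hf F y a m I q j hq)).trans ((Category.assoc _ _ _).trans ?_))
    refine cechSingle_hom_ext (c := c) (F := F) fun s => ?_
    refine (Category.assoc _ _ _).symm.trans ((congrArg (· ≫ pushRInc cc F p q j hq y ≫ r)
      (cechSingle_etaRow c cc hf F y p I.1 m _ q s)).trans ((Category.assoc _ _ _).trans ?_))
    refine (congrArg (_ ≫ ·) (hs p q hq s)).trans ((Category.assoc _ _ _).trans ?_)
    refine (congrArg (_ ≫ ·) ((hD p q hq s I.1 m _ ((hm.etaValid I).cech cc s)).trans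
      (genBack_eq c F cc hc y q j hq s I m _ a hm.wt rfl))).trans ?_
    refine (Category.assoc _ _ _).symm.trans ((congrArg (· ≫ cechSingle c F _ q s ≫
      kInc c F a I q j hq ≫ uPiece c F y a m j) ?_).trans (Category.id_comp _))
    rw [← F.map_comp, ← F.map_id]
    exact congrArg F.map (X.loc_hom_ext (add_zero _))
  refine ⟨r, uGen_hom_ext fun a g => ?_, ?_⟩
  · refine (Category.assoc _ _ _).symm.trans ((congrArg (· ≫ r)
      (uGen_etaApp c cc id hf F j y a g)).trans ?_)
    refine truncObj_hom_ext fun ha => ?_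
    refine (Preadditive.zsmul_comp _ _ _).trans ((congrArg ((j.negOnePow : ℤ) • ·)
      ((Category.assoc _ _ _).trans ((congrArg (X.truncIncl a _ ≫ ·)
        (h1 a g.exp (g.monoValid ha))).trans (truncIncl_uPiece c F ha g j)))).trans ?_)
    refine (smul_smul _ _ _).trans ?_
    rw [negOnePow_mul_self, one_smul, Category.comp_id]
  · refine pushInc_hom_ext cc (C := (X.tensorR k).obj ((X.pullbackFst X k).obj F))
      (Fintype.card ι) hN fun p q h => ?_
    refine pushSingle_hom_ext (cc := cc) (H := X.RObj F p) fun s => ?_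
    refine gen_hom_ext fun I m w hv => ?_
    have hm := MonoValid.of_genValid hy hv
    have hw : w = y.wt - X.wtExp m - X.wtSum I := by
      rw [hv.wt]
      change 0 - X.wtSum I - (X.wtExp m - y.wt) + 0 = _
      abel
    have e1 : pushSingle cc (X.RObj F p) q y s ≫ pushRInc cc F p q j h y ≫ r ≫
        ((etaApp c cc id hf F).f j).app y = D p q h s ≫ ((etaApp c cc id hf F).f j).app y :=
      (Eq.trans (congrArg (_ ≫ ·) (Category.assoc _ _ _).symm) (Category.assoc _ _ _).symm).trans
        (congrArg (· ≫ _) (hs p q h s))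
    refine (congrArg (X.gen F (X.cechLoc cc s y) p I m w ≫ ·) e1).trans ?_
    refine (Category.assoc _ _ _).symm.trans ((congrArg (· ≫ ((etaApp c cc id hf F).f j).app y)
      ((hD p q h s I m w hv).trans (genBack_eq c F cc hc y q j h s ⟨I, hv.card⟩ m w _ hm.wt
        hw))).trans ?_)
    refine (Category.assoc _ _ _).trans ((congrArg (_ ≫ ·) ((Category.assoc _ _ _).trans
      (congrArg (_ ≫ ·) ((Category.assoc _ _ _).trans ((congrArg (_ ≫ ·)
        (uPiece_etaApp c F cc id hf hm j)).trans
          (kInc_etaGen c cc id hf F y _ m ⟨I, hv.card⟩ q j h)))))).trans ?_)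
    refine (congrArg (_ ≫ ·) ((Category.assoc _ _ _).symm.trans ((congrArg (· ≫ _)
      (cechSingle_etaRow c cc hf F y p I m _ q s)).trans (Category.assoc _ _ _)))).trans ?_
    refine (Category.assoc _ _ _).symm.trans (congrArg₂ (· ≫ ·) ?_ (Category.comp_id _).symm)
    refine (Category.assoc _ _ _).symm.trans ?_
    refine (congrArg (· ≫ _) (F.map_comp _ _).symm).trans ?_
    exact map_gen _ p I m _ (add_zero _)

end CoxData

end ToricBGG

namespace ToricBGG

namespace CoxData

variable {ι A P : Type} [Fintype ι] [LinearOrder ι] [AddCommGroup A] [SemilatticeInf P]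
  {X : CoxData ι A P} {k : Type u} [Field k] {K : Type} [Finite K] (c : K → P)

/-- The comparison map is a quasi-isomorphism. -/
theorem quasiIso_etaApp (hX : X.EnoughUnits) (hc : ∀ p, ∃ s, p ≤ c s) {F : X.Mod k}
    (hF : X.IsQuasicoherent F) :
    QuasiIso (etaApp c (chartPair c c) Prod.fst (fun _ => le_rfl) F) := by
  refine quasiIso_of_evaluation _ fun y => ?_
  obtain ⟨s, hs⟩ := hc y.chart
  let v : K → K × K := fun t => (t, s)
  have h1 : QuasiIso ((X.evalComplex y).map ((pushRRestrict (chartPair c c) X k v).app F)) :=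
    X.quasiIso_totalize_restrict (chartPair c c) v hX hF (t := s) ⟨hs, hs⟩
  have h2 : IsIso ((X.evalComplex y).map
      (etaApp c (chartPair c c ∘ v) (Prod.fst ∘ v) (fun _ => le_rfl) F)) := by
    have : ∀ j, IsIso (((X.evalComplex y).map
        (etaApp c (chartPair c c ∘ v) (Prod.fst ∘ v) (fun _ => le_rfl) F)).f j) := fun j =>
      isIso_etaApp c F (chartPair c c ∘ v) (fun _ => le_rfl) (fun _ => le_rfl) (fun _ => hs) j
    exact HomologicalComplex.Hom.isIso_of_components _
  have h3 := congrArg (X.evalComplex y).map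
    (etaApp_restrict c (chartPair c c) Prod.fst (fun _ => le_rfl) F v)
  rw [Functor.map_comp] at h3
  have h4 : QuasiIso ((X.evalComplex y).map
      (etaApp c (chartPair c c) Prod.fst (fun _ => le_rfl) F) ≫
      (X.evalComplex y).map ((pushRRestrict (chartPair c c) X k v).app F)) := by
    rw [h3]
    infer_instance
  exact quasiIso_of_comp_right _ _ (hφ := h1) (hφφ' := h4)

/-- The derived pushforward of `π₁^* F ⊗ ℛ` is a resolution of `F`. -/
theorem exists_quasiIso_pushR (hX : X.EnoughUnits) (hc : ∀ p, ∃ s, p ≤ c s) {F : X.Mod k}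
    (hF : X.IsQuasicoherent F) :
    ∃ (L : ChainComplex (X.Mod k) ℤ) (α : (X.pushR k (chartPair c c)).obj F ⟶ L)
      (β : (HomologicalComplex.single _ (ComplexShape.down ℤ) 0).obj F ⟶ L),
      QuasiIso α ∧ QuasiIso β := by
  refine ⟨_, (totalize (X.pushCech k (chartPair c c))).map (X.augComplex F),
    X.unitComplex (chartPair c c) F, quasiIso_of_evaluation _ fun y => ?_,
    quasiIso_of_evaluation _ fun y => ?_⟩
  · exact X.quasiIso_totalize_aug (chartPair c c) hX hF y
  · obtain ⟨s, hs⟩ := hc y.chart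
    exact X.quasiIso_unitComplex (chartPair c c) F (t := (s, s)) ⟨hs, hs⟩

theorem exactAt_of_quasiIso_pushR (hX : X.EnoughUnits) (hc : ∀ p, ∃ s, p ≤ c s) {F : X.Mod k}
    (hF : X.IsQuasicoherent F) {C : ChainComplex (X.Mod k) ℤ}
    (γ : C ⟶ (X.pushR k (chartPair c c)).obj F) (hγ : QuasiIso γ) :
    (∀ j : ℤ, j ≠ 0 → C.ExactAt j) ∧ Nonempty (C.homology 0 ≅ F) := by
  obtain ⟨L, α, β, hα, hβ⟩ := exists_quasiIso_pushR c hX hc hF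
  have h : QuasiIso (γ ≫ α) := quasiIso_comp _ _
  refine ⟨fun j hj => ?_, ⟨isoOfQuasiIsoAt (γ ≫ α) 0 ≪≫ (isoOfQuasiIsoAt β 0).symm ≪≫
    HomologicalComplex.singleObjHomologySelfIso _ 0 F⟩⟩
  rw [exactAt_iff_of_quasiIsoAt (γ ≫ α), ← exactAt_iff_of_quasiIsoAt β]
  exact HomologicalComplex.exactAt_single_obj _ _ _ _ hj

/-- A natural transformation is natural up to homotopy. -/
theorem nonempty_homotopy_of_htpy {V : Type*} [Category V]
    {H : V ⥤ DM X.deg (ModuleCat.{u} k)} {G : V ⥤ ChainComplex (X.Mod k) ℤ}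
    (η : H ⋙ X.functorU k ⟶ G) {F F' : V} (g : F ⟶ F')
    {D D' : DM X.deg (ModuleCat.{u} k)} (α : D ⟶ H.obj F) (α' : D' ⟶ H.obj F') (φ : D ⟶ D')
    (h : DM.Htpy (φ ≫ α') (α ≫ H.map g)) :
    Nonempty (Homotopy ((X.functorU k).map φ ≫ (X.functorU k).map α' ≫ η.app F')
      (((X.functorU k).map α ≫ η.app F) ≫ G.map g)) := by
  have e1 : (X.functorU k).map φ ≫ (X.functorU k).map α' ≫ η.app F' =
      (X.functorU k).map (φ ≫ α') ≫ η.app F' := by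
    rw [Functor.map_comp, Category.assoc]
  have e2 : (X.functorU k).map (α ≫ H.map g) ≫ η.app F' =
      ((X.functorU k).map α ≫ η.app F) ≫ G.map g := by
    rw [Functor.map_comp, Category.assoc, Category.assoc]
    exact congrArg (_ ≫ ·) (η.naturality g)
  exact ⟨(Homotopy.ofEq e1).trans (((X.mapHtpyU h).compRight _).trans (Homotopy.ofEq e2))⟩

/-- The comparison map for the product covering. -/
def etaR (X : CoxData ι A P) (k : Type u) [Field k] (c : K → P) :
    X.transformK k c ⋙ X.functorU k ⟶ X.transformR k c :=
  eta c (chartPair c c) Prod.fst (fun _ => le_rfl)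

/-- The comparison map for coherent sheaves. -/
def cohEta (X : CoxData ι A P) (k : Type u) [Field k] (c : K → P) :
    ((X.coherent k).ι ⋙ X.transformK k c) ⋙ X.functorU k ⟶ (X.coherent k).ι ⋙ X.transformR k c :=
  (Functor.associator _ _ _).hom ≫ Functor.whiskerLeft _ (X.etaR k c)

theorem quasiIso_cohEta (hX : X.EnoughUnits) (hc : ∀ p, ∃ s, p ≤ c s) (F : X.Coh k) :
    QuasiIso ((X.cohEta k c).app F) := by
  have h : QuasiIso ((X.etaR k c).app F.obj) := quasiIso_etaApp c hX hc F.property.1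
  have e : (X.cohEta k c).app F = (X.etaR k c).app F.obj := Category.id_comp _
  rw [e]
  exact h

theorem quasiIso_map_comp_cohEta (hX : X.EnoughUnits) (hc : ∀ p, ∃ s, p ≤ c s) {F : X.Coh k}
    (T : X.TateResolution c F.obj) :
    QuasiIso ((X.functorU k).map T.equiv.hom ≫ (X.cohEta k c).app F) :=
  quasiIso_comp _ _ (hφ := quasiIso_map_functorU _ T.equiv) (hφ' := quasiIso_cohEta c hX hc F)

theorem exactAt_functorU_tate (hX : X.EnoughUnits) (hc : ∀ p, ∃ s, p ≤ c s) {F : X.Coh k}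
    (T : X.TateResolution c F.obj) :
    (∀ j : ℤ, j ≠ 0 → ((X.functorU k).obj T.D).ExactAt j) ∧
      Nonempty (((X.functorU k).obj T.D).homology 0 ≅ F.obj) :=
  exactAt_of_quasiIso_pushR c hX hc F.property.1 _ (quasiIso_map_comp_cohEta c hX hc T)

end CoxData

namespace Fan

variable {N ι : Type} [AddCommGroup N] [Fintype ι] [LinearOrder ι] (Φ : Fan N ι)

theorem exists_le_maxChart (τ : Φ.Cone) : ∃ σ : Φ.MaxCone, τ ≤ Φ.maxChart σ := by
  obtain ⟨σ, h1, h2⟩ := Finite.exists_le_maximal (p := fun _ : Φ.Cone => True) (a := τ) trivial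
  exact ⟨⟨σ, fun _ h => h2.2 trivial h⟩, h1⟩

/-- A functional that is positive on the rays of a cone. -/
theorem exists_pos [Module.Free ℤ N] (σ : Φ.Cone) : ∃ m : N →+ ℤ, ∀ i ∈ σ.1, 0 < m (Φ.u i) := by
  have h0 : ∀ i, Φ.u i ≠ 0 := fun i hi => by
    have := Φ.primitive i 2 0 (by rw [smul_zero, hi])
    revert this
    decide
  by_cases hs : ∃ i, σ.1 = {i}
  · obtain ⟨i, hi⟩ := hs
    let b := Module.Free.chooseBasis ℤ N
    obtain ⟨l, hl⟩ : ∃ l, b.repr (Φ.u i) l ≠ 0 := by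
      by_contra! h
      exact h0 i (b.repr.map_eq_zero_iff.1 (Finsupp.ext h))
    have hm : ∀ m : N →+ ℤ, 0 < m (Φ.u i) → ∀ i ∈ σ.1, 0 < m (Φ.u i) := by
      intro m hm i' hi'
      rw [hi, Finset.mem_singleton] at hi'
      rwa [hi']
    rcases lt_or_gt_of_ne hl with h | h
    · exact ⟨-(b.coord l).toAddMonoidHom, hm _ (neg_pos.2 h)⟩
    · exact ⟨(b.coord l).toAddMonoidHom, hm _ h⟩
  · have key : ∀ j ∈ σ.1, ∃ m : N →+ ℤ, (∀ i ∈ σ.1, 0 ≤ m (Φ.u i)) ∧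
        ∀ i ∈ σ.1, i ≠ j → 0 < m (Φ.u i) := by
      intro j hj
      obtain ⟨m, h1, h2⟩ := Φ.inter_isFace σ.1 σ.2 {j} (Φ.ray_mem j)
      refine ⟨m, h1, fun i hi hij => lt_of_le_of_ne (h1 i hi) fun h => hij ?_⟩
      have := (h2 i).2 ⟨hi, h.symm⟩
      exact Finset.mem_singleton.1 (Finset.mem_inter.1 this).2
    choose! m h1 h2 using key
    refine ⟨∑ j ∈ σ.1, m j, fun i hi => ?_⟩
    rw [AddMonoidHom.finsetSum_apply]
    obtain ⟨j, hj, hij⟩ : ∃ j ∈ σ.1, j ≠ i := by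
      by_contra! h
      exact hs ⟨i, Finset.eq_singleton_iff_unique_mem.2 ⟨hi, h⟩⟩
    exact Finset.sum_pos' (fun j hj => h1 j hj i hi) ⟨j, hj, h2 j hj i hi hij.symm⟩

theorem wtExp_stack (a : ι → ℤ) : Φ.stack.wtExp a = QuotientAddGroup.mk a := by
  have e : a = ∑ i, a i • Pi.single i (1 : ℤ) := by
    funext l
    simp [Finset.sum_apply, Pi.single_apply]
  have h := congrArg (QuotientAddGroup.mk' Φ.divHom.range) e
  rw [map_sum] at h
  refine Eq.trans ?_ h.symm
  exact Finset.sum_congr rfl fun i _ => (map_zsmul (QuotientAddGroup.mk' Φ.divHom.range) _ _).symm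

theorem stack_enoughUnits [Module.Free ℤ N] : Φ.stack.EnoughUnits := by
  intro σ a
  obtain ⟨a, rfl⟩ := QuotientAddGroup.mk_surjective a
  obtain ⟨m, hm⟩ := Φ.exists_pos σ
  let b : ι → ℤ := a + Φ.divHom ((∑ i, |a i|) • m)
  have hb : ∀ i ∈ σ.1, 0 ≤ b i := by
    intro i hi
    have h1 : |a i| ≤ ∑ i, |a i| := Finset.single_le_sum (f := fun i => |a i|)
      (fun i _ => abs_nonneg _) (Finset.mem_univ i)
    have h2 : b i = a i + (∑ i, |a i|) * m (Φ.u i) := rfl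
    have h3 := hm i hi
    have h4 := neg_abs_le (a i)
    rw [h2]
    nlinarith [abs_nonneg (a i)]
  refine ⟨fun i => if i ∈ σ.1 then 0 else (b i).natAbs, fun i hi => if_pos hi, ?_⟩
  have h1 : (QuotientAddGroup.mk a : Φ.Cl) = QuotientAddGroup.mk b := by
    refine QuotientAddGroup.eq.2 ⟨(∑ i, |a i|) • m, ?_⟩
    change _ = -a + (a + _)
    rw [neg_add_cancel_left]
  rw [h1, ← wtExp_stack, ← CoxData.wtExp_add]
  refine sum_mem fun i _ => ?_
  obtain ⟨n, hn⟩ : ∃ n : ℕ, (b + fun i => ((if i ∈ σ.1 then 0 else (b i).natAbs : ℕ) : ℤ)) i = n := by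
    refine ⟨_, (Int.toNat_of_nonneg ?_).symm⟩
    change 0 ≤ b i + ((if i ∈ σ.1 then 0 else (b i).natAbs : ℕ) : ℤ)
    split_ifs with hi
    · simpa using hb i hi
    · omega
  rw [hn, natCast_zsmul]
  exact nsmul_mem (Φ.stack.deg_mem_Eff i) n

variable (k : Type u) [Field k]

/-- The comparison map between the monad built from `Φ_𝒦` and `Φ_ℛ`. -/
def eta : Φ.PhiK k ⋙ Φ.U k ⟶ Φ.PhiR k := Φ.stack.cohEta k Φ.maxChart

variable {k}

theorem quasiIso_eta [Module.Free ℤ N] (F : Φ.CohStack k) : QuasiIso ((Φ.eta k).app F) :=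
  CoxData.quasiIso_cohEta Φ.maxChart Φ.stack_enoughUnits Φ.exists_le_maxChart F

theorem quasiIso_comp_eta [Module.Free ℤ N] {F : Φ.CohStack k} (T : Φ.Tate F) :
    QuasiIso ((Φ.U k).map T.equiv.hom ≫ (Φ.eta k).app F) :=
  CoxData.quasiIso_map_comp_cohEta Φ.maxChart Φ.stack_enoughUnits Φ.exists_le_maxChart T

theorem exactAt_tate [Module.Free ℤ N] {F : Φ.CohStack k} (T : Φ.Tate F) :
    (∀ j : ℤ, j ≠ 0 → ((Φ.U k).obj T.D).ExactAt j) ∧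
      Nonempty (((Φ.U k).obj T.D).homology 0 ≅ F.obj) :=
  CoxData.exactAt_functorU_tate Φ.maxChart Φ.stack_enoughUnits Φ.exists_le_maxChart T

theorem nonempty_homotopy_eta {F F' : Φ.CohStack k} (f : F ⟶ F') (T : Φ.Tate F) (T' : Φ.Tate F')
    (φ : T.D ⟶ T'.D) (h : DM.Htpy (φ ≫ T'.equiv.hom) (T.equiv.hom ≫ (Φ.PhiK k).map f)) :
    Nonempty (Homotopy ((Φ.U k).map φ ≫ (Φ.U k).map T'.equiv.hom ≫ (Φ.eta k).app F')
      (((Φ.U k).map T.equiv.hom ≫ (Φ.eta k).app F) ≫ (Φ.PhiR k).map f)) :=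
  CoxData.nonempty_homotopy_of_htpy (Φ.stack.cohEta k Φ.maxChart) f T.equiv.hom T'.equiv.hom φ h

end Fan

end ToricBGG

end

theorem theorem5p2 {N ι : Type} [AddCommGroup N] [Module.Free ℤ N] [Module.Finite ℤ N]
    [Fintype ι] [LinearOrder ι] (Φ : ToricBGG.Fan N ι) (hΦ : Φ.IsProjective) (k : Type u) [Field k] :
    (∀ F : Φ.CohStack k, Nonempty (Φ.Tate F)) ∧
    ∃ η : Φ.PhiK k ⋙ Φ.U k ⟶ Φ.PhiR k,
      (∀ F : Φ.CohStack k, QuasiIso (η.app F)) ∧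
      (∀ (F : Φ.CohStack k) (T : Φ.Tate F),
        QuasiIso ((Φ.U k).map T.equiv.hom ≫ η.app F) ∧
        (∀ j : ℤ, j ≠ 0 → ((Φ.U k).obj T.D).ExactAt j) ∧
        Nonempty (((Φ.U k).obj T.D).homology 0 ≅ F.obj)) ∧
      (∀ (F F' : Φ.CohStack k) (f : F ⟶ F') (T : Φ.Tate F) (T' : Φ.Tate F') (φ : T.D ⟶ T'.D),
        Nonempty (ToricBGG.DM.Htpy (φ ≫ T'.equiv.hom) (T.equiv.hom ≫ (Φ.PhiK k).map f)) →
        Nonempty (Homotopy ((Φ.U k).map φ ≫ (Φ.U k).map T'.equiv.hom ≫ η.app F')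
          (((Φ.U k).map T.equiv.hom ≫ η.app F) ≫ (Φ.PhiR k).map f))) :=
  ⟨fun _ => ToricBGG.CoxData.nonempty_tateResolution _ _ _, Φ.eta k, Φ.quasiIso_eta,
    fun _ T => ⟨Φ.quasiIso_comp_eta T, Φ.exactAt_tate T⟩,
    fun _ _ f T T' φ ⟨h⟩ => Φ.nonempty_homotopy_eta f T T' φ h⟩
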